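/- Let $d\ge 1$, $G\in \mathrm{GL}_{1+d}(\mathbb R)$, $\sigma(\xi)=(\sqrt{1-\|\xi\|^2},\xi)\in\mathbb R^{1+d}$ for $\xi\in\mathbb R^d$, $\|\xi\|<1$, let $\pi:\mathbb R^{1+d}\to\mathbb R^d$, $\pi(\xi_0,\xi)=\xi$, $\mathcal P_0=\{\xi_0=0\}\subset\mathbb R^{1+d}$, and $g=\pi\circ{}^tG\circ\sigma$. For $0<\hbar$ let $$U_G\psi(\tilde x)=\frac1{(2\pi\hbar)^d}\int_{\|\xi\|<1}e^{\frac i\hbar\langle G(0,\tilde x),\sigma(\xi)\rangle}\int_{\mathbb R^d} e^{-\frac i\hbar\langle x,\xi\rangle}\psi(x)\,dx\,d\xi .$$ Put $J(\xi)=(\det dg(\xi))^{-1}$, $\kappa_{U_G}(x,\xi)=(({}^tdg(\xi))^{-1}x,\,g(\xi))$, and $\{a,b\}=\sum_j(\partial_{\xi_j}a\,\partial_{x_j}b-\partial_{x_j}a\,\partial_{\xi_j}b)$. Operators $T_\hbar,S_\hbar$ are called microlocally equal near a set $K\subset\mathbb R^{2d}$ if, for some open $\Omega\supset K$ and all $\chi_1,\chi_2\in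 C_c^\infty(\Omega)$, $\mathrm{Op}_\hbar(\chi_1)(T_\hbar-S_\hbar)\mathrm{Op}_\hbar(\chi_2)=O(\hbar^\infty)$ on $L^2(\mathbb R^d)$ as $\hbar\to0^+$; here $\mathrm{Op}_\hbar(\chi_1)$ is the Weyl quantization, and $\mathrm{Op}_\hbar(\chi_2)$ the right quantization $\frac1{(2\pi\hbar)^d}\iint e^{\frac i\hbar\langle x-y,\xi\rangle}\chi_2(y,\xi)\psi(y)\,dy\,d\xi$ (whose output has compactly supported Fourier transform). A microlocal left inverse $U_G^{-1}$ of $U_G$ near $K$ is a Fourier integral operator $$U_G^{-1}u(x)=\frac1{(2\pi\hbar)^d}\iint e^{\frac i\hbar(\langle x,\xi\rangle-\langle G(0,\tilde x),\sigma(\xi)\rangle)}b_\hbar(x,\tilde x,\xi)u(\tilde x)\,d\tilde x\,d\xi,$$ with $b_\hbar$ smooth, supported in a fixed compact set of $\xi$ with $\|\xi\|<1$, and all derivatives $O(\hbar^{-m}(1+\|(x,\tilde x,\xi)\|)^m)$ for one $m$, such that $U_G^{-1}U_G$ is microlocally equal to $\mathrm{Id}$ near $K$. **Theorem.** Let $P=\mathrm{Op}^w_\hbar(p_0)$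 where $p_0\in C^\infty(\mathbb R^{2d})$ does not depend on $\hbar$ and, for some $m$, all its derivatives are $O((1+\|(x,\xi)\|)^m)$. Let $\varepsilon>0$ and consider the region $\mathcal R_\varepsilon=\{(x,\xi):\|\xi\|\le1-\varepsilon,\ \sigma(\xi)\notin G\mathcal P_0\}$. (1) Let $K\subset\mathcal R_\varepsilon$ be compact and let $U_G^{-1}$ be any microlocal left inverse of $U_G$ near $K$. Then near $K$ the Weyl symbol of $R=U_G^{-1}PU_G$ is $r_0+\hbar r_1+O(\hbar^2)$, where $$r_0=p_0\circ\kappa_{U_G},\qquad r_1=\frac{i}{2J}\{J,r_0\}.$$ That is, $R$ is microlocally equal near $K$ to $\mathrm{Op}^w_\hbar(r_\hbar)$ for a family of smooth symbols $r_\hbar$ with all derivatives bounded uniformly as $\hbar\to0^+$, and, on a neighbourhood of $K$ on which $r_0$ and $r_1$ are smooth, $r_\hbar-r_0-\hbar r_1$ and each of its derivatives are uniformly $O(\hbar^2)$. (2) Near each point of $\mathcal R_\varepsilon$ there is a microlocal left inverse of $U_G$. (3) Let $(x,\xi)\in\mathcal R_\varepsilon$. Near $\xi$ the map $g$ has a left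 inverse $g^{-1}$, and for any such $g^{-1}$, $\tilde J:=J\circ g^{-1}$ satisfies $\tilde J=\det(dg^{-1})$ near $g(\xi)$ and $$r_1(x,\xi)=\Big(\Big[\frac{i}{2\tilde J}\{\tilde J,p_0\}\Big]\circ\kappa_{U_G}\Big)(x,\xi).$$ -/

import Mathlib

open MeasureTheory Filter Topology
open scoped ContDiff SchwartzMap

noncomputable section

namespace HelmholtzEgorov

/-- The Euclidean space `ℝᵈ`, with coordinates `x₁, …, x_d`. -/
abbrev E (d : ℕ) : Type := EuclideanSpace ℝ (Fin d)

/-- Phase space `T*ℝᵈ`, with points `z = (x, ξ)`. -/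
abbrev Phase (d : ℕ) : Type := E d × E d

variable {d : ℕ}

/-! ### Geometry of the propagator -/

/-- The point `(t, x) ∈ ℝ¹⁺ᵈ`; the coordinate `x₀` has index `0`. -/
def lift (t : ℝ) (x : E d) : E (d + 1) :=
  WithLp.toLp 2 (Fin.cons t (fun i => x i))

/-- `σ(ξ) = (√(1 - ‖ξ‖²), ξ)`, the lift of the unit ball to the right hemisphere. -/
def sigma (ξ : E d) : E (d + 1) := lift (Real.sqrt (1 - ‖ξ‖ ^ 2)) ξ

/-- The action of a matrix on `ℝ¹⁺ᵈ`. -/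
def act (M : Matrix (Fin (d + 1)) (Fin (d + 1)) ℝ) (X : E (d + 1)) : E (d + 1) :=
  WithLp.toLp 2 (M.mulVec (fun i => X i))

/-- The projection `π : ℝ¹⁺ᵈ → ℝᵈ` that forgets the coordinate `x₀`. -/
def proj (X : E (d + 1)) : E d := WithLp.toLp 2 (fun i => X i.succ)

/-- `g = π ∘ ᵗG ∘ σ`. -/
def gMap (G : Matrix.GeneralLinearGroup (Fin (d + 1)) ℝ) (ξ : E d) : E d :=
  proj (act (G : Matrix (Fin (d + 1)) (Fin (d + 1)) ℝ).transpose (sigma ξ))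

/-- The hyperplane `G 𝒫₀`, where `𝒫₀ = {ξ₀ = 0} ⊆ ℝ¹⁺ᵈ`. -/
def tiltedHyperplane (G : Matrix.GeneralLinearGroup (Fin (d + 1)) ℝ) : Set (E (d + 1)) :=
  act (G : Matrix (Fin (d + 1)) (Fin (d + 1)) ℝ) '' {X | X 0 = 0}

/-- The phase space region `‖ξ‖ ≤ 1 - ε`, `σ(ξ) ∉ G 𝒫₀`. -/
def region (G : Matrix.GeneralLinearGroup (Fin (d + 1)) ℝ) (ε : ℝ) : Set (Phase d) :=
  {z | ‖z.2‖ ≤ 1 - ε ∧ sigma z.2 ∉ tiltedHyperplane G}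

/-- `κ_{U_G}(x, ξ) = ((ᵗdg(ξ))⁻¹ x, g(ξ))`. -/
def kappa (G : Matrix.GeneralLinearGroup (Fin (d + 1)) ℝ) (z : Phase d) : Phase d :=
  ((ContinuousLinearMap.adjoint (fderiv ℝ (gMap G) z.2)).inverse z.1, gMap G z.2)

/-- `J(ξ) = (det dg(ξ))⁻¹`. -/
def jac (G : Matrix.GeneralLinearGroup (Fin (d + 1)) ℝ) (ξ : E d) : ℝ :=
  ((fderiv ℝ (gMap G) ξ).det)⁻¹

/-- `h` is a left inverse of `g = gMap G` near `ξ`, hence the inverse of `g` near `g(ξ)`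
wherever `g` is a local diffeomorphism at `ξ`. -/
def IsLocalLeftInverse (G : Matrix.GeneralLinearGroup (Fin (d + 1)) ℝ) (h : E d → E d)
    (ξ : E d) : Prop :=
  ∀ᶠ η in 𝓝 ξ, h (gMap G η) = η

/-- The Poisson bracket `{a, b} = ∑ⱼ (∂a/∂ξⱼ ∂b/∂xⱼ - ∂a/∂xⱼ ∂b/∂ξⱼ)`. -/
def poisson (a b : Phase d → ℂ) (z : Phase d) : ℂ :=
  ∑ j : Fin d,
    (fderiv ℝ a z (0, EuclideanSpace.single j 1) * fderiv ℝ b z (EuclideanSpace.single j 1, 0)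
      - fderiv ℝ a z (EuclideanSpace.single j 1, 0) * fderiv ℝ b z (0, EuclideanSpace.single j 1))

/-- The principal symbol `r₀ = p₀ ∘ κ_{U_G}`. -/
def r0 (G : Matrix.GeneralLinearGroup (Fin (d + 1)) ℝ) (p₀ : Phase d → ℂ) (z : Phase d) : ℂ :=
  p₀ (kappa G z)

/-- The subprincipal term `r₁ = (i / 2J) {J, r₀}`. -/
def r1 (G : Matrix.GeneralLinearGroup (Fin (d + 1)) ℝ) (p₀ : Phase d → ℂ) (z : Phase d) : ℂ :=
  Complex.I / (2 * (jac G z.2 : ℂ)) * poisson (fun w => (jac G w.2 : ℂ)) (r0 G p₀) z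

/-! ### Operators -/

/-- `e^{iθ/ħ}`. -/
def osc (ħ θ : ℝ) : ℂ := Complex.exp (Complex.I * ((θ / ħ : ℝ) : ℂ))

/-- The constant `(2πħ)^{-d}`. -/
def planck (d : ℕ) (ħ : ℝ) : ℂ := ((((2 * Real.pi * ħ) ^ d)⁻¹ : ℝ) : ℂ)

/-- The semiclassical Fourier transform `∫ e^{-i⟨x,ξ⟩/ħ} ψ(x) dx`. -/
def fourierH (ħ : ℝ) (ψ : E d → ℂ) (ξ : E d) : ℂ :=
  ∫ x : E d, osc ħ (-(inner ℝ x ξ)) * ψ x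

/-- The propagator
`U_G ψ(x̃) = (2πħ)^{-d} ∫_{‖ξ‖<1} e^{i⟨G(0,x̃), σ(ξ)⟩/ħ} (∫ e^{-i⟨x,ξ⟩/ħ} ψ(x) dx) dξ`,
over the physical (non evanescent) frequencies. -/
def propagator (G : Matrix.GeneralLinearGroup (Fin (d + 1)) ℝ) (ħ : ℝ) (ψ : E d → ℂ)
    (y : E d) : ℂ :=
  planck d ħ * ∫ ξ in Metric.ball (0 : E d) 1,
    osc ħ (inner ℝ (act (G : Matrix (Fin (d + 1)) (Fin (d + 1)) ℝ) (lift 0 y)) (sigma ξ))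
      * fourierH ħ ψ ξ

/-- Weyl quantization:
`Op_ħʷ(a) ψ(x) = (2πħ)^{-d} ∫ (∫ e^{i⟨x-y,ξ⟩/ħ} a((x+y)/2, ξ) ψ(y) dy) dξ`. -/
def weylOp (ħ : ℝ) (a : Phase d → ℂ) (ψ : E d → ℂ) (x : E d) : ℂ :=
  planck d ħ * ∫ ξ : E d, ∫ y : E d,
    osc ħ (inner ℝ (x - y) ξ) * a ((1 / 2 : ℝ) • (x + y), ξ) * ψ y

/-- Right quantization, `(2πħ)^{-d} ∫ (∫ e^{i⟨x-y,ξ⟩/ħ} a(y, ξ) ψ(y) dy) dξ`. It is only used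
with cut-off functions `a ∈ C_c^∞`; the semiclassical Fourier transform of the result is
`ξ ↦ ∫ e^{-i⟨y,ξ⟩/ħ} a(y, ξ) ψ(y) dy`, which is supported in the `ξ`-projection of `supp a`. -/
def rightOp (ħ : ℝ) (a : Phase d → ℂ) (ψ : E d → ℂ) (x : E d) : ℂ :=
  planck d ħ * ∫ ξ : E d, ∫ y : E d, osc ħ (inner ℝ (x - y) ξ) * a (y, ξ) * ψ y

/-- The Fourier integral operator with phase `⟨x,ξ⟩ - ⟨G(0,x̃), σ(ξ)⟩` and amplitude
`b(x, x̃, ξ)`,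
`A u(x) = (2πħ)^{-d} ∫ (∫ e^{i(⟨x,ξ⟩ - ⟨G(0,x̃),σ(ξ)⟩)/ħ} b(x, x̃, ξ) u(x̃) dx̃) dξ`.
Its canonical relation is the inverse of that of `U_G`, since the phase of `U_G` is
`⟨G(0,x̃), σ(ξ)⟩ - ⟨x,ξ⟩`. -/
def inverseFIO (G : Matrix.GeneralLinearGroup (Fin (d + 1)) ℝ) (ħ : ℝ)
    (b : E d × E d × E d → ℂ) (u : E d → ℂ) (x : E d) : ℂ :=
  planck d ħ * ∫ ξ : E d, ∫ y : E d,
    osc ħ (inner ℝ x ξ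
        - inner ℝ (act (G : Matrix (Fin (d + 1)) (Fin (d + 1)) ℝ) (lift 0 y)) (sigma ξ))
      * b (x, y, ξ) * u y

/-! ### Symbols and amplitudes -/

/-- `ħ`-independent symbols: smooth functions all of whose derivatives are
`O((1 + ‖z‖)^m)`, for one `m`. This is the union of the classes `S(m)` over all order
functions `m`. -/
def IsSymbol (p : Phase d → ℂ) : Prop :=
  ContDiff ℝ ∞ p ∧ ∃ m : ℕ, ∀ k : ℕ, ∃ C : ℝ, ∀ z,
    ‖iteratedFDeriv ℝ k p z‖ ≤ C * (1 + ‖z‖) ^ m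

/-- `ħ`-dependent symbols in `S(1)`: all derivatives are bounded, uniformly as `ħ → 0⁺`. -/
def IsSymbolFamily (r : ℝ → Phase d → ℂ) : Prop :=
  (∀ ħ > 0, ContDiff ℝ ∞ (r ħ)) ∧ ∀ k : ℕ, ∃ C : ℝ, ∀ᶠ ħ in 𝓝[>] (0 : ℝ), ∀ z,
    ‖iteratedFDeriv ℝ k (r ħ) z‖ ≤ C

/-- `ħ`-dependent amplitudes `b_ħ(x, x̃, ξ)`: smooth, supported in a fixed compact set of
`ξ` with `‖ξ‖ < 1`, and with all derivatives `O(ħ^{-m} (1 + ‖·‖)^m)` for one `m`. -/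
def IsAmplitude (b : ℝ → E d × E d × E d → ℂ) : Prop :=
  (∀ ħ > 0, ContDiff ℝ ∞ (b ħ)) ∧
  (∃ L : Set (E d), IsCompact L ∧ L ⊆ Metric.ball 0 1 ∧
    ∀ ħ > 0, ∀ w, w.2.2 ∉ L → b ħ w = 0) ∧
  ∃ m : ℕ, ∀ k : ℕ, ∃ C : ℝ, ∀ᶠ ħ in 𝓝[>] (0 : ℝ), ∀ w,
    ‖iteratedFDeriv ℝ k (b ħ) w‖ ≤ C / ħ ^ m * (1 + ‖w‖) ^ m

/-! ### Microlocal equality -/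

/-- `T ∼ S` microlocally near the set `K` of phase space: on some open `Ω ⊇ K`, for all cut-off
functions `χ₁, χ₂ ∈ C_c^∞(Ω)`, the operator `Op(χ₁) (T_ħ - S_ħ) Op(χ₂)` is `O(ħ^∞)` in the norm
of operators on `L²(ℝᵈ)`. -/
def MicrolocallyEqualNear (T S : ℝ → (E d → ℂ) → (E d → ℂ)) (K : Set (Phase d)) : Prop :=
  ∃ Ω : Set (Phase d), IsOpen Ω ∧ K ⊆ Ω ∧
    ∀ χ₁ χ₂ : Phase d → ℂ, ContDiff ℝ ∞ χ₁ → HasCompactSupport χ₁ → tsupport χ₁ ⊆ Ω →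
      ContDiff ℝ ∞ χ₂ → HasCompactSupport χ₂ → tsupport χ₂ ⊆ Ω →
      ∀ N : ℕ, ∃ C : ℝ, ∀ᶠ ħ in 𝓝[>] (0 : ℝ), ∀ ψ : 𝓢(E d, ℂ),
        eLpNorm (weylOp ħ χ₁ (fun x => T ħ (rightOp ħ χ₂ ψ) x - S ħ (rightOp ħ χ₂ ψ) x)) 2 volume
          ≤ ENNReal.ofReal (C * ħ ^ N) * eLpNorm ψ 2 volume

/-- The Fourier integral operator with amplitude `b` is a microlocal left inverse `U_G⁻¹` of
`U_G` near `K`: `U_G⁻¹ U_G ∼ Id` near `K`. -/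
def IsMicrolocalLeftInverse (G : Matrix.GeneralLinearGroup (Fin (d + 1)) ℝ)
    (b : ℝ → E d × E d × E d → ℂ) (K : Set (Phase d)) : Prop :=
  IsAmplitude b ∧
    MicrolocallyEqualNear (fun ħ φ => inverseFIO G ħ (b ħ) (propagator G ħ φ)) (fun _ φ => φ) K

/-- Near `K`, the (locally defined) Weyl symbol of the family of operators `R` is
`r₀ + ħ r₁ + O(ħ²)`, the remainder being understood in the `C^∞` topology: `R_ħ` is microlocally
equal to `Op_ħʷ(r_ħ)` near `K`, with `r_ħ = r₀ + ħ r₁ + O(ħ²)` and likewise for all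
derivatives, uniformly in a neighbourhood of `K`. -/
def HasWeylSymbolNear (R : ℝ → (E d → ℂ) → (E d → ℂ)) (a₀ a₁ : Phase d → ℂ)
    (K : Set (Phase d)) : Prop :=
  ∃ r : ℝ → Phase d → ℂ, IsSymbolFamily r ∧
    MicrolocallyEqualNear R (fun ħ => weylOp ħ (r ħ)) K ∧
    ∃ Ω : Set (Phase d), IsOpen Ω ∧ K ⊆ Ω ∧ ContDiffOn ℝ ∞ a₀ Ω ∧ ContDiffOn ℝ ∞ a₁ Ω ∧
      ∀ k : ℕ, ∃ C : ℝ, ∀ᶠ ħ in 𝓝[>] (0 : ℝ), ∀ z ∈ Ω,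
        ‖iteratedFDeriv ℝ k (fun w => r ħ w - (a₀ w + (ħ : ℂ) * a₁ w)) z‖ ≤ C * ħ ^ 2

end HelmholtzEgorov

end

open HelmholtzEgorov

namespace HelmholtzEgorov

open Metric
open Matrix (GeneralLinearGroup)
open Complex (I norm_real norm_I)
open Real (sqrt norm_of_nonneg)
open ContinuousLinearMap (adjoint inl inr)
open EuclideanSpace (single)
open Finset (mul_sum sum_mul sum_nonneg sum_le_sum sum_congr sum_eq_zero single_le_sum)

local notation "C^∞" => ContDiff ℝ ∞
local notation "½" => (1 / 2 : ℝ)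
local notation:max "⟪" x "⟫" => 1 + ‖x‖

section

/-! ### The oscillating factor -/

lemma norm_osc (ħ t : ℝ) : ‖osc ħ t‖ = 1 := by
  unfold osc; rw [mul_comm, Complex.norm_exp_ofReal_mul_I]

lemma osc_add (ħ s t : ℝ) : osc ħ (s + t) = osc ħ s * osc ħ t := by
  unfold osc; rw [← Complex.exp_add]; congr 1; push_cast; ring

lemma contDiff_osc (ħ : ℝ) {n : WithTop ℕ∞} : ContDiff ℝ n (osc ħ) := by
  unfold osc
  exact (contDiff_const.mul (Complex.ofRealCLM.contDiff.comp (contDiff_id.div_const ħ))).cexp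

@[fun_prop] lemma continuous_osc (ħ : ℝ) : Continuous (osc ħ) :=
  (contDiff_osc ħ (n := 0)).continuous

lemma hasDerivAt_osc (ħ t : ℝ) : HasDerivAt (osc ħ) (I / ħ * osc ħ t) t := by
  unfold osc
  have h1 : HasDerivAt (fun t : ℝ => I * ((t / ħ : ℝ) : ℂ)) (I / ħ) t := by
    have := (((hasDerivAt_id t).div_const ħ).ofReal_comp).const_mul I
    exact this.congr_deriv (by push_cast; rw [mul_one_div])
  exact h1.cexp.congr_deriv (by ring)

lemma fderiv_osc_comp {T : Type*} [NormedAddCommGroup T] [NormedSpace ℝ T] (ħ : ℝ)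
    {θ : T → ℝ} {t : T} (hθ : DifferentiableAt ℝ θ t) (e : T) :
    fderiv ℝ (fun t => osc ħ (θ t)) t e = I / ħ * (fderiv ℝ θ t e : ℂ) * osc ħ (θ t) := by
  have h2 := ((hasDerivAt_osc ħ (θ t)).hasFDerivAt.comp t hθ.hasFDerivAt).fderiv
  simp only [Function.comp_def] at h2
  rw [h2]
  simp
  ring

/-! ### Functions supported in a set -/

section Support

variable {T : Type*} [NormedAddCommGroup T] [NormedSpace ℝ T]

lemma contDiff_mul_of_tsupport {n : WithTop ℕ∞} {f a : T → ℂ} (ha : ContDiff ℝ n a)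
    (hf : ∀ t ∈ tsupport a, ContDiffAt ℝ n f t) : ContDiff ℝ n (fun t => f t * a t) := by
  rw [contDiff_iff_contDiffAt]
  intro t
  by_cases ht : t ∈ tsupport a
  · exact (hf t ht).mul ha.contDiffAt
  · have : (fun t => f t * a t) =ᶠ[𝓝 t] fun _ => 0 := by
      filter_upwards [notMem_tsupport_iff_eventuallyEq.1 ht] with s hs
      simp [hs]
    exact contDiffAt_const.congr_of_eventuallyEq this

lemma dir_eq_zero_of_notMem {a : T → ℂ} {t : T} (ht : t ∉ tsupport a) (e : T) :
    fderiv ℝ a t e = 0 := by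
  rw [(notMem_tsupport_iff_eventuallyEq.1 ht).fderiv_eq]
  simp

lemma tsupport_fderiv_apply_subset' (a : T → ℂ) (e : T) :
    tsupport (fun t => fderiv ℝ a t e) ⊆ tsupport a := by
  refine closure_minimal (fun t ht => ?_) (isClosed_tsupport a)
  by_contra h
  exact ht (dir_eq_zero_of_notMem h e)

lemma compactSupp_dir {a : T → ℂ} (ha : HasCompactSupport a) (e : T) :
    HasCompactSupport (fun t => fderiv ℝ a t e) :=
  IsCompact.of_isClosed_subset ha (isClosed_tsupport _) (tsupport_fderiv_apply_subset' a e)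

lemma norm_iteratedFDeriv_affine {Z : Type*} [NormedAddCommGroup Z] [NormedSpace ℝ Z]
    {a : Z → ℂ} (ha : C^∞ a) (L : T →L[ℝ] Z) (c : Z) (N : ℕ) (t : T) :
    ‖iteratedFDeriv ℝ N (fun t => a (c + L t)) t‖ ≤ ‖iteratedFDeriv ℝ N a (c + L t)‖ * ‖L‖ ^ N := by
  have h1 : C^∞ (fun z => a (c + z)) := ha.comp (contDiff_const.add contDiff_id)
  have h2 := ContinuousLinearMap.iteratedFDeriv_comp_right L h1 t (i := N) (by exact_mod_cast le_top)
  have h3 : (fun t => a (c + L t)) = (fun z => a (c + z)) ∘ L := rfl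
  rw [h3, h2, iteratedFDeriv_comp_add_left]
  refine (ContinuousMultilinearMap.norm_compContinuousLinearMap_le _ _).trans ?_
  simp

lemma exists_bound {a : T → ℂ} (ha : C^∞ a) (hc : HasCompactSupport a)
    (N : ℕ) : ∃ B, 0 ≤ B ∧ ∀ t, ‖iteratedFDeriv ℝ N a t‖ ≤ B := by
  obtain ⟨B, hB⟩ := (hc.iteratedFDeriv (𝕜 := ℝ) N).exists_bound_of_continuous
    (ha.continuous_iteratedFDeriv (by exact_mod_cast le_top))
  exact ⟨B, (norm_nonneg _).trans (hB 0), hB⟩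

lemma exists_deriv_section_le {S : Type*} [NormedAddCommGroup S] [NormedSpace ℝ S]
    {a : S × T → ℂ} (ha : C^∞ a) (hc : HasCompactSupport a) (N : ℕ) :
    ∃ B, 0 ≤ B ∧ ∀ s t, ‖iteratedFDeriv ℝ N (fun t => a (s, t)) t‖ ≤ B := by
  obtain ⟨B, hB0, hB⟩ := exists_bound ha hc N
  refine ⟨B * ‖inr ℝ S T‖ ^ N, by positivity, fun s t => ?_⟩
  have := norm_iteratedFDeriv_affine ha (inr ℝ S T) (s, 0) N t
  simp only [ContinuousLinearMap.inr_apply, Prod.mk_add_mk, add_zero, zero_add] at this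
  exact this.trans (by gcongr; exact hB _)

lemma smooth_dir {a : T → ℂ} (ha : C^∞ a) (e : T) : C^∞ (fun t => fderiv ℝ a t e) :=
  (ha.fderiv_right (m := ∞) (by simp)).clm_apply contDiff_const

lemma norm_iteratedFDeriv_dir_le {a : T → ℂ} (ha : C^∞ a) (e : T) (N : ℕ)
    (t : T) : ‖iteratedFDeriv ℝ N (fun t => fderiv ℝ a t e) t‖
      ≤ ‖e‖ * ‖iteratedFDeriv ℝ (N + 1) a t‖ := by
  have := norm_iteratedFDeriv_clm_apply_const (𝕜 := ℝ) (f := fderiv ℝ a) (c := e) (x := t) (n := N)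
    (N := ∞) (ha.fderiv_right (m := ∞) (by simp)).contDiffAt (by exact_mod_cast le_top)
  rwa [norm_iteratedFDeriv_fderiv] at this

end Support

/-! ### Integration by parts -/

section Parts

variable {T : Type*} [NormedAddCommGroup T] [NormedSpace ℝ T] [MeasurableSpace T] [BorelSpace T]
  [FiniteDimensional ℝ T] {μ : Measure T} [μ.IsAddHaarMeasure]

lemma integral_fderiv_apply_eq_zero {F : T → ℂ} (hF : Differentiable ℝ F) (e : T)
    (hi : Integrable F μ) (hi' : Integrable (fun t => fderiv ℝ F t e) μ) :
    ∫ t, fderiv ℝ F t e ∂μ = 0 := by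
  have := integral_mul_fderiv_eq_neg_fderiv_mul_of_integrable (μ := μ) (f := fun _ : T => (1 : ℂ))
    (g := F) (v := e) (by simp) (by simpa using hi') (by simpa using hi)
    (fun x _ => differentiableAt_const _) (fun x _ => hF x)
  simpa using this

lemma integral_osc_mul_fderiv {ħ : ℝ} (hħ : ħ ≠ 0) {θ : T → ℝ} {a : T → ℂ}
    (ha : ContDiff ℝ 1 a) (hc : HasCompactSupport a)
    (hθ : ∀ t ∈ tsupport a, ContDiffAt ℝ 1 θ t) (e : T) :
    ∫ t, osc ħ (θ t) * (fderiv ℝ θ t e : ℂ) * a t ∂μ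
      = I * ħ * ∫ t, osc ħ (θ t) * fderiv ℝ a t e ∂μ := by
  have hF : ContDiff ℝ 1 (fun t => osc ħ (θ t) * a t) :=
    contDiff_mul_of_tsupport ha (fun t ht => (contDiff_osc ħ).contDiffAt.comp t (hθ t ht))
  have hFc : HasCompactSupport (fun t => osc ħ (θ t) * a t) := hc.mul_left
  have hF' : Continuous (fun t => fderiv ℝ (fun t => osc ħ (θ t) * a t) t e) :=
    (hF.continuous_fderiv (by simp)).clm_apply continuous_const
  have hd : ∀ t, fderiv ℝ (fun t => osc ħ (θ t) * a t) t e = osc ħ (θ t) * fderiv ℝ a t e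
        + I / ħ * (osc ħ (θ t) * (fderiv ℝ θ t e : ℂ) * a t) := by
    intro t
    by_cases ht : t ∈ tsupport a
    · have h1 : DifferentiableAt ℝ θ t := (hθ t ht).differentiableAt (by simp)
      have h2 : DifferentiableAt ℝ (fun t => osc ħ (θ t)) t :=
        ((contDiff_osc ħ (n := 1)).differentiable (by simp) _).comp t h1
      rw [fderiv_fun_mul h2 (ha.differentiable (by simp) t)]
      simp only [_root_.add_apply, _root_.smul_apply, smul_eq_mul, fderiv_osc_comp ħ h1]
      ring
    · have h0 : (fun t => osc ħ (θ t) * a t) =ᶠ[𝓝 t] fun _ => 0 := by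
        filter_upwards [notMem_tsupport_iff_eventuallyEq.1 ht] with s hs
        simp [hs]
      rw [h0.fderiv_eq, dir_eq_zero_of_notMem ht, image_eq_zero_of_notMem_tsupport ht]
      simp
  have hz := integral_fderiv_apply_eq_zero (μ := μ) (hF.differentiable (by simp)) e
    (hF.continuous.integrable_of_hasCompactSupport hFc)
    (hF'.integrable_of_hasCompactSupport (compactSupp_dir hFc e))
  have hc1 : Continuous (fun t => osc ħ (θ t) * fderiv ℝ a t e) :=
    (contDiff_mul_of_tsupport (n := 0) (contDiff_zero.2
      ((ha.continuous_fderiv (by simp)).clm_apply continuous_const))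
      (fun t ht => ((contDiff_osc ħ).contDiffAt.comp t
        (hθ t (tsupport_fderiv_apply_subset' a e ht))).of_le (by simp))).continuous
  have hi1 : Integrable (fun t => osc ħ (θ t) * fderiv ℝ a t e) μ :=
    hc1.integrable_of_hasCompactSupport (compactSupp_dir hc e).mul_left
  have hi2 : Integrable (fun t => I / ħ * (osc ħ (θ t) * (fderiv ℝ θ t e : ℂ) * a t)) μ := by
    have : (fun t => I / ħ * (osc ħ (θ t) * (fderiv ℝ θ t e : ℂ) * a t))
        = fun t => fderiv ℝ (fun t => osc ħ (θ t) * a t) t e - osc ħ (θ t) * fderiv ℝ a t e := by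
      funext t; rw [hd]; ring
    rw [this]
    exact (hF'.integrable_of_hasCompactSupport (compactSupp_dir hFc e)).sub hi1
  simp only [hd] at hz
  rw [integral_add hi1 hi2, integral_const_mul] at hz
  have hħ' : (ħ : ℂ) ≠ 0 := by exact_mod_cast hħ
  have hI : I ≠ 0 := Complex.I_ne_zero
  have : (∫ t, osc ħ (θ t) * (fderiv ℝ θ t e : ℂ) * a t ∂μ)
      = -(ħ / I) * ∫ t, osc ħ (θ t) * fderiv ℝ a t e ∂μ := by
    rw [eq_neg_of_add_eq_zero_left hz]
    field_simp
  rw [this]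
  congr 1
  rw [Complex.div_I]
  ring

end Parts

/-! ### Decay of Fourier integrals -/

lemma fderiv_inner_right_apply {d : ℕ} (τ t e : E d) :
    fderiv ℝ (fun t : E d => (inner ℝ t τ : ℝ)) t e = inner ℝ e τ := by
  rw [fderiv_inner_apply ℝ differentiableAt_fun_id (differentiableAt_const τ)]
  simp

lemma norm_pow_mul_integral_osc_le {d : ℕ} {ρ B : ℝ} (N : ℕ) {a : E d → ℂ} (ha : C^∞ a)
    (hs : ∀ t, ρ < ‖t‖ → a t = 0) (hB : ∀ t, ‖iteratedFDeriv ℝ N a t‖ ≤ B) {ħ : ℝ} (hħ : 0 < ħ)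
    (τ : E d) : ‖τ‖ ^ N * ‖∫ t, osc ħ (inner ℝ t τ) * a t‖
      ≤ ħ ^ N * (B * volume.real (closedBall (0 : E d) ρ)) := by
  induction N generalizing a B with
  | zero =>
    have h1 : ∫ t, osc ħ (inner ℝ t τ) * a t
        = ∫ t in closedBall (0 : E d) ρ, osc ħ (inner ℝ t τ) * a t := by
      rw [setIntegral_eq_integral_of_forall_compl_eq_zero]
      intro t ht
      rw [hs t (by simpa using ht), mul_zero]
    rw [h1]
    simp only [pow_zero, one_mul]
    refine norm_setIntegral_le_of_norm_le_const measure_closedBall_lt_top fun t _ => ?_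
    rw [norm_mul, norm_osc, one_mul]
    simpa using hB t
  | succ N ih =>
    have hB0 : 0 ≤ B := (norm_nonneg _).trans (hB 0)
    by_cases hτ : τ = 0
    · subst hτ
      simp only [norm_zero, pow_succ, mul_zero, zero_mul]
      positivity
    have hτ' : 0 < ‖τ‖ := norm_pos_iff.2 hτ
    set e : E d := ‖τ‖⁻¹ • τ
    have he : ‖e‖ = 1 := norm_smul_inv_norm (𝕜 := ℝ) hτ
    have hc : HasCompactSupport a := HasCompactSupport.of_support_subset_isCompact
      (isCompact_closedBall (0 : E d) ρ) fun t ht => by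
        by_contra h
        exact ht (hs t (by simpa using h))
    have hp := integral_osc_mul_fderiv (μ := volume) hħ.ne' (θ := fun t : E d => (inner ℝ t τ : ℝ))
      (ha.of_le (by simp)) hc
      (fun t _ => (contDiff_id.inner ℝ contDiff_const).contDiffAt) e
    simp only [fderiv_inner_right_apply] at hp
    have hin : (inner ℝ e τ : ℝ) = ‖τ‖ := by
      rw [real_inner_smul_left, real_inner_self_eq_norm_sq]
      field_simp
    rw [hin] at hp
    have h2 : ∫ t, osc ħ (inner ℝ t τ) * (‖τ‖ : ℂ) * a t
        = (‖τ‖ : ℂ) * ∫ t, osc ħ (inner ℝ t τ) * a t := by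
      rw [← integral_const_mul]; congr 1; funext t; ring
    rw [h2] at hp
    have h3 := congrArg norm hp
    simp only [norm_mul, norm_I, one_mul, norm_real, Real.norm_eq_abs, abs_norm,
      abs_of_pos hħ] at h3
    have h4 := ih (a := fun t => fderiv ℝ a t e) (B := B) (smooth_dir ha e)
      (fun t ht => dir_eq_zero_of_notMem (fun hm => by
        have : tsupport a ⊆ closedBall 0 ρ := closure_minimal (fun t ht => by
          by_contra h
          exact ht (hs t (by simpa using h))) isClosed_closedBall
        have := this hm
        simp at this
        linarith) e)
      (fun t => (norm_iteratedFDeriv_dir_le ha e N t).trans (by rw [he, one_mul]; exact hB t))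
    calc ‖τ‖ ^ (N + 1) * ‖∫ t, osc ħ (inner ℝ t τ) * a t‖
        = ‖τ‖ ^ N * (‖τ‖ * ‖∫ t, osc ħ (inner ℝ t τ) * a t‖) := by ring
      _ = ħ * (‖τ‖ ^ N * ‖∫ t, osc ħ (inner ℝ t τ) * fderiv ℝ a t e‖) := by rw [h3]; ring
      _ ≤ ħ * (ħ ^ N * (B * volume.real (closedBall (0 : E d) ρ))) := by gcongr
      _ = _ := by ring

end

section

/-! ### Integrals depending on a parameter -/

section Parametric

variable {Z T : Type*} [NormedAddCommGroup Z] [NormedSpace ℝ Z] [NormedAddCommGroup T]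
  [NormedSpace ℝ T] [MeasurableSpace T] [BorelSpace T] {μ : Measure T}
  [IsFiniteMeasureOnCompacts μ]

lemma fderiv_left {H : Z × T → ℂ} (hH : C^∞ H) (z : Z) (t : T) (v : Z) :
    fderiv ℝ (fun z => H (z, t)) z v = fderiv ℝ H (z, t) (v, 0) := by
  have h1 : HasFDerivAt (fun z : Z => (z, t)) (inl ℝ Z T) z :=
    hasFDerivAt_prodMk_left z t
  have h2 := ((hH.differentiable (by simp) (z, t)).hasFDerivAt.comp z h1).fderiv
  simp only [Function.comp_def] at h2
  rw [h2]
  simp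

variable [FiniteDimensional ℝ Z]

lemma hasFDerivAt_integral {H : Z × T → ℂ} (hH : C^∞ H)
    (hs : ∀ z₀, ∃ k, IsCompact k ∧ ∀ z ∈ ball z₀ 1, ∀ t ∉ k, H (z, t) = 0) (z : Z) :
    HasFDerivAt (fun z => ∫ t, H (z, t) ∂μ) (∫ t, (fderiv ℝ H (z, t)).comp (inl ℝ Z T) ∂μ) z ∧
    ∀ v, (∫ t, (fderiv ℝ H (z, t)).comp (inl ℝ Z T) ∂μ) v = ∫ t, fderiv ℝ H (z, t) (v, 0) ∂μ := by
  obtain ⟨k, hk, hs⟩ := hs z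
  have hcf : Continuous (fun p : Z × T => (fderiv ℝ H p).comp (inl ℝ Z T)) :=
    (hH.continuous_fderiv (by simp)).clm_comp continuous_const
  have hd : ∀ z t, HasFDerivAt (fun z => H (z, t))
      ((fderiv ℝ H (z, t)).comp (inl ℝ Z T)) z := fun z t =>
    (hH.differentiable (by simp) (z, t)).hasFDerivAt.comp z (hasFDerivAt_prodMk_left z t)
  obtain ⟨C, hC⟩ := ((isCompact_closedBall z 1).prod hk).exists_bound_of_continuousOn
    hcf.continuousOn
  have h0 : ∀ y ∈ ball z 1, ∀ t ∉ k, (fderiv ℝ H (y, t)).comp (inl ℝ Z T) = 0 := by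
    intro y hy t ht
    rw [← (hd y t).fderiv]
    have : (fun z => H (z, t)) =ᶠ[𝓝 y] fun _ => 0 := by
      filter_upwards [isOpen_ball.mem_nhds hy] with w hw using hs w hw t ht
    rw [this.fderiv_eq]
    simp
  have hz : z ∈ ball z 1 := mem_ball_self one_pos
  constructor
  · refine hasFDerivAt_integral_of_dominated_of_fderiv_le (s := ball z 1)
      (F := fun z t => H (z, t)) (bound := k.indicator fun _ => C)
      (F' := fun z t => (fderiv ℝ H (z, t)).comp (inl ℝ Z T))
      (ball_mem_nhds z one_pos) ?_ ?_ ?_ ?_ ?_ ?_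
    · exact .of_forall fun z =>
        (hH.continuous.comp (Continuous.prodMk_right z)).aestronglyMeasurable
    · exact (hH.continuous.comp (Continuous.prodMk_right z)).integrable_of_hasCompactSupport
        (.intro hk fun t ht => hs z hz t ht)
    · exact (hcf.comp (Continuous.prodMk_right z)).aestronglyMeasurable
    · refine .of_forall fun t y hy => ?_
      by_cases ht : t ∈ k
      · rw [Set.indicator_of_mem ht]
        exact hC (y, t) ⟨ball_subset_closedBall hy, ht⟩
      · rw [Set.indicator_of_notMem ht, h0 y hy t ht, norm_zero]
    · rw [integrable_indicator_iff hk.measurableSet]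
      exact integrableOn_const hk.measure_lt_top.ne
    · exact .of_forall fun t y _ => hd y t
  · intro v
    rw [ContinuousLinearMap.integral_apply]
    · rfl
    · exact (hcf.comp (Continuous.prodMk_right z)).integrable_of_hasCompactSupport
        (.intro hk fun t ht => h0 z hz t ht)

lemma fderiv_integral_of_compact {H : Z × T → ℂ} (hH : C^∞ H)
    (hs : ∀ z₀, ∃ k, IsCompact k ∧ ∀ z ∈ ball z₀ 1, ∀ t ∉ k, H (z, t) = 0) (z v : Z) :
    fderiv ℝ (fun z => ∫ t, H (z, t) ∂μ) z v = ∫ t, fderiv ℝ H (z, t) (v, 0) ∂μ := by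
  obtain ⟨h1, h2⟩ := hasFDerivAt_integral (μ := μ) hH hs z
  rw [h1.fderiv, h2]

lemma contDiff_integral_compact {H : Z × T → ℂ} (hH : C^∞ H)
    (hs : ∀ z₀, ∃ k, IsCompact k ∧ ∀ z ∈ ball z₀ 1, ∀ t ∉ k, H (z, t) = 0) :
    C^∞ (fun z => ∫ t, H (z, t) ∂μ) := by
  rw [contDiff_infty]
  intro n
  induction n generalizing H with
  | zero =>
    exact contDiff_zero.2 (Differentiable.continuous (𝕜 := ℝ) fun z =>
      (hasFDerivAt_integral hH hs z).1.differentiableAt)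
  | succ n ih =>
    push_cast
    rw [contDiff_succ_iff_fderiv_apply]
    refine ⟨fun z => (hasFDerivAt_integral hH hs z).1.differentiableAt,
      fun h => absurd h (by exact_mod_cast WithTop.coe_ne_top), fun v => ?_⟩
    simp only [fderiv_integral_of_compact hH hs]
    refine ih (H := fun p => fderiv ℝ H p (v, 0)) (smooth_dir hH _) fun z₀ => ?_
    obtain ⟨k, hk, hs⟩ := hs z₀
    refine ⟨k, hk, fun z hz t ht => ?_⟩
    rw [← fderiv_left hH z t v]
    have : (fun z => H (z, t)) =ᶠ[𝓝 z] fun _ => 0 := by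
      filter_upwards [isOpen_ball.mem_nhds hz] with w hw using hs w hw t ht
    rw [this.fderiv_eq]
    simp

end Parametric

/-! ### Directional derivatives -/

section Directional

variable {Z : Type*} [NormedAddCommGroup Z] [NormedSpace ℝ Z]

lemma fderiv_fderiv_comm {Q : Z → ℂ} (hQ : C^∞ Q) (a b p : Z) :
    fderiv ℝ (fun p => fderiv ℝ Q p a) p b = fderiv ℝ (fun p => fderiv ℝ Q p b) p a := by
  have hd : DifferentiableAt ℝ (fderiv ℝ Q) p :=
    (hQ.fderiv_right (m := ∞) (by simp)).differentiable (by simp) p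
  rw [fderiv_clm_apply hd (differentiableAt_const _), fderiv_clm_apply hd (differentiableAt_const _)]
  have := (hQ.contDiffAt (x := p)).isSymmSndFDerivAt (by
    rw [minSmoothness_of_isRCLikeNormedField]; exact WithTop.coe_le_coe.2 le_top)
  simpa using this b a

variable (Z) in
lemma exists_deriv_succ_le_sum [FiniteDimensional ℝ Z] :
    ∃ (n : ℕ) (b : Fin n → Z) (C : ℝ), 0 ≤ C ∧ ∀ f : Z → ℂ, C^∞ f → ∀ (k : ℕ) (z : Z),
      ‖iteratedFDeriv ℝ (k + 1) f z‖
        ≤ C * ∑ i, ‖iteratedFDeriv ℝ k (fun z => fderiv ℝ f z (b i)) z‖ := by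
  set b := Module.finBasis ℝ Z
  set c : Fin (Module.finrank ℝ Z) → (Z →L[ℝ] ℝ) := fun i =>
    LinearMap.toContinuousLinearMap (b.coord i)
  set L : Fin (Module.finrank ℝ Z) → (ℂ →L[ℝ] Z →L[ℝ] ℂ) := fun i =>
    ContinuousLinearMap.smulRightL ℝ Z ℂ (c i)
  refine ⟨_, b, ∑ i, ‖L i‖, sum_nonneg fun i _ => norm_nonneg (L i), fun f hf k z => ?_⟩
  have h1 : fderiv ℝ f = fun z => ∑ i, L i (fderiv ℝ f z (b i)) := by
    funext z
    ext v
    conv_lhs => rw [← b.sum_repr v, map_sum]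
    simp [L, c]
  have h2 : iteratedFDeriv ℝ k (fderiv ℝ f) z
      = ∑ i, iteratedFDeriv ℝ k (fun z => L i (fderiv ℝ f z (b i))) z := by
    conv_lhs => rw [h1]
    exact iteratedFDeriv_fun_sum_apply (𝕜 := ℝ) (f := fun i z => L i (fderiv ℝ f z (b i)))
      (u := Finset.univ) (n := k) (x := z) fun i _ => by
      have h3 : C^∞ (fun z => L i (fderiv ℝ f z (b i))) :=
        (L i).contDiff.comp (smooth_dir hf (b i))
      exact (h3.of_le (by exact_mod_cast le_top)).contDiffAt
  rw [← norm_iteratedFDeriv_fderiv, h2]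
  · refine (norm_sum_le _ _).trans ?_
    rw [mul_sum]
    refine sum_le_sum fun i _ => ?_
    refine (ContinuousLinearMap.norm_iteratedFDeriv_comp_left (L i)
      (smooth_dir hf (b i)).contDiffAt (by exact_mod_cast le_top)).trans ?_
    gcongr
    exact single_le_sum (f := fun i => ‖L i‖) (fun i _ => norm_nonneg (L i)) (Finset.mem_univ i)

end Directional

/-! ### Integrable weights -/

lemma integrable_inv_pow (d : ℕ) : Integrable (fun x : E d => (⟪x⟫ ^ (d + 1))⁻¹) := by
  have := integrable_one_add_norm (E := E d) (μ := volume) (r := d + 1) (by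
    rw [finrank_euclideanSpace_fin]; simp)
  refine this.congr (.of_forall fun x => ?_)
  simp only
  rw [Real.rpow_neg (by positivity), ← Nat.cast_succ, Real.rpow_natCast]

lemma integrable_inv_one_add_norm_div_pow (d : ℕ) {ħ : ℝ} (hħ : 0 < ħ) :
    Integrable (fun x : E d => ((1 + ‖x‖ / ħ) ^ (d + 1))⁻¹) := by
  have := (integrable_inv_pow d).comp_smul (inv_ne_zero hħ.ne')
  refine this.congr (.of_forall fun x => ?_)
  simp only
  rw [norm_smul, norm_of_nonneg (by positivity), inv_mul_eq_div]

lemma exists_planck_mul_integral_eq (d : ℕ) : ∃ C : ℝ, 0 ≤ C ∧ ∀ ħ : ℝ, 0 < ħ →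
    ‖planck d ħ‖ * ∫ x : E d, ((1 + ‖x‖ / ħ) ^ (d + 1))⁻¹ = C := by
  refine ⟨((2 * Real.pi) ^ d)⁻¹ * ∫ x : E d, (⟪x⟫ ^ (d + 1))⁻¹,
    mul_nonneg (by positivity) (integral_nonneg fun x => by positivity), fun ħ hħ => ?_⟩
  have h1 := Measure.integral_comp_smul (volume : Measure (E d))
    (fun x : E d => (⟪x⟫ ^ (d + 1))⁻¹) ħ⁻¹
  have h2 : ∀ x : E d, ‖ħ⁻¹ • x‖ = ‖x‖ / ħ := fun x => by
    rw [norm_smul, norm_of_nonneg (by positivity), inv_mul_eq_div]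
  simp only [h2] at h1
  rw [h1, finrank_euclideanSpace_fin, planck, norm_real, norm_of_nonneg (by positivity),
    abs_of_pos (by positivity), mul_pow, smul_eq_mul, inv_pow, inv_inv]
  field_simp

lemma norm_planck {d : ℕ} {ħ : ℝ} (hħ : 0 < ħ) : ‖planck d ħ‖ = ((2 * Real.pi * ħ) ^ d)⁻¹ := by
  rw [planck, norm_real, norm_of_nonneg (by positivity)]

/-! ### The semiclassical Fourier transform -/

/-- The inverse semiclassical Fourier transform. -/
noncomputable def invFourierH {d : ℕ} (ħ : ℝ) (t : E d → ℂ) (x : E d) : ℂ :=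
  planck d ħ * ∫ ξ : E d, osc ħ (inner ℝ x ξ) * t ξ

lemma fourierH_eq_fourier {d : ℕ} {ħ : ℝ} (ψ : E d → ℂ) (ξ : E d) :
    fourierH ħ ψ ξ = FourierTransform.fourier ψ ((2 * Real.pi * ħ)⁻¹ • ξ) := by
  rw [Real.fourier_eq']
  unfold fourierH osc
  congr 1
  funext x
  rw [smul_eq_mul, real_inner_smul_right]
  congr 2
  push_cast
  have : (Real.pi : ℂ) ≠ 0 := by exact_mod_cast Real.pi_ne_zero
  by_cases h : (ħ : ℂ) = 0
  · simp [h]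
  · field_simp

lemma invFourierH_eq_fourierInv {d : ℕ} {ħ : ℝ} (hħ : 0 < ħ) (t : E d → ℂ) (x : E d) :
    invFourierH ħ t x = FourierTransformInv.fourierInv (fun ξ => t ((2 * Real.pi * ħ) • ξ)) x := by
  have hc : 0 < 2 * Real.pi * ħ := by positivity
  rw [Real.fourierInv_eq']
  unfold invFourierH osc planck
  have h1 := Measure.integral_comp_smul (volume : Measure (E d))
    (fun ξ : E d => Complex.exp (I * ((inner ℝ x ξ / ħ : ℝ) : ℂ)) * t ξ) (2 * Real.pi * ħ)
  rw [finrank_euclideanSpace_fin, abs_of_pos (by positivity)] at h1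
  rw [← Complex.real_smul, ← h1]
  congr 1
  funext ξ
  rw [smul_eq_mul, real_inner_smul_right, real_inner_comm]
  congr 2
  have : (ħ : ℂ) ≠ 0 := by exact_mod_cast hħ.ne'
  push_cast
  field_simp

lemma exists_schwartz {d : ℕ} {ħ : ℝ} (hħ : 0 < ħ) {t : E d → ℂ}
    (ht : C^∞ t) (hc : HasCompactSupport t) :
    ∃ ψ : 𝓢(E d, ℂ), (∀ x, ψ x = invFourierH ħ t x) ∧ ∀ ξ, fourierH ħ ψ ξ = t ξ := by
  have hp : 0 < 2 * Real.pi * ħ := by positivity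
  have hc' : HasCompactSupport (fun ξ => t ((2 * Real.pi * ħ) • ξ)) :=
    hc.comp_smul hp.ne'
  have ht' : C^∞ (fun ξ : E d => t ((2 * Real.pi * ħ) • ξ)) :=
    ht.comp (contDiff_const_smul _)
  set q : 𝓢(E d, ℂ) := hc'.toSchwartzMap ht' with hq
  have hqc : (q : E d → ℂ) = fun ξ => t ((2 * Real.pi * ħ) • ξ) := rfl
  refine ⟨FourierTransformInv.fourierInv q, fun x => ?_, fun ξ => ?_⟩
  · rw [SchwartzMap.fourierInv_coe, invFourierH_eq_fourierInv hħ, hqc]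
  · rw [fourierH_eq_fourier, ← SchwartzMap.fourier_coe, FourierTransform.fourier_fourierInv_eq, hqc]
    simp only [smul_smul]
    rw [mul_inv_cancel₀ hp.ne', one_smul]

lemma integrable_fourierH {d : ℕ} {ħ : ℝ} (hħ : 0 < ħ) (q : 𝓢(E d, ℂ)) :
    Integrable (fourierH ħ q) := by
  have hp : 0 < 2 * Real.pi * ħ := by positivity
  have : fourierH ħ q = fun ξ => FourierTransform.fourier q ((2 * Real.pi * ħ)⁻¹ • ξ) := by
    funext ξ
    rw [fourierH_eq_fourier, SchwartzMap.fourier_coe]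
  rw [this]
  exact (FourierTransform.fourier q).integrable.comp_smul (inv_ne_zero hp.ne')

lemma invFourierH_fourierH {d : ℕ} {ħ : ℝ} (hħ : 0 < ħ) (q : 𝓢(E d, ℂ)) (x : E d) :
    invFourierH ħ (fourierH ħ q) x = q x := by
  have hp : 0 < 2 * Real.pi * ħ := by positivity
  rw [invFourierH_eq_fourierInv hħ]
  have : (fun ξ => fourierH ħ q ((2 * Real.pi * ħ) • ξ)) = FourierTransform.fourier (q : E d → ℂ) := by
    funext ξ
    rw [fourierH_eq_fourier, smul_smul, inv_mul_cancel₀ hp.ne', one_smul]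
  rw [this, ← SchwartzMap.fourier_coe, ← SchwartzMap.fourierInv_coe,
    FourierTransform.fourierInv_fourier_eq]

/-! ### Cauchy-Schwarz on bounded sets -/

/-- The `L²` norm of a Schwartz function, as a real number. -/
noncomputable def l2 {d : ℕ} (ψ : 𝓢(E d, ℂ)) : ℝ := (eLpNorm ψ 2 volume).toReal

lemma l2_nonneg {d : ℕ} (ψ : 𝓢(E d, ℂ)) : 0 ≤ l2 ψ := ENNReal.toReal_nonneg

lemma ofReal_l2 {d : ℕ} (ψ : 𝓢(E d, ℂ)) : ENNReal.ofReal (l2 ψ) = eLpNorm ψ 2 volume :=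
  ENNReal.ofReal_toReal (ψ.memLp 2 volume).2.ne

lemma exists_setIntegral_norm_le_l2 {d : ℕ} {k : Set (E d)} (hk : IsCompact k) :
    ∃ C, 0 ≤ C ∧ ∀ ψ : 𝓢(E d, ℂ), ∫ w in k, ‖ψ w‖ ≤ C * l2 ψ := by
  refine ⟨((volume k) ^ ½).toReal, ENNReal.toReal_nonneg, fun ψ => ?_⟩
  have h1 := eLpNorm_le_eLpNorm_mul_rpow_measure_univ (μ := volume.restrict k) (p := 1) (q := 2)
    (f := ψ) (by norm_num) ψ.continuous.aestronglyMeasurable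
  have h2 : eLpNorm ψ 2 (volume.restrict k) ≤ eLpNorm ψ 2 volume :=
    eLpNorm_mono_measure _ Measure.restrict_le_self
  have h3 : eLpNorm ψ 1 (volume.restrict k) ≤ eLpNorm ψ 2 volume * (volume k) ^ ½ := by
    refine h1.trans ?_
    rw [Measure.restrict_apply_univ]
    norm_num
    gcongr
  have h4 : eLpNorm ψ 1 (volume.restrict k) = ENNReal.ofReal (∫ w in k, ‖ψ w‖) := by
    rw [eLpNorm_one_eq_lintegral_enorm,
      ofReal_integral_norm_eq_lintegral_enorm ψ.integrable.integrableOn]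
  rw [h4, ENNReal.ofReal_le_iff_le_toReal, ENNReal.toReal_mul] at h3
  · rw [mul_comm]; exact h3
  · exact (ENNReal.mul_lt_top (ψ.memLp 2 volume).2
      (ENNReal.rpow_lt_top_of_nonneg (by norm_num) hk.measure_lt_top.ne)).ne

end

section

/-! ### The frequency map `g` -/

section Geometry

variable {d : ℕ} (G : GeneralLinearGroup (Fin (d + 1)) ℝ)

lemma inner_act_left (M : Matrix (Fin (d + 1)) (Fin (d + 1)) ℝ) (X Y : E (d + 1)) :
    (inner ℝ (act M X) Y : ℝ) = inner ℝ X (act M.transpose Y) := by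
  simp only [act, EuclideanSpace.inner_eq_star_dotProduct, star_trivial]
  rw [Matrix.dotProduct_mulVec, ← Matrix.mulVec_transpose]

lemma inner_lift (t s : ℝ) (x y : E d) :
    (inner ℝ (lift t x) (lift s y) : ℝ) = t * s + inner ℝ x y := by
  simp only [lift, PiLp.inner_apply, Fin.sum_univ_succ, Fin.cons_zero, Fin.cons_succ]
  simp [mul_comm]

lemma inner_lift_zero (y : E d) (X : E (d + 1)) :
    (inner ℝ (lift 0 y) X : ℝ) = inner ℝ y (proj X) := by
  simp only [lift, proj, PiLp.inner_apply, Fin.sum_univ_succ, Fin.cons_zero, Fin.cons_succ]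
  simp

lemma inner_act_lift (y ξ : E d) :
    (inner ℝ (act (G : Matrix (Fin (d + 1)) (Fin (d + 1)) ℝ) (lift 0 y)) (sigma ξ) : ℝ)
      = inner ℝ y (gMap G ξ) := by
  rw [inner_act_left, inner_lift_zero, gMap]

/-- The linear map `ξ ↦ π ᵗG (0, ξ)`. -/
noncomputable def gLin : E d →L[ℝ] E d :=
  LinearMap.toContinuousLinearMap
    { toFun := fun ξ => proj (act (G : Matrix (Fin (d + 1)) (Fin (d + 1)) ℝ).transpose (lift 0 ξ))
      map_add' := fun x y => by
        ext i
        simp [proj, act, lift, Matrix.mulVec, dotProduct, Fin.sum_univ_succ, mul_add,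
          Finset.sum_add_distrib]
      map_smul' := fun c x => by
        ext i
        simp [proj, act, lift, Matrix.mulVec, dotProduct, Fin.sum_univ_succ, mul_sum,
          mul_left_comm] }

/-- The vector `π ᵗG (1, 0)`. -/
noncomputable def gVec : E d :=
  proj (act (G : Matrix (Fin (d + 1)) (Fin (d + 1)) ℝ).transpose (lift 1 0))

lemma proj_act_lift (t : ℝ) (ξ : E d) :
    proj (act (G : Matrix (Fin (d + 1)) (Fin (d + 1)) ℝ).transpose (lift t ξ))
      = t • gVec G + gLin G ξ := by
  ext i
  simp [proj, act, lift, Matrix.mulVec, dotProduct, Fin.sum_univ_succ, gVec, gLin, mul_comm]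

lemma gMap_eq (ξ : E d) : gMap G ξ = sqrt (1 - ‖ξ‖ ^ 2) • gVec G + gLin G ξ := by
  rw [gMap, sigma, proj_act_lift]

lemma continuous_gMap : Continuous (gMap G) := by
  have : gMap G = fun ξ => sqrt (1 - ‖ξ‖ ^ 2) • gVec G + gLin G ξ := funext (gMap_eq G)
  rw [this]
  fun_prop

lemma one_sub_sq_pos {ξ : E d} (h : ‖ξ‖ < 1) : 0 < 1 - ‖ξ‖ ^ 2 := by
  have := norm_nonneg ξ
  nlinarith

lemma contDiffAt_sqrt_one_sub {ξ : E d} (h : ‖ξ‖ < 1) :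
    ContDiffAt ℝ ∞ (fun ξ : E d => sqrt (1 - ‖ξ‖ ^ 2)) ξ :=
  (contDiffAt_const.sub (contDiff_norm_sq ℝ).contDiffAt).sqrt (one_sub_sq_pos h).ne'

lemma contDiffAt_gMap {ξ : E d} (h : ‖ξ‖ < 1) : ContDiffAt ℝ ∞ (gMap G) ξ := by
  have : gMap G = fun ξ => sqrt (1 - ‖ξ‖ ^ 2) • gVec G + gLin G ξ := funext (gMap_eq G)
  rw [this]
  exact ((contDiffAt_sqrt_one_sub h).smul contDiffAt_const).add (gLin G).contDiff.contDiffAt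

/-- The matrix `M(ξ, ξ')` with `g(ξ) - g(ξ') = M(ξ, ξ') (ξ - ξ')`. -/
noncomputable def kur (ξ ξ' : E d) : E d →L[ℝ] E d :=
  gLin G - (sqrt (1 - ‖ξ‖ ^ 2) + sqrt (1 - ‖ξ'‖ ^ 2))⁻¹ • (innerSL ℝ (ξ + ξ')).smulRight (gVec G)

lemma kur_apply (ξ ξ' v : E d) : kur G ξ ξ' v = gLin G v
    - ((sqrt (1 - ‖ξ‖ ^ 2) + sqrt (1 - ‖ξ'‖ ^ 2))⁻¹ * inner ℝ (ξ + ξ') v) • gVec G := by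
  simp [kur, smul_smul, mul_add, add_smul, inner_add_left]

lemma kur_self_apply {ξ : E d} (h : ‖ξ‖ < 1) (v : E d) : kur G ξ ξ v
    = (-((sqrt (1 - ‖ξ‖ ^ 2))⁻¹ * inner ℝ ξ v)) • gVec G + gLin G v := by
  have hs : sqrt (1 - ‖ξ‖ ^ 2) ≠ 0 := (Real.sqrt_pos.2 (one_sub_sq_pos h)).ne'
  rw [kur_apply, sub_eq_add_neg (gLin G v), add_comm, ← neg_smul, inner_add_left]
  congr 2
  field_simp

lemma kur_comm (ξ ξ' : E d) : kur G ξ ξ' = kur G ξ' ξ := by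
  rw [kur, kur, add_comm ξ, add_comm (sqrt _)]

lemma gMap_sub_gMap {ξ ξ' : E d} (h : ‖ξ‖ < 1) (h' : ‖ξ'‖ < 1) :
    gMap G ξ - gMap G ξ' = kur G ξ ξ' (ξ - ξ') := by
  rw [gMap_eq, gMap_eq, kur_apply, map_sub]
  have hs : 0 < sqrt (1 - ‖ξ‖ ^ 2) := Real.sqrt_pos.2 (one_sub_sq_pos h)
  have hs' : 0 < sqrt (1 - ‖ξ'‖ ^ 2) := Real.sqrt_pos.2 (one_sub_sq_pos h')
  have e1 := Real.sq_sqrt (one_sub_sq_pos h).le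
  have e2 := Real.sq_sqrt (one_sub_sq_pos h').le
  have e3 : (inner ℝ (ξ + ξ') (ξ - ξ') : ℝ) = ‖ξ‖ ^ 2 - ‖ξ'‖ ^ 2 := by
    rw [inner_add_left, inner_sub_right, inner_sub_right, real_inner_self_eq_norm_sq,
      real_inner_self_eq_norm_sq, real_inner_comm]
    ring
  have e4 : (sqrt (1 - ‖ξ‖ ^ 2) + sqrt (1 - ‖ξ'‖ ^ 2))⁻¹ * inner ℝ (ξ + ξ') (ξ - ξ')
      = -(sqrt (1 - ‖ξ‖ ^ 2) - sqrt (1 - ‖ξ'‖ ^ 2)) := by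
    rw [e3, inv_mul_eq_iff_eq_mul₀ (by positivity)]
    nlinarith
  rw [e4]
  module

lemma contDiffAt_kur {p : E d × E d} (h : ‖p.1‖ < 1) (h' : ‖p.2‖ < 1) :
    ContDiffAt ℝ ∞ (fun p : E d × E d => kur G p.1 p.2) p := by
  have h1 : 0 < sqrt (1 - ‖p.1‖ ^ 2) := Real.sqrt_pos.2 (one_sub_sq_pos h)
  have h2 : 0 < sqrt (1 - ‖p.2‖ ^ 2) := Real.sqrt_pos.2 (one_sub_sq_pos h')
  refine contDiffAt_const.sub (ContDiffAt.smul (ContDiffAt.inv (ContDiffAt.add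
    ((contDiffAt_sqrt_one_sub h).comp p contDiffAt_fst)
    ((contDiffAt_sqrt_one_sub h').comp p contDiffAt_snd)) (by positivity)) ?_)
  have h3 : (fun p : E d × E d => (innerSL ℝ (p.1 + p.2)).smulRight (gVec G))
      = fun p => (ContinuousLinearMap.smulRightL ℝ (E d) (E d)).flip (gVec G)
        (innerSL ℝ (p.1 + p.2)) := rfl
  rw [h3]
  exact (ContinuousLinearMap.contDiff _).contDiffAt.comp p
    ((innerSL ℝ : E d →L[ℝ] _).contDiff.contDiffAt.comp p (contDiffAt_fst.add contDiffAt_snd))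

lemma hasFDerivAt_gMap {ξ : E d} (h : ‖ξ‖ < 1) : HasFDerivAt (gMap G) (kur G ξ ξ) ξ := by
  have : gMap G = fun ξ => sqrt (1 - ‖ξ‖ ^ 2) • gVec G + gLin G ξ := funext (gMap_eq G)
  rw [this]
  have h1 : HasFDerivAt (fun ξ : E d => sqrt (1 - ‖ξ‖ ^ 2))
      ((1 / (2 * sqrt (1 - ‖ξ‖ ^ 2))) • (-((2 : ℝ) • innerSL ℝ ξ))) ξ := by
    have h0 : HasFDerivAt (fun ξ : E d => 1 - ‖ξ‖ ^ 2) (-((2 : ℝ) • innerSL ℝ ξ)) ξ := by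
      have := (hasStrictFDerivAt_norm_sq ξ).hasFDerivAt.const_sub 1
      simpa [two_smul] using this
    exact h0.sqrt (one_sub_sq_pos h).ne'
  refine ((h1.smul_const (gVec G)).add (gLin G).hasFDerivAt).congr_fderiv ?_
  ext1 v
  have hs : sqrt (1 - ‖ξ‖ ^ 2) ≠ 0 := (Real.sqrt_pos.2 (one_sub_sq_pos h)).ne'
  rw [kur_self_apply G h]
  simp only [_root_.add_apply, ContinuousLinearMap.smulRight_apply,
    _root_.smul_apply, _root_.neg_apply, innerSL_apply_apply, smul_eq_mul]
  congr 2
  field_simp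

lemma fderiv_gMap {ξ : E d} (h : ‖ξ‖ < 1) : fderiv ℝ (gMap G) ξ = kur G ξ ξ :=
  (hasFDerivAt_gMap G h).fderiv

lemma contDiff_clm_det : C^∞ (fun A : E d →L[ℝ] E d => A.det) := by
  have : (fun A : E d →L[ℝ] E d => A.det) = fun A => ∑ σ : Equiv.Perm (Fin d),
      (Equiv.Perm.sign σ : ℝ) * ∏ i, (A (single i 1)) (σ i) := by
    funext A
    rw [ContinuousLinearMap.det, ← LinearMap.det_toMatrix (EuclideanSpace.basisFun (Fin d) ℝ).toBasis,
      Matrix.det_apply']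
    simp [LinearMap.toMatrix_apply]
  rw [this]
  refine ContDiff.sum fun σ _ => contDiff_const.mul (contDiff_prod fun i _ => ?_)
  exact ((EuclideanSpace.proj (σ i) : E d →L[ℝ] ℝ).comp
    (ContinuousLinearMap.apply ℝ (E d) (single i (1 : ℝ)))).contDiff

lemma isInvertible_of_det {A : E d →L[ℝ] E d} (h : A.det ≠ 0) : A.IsInvertible :=
  ⟨A.toContinuousLinearEquivOfDetNeZero h, by ext; simp⟩

lemma isInvertible_adjoint {A : E d →L[ℝ] E d} (h : A.IsInvertible) : (adjoint A).IsInvertible := by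
  obtain ⟨e, rfl⟩ := h
  refine ContinuousLinearMap.IsInvertible.of_inverse
    (g := adjoint (e.symm : E d →L[ℝ] E d)) ?_ ?_
  · rw [← ContinuousLinearMap.adjoint_comp]
    simp [ContinuousLinearMap.adjoint_id]
  · rw [← ContinuousLinearMap.adjoint_comp]
    simp [ContinuousLinearMap.adjoint_id]

lemma det_adjoint (A : E d →L[ℝ] E d) : (adjoint A).det = A.det := by
  rw [ContinuousLinearMap.det, ContinuousLinearMap.det,
    ← LinearMap.det_toMatrix (EuclideanSpace.basisFun (Fin d) ℝ).toBasis,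
    ← LinearMap.det_toMatrix (EuclideanSpace.basisFun (Fin d) ℝ).toBasis, ← Matrix.det_transpose]
  congr 1
  ext i j
  simp only [Matrix.transpose_apply, LinearMap.toMatrix_apply, OrthonormalBasis.coe_toBasis,
    OrthonormalBasis.coe_toBasis_repr_apply, OrthonormalBasis.repr_apply_apply,
    ContinuousLinearMap.coe_coe, ContinuousLinearMap.adjoint_inner_right]
  rw [real_inner_comm]

lemma det_kur_ne_zero_of_mem_region {ε : ℝ} (hε : 0 < ε) {z : Phase d} (hz : z ∈ region G ε) :
    (kur G z.2 z.2).det ≠ 0 := by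
  obtain ⟨h1, h2⟩ := hz
  set ξ := z.2
  have hξ : ‖ξ‖ < 1 := by linarith
  have hs : sqrt (1 - ‖ξ‖ ^ 2) ≠ 0 := (Real.sqrt_pos.2 (one_sub_sq_pos hξ)).ne'
  intro hdet
  obtain ⟨v, hv, hv0⟩ := LinearMap.bot_lt_ker_of_det_eq_zero hdet |>.ne' |> fun h =>
    (Submodule.ne_bot_iff _).1 h
  rw [LinearMap.mem_ker] at hv
  set c : ℝ := -((sqrt (1 - ‖ξ‖ ^ 2))⁻¹ * inner ℝ ξ v) with hc
  set M : Matrix (Fin (d + 1)) (Fin (d + 1)) ℝ := (G : Matrix (Fin (d + 1)) (Fin (d + 1)) ℝ)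
  have hp : proj (act M.transpose (lift c v)) = 0 := by
    have hv' : kur G ξ ξ v = 0 := hv
    rw [kur_self_apply G hξ] at hv'
    rw [proj_act_lift, ← hv', hc]
  set X := lift c v with hX
  have horth : (inner ℝ X (sigma ξ) : ℝ) = 0 := by
    rw [hX, sigma, inner_lift, hc, real_inner_comm]
    field_simp
    ring
  have hinv1 : ∀ Y : E (d + 1), act M (act M⁻¹ Y) = Y := fun Y => by
    ext i
    simp only [act, Matrix.mulVec_mulVec]
    rw [Matrix.mul_nonsing_inv _ ((Matrix.isUnit_iff_isUnit_det _).1 G.isUnit)]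
    simp
  have hinv2 : ∀ Y Z : E (d + 1), (inner ℝ Y Z : ℝ) = inner ℝ (act M.transpose Y) (act M⁻¹ Z) := by
    intro Y Z
    rw [inner_act_left, Matrix.transpose_transpose, hinv1]
  have hfirst : ∀ Z : E (d + 1), (inner ℝ X Z : ℝ) = (act M.transpose X) 0 * (act M⁻¹ Z) 0 := by
    intro Z
    rw [hinv2]
    simp only [PiLp.inner_apply, Fin.sum_univ_succ]
    have : ∀ i : Fin d, (act M.transpose X) i.succ = 0 := fun i => by
      have := congrArg (fun x : E d => x i) hp
      simpa [proj] using this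
    simp [this, mul_comm]
  by_cases hτ : (act M.transpose X) 0 = 0
  · have : (inner ℝ X X : ℝ) = 0 := by rw [hfirst, hτ, zero_mul]
    rw [hX, inner_lift] at this
    have h3 : (inner ℝ v v : ℝ) ≤ 0 := by nlinarith [mul_self_nonneg c]
    exact hv0 (real_inner_self_nonpos.1 h3)
  · apply h2
    refine ⟨act M⁻¹ (sigma ξ), ?_, hinv1 _⟩
    have := hfirst (sigma ξ)
    rw [horth] at this
    rcases mul_eq_zero.1 this.symm with h | h
    · exact absurd h hτ
    · exact h

lemma norm_lt_one_of_mem_region {ε : ℝ} (hε : 0 < ε) {z : Phase d} (hz : z ∈ region G ε) :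
    ‖z.2‖ < 1 := by
  have := hz.1
  linarith

lemma exists_local_inverse {ξ : E d} (h : ‖ξ‖ < 1) (hdet : (kur G ξ ξ).det ≠ 0) :
    ∃ k : E d → E d, ContDiffAt ℝ ∞ k (gMap G ξ) ∧ k (gMap G ξ) = ξ ∧
      (∀ᶠ η in 𝓝 (gMap G ξ), gMap G (k η) = η) ∧ ∀ᶠ ζ in 𝓝 ξ, k (gMap G ζ) = ζ := by
  obtain ⟨e, he⟩ := isInvertible_of_det hdet
  have hd : HasFDerivAt (gMap G) (e : E d →L[ℝ] E d) ξ := by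
    rw [he]; exact hasFDerivAt_gMap G h
  have hc := contDiffAt_gMap G h
  have hs := hc.hasStrictFDerivAt' hd (by simp)
  exact ⟨hc.localInverse hd (by simp), hc.to_localInverse hd (by simp),
    hc.localInverse_apply_image hd (by simp), hs.eventually_right_inverse,
    hs.eventually_left_inverse⟩

lemma exists_chart {B : Set (E d)} (hB : IsOpen B) (hB1 : ∀ ξ ∈ B, ‖ξ‖ < 1)
    (hdet : ∀ ξ ∈ B, ∀ ξ' ∈ B, (kur G ξ ξ').det ≠ 0) :
    Set.InjOn (gMap G) B ∧ IsOpen (gMap G '' B) ∧ ∃ h : E d → E d, (∀ ξ ∈ B, h (gMap G ξ) = ξ) ∧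
        ∀ η ∈ gMap G '' B, ContDiffAt ℝ ∞ h η := by
  have hinj : Set.InjOn (gMap G) B := by
    intro ξ hξ ξ' hξ' heq
    have h1 := gMap_sub_gMap G (hB1 ξ hξ) (hB1 ξ' hξ')
    rw [heq, sub_self] at h1
    obtain ⟨e, he⟩ := isInvertible_of_det (hdet ξ hξ ξ' hξ')
    rw [← he] at h1
    have h2 : ξ - ξ' = 0 := e.injective (by rw [map_zero]; exact h1.symm)
    exact sub_eq_zero.1 h2
  have hopen : IsOpen (gMap G '' B) := by
    rw [isOpen_iff_mem_nhds]
    rintro _ ⟨ξ, hξ, rfl⟩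
    obtain ⟨k, hk1, hk2, hk3, -⟩ := exists_local_inverse G (hB1 ξ hξ) (hdet ξ hξ ξ hξ)
    have hkB : ∀ᶠ η in 𝓝 (gMap G ξ), k η ∈ B :=
      hk1.continuousAt.eventually (by rw [hk2]; exact hB.mem_nhds hξ)
    filter_upwards [hk3, hkB] with η h3 h4
    exact ⟨k η, h4, h3⟩
  refine ⟨hinj, hopen, Function.invFunOn (gMap G) B, fun ξ hξ => hinj.leftInvOn_invFunOn hξ, ?_⟩
  rintro _ ⟨ξ, hξ, rfl⟩
  obtain ⟨k, hk1, hk2, hk3, -⟩ := exists_local_inverse G (hB1 ξ hξ) (hdet ξ hξ ξ hξ)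
  refine hk1.congr_of_eventuallyEq ?_
  have hkB : ∀ᶠ η in 𝓝 (gMap G ξ), k η ∈ B :=
    hk1.continuousAt.eventually (by rw [hk2]; exact hB.mem_nhds hξ)
  filter_upwards [hk3, hkB] with η h3 h4
  conv_lhs => rw [← h3]
  exact hinj.leftInvOn_invFunOn h4

/-! ### The second formula for the subprincipal term -/

lemma contDiffAt_inverse_adjoint_kur {p : E d × E d} (h : ‖p.1‖ < 1) (h' : ‖p.2‖ < 1)
    (hdet : (kur G p.1 p.2).det ≠ 0) :
    ContDiffAt ℝ ∞ (fun p : E d × E d => (adjoint (kur G p.1 p.2)).inverse) p := by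
  refine ContDiffAt.comp (g := ContinuousLinearMap.inverse)
    (f := fun p : E d × E d => adjoint (kur G p.1 p.2)) p
    (isInvertible_adjoint (isInvertible_of_det hdet)).contDiffAt_map_inverse ?_
  exact (LinearMap.toContinuousLinearMap
    { toFun := fun A : E d →L[ℝ] E d => adjoint A
      map_add' := fun A B => map_add _ A B
      map_smul' := fun c A => by simp }).contDiff.contDiffAt.comp p (contDiffAt_kur G h h')

lemma jac_eq {ξ : E d} (h : ‖ξ‖ < 1) : jac G ξ = (kur G ξ ξ).det⁻¹ := by
  rw [jac, fderiv_gMap G h]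

lemma kappa_eq {z : Phase d} (h : ‖z.2‖ < 1) : kappa G z
    = ((adjoint (kur G z.2 z.2)).inverse z.1, gMap G z.2) := by
  rw [kappa, fderiv_gMap G h]

lemma eventually_norm_lt_one {ξ : E d} (h : ‖ξ‖ < 1) : ∀ᶠ η in 𝓝 ξ, ‖η‖ < 1 :=
  continuous_norm.continuousAt.eventually (Iio_mem_nhds h)

lemma contDiffAt_det_kur {ξ : E d} (h : ‖ξ‖ < 1) : ContDiffAt ℝ ∞ (fun ξ => (kur G ξ ξ).det) ξ :=
  contDiff_clm_det.contDiffAt.comp ξ (ContDiffAt.comp (f := fun ξ => (ξ, ξ)) ξ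
    (contDiffAt_kur G (p := (ξ, ξ)) h h) (contDiffAt_id.prodMk contDiffAt_id))

lemma contDiffAt_jac {ξ : E d} (h : ‖ξ‖ < 1) (hdet : (kur G ξ ξ).det ≠ 0) :
    ContDiffAt ℝ ∞ (jac G) ξ := by
  refine ((contDiffAt_det_kur G h).inv hdet).congr_of_eventuallyEq ?_
  filter_upwards [eventually_norm_lt_one h] with η hη
  exact jac_eq G hη

lemma contDiffAt_kappa {z : Phase d} (h : ‖z.2‖ < 1) (hdet : (kur G z.2 z.2).det ≠ 0) :
    ContDiffAt ℝ ∞ (kappa G) z := by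
  have h1 : ContDiffAt ℝ ∞ (fun z : Phase d =>
      ((adjoint (kur G z.2 z.2)).inverse z.1, gMap G z.2)) z := by
    refine ContDiffAt.prodMk (ContDiffAt.clm_apply ?_ contDiffAt_fst) ?_
    · exact (contDiffAt_inverse_adjoint_kur G (p := (z.2, z.2)) h h hdet).comp z
        (contDiffAt_snd.prodMk contDiffAt_snd)
    · exact (contDiffAt_gMap G h).comp z contDiffAt_snd
  refine h1.congr_of_eventuallyEq ?_
  filter_upwards [continuous_snd.continuousAt.eventually (eventually_norm_lt_one h)] with w hw
  exact kappa_eq G hw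

lemma sum_apply_mul_apply_inverse_adjoint {A : E d →L[ℝ] E d} (hA : A.IsInvertible)
    (α : E d →L[ℝ] ℂ) (β : E d →L[ℝ] ℂ) :
    ∑ j, α (A (single j 1)) * β ((adjoint A).inverse (single j 1))
      = ∑ j, α (single j 1) * β (single j 1) := by
  set b := EuclideanSpace.basisFun (Fin d) ℝ
  have hb : ∀ j, single j (1 : ℝ) = b j := fun j => by simp [b]
  simp only [hb]
  set B := (adjoint A).inverse
  have hB : ∀ x, B (adjoint A x) = x := fun x => by
    obtain ⟨e, he⟩ := isInvertible_adjoint hA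
    simp [B, ← he]
  have h1 : ∀ j, α (A (b j)) = ∑ k, ((inner ℝ (b k) (A (b j)) : ℝ) : ℂ) * α (b k) := fun j => by
    conv_lhs => rw [← b.sum_repr' (A (b j)), map_sum]
    simp
  have h2 : ∀ k, β (b k) = ∑ j, ((inner ℝ (b k) (A (b j)) : ℝ) : ℂ) * β (B (b j)) := fun k => by
    conv_lhs => rw [← hB (b k), ← b.sum_repr' (adjoint A (b k)), map_sum, map_sum]
    refine sum_congr rfl fun j _ => ?_
    rw [ContinuousLinearMap.adjoint_inner_right, real_inner_comm]
    simp
  simp only [h1]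
  conv_rhs => enter [2, k]; rw [h2 k]
  simp only [sum_mul, mul_sum]
  rw [Finset.sum_comm]
  refine sum_congr rfl fun k _ => sum_congr rfl fun j _ => by ring

lemma eventuallyEq_of_isLocalLeftInverse {ξ : E d} {h k : E d → E d}
    (hh : IsLocalLeftInverse G h ξ) (hk : ContDiffAt ℝ ∞ k (gMap G ξ)) (hk2 : k (gMap G ξ) = ξ)
    (hk3 : ∀ᶠ η in 𝓝 (gMap G ξ), gMap G (k η) = η) : h =ᶠ[𝓝 (gMap G ξ)] k := by
  have : ∀ᶠ η in 𝓝 (gMap G ξ), h (gMap G (k η)) = k η :=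
    hk.continuousAt.eventually (by rw [hk2]; exact hh)
  filter_upwards [this, hk3] with η h1 h2
  rw [← h1, h2]

lemma eventually_jac_comp_eq_det {ξ : E d} (h1 : ‖ξ‖ < 1) (hdet : (kur G ξ ξ).det ≠ 0)
    {h : E d → E d} (hh : IsLocalLeftInverse G h ξ) :
    ∀ᶠ η in 𝓝 (gMap G ξ), jac G (h η) = (fderiv ℝ h η).det := by
  obtain ⟨k, hk, hk2, hk3, -⟩ := exists_local_inverse G h1 hdet
  have hev := eventuallyEq_of_isLocalLeftInverse G hh hk hk2 hk3
  have hn : ∀ᶠ η in 𝓝 (gMap G ξ), ‖k η‖ < 1 :=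
    hk.continuousAt.eventually (by rw [hk2]; exact eventually_norm_lt_one h1)
  filter_upwards [hev.eventuallyEq_nhds, hn, hk3.eventually_nhds,
    (hk.of_le (m := 1) (by simp)).eventually (by simp)] with η e1 e2 e3 e4
  have hkd : DifferentiableAt ℝ k η := e4.differentiableAt (by simp)
  rw [e1.fderiv_eq, e1.self_of_nhds, jac_eq G e2]
  have hcomp : (kur G (k η) (k η)).comp (fderiv ℝ k η) = ContinuousLinearMap.id ℝ (E d) := by
    have := ((hasFDerivAt_gMap G e2).comp η hkd.hasFDerivAt)
    have h2 : HasFDerivAt (fun η => η) ((kur G (k η) (k η)).comp (fderiv ℝ k η)) η :=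
      this.congr_of_eventuallyEq (by filter_upwards [e3] with x hx using hx.symm)
    exact h2.unique (hasFDerivAt_id η)
  have hd := congrArg ContinuousLinearMap.det hcomp
  have hd2 : (kur G (k η) (k η)).det * (fderiv ℝ k η).det = 1 := by
    rw [ContinuousLinearMap.det, ContinuousLinearMap.det, ← LinearMap.det_comp]
    exact hd.trans LinearMap.det_id
  exact inv_eq_of_mul_eq_one_right hd2

lemma r1_eq_pullback {p₀ : Phase d → ℂ} (hp : C^∞ p₀) {z : Phase d} (h1 : ‖z.2‖ < 1)
    (hdet : (kur G z.2 z.2).det ≠ 0) {h : E d → E d} (hh : IsLocalLeftInverse G h z.2) :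
    r1 G p₀ z = I / (2 * (jac G (h (kappa G z).2) : ℂ)) *
      poisson (fun w => (jac G (h w.2) : ℂ)) p₀ (kappa G z) := by
  obtain ⟨k, hk, hk2, hk3, hk4⟩ := exists_local_inverse G h1 hdet
  have hev := eventuallyEq_of_isLocalLeftInverse G hh hk hk2 hk3
  have hκ2 : (kappa G z).2 = gMap G z.2 := rfl
  have hhξ : h (gMap G z.2) = z.2 := hh.self_of_nhds
  set Jt : E d → ℂ := fun η => (jac G (h η) : ℂ)
  set Jc : E d → ℂ := fun ξ => (jac G ξ : ℂ)
  have hJc : DifferentiableAt ℝ Jc z.2 :=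
    DifferentiableAt.comp (g := fun x : ℝ => (x : ℂ)) z.2 Complex.ofRealCLM.differentiableAt ((contDiffAt_jac G h1 hdet).differentiableAt (by simp))
  have hJt : DifferentiableAt ℝ Jt (gMap G z.2) := by
    have hd : DifferentiableAt ℝ (fun η => Jc (k η)) (gMap G z.2) := by
      refine DifferentiableAt.comp (g := Jc) (f := k) _ ?_ (hk.differentiableAt (by simp))
      rw [hk2]; exact hJc
    refine hd.congr_of_eventuallyEq ?_
    filter_upwards [hev] with η hη
    simp [Jt, Jc, hη]
  have hJ : fderiv ℝ Jc z.2 = (fderiv ℝ Jt (gMap G z.2)).comp (kur G z.2 z.2) := by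
    have h2 := hJt.hasFDerivAt.comp z.2 (hasFDerivAt_gMap G h1)
    have h3 : HasFDerivAt Jc ((fderiv ℝ Jt (gMap G z.2)).comp (kur G z.2 z.2)) z.2 := by
      refine h2.congr_of_eventuallyEq ?_
      filter_upwards [hh] with η hη
      simp [Jt, Jc, hη]
    exact h3.fderiv
  have hsnd : ∀ (F : E d → ℂ) (w : Phase d), DifferentiableAt ℝ F w.2 →
      ∀ v, fderiv ℝ (fun w : Phase d => F w.2) w v = fderiv ℝ F w.2 v.2 := by
    intro F w hF v
    have := (hF.hasFDerivAt.comp w hasFDerivAt_snd).fderiv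
    simp only [Function.comp_def] at this
    rw [this]; simp
  have hr0 : ∀ v, fderiv ℝ (r0 G p₀) z (v, 0) = fderiv ℝ p₀ (kappa G z)
      ((adjoint (kur G z.2 z.2)).inverse v, 0) := by
    intro v
    have hκd : DifferentiableAt ℝ (kappa G) z := (contDiffAt_kappa G h1 hdet).differentiableAt (by simp)
    have e1 : fderiv ℝ (r0 G p₀) z (v, 0) = fderiv ℝ p₀ (kappa G z) (fderiv ℝ (kappa G) z (v, 0)) := by
      have := ((hp.differentiable (by simp) (kappa G z)).hasFDerivAt.comp z hκd.hasFDerivAt).fderiv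
      simp only [Function.comp_def] at this
      unfold r0
      rw [this]
      rfl
    rw [e1]
    congr 1
    have h2 : HasFDerivAt (fun x : E d => kappa G (x, z.2))
        ((fderiv ℝ (kappa G) z).comp (inl ℝ _ _)) z.1 :=
      HasFDerivAt.comp z.1 (f := fun x : E d => (x, z.2)) hκd.hasFDerivAt
        (hasFDerivAt_prodMk_left z.1 z.2)
    have h3 : HasFDerivAt (fun x : E d => kappa G (x, z.2))
        (((adjoint (kur G z.2 z.2)).inverse).prod 0) z.1 := by
      have : (fun x : E d => kappa G (x, z.2)) = fun x =>
          ((adjoint (kur G z.2 z.2)).inverse x, gMap G z.2) :=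
        funext fun x => kappa_eq G (z := (x, z.2)) h1
      rw [this]
      exact (ContinuousLinearMap.hasFDerivAt _).prodMk (hasFDerivAt_const _ _)
    have h4 := congrArg (fun A : E d →L[ℝ] Phase d => A v) (h2.unique h3)
    simpa using h4
  have hpo : poisson (fun w => (jac G w.2 : ℂ)) (r0 G p₀) z
      = poisson (fun w => (jac G (h w.2) : ℂ)) p₀ (kappa G z) := by
    have e1 := sum_apply_mul_apply_inverse_adjoint (isInvertible_of_det hdet)
      (fderiv ℝ Jt (gMap G z.2))
      ((fderiv ℝ p₀ (kappa G z)).comp (inl ℝ (E d) (E d)))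
    have a1 := hsnd Jc z hJc
    have a2 := hsnd Jt (kappa G z) hJt
    simp only [Jc] at a1
    simp only [Jt] at a2
    unfold poisson
    simp only [a1, a2, hr0, map_zero, zero_mul, sub_zero]
    have hJ' : ∀ v, fderiv ℝ (fun ξ => (jac G ξ : ℂ)) z.2 v
      = fderiv ℝ Jt (gMap G z.2) (kur G z.2 z.2 v) := fun v => by
        have := congrArg (fun A : E d →L[ℝ] ℂ => A v) hJ
        simpa using this
    simp only [hJ']
    rw [hκ2]
    simpa using e1
  unfold r1
  rw [hpo, hκ2, hhξ]

end Geometry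

end

section

/-! ### Local charts for `g` and existence of microlocal left inverses -/

section Charts

variable {d : ℕ} (G : GeneralLinearGroup (Fin (d + 1)) ℝ)

/-- The pairs of frequencies in the unit ball at which `M(ξ, ξ')` is invertible. -/
def goodPairs : Set (E d × E d) := {p | ‖p.1‖ < 1 ∧ ‖p.2‖ < 1 ∧ (kur G p.1 p.2).det ≠ 0}

lemma isOpen_goodPairs : IsOpen (goodPairs G) := by
  rw [isOpen_iff_mem_nhds]
  rintro p ⟨h1, h2, h3⟩
  have e3 : ∀ᶠ q : E d × E d in 𝓝 p, (kur G q.1 q.2).det ≠ 0 :=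
    (ContinuousAt.comp (f := fun q : E d × E d => kur G q.1 q.2) (x := p)
      contDiff_clm_det.continuous.continuousAt (contDiffAt_kur G h1 h2).continuousAt).eventually_ne h3
  filter_upwards [continuous_fst.continuousAt.eventually (eventually_norm_lt_one h1),
    continuous_snd.continuousAt.eventually (eventually_norm_lt_one h2), e3] with q a b c
  exact ⟨a, b, c⟩

lemma exists_radius_goodPairs {k : Set (E d)} (hk : IsCompact k)
    (h : ∀ ξ ∈ k, (ξ, ξ) ∈ goodPairs G) : ∃ r > 0, ∀ ξ ∈ k,
      ∀ η ∈ ball ξ r, ∀ η' ∈ ball ξ r, (η, η') ∈ goodPairs G := by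
  have hk2 : IsCompact ((fun ξ => (ξ, ξ)) '' k) := hk.image (by fun_prop)
  obtain ⟨r, hr, hsub⟩ := hk2.exists_thickening_subset_open (isOpen_goodPairs G)
    (by rintro _ ⟨ξ, hξ, rfl⟩; exact h ξ hξ)
  refine ⟨r, hr, fun ξ hξ η hη η' hη' => hsub ?_⟩
  rw [mem_thickening_iff]
  exact ⟨(ξ, ξ), ⟨ξ, hξ, rfl⟩, by
    rw [Prod.dist_eq]; exact max_lt hη hη'⟩

lemma contDiff_of_contDiffAt {X F : Type*} [NormedAddCommGroup X] [NormedSpace ℝ X]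
    [NormedAddCommGroup F] [NormedSpace ℝ F]
    {f : X → F} {V k : Set X} (hk : IsClosed k) (hkV : k ⊆ V) (hV : ∀ x ∈ V, ContDiffAt ℝ ∞ f x)
    (h0 : ∀ x ∉ k, f x = 0) : C^∞ f := by
  rw [contDiff_iff_contDiffAt]
  intro x
  by_cases hx : x ∈ k
  · exact hV x (hkV hx)
  · refine contDiffAt_const (c := (0 : F)).congr_of_eventuallyEq ?_
    filter_upwards [hk.isOpen_compl.mem_nhds hx] with y hy using h0 y hy

lemma contDiffAt_inv_abs {X : Type*} [NormedAddCommGroup X] [NormedSpace ℝ X] {f : X → ℝ} {x : X}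
    (hf : ContDiffAt ℝ ∞ f x) (h : f x ≠ 0) : ContDiffAt ℝ ∞ (fun x => |f x|⁻¹) x :=
  (hf.abs h).inv (abs_ne_zero.2 h)

/-- The function `U_G φ`, in terms of the semiclassical Fourier transform `f` of `φ`. -/
noncomputable def uHat (ħ : ℝ) (f : E d → ℂ) (y : E d) : ℂ :=
  planck d ħ * ∫ ξ, osc ħ (inner ℝ y (gMap G ξ)) * f ξ

lemma propagator_eq_uHat {ħ : ℝ} {φ f : E d → ℂ} (hf : ∀ ξ, fourierH ħ φ ξ = f ξ)
    (h0 : ∀ ξ, 1 ≤ ‖ξ‖ → f ξ = 0) : propagator G ħ φ = uHat G ħ f := by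
  funext y
  unfold propagator uHat
  congr 1
  simp only [hf, inner_act_lift]
  rw [setIntegral_eq_integral_of_forall_compl_eq_zero]
  intro ξ hξ
  rw [h0 ξ (by simpa using hξ), mul_zero]

lemma setIntegral_image_gMap {B : Set (E d)} (hB : IsOpen B)
    (hgood : ∀ ξ ∈ B, ∀ ξ' ∈ B, (ξ, ξ') ∈ goodPairs G) (F : E d → ℂ) :
    ∫ η in gMap G '' B, F η = ∫ ξ in B, ((|(kur G ξ ξ).det| : ℝ) : ℂ) * F (gMap G ξ) := by
  obtain ⟨hinj, -, -⟩ := exists_chart G hB (fun ξ hξ => (hgood ξ hξ ξ hξ).1)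
    (fun ξ hξ ξ' hξ' => (hgood ξ hξ ξ' hξ').2.2)
  rw [integral_image_eq_integral_abs_det_fderiv_smul volume hB.measurableSet
    (fun ξ hξ => (hasFDerivAt_gMap G (hgood ξ hξ ξ hξ).1).hasFDerivWithinAt) hinj]
  simp only [Complex.real_smul]

lemma exists_fourierH_uHat {B : Set (E d)} (hB : IsOpen B)
    (hgood : ∀ ξ ∈ B, ∀ ξ' ∈ B, (ξ, ξ') ∈ goodPairs G) {f : E d → ℂ} (hf : C^∞ f)
    {k : Set (E d)} (hk : IsCompact k) (hkB : k ⊆ B) (hfk : ∀ ξ ∉ k, f ξ = 0) {ħ : ℝ}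
    (hħ : 0 < ħ) {ξ : E d} (hξ : ξ ∈ B) :
    ((|(kur G ξ ξ).det| : ℝ) : ℂ) * fourierH ħ (uHat G ħ f) (gMap G ξ) = f ξ := by
  classical
  obtain ⟨hinj, hopen, h, hleft, hsm⟩ := exists_chart G hB (fun ξ hξ => (hgood ξ hξ ξ hξ).1)
    (fun ξ hξ ξ' hξ' => (hgood ξ hξ ξ' hξ').2.2)
  set D : E d → ℝ := fun ξ => |(kur G ξ ξ).det|⁻¹
  set a : E d → ℂ := fun η => if η ∈ gMap G '' B then (D (h η) : ℂ) * f (h η) else 0 with ha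
  have hav : ∀ ξ ∈ B, a (gMap G ξ) = (D ξ : ℂ) * f ξ := fun ξ hξ => by
    rw [ha]
    simp only
    rw [if_pos ⟨ξ, hξ, rfl⟩, hleft ξ hξ]
  have hk' : IsCompact (gMap G '' k) := hk.image (continuous_gMap G)
  have ha0 : ∀ η ∉ gMap G '' k, a η = 0 := by
    intro η hη
    by_cases h2 : η ∈ gMap G '' B
    · obtain ⟨ξ, hξ, rfl⟩ := h2
      rw [hav ξ hξ, hfk ξ (fun h3 => hη ⟨ξ, h3, rfl⟩), mul_zero]
    · rw [ha]; simp only; rw [if_neg h2]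
  have has : C^∞ a := by
    refine contDiff_of_contDiffAt hk'.isClosed (Set.image_mono hkB) ?_ ha0
    intro η hη
    have hη' := hη
    obtain ⟨ξ, hξ, rfl⟩ := hη'
    have h1 : ContDiffAt ℝ ∞ (fun η => (D (h η) : ℂ) * f (h η)) (gMap G ξ) := by
      have hg := hgood ξ hξ ξ hξ
      refine ContDiffAt.mul ?_ (hf.contDiffAt.comp _ (hsm _ hη))
      refine Complex.ofRealCLM.contDiff.contDiffAt.comp _ ?_
      refine ContDiffAt.comp (g := D) (f := h) _ ?_ (hsm _ hη)
      rw [hleft ξ hξ]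
      exact contDiffAt_inv_abs (contDiffAt_det_kur G hg.1) hg.2.2
    refine h1.congr_of_eventuallyEq ?_
    filter_upwards [hopen.mem_nhds hη] with y hy
    rw [ha]; simp only; rw [if_pos hy]
  have hac : HasCompactSupport a := .intro hk' ha0
  have hu : uHat G ħ f = invFourierH ħ a := by
    funext y
    unfold uHat invFourierH
    congr 1
    rw [← setIntegral_eq_integral_of_forall_compl_eq_zero (s := gMap G '' B)
      (f := fun η => osc ħ (inner ℝ y η) * a η),
      ← setIntegral_eq_integral_of_forall_compl_eq_zero (s := B), setIntegral_image_gMap G hB hgood]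
    · refine setIntegral_congr_fun hB.measurableSet fun ξ hξ => ?_
      have hne : ((|(kur G ξ ξ).det| : ℝ) : ℂ) ≠ 0 := by
        exact_mod_cast abs_ne_zero.2 (hgood ξ hξ ξ hξ).2.2
      simp only [hav ξ hξ, D]
      push_cast
      field_simp
    · intro ξ hξ
      rw [hfk ξ (fun h => hξ (hkB h)), mul_zero]
    · intro η hη
      rw [ha0 η (fun h => hη (Set.image_mono hkB h)), mul_zero]
  obtain ⟨ψ, hψ1, hψ2⟩ := exists_schwartz hħ has hac
  have hψ : (ψ : E d → ℂ) = uHat G ħ f := by rw [hu]; exact funext hψ1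
  rw [← hψ, hψ2, hav ξ hξ]
  have hne : ((|(kur G ξ ξ).det| : ℝ) : ℂ) ≠ 0 := by
    exact_mod_cast abs_ne_zero.2 (hgood ξ hξ ξ hξ).2.2
  simp only [D]
  push_cast
  field_simp

/-! ### Cut-offs and their right quantization -/

/-- The semiclassical Fourier transform of `rightOp ħ χ ψ`. -/
noncomputable def packet (χ : Phase d → ℂ) (ħ : ℝ) (ψ : E d → ℂ) (ξ : E d) : ℂ :=
  ∫ w, osc ħ (-(inner ℝ w ξ)) * (χ (w, ξ) * ψ w)

lemma rightOp_eq_invFourierH (χ : Phase d → ℂ) (ħ : ℝ) (ψ : E d → ℂ) :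
    rightOp ħ χ ψ = invFourierH ħ (packet χ ħ ψ) := by
  funext x
  unfold rightOp invFourierH packet
  congr 2
  funext ξ
  rw [← integral_const_mul]
  congr 1
  funext y
  rw [inner_sub_left, sub_eq_add_neg, osc_add]
  ring

lemma packet_eq_zero {χ : Phase d → ℂ} {ξ : E d} (h : ∀ w, χ (w, ξ) = 0) (ħ : ℝ) (ψ : E d → ℂ) :
    packet χ ħ ψ ξ = 0 := by
  simp [packet, h]

lemma packet_eq_zero_of_notMem {χ : Phase d → ℂ} {ξ : E d} (h : ξ ∉ Prod.snd '' tsupport χ)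
    (ħ : ℝ) (ψ : E d → ℂ) : packet χ ħ ψ ξ = 0 :=
  packet_eq_zero (fun _ => image_eq_zero_of_notMem_tsupport fun hw => h ⟨_, hw, rfl⟩) ħ ψ

lemma contDiff_packet {χ : Phase d → ℂ} (hχ : C^∞ χ) (hc : HasCompactSupport χ) (ħ : ℝ)
    (ψ : 𝓢(E d, ℂ)) : C^∞ (packet χ ħ ψ) := by
  have hk : IsCompact (Prod.fst '' tsupport χ) := hc.isCompact.image continuous_fst
  refine contDiff_integral_compact (μ := volume)
    (H := fun p : E d × E d => osc ħ (-(inner ℝ p.2 p.1)) * (χ (p.2, p.1) * ψ p.2)) ?_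
    ?_
  · refine ContDiff.mul ((contDiff_osc ħ).comp (contDiff_snd.inner ℝ contDiff_fst).neg) ?_
    exact (hχ.comp (contDiff_snd.prodMk contDiff_fst)).mul ((ψ.smooth ⊤).comp contDiff_snd)
  · refine fun _ => ⟨Prod.fst '' tsupport χ, hk, fun z _ t ht => ?_⟩
    have : χ (t, z) = 0 := image_eq_zero_of_notMem_tsupport fun hw => ht ⟨_, hw, rfl⟩
    simp [this]

lemma compactSupp_packet {χ : Phase d → ℂ} (hc : HasCompactSupport χ) (ħ : ℝ)
    (ψ : E d → ℂ) : HasCompactSupport (packet χ ħ ψ) :=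
  .intro (hc.isCompact.image continuous_snd) fun _ hξ => packet_eq_zero_of_notMem hξ ħ ψ

lemma fourierH_rightOp {χ : Phase d → ℂ} (hχ : C^∞ χ) (hc : HasCompactSupport χ) {ħ : ℝ}
    (hħ : 0 < ħ) (ψ : 𝓢(E d, ℂ)) (ξ : E d) : fourierH ħ (rightOp ħ χ ψ) ξ = packet χ ħ ψ ξ := by
  obtain ⟨φ, h1, h2⟩ := exists_schwartz hħ (contDiff_packet hχ hc ħ ψ) (compactSupp_packet hc ħ ψ)
  have : (φ : E d → ℂ) = rightOp ħ χ ψ := by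
    rw [rightOp_eq_invFourierH]; exact funext h1
  rw [← this, h2]

lemma inverseFIO_eq (ħ : ℝ) (b : E d × E d × E d → ℂ) (u : E d → ℂ) (x : E d) :
    inverseFIO G ħ b u x = planck d ħ * ∫ ξ : E d, ∫ y : E d,
      osc ħ (inner ℝ x ξ - inner ℝ y (gMap G ξ)) * b (x, y, ξ) * u y := by
  simp only [inverseFIO, inner_act_lift]

lemma exists_isMicrolocalLeftInverse {z : Phase d} (hz : ‖z.2‖ < 1)
    (hdet : (kur G z.2 z.2).det ≠ 0) :
    ∃ b : ℝ → E d × E d × E d → ℂ, IsMicrolocalLeftInverse G b {z} := by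
  obtain ⟨r, hr, hgood⟩ := exists_radius_goodPairs G (isCompact_singleton (x := z.2))
    (by rintro _ rfl; exact ⟨hz, hz, hdet⟩)
  have hgood' := hgood z.2 rfl
  let c : ContDiffBump z.2 := ⟨r / 3, r / 2, by positivity, by linarith⟩
  set β : E d → ℂ := fun ξ => ((|(kur G ξ ξ).det| : ℝ) : ℂ) * ((c ξ : ℝ) : ℂ) with hβ
  have hc0 : ∀ ξ ∉ closedBall z.2 (r / 2), c ξ = 0 := fun ξ hξ =>
    c.zero_of_le_dist (by simpa using (not_le.1 hξ).le)
  have hsub : closedBall z.2 (r / 2) ⊆ ball z.2 r :=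
    closedBall_subset_ball (by linarith)
  have hβs : C^∞ β := by
    refine contDiff_of_contDiffAt (V := ball z.2 r) isClosed_closedBall hsub
      ?_ (fun ξ hξ => by rw [hβ]; simp [hc0 ξ hξ])
    intro ξ hξ
    have hg := hgood' ξ hξ ξ hξ
    refine ContDiffAt.mul ?_ ?_
    · exact Complex.ofRealCLM.contDiff.contDiffAt.comp _ ((contDiffAt_det_kur G hg.1).abs hg.2.2)
    · exact Complex.ofRealCLM.contDiff.contDiffAt.comp _ c.contDiff.contDiffAt
  have hβc : HasCompactSupport β := .intro (isCompact_closedBall z.2 (r / 2))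
    fun ξ hξ => by rw [hβ]; simp [hc0 ξ hξ]
  refine ⟨fun _ w => β w.2.2, ⟨?_, ⟨closedBall z.2 (r / 2), isCompact_closedBall _ _, ?_, ?_⟩,
    0, fun k => ?_⟩, ?_⟩
  · intro ħ _
    exact hβs.comp (contDiff_snd.comp contDiff_snd)
  · intro ξ hξ
    have := (hgood' ξ (hsub hξ) ξ (hsub hξ)).1
    simpa using this
  · intro ħ _ w hw
    rw [hβ]; simp [hc0 _ hw]
  · obtain ⟨C, hC0, hC⟩ := exists_bound hβs hβc k
    set L : E d × E d × E d →L[ℝ] E d :=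
      (ContinuousLinearMap.snd ℝ (E d) (E d)).comp (ContinuousLinearMap.snd ℝ (E d) (E d × E d))
    refine ⟨C * ‖L‖ ^ k, .of_forall fun ħ w => ?_⟩
    have := norm_iteratedFDeriv_affine hβs L 0 k w
    simp only [zero_add] at this
    simp only [pow_zero, div_one, mul_one]
    exact this.trans (by gcongr; exact hC _)
  · refine ⟨{w | w.2 ∈ ball z.2 (r / 3)}, isOpen_ball.preimage continuous_snd,
      by simp [hr], ?_⟩
    intro χ₁ χ₂ _ _ _ hχ₂ hχ₂c hχ₂s N
    refine ⟨0, eventually_nhdsWithin_of_forall fun ħ hħ ψ => ?_⟩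
    have hħ : 0 < ħ := hħ
    set f := packet χ₂ ħ ψ
    set k : Set (E d) := Prod.snd '' tsupport χ₂
    have hkB3 : k ⊆ ball z.2 (r / 3) := by
      rintro _ ⟨w, hw, rfl⟩; exact hχ₂s hw
    have hkB : k ⊆ ball z.2 r := hkB3.trans (ball_subset_ball (by linarith))
    have hk : IsCompact k := hχ₂c.isCompact.image continuous_snd
    have hfk : ∀ ξ ∉ k, f ξ = 0 := fun ξ hξ => packet_eq_zero_of_notMem hξ ħ ψ
    have hprop : propagator G ħ (rightOp ħ χ₂ ψ) = uHat G ħ f :=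
      propagator_eq_uHat G (fourierH_rightOp hχ₂ hχ₂c hħ ψ) (fun ξ hξ => hfk ξ fun h => by
        have := (hgood' ξ (hkB h) ξ (hkB h)).1
        simp at this
        linarith)
    have hzero : (fun x => inverseFIO G ħ (fun w => β w.2.2) (propagator G ħ (rightOp ħ χ₂ ψ)) x
        - rightOp ħ χ₂ ψ x) = fun _ => 0 := by
      funext x
      rw [sub_eq_zero, hprop, rightOp_eq_invFourierH, inverseFIO_eq, invFourierH]
      congr 2
      funext ξ
      have e1 : ∀ y, osc ħ (inner ℝ x ξ - inner ℝ y (gMap G ξ)) * β ξ * uHat G ħ f y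
          = osc ħ (inner ℝ x ξ) * β ξ * (osc ħ (-(inner ℝ y (gMap G ξ))) * uHat G ħ f y) := by
        intro y
        rw [sub_eq_add_neg, osc_add]; ring
      simp only [e1]
      rw [integral_const_mul, mul_assoc]
      congr 1
      change β ξ * fourierH ħ (uHat G ħ f) (gMap G ξ) = f ξ
      by_cases hξ : ξ ∈ ball z.2 r
      · rw [hβ]
        have := exists_fourierH_uHat G isOpen_ball hgood' (contDiff_packet hχ₂ hχ₂c ħ ψ)
          hk hkB hfk hħ hξ
        simp only
        rw [mul_right_comm, this]
        by_cases hξk : ξ ∈ k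
        · rw [c.one_of_mem_closedBall (ball_subset_closedBall (hkB3 hξk))]
          simp [f]
        · rw [show packet χ₂ ħ ψ ξ = 0 from hfk ξ hξk, show f ξ = 0 from hfk ξ hξk, zero_mul]
      · rw [hfk ξ (fun h => hξ (hkB h))]
        have : c ξ = 0 := hc0 ξ fun h => hξ (hsub h)
        rw [hβ]; simp [this]
    simp only [hzero]
    have h0 : weylOp ħ χ₁ (fun _ => 0) = fun _ => 0 := by
      funext x; simp [weylOp]
    rw [h0]
    simp

end Charts

end

section

/-! ### Symbols given by amplitudes depending on two frequencies -/

section Amplitude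

variable {d : ℕ}

lemma exists_radius {X : Type*} [NormedAddCommGroup X] {a : X → ℂ}
    (ha : HasCompactSupport a) : ∃ ρ, 0 ≤ ρ ∧ ∀ t, ρ < ‖t‖ → a t = 0 := by
  obtain ⟨ρ, hρ⟩ := ha.isCompact.isBounded.exists_norm_le
  refine ⟨max ρ 0, le_max_right _ _, fun t ht => image_eq_zero_of_notMem_tsupport fun h => ?_⟩
  exact absurd (hρ t h) (not_le.2 ((le_max_left _ _).trans_lt ht))

/-- The Fourier transform of an amplitude `Q((x, ζ), θ)` with respect to `x`. -/
noncomputable def qHat (Q : Phase d × E d → ℂ) (ħ : ℝ) (ζ θ : E d) : ℂ :=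
  ∫ x : E d, osc ħ (-(inner ℝ x θ)) * Q ((x, ζ), θ)

/-- The Weyl symbol of the operator with amplitude `Q((x, (ξ + ξ') / 2), ξ - ξ')`. -/
noncomputable def symS (Q : Phase d × E d → ℂ) (ħ : ℝ) (z : Phase d) : ℂ :=
  invFourierH ħ (qHat Q ħ z.2) z.1

lemma compactSupp_shift {Q : Phase d × E d → ℂ} (hc : HasCompactSupport Q) (ħ : ℝ)
    (z₀ : Phase d) : ∃ k : Set (E d × E d), IsCompact k ∧ ∀ z ∈ ball z₀ 1, ∀ t ∉ k,
      osc ħ (-(inner ℝ t.2 t.1)) * Q ((z.1 + t.2, z.2), t.1) = 0 := by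
  obtain ⟨ρ, hρ0, hρ⟩ := exists_radius hc
  refine ⟨closedBall 0 (ρ + ‖z₀‖ + 1), isCompact_closedBall _ _, fun z hz t ht => ?_⟩
  rw [hρ, mul_zero]
  rw [mem_closedBall_zero_iff, Prod.norm_def, max_le_iff, not_and_or, not_le, not_le] at ht
  rw [mem_ball_iff_norm] at hz
  have h1 : ‖z.1‖ ≤ ‖z₀‖ + 1 := by
    have h2 := norm_fst_le (z - z₀)
    have h3 := norm_fst_le z₀
    have h4 : ‖z.1‖ ≤ ‖(z - z₀).1‖ + ‖z₀.1‖ := by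
      simpa using norm_add_le (z - z₀).1 z₀.1
    linarith
  rcases ht with ht | ht
  · exact lt_of_lt_of_le (by linarith [norm_nonneg z₀]) (norm_snd_le _)
  · refine lt_of_lt_of_le ?_ ((norm_fst_le _).trans (norm_fst_le _))
    have h4 : ‖t.2‖ ≤ ‖z.1 + t.2‖ + ‖z.1‖ := by
      simpa using norm_sub_le (z.1 + t.2) z.1
    simp only
    linarith

lemma contDiff_shift {Q : Phase d × E d → ℂ} (hQ : C^∞ Q) (ħ : ℝ) :
    C^∞ (fun p : Phase d × (E d × E d) =>
      osc ħ (-(inner ℝ p.2.2 p.2.1)) * Q ((p.1.1 + p.2.2, p.1.2), p.2.1)) := by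
  refine ContDiff.mul ((contDiff_osc ħ).comp ?_) (hQ.comp ?_)
  · exact ((contDiff_snd.comp contDiff_snd).inner ℝ (contDiff_fst.comp contDiff_snd)).neg
  · fun_prop

lemma symS_eq {Q : Phase d × E d → ℂ} (hQ : C^∞ Q) (hc : HasCompactSupport Q) (ħ : ℝ)
    (z : Phase d) : symS Q ħ z = planck d ħ * ∫ t : E d × E d,
      osc ħ (-(inner ℝ t.2 t.1)) * Q ((z.1 + t.2, z.2), t.1) := by
  obtain ⟨k, hk, hk0⟩ := compactSupp_shift hc ħ z
  have hint : Integrable (fun t : E d × E d =>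
      osc ħ (-(inner ℝ t.2 t.1)) * Q ((z.1 + t.2, z.2), t.1)) :=
    ((contDiff_shift hQ ħ).continuous.comp
      (Continuous.prodMk_right z)).integrable_of_hasCompactSupport
      (.intro hk fun t ht => hk0 z (mem_ball_self one_pos) t ht)
  rw [Measure.volume_eq_prod, integral_prod _ hint]
  unfold symS invFourierH qHat
  congr 2
  funext θ
  rw [← integral_const_mul, ← integral_add_left_eq_self _ z.1]
  congr 1
  funext s
  rw [← mul_assoc, ← osc_add, inner_add_left]
  congr 2
  ring

lemma contDiff_symS {Q : Phase d × E d → ℂ} (hQ : C^∞ Q) (hc : HasCompactSupport Q)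
    (ħ : ℝ) : C^∞ (symS Q ħ) := by
  rw [funext (symS_eq hQ hc ħ)]
  exact contDiff_const.mul (contDiff_integral_compact (contDiff_shift hQ ħ)
    (compactSupp_shift hc ħ))

lemma fderiv_symS {Q : Phase d × E d → ℂ} (hQ : C^∞ Q) (hc : HasCompactSupport Q)
    (ħ : ℝ) (z v : Phase d) :
    fderiv ℝ (symS Q ħ) z v = symS (fun p => fderiv ℝ Q p (v, 0)) ħ z := by
  rw [symS_eq (smooth_dir hQ _) (compactSupp_dir hc _), funext (symS_eq hQ hc ħ)]
  have h1 := (hasFDerivAt_integral (μ := volume) (contDiff_shift hQ ħ)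
    (compactSupp_shift hc ħ) z).1.differentiableAt
  rw [fderiv_const_mul h1, _root_.smul_apply, smul_eq_mul,
    fderiv_integral_of_compact (contDiff_shift hQ ħ) (compactSupp_shift hc ħ)]
  congr 2
  funext t
  rw [← fderiv_left (contDiff_shift hQ ħ)]
  have h2 : HasFDerivAt (fun z : Phase d => ((z.1 + t.2, z.2), t.1)) (inl ℝ (Phase d) (E d)) z := by
    have := (hasFDerivAt_id (𝕜 := ℝ) (z + (t.2, 0))).prodMk (hasFDerivAt_const t.1 (z + (t.2, 0)))
    have h3 := this.comp z ((hasFDerivAt_id (𝕜 := ℝ) z).add_const (t.2, 0))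
    refine (h3.congr_of_eventuallyEq (.of_forall fun w => ?_)).congr_fderiv ?_
    · simp [Prod.ext_iff]
    · ext <;> simp
  have h4 := (hQ.differentiable (by simp) ((z.1 + t.2, z.2), t.1)).hasFDerivAt.comp z h2
  have h5 := (h4.const_mul (osc ħ (-(inner ℝ t.2 t.1)))).fderiv
  simp only [Function.comp_def] at h5
  rw [h5]
  simp

/-! ### Second order Taylor expansion of an amplitude on the diagonal -/

/-- The remainder of the first order Taylor expansion of `Q(z, θ)` at `θ = 0`. -/
noncomputable def taylorRem (Q : Phase d × E d → ℂ) (z : Phase d) (θ : E d) : ℂ :=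
  Q (z, θ) - Q (z, 0) - fderiv ℝ Q (z, 0) (0, θ)

lemma exists_fderiv_lipschitz {X : Type*} [NormedAddCommGroup X] [NormedSpace ℝ X] {Q : X → ℂ}
    (hQ : C^∞ Q) (hc : HasCompactSupport Q) :
    ∃ C, 0 ≤ C ∧ ∀ p q, ‖fderiv ℝ Q p - fderiv ℝ Q q‖ ≤ C * ‖p - q‖ := by
  have hQ1 : C^∞ (fderiv ℝ Q) := hQ.fderiv_right (m := ∞) (by simp)
  obtain ⟨C, hC0, hC2⟩ := exists_bound hQ hc 2
  have hC : ∀ p, ‖fderiv ℝ (fderiv ℝ Q) p‖ ≤ C := fun p => by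
    have := hC2 p
    rwa [← norm_iteratedFDeriv_fderiv, norm_iteratedFDeriv_one] at this
  refine ⟨C, hC0, fun p q => ?_⟩
  exact convex_univ.norm_image_sub_le_of_norm_fderiv_le (𝕜 := ℝ) (f := fderiv ℝ Q)
      (fun x _ => hQ1.differentiable (by simp) x) (fun x _ => hC x) (Set.mem_univ q)
      (Set.mem_univ p)

lemma exists_norm_taylorRem_le {Q : Phase d × E d → ℂ} (hQ : C^∞ Q)
    (hc : HasCompactSupport Q) : ∃ C, 0 ≤ C ∧ ∀ z θ, ‖taylorRem Q z θ‖ ≤ C * ‖θ‖ ^ 2 := by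
  obtain ⟨C, hC0, hlip⟩ := exists_fderiv_lipschitz hQ hc
  refine ⟨C, hC0, fun z θ => ?_⟩
  have hd : ∀ t : E d, HasFDerivAt (fun t => Q (z, t) - fderiv ℝ Q (z, 0) (0, t))
      ((fderiv ℝ Q (z, t) - fderiv ℝ Q (z, 0)).comp
        (inr ℝ (Phase d) (E d))) t := fun t => by
    have h1 := (hQ.differentiable (by simp) (z, t)).hasFDerivAt.comp t
      (hasFDerivAt_prodMk_right z t)
    have h2 := ((fderiv ℝ Q (z, 0)).comp
      (inr ℝ (Phase d) (E d))).hasFDerivAt (x := t)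
    rw [ContinuousLinearMap.sub_comp]
    exact h1.sub h2
  have hb : ∀ t ∈ closedBall (0 : E d) ‖θ‖, ‖(fderiv ℝ Q (z, t) - fderiv ℝ Q (z, 0)).comp
        (inr ℝ (Phase d) (E d))‖ ≤ C * ‖θ‖ := by
    intro t ht
    refine ContinuousLinearMap.opNorm_le_bound _ (by positivity) fun v => ?_
    refine (ContinuousLinearMap.le_opNorm (fderiv ℝ Q (z, t) - fderiv ℝ Q (z, 0)) (0, v)).trans ?_
    have h4 : ‖((0 : Phase d), v)‖ = ‖v‖ := by simp [Prod.norm_def]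
    have h5 : ‖(z, t) - (z, (0 : E d))‖ = ‖t‖ := by simp [Prod.norm_def]
    have h6 := hlip (z, t) (z, 0)
    rw [h5] at h6
    rw [h4]
    have : ‖t‖ ≤ ‖θ‖ := by simpa using ht
    gcongr
    exact h6.trans (by gcongr)
  have h2 := (convex_closedBall (0 : E d) ‖θ‖).norm_image_sub_le_of_norm_hasFDerivWithin_le
    (fun t _ => (hd t).hasFDerivWithinAt) hb
    (mem_closedBall_self (norm_nonneg θ)) (show θ ∈ closedBall (0 : E d) ‖θ‖ by simp)
  have h3 : taylorRem Q z θ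
      = Q (z, θ) - fderiv ℝ Q (z, 0) (0, θ) - (Q (z, 0) - fderiv ℝ Q (z, 0) (0, 0)) := by
    have : ((0 : Phase d), (0 : E d)) = 0 := rfl
    rw [this, map_zero, taylorRem]
    ring
  rw [h3]
  refine h2.trans (le_of_eq ?_)
  rw [sub_zero]
  ring

end Amplitude

end

section

section Expansion

variable {d : ℕ}

lemma sum_smul_single (θ : E d) : ∑ j, θ j • single j (1 : ℝ) = θ := by
  ext i
  simp [Finset.sum_apply, Pi.single_apply]

lemma norm_le_sum_abs (θ : E d) : ‖θ‖ ≤ ∑ j, |θ j| := by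
  conv_lhs => rw [← sum_smul_single θ]
  refine (norm_sum_le _ _).trans (sum_le_sum fun j _ => ?_)
  rw [norm_smul, PiLp.norm_single]
  simp

/-- Integration by parts for the semiclassical Fourier transform. -/
lemma coord_mul_fourierH {ħ : ℝ} (hħ : ħ ≠ 0) {a : E d → ℂ} (ha : C^∞ a)
    (hc : HasCompactSupport a) (θ : E d) (j : Fin d) :
    (θ j : ℂ) * fourierH ħ a θ = -I * ħ * fourierH ħ (fun x => fderiv ℝ a x (single j 1)) θ := by
  have h1 := integral_osc_mul_fderiv (μ := volume) hħ (θ := fun x : E d => -(inner ℝ x θ : ℝ))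
    (ha.of_le (by exact_mod_cast le_top)) hc
    (fun t _ => ((contDiff_id.inner ℝ contDiff_const).neg).contDiffAt)
    (single j 1)
  have h2 : ∀ x : E d, fderiv ℝ (fun x : E d => -(inner ℝ x θ : ℝ)) x (single j 1) = -θ j := by
    intro x
    rw [fderiv_fun_neg, _root_.neg_apply, fderiv_inner_right_apply,
      EuclideanSpace.inner_single_left]
    simp
  simp only [h2] at h1
  unfold fourierH
  rw [← integral_const_mul, neg_mul, neg_mul, ← h1, ← integral_neg]
  congr 1
  funext x
  push_cast
  ring

lemma contDiff_section {Q : Phase d × E d → ℂ} (hQ : C^∞ Q) (ζ θ : E d) :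
    C^∞ (fun x => Q ((x, ζ), θ)) := hQ.comp (by fun_prop)

lemma compactSupp_section {Q : Phase d × E d → ℂ} (hc : HasCompactSupport Q) (ζ θ : E d) :
    HasCompactSupport (fun x => Q ((x, ζ), θ)) := by
  obtain ⟨ρ, -, hρ⟩ := exists_radius hc
  refine .intro (isCompact_closedBall 0 ρ) fun x hx => hρ _ ?_
  refine lt_of_lt_of_le (by simpa using hx) ((norm_fst_le _).trans (norm_fst_le _))

lemma fderiv_section {Q : Phase d × E d → ℂ} (hQ : C^∞ Q) (ζ θ x v : E d) :
    fderiv ℝ (fun x => Q ((x, ζ), θ)) x v = fderiv ℝ Q ((x, ζ), θ) ((v, 0), 0) := by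
  have h1 : C^∞ (fun z : Phase d => Q (z, θ)) := hQ.comp (by fun_prop)
  rw [fderiv_left (T := E d) (H := fun z : E d × E d => Q (z, θ)) h1 x ζ v]
  exact fderiv_left hQ (x, ζ) θ (v, 0)

lemma contDiff_taylorRem {Q : Phase d × E d → ℂ} (hQ : C^∞ Q) (θ : E d) :
    C^∞ (fun z => taylorRem Q z θ) := by
  have h1 := smooth_dir hQ (0, θ)
  unfold taylorRem
  refine ((hQ.comp ?_).sub (hQ.comp ?_)).sub (h1.comp ?_ (f := fun z : Phase d => (z, (0 : E d))))
  all_goals fun_prop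

lemma taylorRem_eq_zero {Q : Phase d × E d → ℂ} {ρ : ℝ} (hρ : ∀ t, ρ < ‖t‖ → Q t = 0)
    {z : Phase d} (hz : ρ < ‖z‖) (θ : E d) : taylorRem Q z θ = 0 := by
  have h0 : ∀ θ' : E d, ρ < ‖(z, θ')‖ := fun θ' => hz.trans_le (norm_fst_le (z, θ'))
  have h1 : Q =ᶠ[𝓝 (z, 0)] fun _ => 0 := by
    filter_upwards [(isOpen_lt continuous_const continuous_norm).mem_nhds (h0 0)] with t ht
    exact hρ t ht
  rw [taylorRem, h1.fderiv_eq, hρ _ (h0 _), hρ _ (h0 _)]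
  simp

lemma fderiv_taylorRem {Q : Phase d × E d → ℂ} (hQ : C^∞ Q) (θ : E d) (z v : Phase d) :
    fderiv ℝ (fun z => taylorRem Q z θ) z v = taylorRem (fun p => fderiv ℝ Q p (v, 0)) z θ := by
  have h1 := smooth_dir hQ (0, θ)
  have d1 : ∀ θ : E d, DifferentiableAt ℝ (fun z => Q (z, θ)) z := fun θ =>
    (hQ.differentiable (by simp) _).comp z (by fun_prop)
  have d2 : DifferentiableAt ℝ (fun z => fderiv ℝ Q (z, 0) (0, θ)) z :=
    (h1.comp (by fun_prop : C^∞ fun z : Phase d => (z, (0 : E d)))).differentiable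
      (by simp) z
  have h2 : fderiv ℝ (fun z => taylorRem Q z θ) z = _ :=
    (((d1 θ).hasFDerivAt.sub (d1 0).hasFDerivAt).sub d2.hasFDerivAt).fderiv
  rw [h2, taylorRem, _root_.sub_apply, _root_.sub_apply, fderiv_left hQ, fderiv_left hQ,
    fderiv_left h1 z 0 v, fderiv_fderiv_comm hQ]

/-- The Fourier transform of the Taylor remainder of an amplitude. -/
noncomputable def remHat (Q : Phase d × E d → ℂ) (ħ : ℝ) (ζ θ : E d) : ℂ :=
  fourierH ħ (fun x => taylorRem Q (x, ζ) θ) θ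

lemma coord_mul_remHat {Q : Phase d × E d → ℂ} (hQ : C^∞ Q) (hc : HasCompactSupport Q)
    {ħ : ℝ} (hħ : ħ ≠ 0) (ζ θ : E d) (j : Fin d) :
    (θ j : ℂ) * remHat Q ħ ζ θ = -I * ħ
      * remHat (fun p => fderiv ℝ Q p ((single j 1, 0), 0)) ħ ζ θ := by
  have h1 : C^∞ (fun x => taylorRem Q (x, ζ) θ) :=
    (contDiff_taylorRem hQ θ).comp (by fun_prop : C^∞ fun x : E d => (x, ζ))
  obtain ⟨ρ, -, hρ⟩ := exists_radius hc
  have h2 : HasCompactSupport (fun x => taylorRem Q (x, ζ) θ) := by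
    refine .intro (isCompact_closedBall 0 ρ) fun x hx => taylorRem_eq_zero hρ ?_ θ
    refine lt_of_lt_of_le (by simpa using hx) (norm_fst_le _)
  unfold remHat
  rw [coord_mul_fourierH hħ h1 h2]
  congr 2
  funext x
  rw [fderiv_left (contDiff_taylorRem hQ θ) x ζ, fderiv_taylorRem hQ]

lemma exists_pow_mul_remHat_le (N : ℕ) {Q : Phase d × E d → ℂ} (hQ : C^∞ Q)
    (hc : HasCompactSupport Q) : ∃ C, 0 ≤ C ∧ ∀ ħ > 0, ∀ ζ θ,
      ‖θ‖ ^ N * ‖remHat Q ħ ζ θ‖ ≤ C * ħ ^ N * ‖θ‖ ^ 2 := by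
  induction N generalizing Q with
  | zero =>
    obtain ⟨C, hC0, hC⟩ := exists_norm_taylorRem_le hQ hc
    obtain ⟨ρ, -, hρ⟩ := exists_radius hc
    refine ⟨C * volume.real (closedBall (0 : E d) ρ), by positivity, fun ħ _ ζ θ => ?_⟩
    have h1 : remHat Q ħ ζ θ = ∫ x in closedBall (0 : E d) ρ,
        osc ħ (-(inner ℝ x θ)) * taylorRem Q (x, ζ) θ := by
      rw [setIntegral_eq_integral_of_forall_compl_eq_zero]
      · rfl
      · intro x hx
        rw [taylorRem_eq_zero hρ, mul_zero]
        exact lt_of_lt_of_le (by simpa using hx) (norm_fst_le _)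
    rw [h1, pow_zero, one_mul, pow_zero, mul_one, mul_right_comm]
    refine norm_setIntegral_le_of_norm_le_const measure_closedBall_lt_top fun x _ => ?_
    rw [norm_mul, norm_osc, one_mul]
    exact hC _ _
  | succ N ih =>
    choose C hC0 hC using fun j : Fin d => ih (smooth_dir hQ ((single j 1, 0), 0))
      (compactSupp_dir hc _)
    refine ⟨∑ j, C j, sum_nonneg fun j _ => hC0 j, fun ħ hħ ζ θ => ?_⟩
    calc ‖θ‖ ^ (N + 1) * ‖remHat Q ħ ζ θ‖ = ‖θ‖ ^ N * (‖θ‖ * ‖remHat Q ħ ζ θ‖) := by ring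
      _ ≤ ‖θ‖ ^ N * ((∑ j, |θ j|) * ‖remHat Q ħ ζ θ‖) := by gcongr; exact norm_le_sum_abs θ
      _ = ∑ j, ħ * (‖θ‖ ^ N * ‖remHat (fun p => fderiv ℝ Q p ((single j 1, 0), 0))
            ħ ζ θ‖) := by
        rw [sum_mul, mul_sum]
        refine sum_congr rfl fun j _ => ?_
        have h1 := congrArg norm (coord_mul_remHat hQ hc hħ.ne' ζ θ j)
        simp only [norm_mul, norm_neg, norm_I, one_mul, norm_real,
          Real.norm_eq_abs, abs_of_pos hħ] at h1
        rw [h1]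
        ring
      _ ≤ ∑ j, ħ * (C j * ħ ^ N * ‖θ‖ ^ 2) := by
        exact sum_le_sum fun j _ => mul_le_mul_of_nonneg_left (hC j ħ hħ ζ θ) hħ.le
      _ = _ := by rw [sum_mul, sum_mul]; exact sum_congr rfl fun j _ => by ring

lemma exists_norm_remHat_le {Q : Phase d × E d → ℂ} (hQ : C^∞ Q)
    (hc : HasCompactSupport Q) : ∃ C, 0 ≤ C ∧ ∀ ħ > 0, ∀ ζ θ,
      ‖remHat Q ħ ζ θ‖ ≤ C * ħ ^ 2 * ((1 + ‖θ‖ / ħ) ^ (d + 1))⁻¹ := by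
  obtain ⟨C₁, h10, h1⟩ := exists_pow_mul_remHat_le 0 hQ hc
  obtain ⟨C₂, h20, h2⟩ := exists_pow_mul_remHat_le (d + 3) hQ hc
  refine ⟨(C₁ + C₂) * 2 ^ (d + 1), by positivity, fun ħ hħ ζ θ => ?_⟩
  rw [← div_eq_mul_inv, le_div_iff₀ (by positivity)]
  set t := ‖θ‖ / ħ with ht
  have hθ : ‖θ‖ = t * ħ := by rw [ht]; field_simp
  have ht0 : 0 ≤ t := by positivity
  have a1 := h1 ħ hħ ζ θ
  have a2 := h2 ħ hħ ζ θ
  rw [hθ] at a1 a2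
  set R := ‖remHat Q ħ ζ θ‖
  have hR : 0 ≤ R := norm_nonneg _
  simp only [pow_zero, one_mul, mul_one] at a1
  rcases le_total t 1 with h | h
  · have b1 : R ≤ C₁ * ħ ^ 2 := a1.trans (by
      rw [mul_pow]
      have : t ^ 2 ≤ 1 := pow_le_one₀ ht0 h
      have h5 : 0 ≤ C₁ * ħ ^ 2 := by positivity
      nlinarith)
    have b2 : (1 + t) ^ (d + 1) ≤ 2 ^ (d + 1) := by gcongr; linarith
    calc R * (1 + t) ^ (d + 1) ≤ (C₁ * ħ ^ 2) * 2 ^ (d + 1) := by gcongr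
      _ ≤ (C₁ + C₂) * ħ ^ 2 * 2 ^ (d + 1) := by gcongr; linarith
      _ = _ := by ring
  · have b1 : t ^ (d + 1) * R ≤ C₂ * ħ ^ 2 := by
      have h6 : 0 < t ^ 2 * ħ ^ (d + 3) := by positivity
      refine le_of_mul_le_mul_right ?_ h6
      calc t ^ (d + 1) * R * (t ^ 2 * ħ ^ (d + 3)) = (t * ħ) ^ (d + 3) * R := by
            rw [mul_pow]; ring
        _ ≤ C₂ * ħ ^ (d + 3) * (t * ħ) ^ 2 := a2
        _ = _ := by ring
    have b2 : (1 + t) ^ (d + 1) ≤ 2 ^ (d + 1) * t ^ (d + 1) := by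
      rw [← mul_pow]; gcongr; linarith
    calc R * (1 + t) ^ (d + 1) ≤ R * (2 ^ (d + 1) * t ^ (d + 1)) := by gcongr
      _ = 2 ^ (d + 1) * (t ^ (d + 1) * R) := by ring
      _ ≤ 2 ^ (d + 1) * (C₂ * ħ ^ 2) := by gcongr
      _ ≤ 2 ^ (d + 1) * ((C₁ + C₂) * ħ ^ 2) := by gcongr; linarith
      _ = _ := by ring

lemma norm_invFourierH_le {ħ : ℝ} (t : E d → ℂ) (x : E d) :
    ‖invFourierH ħ t x‖ ≤ ‖planck d ħ‖ * ∫ ξ, ‖t ξ‖ := by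
  unfold invFourierH
  rw [norm_mul]
  gcongr
  refine (norm_integral_le_integral_norm _).trans (le_of_eq ?_)
  simp only [norm_mul, norm_osc, one_mul]

lemma integrable_osc_mul {ħ : ℝ} {t : E d → ℂ} (ht : Integrable t) {φ : E d → ℝ}
    (hφ : Continuous φ) : Integrable (fun ξ => osc ħ (φ ξ) * t ξ) :=
  ht.bdd_mul (c := 1) ((continuous_osc ħ).comp hφ).aestronglyMeasurable
    (.of_forall fun _ => (norm_osc _ _).le)

lemma invFourierH_add {ħ : ℝ} {s t : E d → ℂ} (hs : Integrable s) (ht : Integrable t) (x : E d) :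
    invFourierH ħ (fun ξ => s ξ + t ξ) x = invFourierH ħ s x + invFourierH ħ t x := by
  unfold invFourierH
  rw [← mul_add, ← integral_add (integrable_osc_mul hs (by fun_prop))
    (integrable_osc_mul ht (by fun_prop))]
  simp only [mul_add]

lemma invFourierH_const_mul {ħ : ℝ} (c : ℂ) (t : E d → ℂ) (x : E d) :
    invFourierH ħ (fun ξ => c * t ξ) x = c * invFourierH ħ t x := by
  unfold invFourierH
  simp only [mul_left_comm _ c, integral_const_mul]

/-- The subprincipal part of `symS Q`. -/
noncomputable def subPart (Q : Phase d × E d → ℂ) (z : Phase d) : ℂ :=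
  -I * ∑ j, fderiv ℝ (fun p => fderiv ℝ Q p (0, single j 1)) (z, 0) ((single j 1, 0), 0)

lemma contDiff_subPart {Q : Phase d × E d → ℂ} (hQ : C^∞ Q) : C^∞ (subPart Q) := by
  unfold subPart
  refine contDiff_const.mul (ContDiff.sum fun j _ => ?_)
  exact (smooth_dir (smooth_dir hQ _) _).comp
    (by fun_prop : C^∞ fun z : Phase d => (z, (0 : E d)))

lemma fderiv_comp_zero {Q : Phase d × E d → ℂ} (hQ : C^∞ Q) (z v : Phase d) :
    fderiv ℝ (fun z => Q (z, 0)) z v = fderiv ℝ Q (z, 0) (v, 0) :=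
  fderiv_left hQ z 0 v

lemma fderiv_subPart {Q : Phase d × E d → ℂ} (hQ : C^∞ Q) (z v : Phase d) :
    fderiv ℝ (subPart Q) z v = subPart (fun p => fderiv ℝ Q p (v, 0)) z := by
  have h0 : ∀ j : Fin d, C^∞ (fun p => fderiv ℝ (fun p => fderiv ℝ Q p
      (0, single j 1)) p ((single j 1, 0), 0)) := fun j =>
    smooth_dir (smooth_dir hQ _) _
  have h1 : ∀ j ∈ Finset.univ, HasFDerivAt (fun z : Phase d =>
      fderiv ℝ (fun p => fderiv ℝ Q p (0, single j 1)) (z, 0)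
        ((single j 1, 0), 0)) _ z := fun j _ =>
    (((h0 j).comp (by fun_prop : C^∞ fun z : Phase d => (z, (0 : E d)))).differentiable
      (by simp) z).hasFDerivAt
  have h2 : fderiv ℝ (subPart Q) z = _ :=
    ((HasFDerivAt.fun_sum h1).const_mul (-I)).fderiv
  rw [h2, subPart]
  simp only [_root_.smul_apply, _root_.sum_apply, smul_eq_mul]
  congr 1
  refine sum_congr rfl fun j _ => ?_
  refine (fderiv_comp_zero (h0 j) z v).trans ?_
  rw [fderiv_fderiv_comm (smooth_dir hQ _)]
  congr 2
  funext p
  exact fderiv_fderiv_comm hQ _ _ _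

/-- The error of the expansion of `symS Q` to second order. -/
noncomputable def symErr (Q : Phase d × E d → ℂ) (ħ : ℝ) (z : Phase d) : ℂ :=
  symS Q ħ z - (Q (z, 0) + ħ * subPart Q z)

lemma contDiff_symErr {Q : Phase d × E d → ℂ} (hQ : C^∞ Q) (hc : HasCompactSupport Q)
    (ħ : ℝ) : C^∞ (symErr Q ħ) :=
  (contDiff_symS hQ hc ħ).sub ((hQ.comp (by fun_prop : C^∞ fun z : Phase d =>
    (z, (0 : E d)))).add (contDiff_const.mul (contDiff_subPart hQ)))

lemma fderiv_symErr {Q : Phase d × E d → ℂ} (hQ : C^∞ Q) (hc : HasCompactSupport Q)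
    (ħ : ℝ) (z v : Phase d) :
    fderiv ℝ (symErr Q ħ) z v = symErr (fun p => fderiv ℝ Q p (v, 0)) ħ z := by
  have d1 := ((contDiff_symS hQ hc ħ).differentiable (by simp) z).hasFDerivAt
  have d2 := ((hQ.comp (by fun_prop : C^∞ fun z : Phase d =>
    (z, (0 : E d)))).differentiable (by simp) z).hasFDerivAt
  have d3 := ((contDiff_subPart hQ).differentiable (by simp) z).hasFDerivAt
  have h : fderiv ℝ (symErr Q ħ) z = _ := (d1.sub (d2.add (d3.const_mul (ħ : ℂ)))).fderiv
  rw [h, symErr, _root_.sub_apply, _root_.add_apply, _root_.smul_apply, smul_eq_mul,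
    fderiv_symS hQ hc, fderiv_subPart hQ]
  congr 2
  exact fderiv_comp_zero hQ z v

lemma contDiff_qHat {Q : Phase d × E d → ℂ} (hQ : C^∞ Q) (hc : HasCompactSupport Q)
    (ħ : ℝ) : C^∞ (fun p : E d × E d => qHat Q ħ p.1 p.2) := by
  obtain ⟨ρ, -, hρ⟩ := exists_radius hc
  refine contDiff_integral_compact (μ := volume) (H := fun p : (E d × E d) × E d =>
    osc ħ (-(inner ℝ p.2 p.1.2)) * Q ((p.2, p.1.1), p.1.2)) ?_ ?_
  · refine ContDiff.mul ((contDiff_osc ħ).comp ?_) (hQ.comp (by fun_prop))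
    exact (contDiff_snd.inner ℝ (contDiff_snd.comp contDiff_fst)).neg
  · refine fun _ => ⟨closedBall 0 ρ, isCompact_closedBall _ _, fun z _ x hx => ?_⟩
    rw [hρ, mul_zero]
    exact lt_of_lt_of_le (by simpa using hx) ((norm_fst_le _).trans (norm_fst_le _))

lemma qHat_eq_zero {Q : Phase d × E d → ℂ} {ρ : ℝ} (hρ : ∀ t, ρ < ‖t‖ → Q t = 0) {ħ : ℝ}
    {ζ θ : E d} (h : ρ < ‖ζ‖ ∨ ρ < ‖θ‖) : qHat Q ħ ζ θ = 0 := by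
  have : ∀ x, Q ((x, ζ), θ) = 0 := fun x => hρ _ (by
    rcases h with h | h
    · exact h.trans_le ((norm_snd_le (x, ζ)).trans (norm_fst_le ((x, ζ), θ)))
    · exact h.trans_le (norm_snd_le ((x, ζ), θ)))
  simp [qHat, this]

lemma continuous_qHat_right {Q : Phase d × E d → ℂ} (hQ : C^∞ Q)
    (hc : HasCompactSupport Q) (ħ : ℝ) (ζ : E d) : Continuous (qHat Q ħ ζ) := by
  have h1 : Continuous (fun p : E d × E d => qHat Q ħ p.1 p.2) := (contDiff_qHat hQ hc ħ).continuous
  have h2 : Continuous (fun θ : E d => (ζ, θ)) := Continuous.prodMk_right ζ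
  have h3 := Continuous.comp' h1 h2
  exact h3

lemma compactSupp_qHat_right {Q : Phase d × E d → ℂ} (hc : HasCompactSupport Q) (ħ : ℝ)
    (ζ : E d) : HasCompactSupport (qHat Q ħ ζ) := by
  obtain ⟨ρ, -, hρ⟩ := exists_radius hc
  exact .intro (isCompact_closedBall 0 ρ) fun θ hθ =>
      qHat_eq_zero hρ (Or.inr (by simpa using hθ))

lemma integrable_qHat {Q : Phase d × E d → ℂ} (hQ : C^∞ Q) (hc : HasCompactSupport Q)
    (ħ : ℝ) (ζ : E d) : Integrable (qHat Q ħ ζ) :=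
  (continuous_qHat_right hQ hc ħ ζ).integrable_of_hasCompactSupport (compactSupp_qHat_right hc ħ ζ)

lemma fourierH_add {ħ : ℝ} {s t : E d → ℂ} (hs : Integrable s) (ht : Integrable t) (ξ : E d) :
    fourierH ħ (fun x => s x + t x) ξ = fourierH ħ s ξ + fourierH ħ t ξ := by
  unfold fourierH
  rw [← integral_add (integrable_osc_mul hs (by fun_prop)) (integrable_osc_mul ht (by fun_prop))]
  simp only [mul_add]

lemma fourierH_const_mul {ħ : ℝ} (c : ℂ) (t : E d → ℂ) (ξ : E d) :
    fourierH ħ (fun x => c * t x) ξ = c * fourierH ħ t ξ := by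
  unfold fourierH
  simp only [mul_left_comm _ c, integral_const_mul]

lemma fourierH_sum {ι : Type*} (s : Finset ι) {ħ : ℝ} {t : ι → E d → ℂ}
    (ht : ∀ i, Integrable (t i)) (ξ : E d) :
    fourierH ħ (fun x => ∑ i ∈ s, t i x) ξ = ∑ i ∈ s, fourierH ħ (t i) ξ := by
  unfold fourierH
  rw [← integral_finsetSum _ fun i _ => integrable_osc_mul (ht i) (by fun_prop)]
  simp only [mul_sum]

lemma symErr_eq {Q : Phase d × E d → ℂ} (hQ : C^∞ Q) (hc : HasCompactSupport Q) {ħ : ℝ}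
    (hħ : 0 < ħ) (x ζ : E d) :
    Integrable (remHat Q ħ ζ) ∧ symErr Q ħ (x, ζ) = invFourierH ħ (remHat Q ħ ζ) x := by
  have hq0 := contDiff_section hQ ζ 0
  have hq0c := compactSupp_section hc ζ 0
  have hQj : ∀ j : Fin d, C^∞ (fun p => fderiv ℝ Q p (0, single j 1)) :=
    fun j => smooth_dir hQ _
  have hQjc : ∀ j : Fin d, HasCompactSupport (fun p => fderiv ℝ Q p (0, single j 1)) :=
    fun j => compactSupp_dir hc _
  set q0 : 𝓢(E d, ℂ) := hq0c.toSchwartzMap hq0 with hq0def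
  set q1 : Fin d → E d → ℂ := fun j x => fderiv ℝ (fun p => fderiv ℝ Q p
    (0, single j 1)) ((x, ζ), 0) ((single j 1, 0), 0) with hq1def
  have hq1 : ∀ j, C^∞ (q1 j) := fun j =>
    contDiff_section (smooth_dir (hQj j) _) ζ 0
  have hq1c : ∀ j, HasCompactSupport (q1 j) := fun j =>
    compactSupp_section (compactSupp_dir (hQjc j) _) ζ 0
  have hq1s : C^∞ (fun x => ∑ j, q1 j x) := ContDiff.sum fun j _ => hq1 j
  have hq1sc : HasCompactSupport (fun x => ∑ j, q1 j x) := by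
    choose ρ hρ0 hρ using fun j => exists_radius (hq1c j)
    refine .intro (isCompact_closedBall 0 (∑ j, ρ j)) fun x hx =>
      sum_eq_zero fun j _ => hρ j x ?_
    refine lt_of_le_of_lt (single_le_sum (fun j _ => hρ0 j) (Finset.mem_univ j)) ?_
    simpa using hx
  set q1S : 𝓢(E d, ℂ) := hq1sc.toSchwartzMap hq1s with hq1Sdef
  have key : ∀ θ, qHat Q ħ ζ θ = fourierH ħ q0 θ + (-I * ħ) * fourierH ħ q1S θ
      + remHat Q ħ ζ θ := by
    intro θ
    have e1 : (fun x => Q ((x, ζ), θ)) = fun x => q0 x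
        + (∑ j, (θ j : ℂ) * fderiv ℝ Q ((x, ζ), 0) (0, single j 1) + taylorRem Q (x, ζ) θ) := by
      funext x
      have e2 : fderiv ℝ Q ((x, ζ), 0) (0, θ)
          = ∑ j, (θ j : ℂ) * fderiv ℝ Q ((x, ζ), 0) (0, single j 1) := by
        have e3 : ((0 : Phase d), θ) = ∑ j, θ j • ((0 : Phase d), single j (1 : ℝ)) := by
          conv_lhs => rw [← sum_smul_single θ]
          ext <;> simp [Prod.fst_sum, Prod.snd_sum]
        rw [e3, map_sum]
        simp only [map_smul, Complex.real_smul]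
      rw [taylorRem, e2]
      change _ = Q ((x, ζ), 0) + _
      ring
    have i1 : ∀ j : Fin d, Integrable
        (fun x => (θ j : ℂ) * fderiv ℝ Q ((x, ζ), 0) (0, single j 1)) := fun j =>
      ((contDiff_section (hQj j) ζ 0).continuous.integrable_of_hasCompactSupport
        (compactSupp_section (hQjc j) ζ 0)).const_mul _
    have i2 : Integrable (fun x => taylorRem Q (x, ζ) θ) := by
      obtain ⟨ρ, -, hρ⟩ := exists_radius hc
      refine Continuous.integrable_of_hasCompactSupport
        ((contDiff_taylorRem hQ θ).continuous.comp (by fun_prop : Continuous fun x : E d => (x, ζ)))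
        (.intro (isCompact_closedBall 0 ρ) fun x hx => taylorRem_eq_zero hρ ?_ θ)
      exact lt_of_lt_of_le (by simpa using hx) (norm_fst_le _)
    have e4 : qHat Q ħ ζ θ = fourierH ħ (fun x => Q ((x, ζ), θ)) θ := rfl
    have i3 : Integrable (fun x => ∑ j, (θ j : ℂ) * fderiv ℝ Q ((x, ζ), 0)
        (0, single j 1)) := integrable_finsetSum _ fun j _ => i1 j
    have i4 : Integrable (fun x => ∑ j, (θ j : ℂ) * fderiv ℝ Q ((x, ζ), 0)
        (0, single j 1) + taylorRem Q (x, ζ) θ) := i3.add i2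
    rw [e4, e1, fourierH_add q0.integrable i4, fourierH_add i3 i2, fourierH_sum _ i1, add_assoc]
    congr 2
    have e5 : fourierH ħ q1S θ = ∑ j, fourierH ħ (q1 j) θ :=
      fourierH_sum Finset.univ (fun j => (hq1 j).continuous.integrable_of_hasCompactSupport
        (hq1c j)) θ
    rw [e5, mul_sum]
    refine sum_congr rfl fun j _ => ?_
    rw [fourierH_const_mul, coord_mul_fourierH hħ.ne' (contDiff_section (hQj j) ζ 0)
      (compactSupp_section (hQjc j) ζ 0)]
    congr 2
    funext x
    exact fderiv_section (hQj j) ζ 0 x _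
  have i0 := integrable_fourierH hħ q0
  have i1 := (integrable_fourierH hħ q1S).const_mul (-I * ħ)
  have hrem : remHat Q ħ ζ = fun θ => qHat Q ħ ζ θ
      - (fourierH ħ q0 θ + (-I * ħ) * fourierH ħ q1S θ) := by
    funext θ
    rw [key]
    ring
  have i2 : Integrable (remHat Q ħ ζ) := by
    rw [hrem]
    exact (integrable_qHat hQ hc ħ ζ).sub (i0.add i1)
  refine ⟨i2, ?_⟩
  have h1 : symS Q ħ (x, ζ) = q0 x + -I * ħ * q1S x + invFourierH ħ (remHat Q ħ ζ) x := by
    unfold symS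
    have i3 : Integrable (fun θ => fourierH ħ q0 θ + (-I * ħ) * fourierH ħ q1S θ) :=
      i0.add i1
    rw [funext key, invFourierH_add i3 i2, invFourierH_add i0 i1, invFourierH_const_mul,
      invFourierH_fourierH hħ, invFourierH_fourierH hħ]
  rw [symErr, h1]
  change Q ((x, ζ), 0) + -I * ħ * ∑ j, q1 j x + _ - _ = _
  rw [subPart]
  ring

lemma exists_deriv_symErr_le (k : ℕ) {Q : Phase d × E d → ℂ} (hQ : C^∞ Q)
    (hc : HasCompactSupport Q) : ∃ C, 0 ≤ C ∧ ∀ ħ > 0, ∀ z,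
      ‖iteratedFDeriv ℝ k (symErr Q ħ) z‖ ≤ C * ħ ^ 2 := by
  induction k generalizing Q with
  | zero =>
    obtain ⟨C, hC0, hC⟩ := exists_norm_remHat_le hQ hc
    obtain ⟨C', hC'0, hC'⟩ := exists_planck_mul_integral_eq d
    refine ⟨C * C', by positivity, fun ħ hħ z => ?_⟩
    rw [norm_iteratedFDeriv_zero, (symErr_eq hQ hc hħ z.1 z.2).2]
    refine (norm_invFourierH_le _ _).trans ?_
    have h1 : ∫ θ, ‖remHat Q ħ z.2 θ‖ ≤ ∫ θ : E d, C * ħ ^ 2 * ((1 + ‖θ‖ / ħ) ^ (d + 1))⁻¹ :=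
      integral_mono (symErr_eq hQ hc hħ z.1 z.2).1.norm
        ((integrable_inv_one_add_norm_div_pow d hħ).const_mul _) (fun θ => hC ħ hħ z.2 θ)
    calc _ ≤ ‖planck d ħ‖ * ∫ θ : E d, C * ħ ^ 2 * ((1 + ‖θ‖ / ħ) ^ (d + 1))⁻¹ := by gcongr
      _ = C * ħ ^ 2 * (‖planck d ħ‖ * ∫ θ : E d, ((1 + ‖θ‖ / ħ) ^ (d + 1))⁻¹) := by
        rw [integral_const_mul]; ring
      _ = _ := by rw [hC' ħ hħ]; ring
  | succ k ih =>
    obtain ⟨n, b, B, hB0, hB⟩ := exists_deriv_succ_le_sum (Phase d)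
    choose C hC0 hC using fun i : Fin n => ih (smooth_dir hQ (b i, 0)) (compactSupp_dir hc _)
    refine ⟨B * ∑ i, C i, mul_nonneg hB0 (sum_nonneg fun i _ => hC0 i), fun ħ hħ z => ?_⟩
    refine (hB _ (contDiff_symErr hQ hc ħ) k z).trans ?_
    rw [mul_assoc, sum_mul]
    refine mul_le_mul_of_nonneg_left (sum_le_sum fun i _ => ?_) hB0
    simp only [fderiv_symErr hQ hc]
    exact hC i ħ hħ z

end Expansion

end

section

/-! ### Nonstationary phase -/

section Nonstationary

variable {d : ℕ} {S : Type*} [NormedAddCommGroup S] [NormedSpace ℝ S]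

lemma hasFDerivAt_right {F : Type*} [NormedAddCommGroup F] [NormedSpace ℝ F]
    {Φ : S × E d → F} (hΦ : C^∞ Φ) (s : S) (t : E d) :
    HasFDerivAt (fun t => Φ (s, t)) ((fderiv ℝ Φ (s, t)).comp (inr ℝ S (E d))) t :=
  (hΦ.differentiable (by simp) (s, t)).hasFDerivAt.comp t (hasFDerivAt_prodMk_right s t)

lemma compactSupp_right {a : S × E d → ℂ} (hc : HasCompactSupport a) (s : S) :
    HasCompactSupport (fun t => a (s, t)) := by
  obtain ⟨ρ, -, hρ⟩ := exists_radius hc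
  refine .intro (isCompact_closedBall 0 ρ) fun t ht => hρ _ ?_
  exact lt_of_lt_of_le (by simpa using ht) (norm_snd_le (s, t))

lemma exists_norm_integral_osc_le {a : S × E d → ℂ} (ha : Continuous a)
    (hc : HasCompactSupport a) : ∃ C, 0 ≤ C ∧ ∀ (ħ : ℝ) (s : S) (θ : E d → ℝ),
      ‖∫ t, osc ħ (θ t) * a (s, t)‖ ≤ C := by
  obtain ⟨ρ, -, hρ⟩ := exists_radius hc
  obtain ⟨B, hB⟩ := hc.exists_bound_of_continuous ha
  have hB0 : 0 ≤ B := (norm_nonneg _).trans (hB 0)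
  refine ⟨B * volume.real (closedBall (0 : E d) ρ), by positivity, fun ħ s θ => ?_⟩
  have h1 : ∫ t, osc ħ (θ t) * a (s, t)
      = ∫ t in closedBall (0 : E d) ρ, osc ħ (θ t) * a (s, t) := by
    rw [setIntegral_eq_integral_of_forall_compl_eq_zero]
    intro t ht
    rw [hρ _ (lt_of_lt_of_le (by simpa using ht) (norm_snd_le (s, t))), mul_zero]
  rw [h1]
  refine norm_setIntegral_le_of_norm_le_const measure_closedBall_lt_top fun t _ => ?_
  rw [norm_mul, norm_osc, one_mul]
  exact hB _

lemma exists_norm_integral_osc_le_pow (N : ℕ) {Φ : S × E d → ℝ} (hΦ : C^∞ Φ)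
    {e : S → E d} (he : C^∞ e) {a : S × E d → ℂ} (ha : C^∞ a)
    (hc : HasCompactSupport a) (hns : ∀ p ∈ tsupport a, fderiv ℝ Φ p (0, e p.1) ≠ 0) :
    ∃ C, 0 ≤ C ∧ ∀ ħ > 0, ∀ s, ‖∫ t, osc ħ (Φ (s, t)) * a (s, t)‖ ≤ C * ħ ^ N := by
  induction N generalizing a with
  | zero =>
    obtain ⟨C, hC0, hC⟩ := exists_norm_integral_osc_le ha.continuous hc
    exact ⟨C, hC0, fun ħ _ s => by simpa using hC ħ s _⟩
  | succ N ih =>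
    have hes : C^∞ (fun p : S × E d => ((0 : S), e p.1)) :=
      contDiff_const.prodMk (he.comp contDiff_fst)
    set D : S × E d → ℝ := fun p => fderiv ℝ Φ p (0, e p.1) with hD
    have hDs : C^∞ D := (hΦ.fderiv_right (m := ∞) (by simp)).clm_apply hes
    set b : S × E d → ℂ := fun p => ((D p)⁻¹ : ℝ) * a p with hb
    have hbs : C^∞ b := contDiff_mul_of_tsupport ha fun p hp =>
      Complex.ofRealCLM.contDiff.contDiffAt.comp p (hDs.contDiffAt.inv (hns p hp))
    have hbc : HasCompactSupport b := hc.mul_left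
    have hbt : tsupport b ⊆ tsupport a := closure_mono fun p hp => by
      intro h
      exact hp (by simp [b, h])
    set a' : S × E d → ℂ := fun p => fderiv ℝ b p (0, e p.1) with ha'
    have ha's : C^∞ a' := (hbs.fderiv_right (m := ∞) (by simp)).clm_apply hes
    have ha't : tsupport a' ⊆ tsupport b := by
      refine closure_minimal (fun p hp => ?_) (isClosed_tsupport b)
      by_contra h
      exact hp (dir_eq_zero_of_notMem h _)
    have ha'c : HasCompactSupport a' := IsCompact.of_isClosed_subset hbc (isClosed_tsupport _) ha't
    obtain ⟨C, hC0, hC⟩ := ih ha's ha'c (fun p hp => hns p (hbt (ha't hp)))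
    refine ⟨C, hC0, fun ħ hħ s => ?_⟩
    have h1 := integral_osc_mul_fderiv (μ := volume) hħ.ne' (θ := fun t => Φ (s, t))
      (a := fun t => b (s, t))
      ((hbs.comp (by fun_prop : C^∞ fun t : E d => (s, t))).of_le
        (by exact_mod_cast le_top)) (compactSupp_right hbc s)
      (fun t _ => ((hΦ.comp (by fun_prop : C^∞ fun t : E d => (s, t))).of_le
        (by exact_mod_cast le_top)).contDiffAt) (e s)
    have h2 : ∀ t, osc ħ (Φ (s, t)) * (fderiv ℝ (fun t => Φ (s, t)) t (e s) : ℂ) * b (s, t)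
        = osc ħ (Φ (s, t)) * a (s, t) := by
      intro t
      have e1 : fderiv ℝ (fun t => Φ (s, t)) t (e s) = D (s, t) := by
        rw [(hasFDerivAt_right hΦ s t).fderiv]
        simp [D]
      rw [e1, mul_assoc]
      congr 1
      by_cases h : (s, t) ∈ tsupport a
      · have : ((D (s, t) : ℝ) : ℂ) ≠ 0 := by exact_mod_cast hns _ h
        simp only [b]
        push_cast
        field_simp
      · simp [b, image_eq_zero_of_notMem_tsupport h]
    have h3 : ∀ t, fderiv ℝ (fun t => b (s, t)) t (e s) = a' (s, t) := by
      intro t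
      rw [(hasFDerivAt_right hbs s t).fderiv]
      simp [a']
    simp only [h2, h3] at h1
    rw [h1, norm_mul, norm_mul, norm_I, one_mul, norm_real, norm_of_nonneg hħ.le]
    calc ħ * _ ≤ ħ * (C * ħ ^ N) := by gcongr; exact hC ħ hħ s
      _ = _ := by ring

/-- The kernel of the propagator in the frequency coordinate `η = g(ξ)`, with `h = g⁻¹`. -/
noncomputable def propKer (h : E d → E d) (m : S × E d → ℂ) (ħ : ℝ) (y w : E d) (s : S) : ℂ :=
  ∫ η, osc ħ (inner ℝ y η - inner ℝ w (h η)) * m (s, η)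

lemma fderiv_inner_sub_inner_apply (e u v : E d) {h : E d → E d} {t : E d}
    (hh : DifferentiableAt ℝ h t) :
    fderiv ℝ (fun t => (inner ℝ e t - inner ℝ u (h t) : ℝ)) t v
      = inner ℝ e v - inner ℝ u (fderiv ℝ h t v) := by
  rw [fderiv_fun_sub ((differentiableAt_const e).inner ℝ differentiableAt_fun_id)
    ((differentiableAt_const u).inner ℝ hh), _root_.sub_apply,
    fderiv_inner_apply ℝ (differentiableAt_const e) differentiableAt_fun_id,
    fderiv_inner_apply ℝ (differentiableAt_const u) hh]
  simp

lemma osc_mul_div (c ħ θ : ℝ) (hc : c ≠ 0) : osc ħ (c * θ) = osc (ħ / c) θ := by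
  unfold osc
  congr 3
  field_simp

lemma inner_self_sub_inner_ne_zero {e u : E d} {A : E d →L[ℝ] E d} {Λ : ℝ} (hΛ : 0 ≤ Λ)
    (hA : ‖A‖ ≤ Λ) (he : 3 / 4 ≤ ‖e‖) (hu : ‖u‖ ≤ 5 / 4 * (2 * Λ + 1)⁻¹) :
    (inner ℝ e e - inner ℝ u (A e) : ℝ) ≠ 0 := by
  have e3 : ‖A e‖ ≤ Λ * ‖e‖ := (A.le_opNorm e).trans (by gcongr)
  have e4 : (2 * Λ + 1)⁻¹ * Λ ≤ 1 / 2 := by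
    rw [inv_mul_le_iff₀ (by positivity)]; linarith
  have e2 : inner ℝ u (A e) ≤ (5 / 8) * ‖e‖ := by
    refine (real_inner_le_norm _ _).trans ?_
    calc ‖u‖ * ‖A e‖ ≤ (5 / 4 * (2 * Λ + 1)⁻¹) * (Λ * ‖e‖) := by gcongr
      _ = 5 / 4 * ((2 * Λ + 1)⁻¹ * Λ) * ‖e‖ := by ring
      _ ≤ 5 / 4 * (1 / 2) * ‖e‖ := by gcongr
      _ = _ := by ring
  have e6 : 0 < ‖e‖ ^ 2 - 5 / 8 * ‖e‖ := by nlinarith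
  rw [real_inner_self_eq_norm_sq]
  exact (lt_of_lt_of_le e6 (by linarith)).ne'

lemma exists_cutoff_direction (d : ℕ) {c : ℝ} (hc : 0 < c) : ∃ β : E d × E d → ℝ, C^∞ β ∧
      (∀ p, ‖p.1‖ = 1 → ‖p.2‖ ≤ c → β p = 1) ∧
      ∀ p, β p ≠ 0 → 3 / 4 ≤ ‖p.1‖ ∧ ‖p.1‖ ≤ 2 ∧ ‖p.2‖ ≤ 5 / 4 * c := by
  let b₁ : ContDiffBump (0 : E d) := ⟨1, 2, by norm_num, by norm_num⟩
  let b₂ : ContDiffBump (0 : E d) := ⟨3 / 4, 7 / 8, by norm_num, by norm_num⟩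
  let b₃ : ContDiffBump (0 : E d) := ⟨c, 5 / 4 * c, hc, by linarith⟩
  refine ⟨fun p => (b₁ p.1 - b₂ p.1) * b₃ p.2, ?_, fun p h1 h2 => ?_, fun p hp => ⟨?_, ?_, ?_⟩⟩
  · exact ((b₁.contDiff.comp contDiff_fst).sub (b₂.contDiff.comp contDiff_fst)).mul
      (b₃.contDiff.comp contDiff_snd)
  · simp only
    rw [b₁.one_of_mem_closedBall, b₂.zero_of_le_dist, b₃.one_of_mem_closedBall]
    · norm_num
    · simpa using h2
    · rw [dist_zero_right, h1]; norm_num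
    · rw [mem_closedBall_zero_iff, h1]
  · by_contra hlt
    refine left_ne_zero_of_mul hp ?_
    rw [b₁.one_of_mem_closedBall, b₂.one_of_mem_closedBall, sub_self]
    · rw [mem_closedBall_zero_iff]; exact (not_le.1 hlt).le
    · rw [mem_closedBall_zero_iff]; exact (not_le.1 hlt).le.trans (by norm_num)
  · by_contra hlt
    refine left_ne_zero_of_mul hp ?_
    rw [b₁.zero_of_le_dist, b₂.zero_of_le_dist, sub_self]
    · rw [dist_zero_right]; exact le_trans (by norm_num) (not_le.1 hlt).le
    · rw [dist_zero_right]; exact (not_le.1 hlt).le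
  · by_contra hlt
    exact right_ne_zero_of_mul hp
      (b₃.zero_of_le_dist (by rw [dist_zero_right]; exact (not_le.1 hlt).le))

lemma exists_norm_propKer_scaled_le {h : E d → E d} (hh : C^∞ h) {m : S × E d → ℂ}
    (hm : C^∞ m) (hc : HasCompactSupport m) {Λ : ℝ} (hΛ : 0 ≤ Λ)
    (hb : ∀ p ∈ tsupport m, ‖fderiv ℝ h p.2‖ ≤ Λ) (N : ℕ) :
    ∃ C, 0 ≤ C ∧ ∀ ħ > 0, ∀ (e u : E d) (s : S), ‖e‖ = 1 → ‖u‖ ≤ (2 * Λ + 1)⁻¹ →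
      ‖propKer h m ħ e u s‖ ≤ C * ħ ^ N := by
  obtain ⟨β, hβs, hβ1, hβ0⟩ := exists_cutoff_direction d (c := (2 * Λ + 1)⁻¹) (by positivity)
  let Φ : ((E d × E d) × S) × E d → ℝ := fun p =>
    inner ℝ p.1.1.1 p.2 - inner ℝ p.1.1.2 (h p.2)
  have hΦs : C^∞ Φ := by
    refine ContDiff.sub (ContDiff.inner ℝ ?_ ?_) (ContDiff.inner ℝ ?_ (hh.comp ?_))
    all_goals fun_prop
  have hsm : C^∞ (fun p : ((E d × E d) × S) × E d => (p.1.2, p.2)) := by fun_prop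
  have hsβ : C^∞ (fun p : ((E d × E d) × S) × E d => p.1.1) := by fun_prop
  let a : ((E d × E d) × S) × E d → ℂ := fun p => (β p.1.1 : ℂ) * m (p.1.2, p.2)
  have has : C^∞ a :=
    (Complex.ofRealCLM.contDiff.comp (hβs.comp hsβ)).mul (hm.comp hsm)
  let K : Set (((E d × E d) × S) × E d) := {p | 3 / 4 ≤ ‖p.1.1.1‖ ∧ ‖p.1.1.1‖ ≤ 2 ∧
    ‖p.1.1.2‖ ≤ 5 / 4 * (2 * Λ + 1)⁻¹ ∧ (p.1.2, p.2) ∈ tsupport m}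
  have hKc : IsClosed K := by
    have n1 : Continuous (fun p : ((E d × E d) × S) × E d => ‖p.1.1.1‖) := by fun_prop
    have n2 : Continuous (fun p : ((E d × E d) × S) × E d => ‖p.1.1.2‖) := by fun_prop
    exact (isClosed_le continuous_const n1).inter ((isClosed_le n1 continuous_const).inter
      ((isClosed_le n2 continuous_const).inter ((isClosed_tsupport m).preimage hsm.continuous)))
  have hKt : tsupport a ⊆ K := by
    refine closure_minimal (fun p hp => ?_) hKc
    have h1 : m (p.1.2, p.2) ≠ 0 := right_ne_zero_of_mul hp
    obtain ⟨h2, h3, h4⟩ := hβ0 p.1.1 (fun h => left_ne_zero_of_mul hp (by simp [h]))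
    exact ⟨h2, h3, h4, subset_tsupport _ h1⟩
  have hac : HasCompactSupport a := by
    have : K ⊆ (fun q : (E d × E d) × (S × E d) => ((q.1, q.2.1), q.2.2)) ''
        ((closedBall 0 2 ×ˢ closedBall 0 (5 / 4 * (2 * Λ + 1)⁻¹)) ×ˢ tsupport m) := by
      rintro p ⟨-, h2, h3, h4⟩
      exact ⟨(p.1.1, (p.1.2, p.2)), ⟨⟨by simpa using h2, by simpa using h3⟩, h4⟩, rfl⟩
    refine IsCompact.of_isClosed_subset (IsCompact.image (((isCompact_closedBall _ _).prod
      (isCompact_closedBall _ _)).prod hc) (by fun_prop)) (isClosed_tsupport _) (hKt.trans this)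
  have hns : ∀ p ∈ tsupport a, fderiv ℝ Φ p (0, p.1.1.1) ≠ 0 := by
    intro p hp
    obtain ⟨h1, -, h3, h4⟩ := hKt hp
    have q1 := (hasFDerivAt_right hΦs p.1 p.2).fderiv
    have q2 := fderiv_inner_sub_inner_apply p.1.1.1 p.1.1.2 p.1.1.1
      (hh.differentiable (by simp) p.2)
    have q3 : fderiv ℝ (fun t => Φ (p.1, t)) p.2 p.1.1.1 = fderiv ℝ Φ p (0, p.1.1.1) := by
      rw [q1]
      simp
    rw [← q3]
    exact fun h0 => inner_self_sub_inner_ne_zero hΛ (hb _ h4) h1 h3 (q2.symm.trans h0)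
  obtain ⟨C, hC0, hC⟩ := exists_norm_integral_osc_le_pow N hΦs
    (e := fun p : (E d × E d) × S => p.1.1) (by fun_prop) has hac hns
  refine ⟨C, hC0, fun ħ hħ e u s he hu => ?_⟩
  refine le_trans (le_of_eq ?_) (hC ħ hħ ((e, u), s))
  unfold propKer
  simp only [a, Φ, hβ1 (e, u) he hu, Complex.ofReal_one, one_mul]

lemma exists_norm_propKer_le {h : E d → E d} (hh : C^∞ h) {m : S × E d → ℂ}
    (hm : C^∞ m) (hc : HasCompactSupport m) {Λ : ℝ} (hΛ : 0 ≤ Λ)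
    (hb : ∀ p ∈ tsupport m, ‖fderiv ℝ h p.2‖ ≤ Λ) (N : ℕ) :
    ∃ C, 0 ≤ C ∧ ∀ ħ > 0, ∀ (y w : E d) (s : S), (2 * Λ + 1) * ⟪w⟫ ≤ ‖y‖ →
      ‖propKer h m ħ y w s‖ ≤ C * (ħ / ‖y‖) ^ N := by
  obtain ⟨C, hC0, hC⟩ := exists_norm_propKer_scaled_le hh hm hc hΛ hb N
  refine ⟨C, hC0, fun ħ hħ y w s hy => ?_⟩
  have hy0 : 0 < ‖y‖ := lt_of_lt_of_le (by positivity) hy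
  have n1 : ‖‖y‖⁻¹ • y‖ = 1 := by
    rw [norm_smul, norm_inv, norm_norm, inv_mul_cancel₀ hy0.ne']
  have n2 : ‖‖y‖⁻¹ • w‖ ≤ (2 * Λ + 1)⁻¹ := by
    rw [norm_smul, norm_inv, norm_norm, inv_mul_le_iff₀ hy0, ← div_eq_mul_inv,
      le_div_iff₀ (by positivity)]
    nlinarith
  refine le_trans (le_of_eq ?_) (hC (ħ / ‖y‖) (by positivity) (‖y‖⁻¹ • y) (‖y‖⁻¹ • w) s n1 n2)
  unfold propKer
  congr 2
  funext η
  rw [← osc_mul_div _ _ _ hy0.ne', real_inner_smul_left, real_inner_smul_left]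
  congr 2
  field_simp

lemma exists_weight_mul_propKer_le {h : E d → E d} (hh : C^∞ h)
    {m : S × E d → ℂ} (hm : C^∞ m) (hc : HasCompactSupport m) {Λ : ℝ} (hΛ : 0 ≤ Λ)
    (hb : ∀ p ∈ tsupport m, ‖fderiv ℝ h p.2‖ ≤ Λ) (n : ℕ) :
    ∃ C, 0 ≤ C ∧ ∀ ħ, 0 < ħ → ħ ≤ 1 → ∀ (y w : E d) (s : S),
      ⟪y⟫ ^ n * ‖propKer h m ħ y w s‖ ≤ C * ⟪w⟫ ^ n := by
  obtain ⟨C₁, h10, h1⟩ := exists_norm_propKer_le hh hm hc hΛ hb n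
  obtain ⟨C₂, h20, h2⟩ := exists_norm_integral_osc_le hm.continuous hc
  refine ⟨2 ^ n * C₁ + (2 * Λ + 2) ^ n * C₂, by positivity, fun ħ hħ hħ1 y w s => ?_⟩
  rcases le_total ((2 * Λ + 1) * ⟪w⟫) ‖y‖ with hy | hy
  · have hy1 : 1 ≤ ‖y‖ := by nlinarith [norm_nonneg w, mul_nonneg hΛ (norm_nonneg w)]
    calc ⟪y⟫ ^ n * ‖propKer h m ħ y w s‖ ≤ (2 * ‖y‖) ^ n * (C₁ * (1 / ‖y‖) ^ n) := by
          gcongr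
          · linarith
          · exact (h1 ħ hħ y w s hy).trans (by gcongr)
      _ = 2 ^ n * C₁ := by
          rw [mul_pow, one_div, inv_pow]; field_simp
      _ ≤ (2 ^ n * C₁ + (2 * Λ + 2) ^ n * C₂) * 1 := by
          rw [mul_one]; linarith [(by positivity : 0 ≤ (2 * Λ + 2) ^ n * C₂)]
      _ ≤ _ := by gcongr; exact one_le_pow₀ (by linarith [norm_nonneg w])
  · calc ⟪y⟫ ^ n * ‖propKer h m ħ y w s‖ ≤ ((2 * Λ + 2) * ⟪w⟫) ^ n * C₂ := by
          gcongr
          · nlinarith [norm_nonneg w]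
          · exact h2 ħ s _
      _ = (2 * Λ + 2) ^ n * C₂ * ⟪w⟫ ^ n := by rw [mul_pow]; ring
      _ ≤ _ := by gcongr; linarith [(by positivity : 0 ≤ 2 ^ n * C₁)]

end Nonstationary

/-! ### Derivatives of oscillatory integrals with respect to parameters -/

section OscDeriv

variable {d : ℕ} {Z : Type*} [NormedAddCommGroup Z] [NormedSpace ℝ Z] [FiniteDimensional ℝ Z]

/-- An oscillatory integral depending on the parameter `z`. -/
noncomputable def oscInt (Φ : Z × E d → ℝ) (ħ : ℝ) (a : Z × E d → ℂ) (f : E d → ℂ) (z : Z) : ℂ :=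
  ∫ t, osc ħ (Φ (z, t)) * (a (z, t) * f t)

variable {Φ : Z × E d → ℝ} {a : Z × E d → ℂ} {f : E d → ℂ}

lemma contDiff_oscInt_integrand (hΦ : C^∞ Φ) (ha : C^∞ a) (hf : C^∞ f)
    (ħ : ℝ) : C^∞ (fun p : Z × E d => osc ħ (Φ p) * (a p * f p.2)) :=
  ((contDiff_osc ħ).comp hΦ).mul (ha.mul (hf.comp contDiff_snd))

lemma oscInt_compact (hc : HasCompactSupport a) (ħ : ℝ) (z₀ : Z) :
    ∃ k : Set (E d), IsCompact k ∧ ∀ z ∈ ball z₀ 1, ∀ t ∉ k,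
      osc ħ (Φ (z, t)) * (a (z, t) * f (z, t).2) = 0 := by
  obtain ⟨ρ, -, hρ⟩ := exists_radius hc
  refine ⟨closedBall 0 ρ, isCompact_closedBall _ _, fun z _ t ht => ?_⟩
  rw [hρ _ (lt_of_lt_of_le (by simpa using ht) (norm_snd_le (z, t)))]
  simp

lemma contDiff_oscInt (hΦ : C^∞ Φ) (ha : C^∞ a) (hc : HasCompactSupport a)
    (hf : C^∞ f) (ħ : ℝ) : C^∞ (oscInt Φ ħ a f) :=
  contDiff_integral_compact (μ := volume) (contDiff_oscInt_integrand hΦ ha hf ħ)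
    (oscInt_compact hc ħ)

lemma fderiv_oscInt (hΦ : C^∞ Φ) (ha : C^∞ a) (hc : HasCompactSupport a)
    (hf : C^∞ f) {ħ : ℝ} (z v : Z) :
    fderiv ℝ (oscInt Φ ħ a f) z v
      = (ħ : ℂ)⁻¹ * oscInt Φ ħ (fun p => I * (fderiv ℝ Φ p (v, 0) : ℂ) * a p) f z
        + oscInt Φ ħ (fun p => fderiv ℝ a p (v, 0)) f z := by
  have h0 : ∀ (b : Z × E d → ℂ), Continuous b → HasCompactSupport b →
      Integrable (fun t => osc ħ (Φ (z, t)) * (b (z, t) * f t)) := fun b hb hbc => by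
    have hs : HasCompactSupport (fun t => osc ħ (Φ (z, t)) * (b (z, t) * f t)) :=
      (compactSupp_right hbc z).mul_right.mul_left
    refine Continuous.integrable_of_hasCompactSupport ?_ hs
    have := hΦ.continuous
    have := hf.continuous
    fun_prop
  have hD : Continuous (fun p => fderiv ℝ Φ p (v, 0)) :=
    (hΦ.continuous_fderiv (by simp)).clm_apply continuous_const
  have i1 := h0 (fun p => I * (fderiv ℝ Φ p (v, 0) : ℂ) * a p)
    ((continuous_const.mul (Complex.continuous_ofReal.comp hD)).mul ha.continuous) hc.mul_left
  have i2 := h0 (fun p => fderiv ℝ a p (v, 0)) (smooth_dir ha _).continuous (compactSupp_dir hc _)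
  unfold oscInt
  rw [← integral_const_mul, ← integral_add (i1.const_mul _) i2]
  have h1 := fderiv_integral_of_compact (μ := volume) (contDiff_oscInt_integrand hΦ ha hf ħ)
    (oscInt_compact hc ħ) z v
  refine h1.trans (integral_congr_ae (.of_forall fun t => ?_))
  simp only
  rw [← fderiv_left (contDiff_oscInt_integrand hΦ ha hf ħ)]
  have d1 : DifferentiableAt ℝ (fun z => Φ (z, t)) z :=
    (hΦ.comp (by fun_prop : C^∞ fun z : Z => (z, t))).differentiable (by simp) z
  have d2 : DifferentiableAt ℝ (fun z => a (z, t)) z :=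
    (ha.comp (by fun_prop : C^∞ fun z : Z => (z, t))).differentiable (by simp) z
  have d3 : DifferentiableAt ℝ (fun z => osc ħ (Φ (z, t))) z :=
    ((contDiff_osc ħ (n := 1)).differentiable (by simp) _).comp z d1
  have e1 : fderiv ℝ (fun z => Φ (z, t)) z v = fderiv ℝ Φ (z, t) (v, 0) := by
    have h3 : HasFDerivAt (fun z : Z => (z, t)) (inl ℝ Z (E d)) z :=
      hasFDerivAt_prodMk_left z t
    have := ((hΦ.differentiable (by simp) (z, t)).hasFDerivAt.comp z h3).fderiv
    simp only [Function.comp_def] at this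
    rw [this]
    simp
  have h2 : fderiv ℝ (fun z => osc ħ (Φ (z, t)) * (a (z, t) * f t)) z = _ :=
    (d3.hasFDerivAt.mul (d2.hasFDerivAt.mul_const (f t))).fderiv
  rw [h2]
  simp only [_root_.add_apply, _root_.smul_apply, smul_eq_mul, fderiv_osc_comp ħ d1, e1,
    fderiv_left ha]
  ring

/-- If a class of amplitudes is closed under the operations that occur when an oscillatory
integral is differentiated, bounds for the integrals give bounds for all their derivatives. -/
lemma exists_deriv_oscInt_le {ι : Type*} (hΦ : C^∞ Φ)
    {W : Set (Z × E d → ℂ)} (hW : ∀ a ∈ W, C^∞ a ∧ HasCompactSupport a)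
    (hW1 : ∀ a ∈ W, ∀ v : Z, (fun p => I * (fderiv ℝ Φ p (v, 0) : ℂ) * a p) ∈ W)
    (hW2 : ∀ a ∈ W, ∀ v : Z, (fun p => fderiv ℝ a p (v, 0)) ∈ W)
    {f : ι → E d → ℂ} (hf : ∀ i, C^∞ (f i)) {wt : ℝ → ι → ℝ}
    (hwt : ∀ a ∈ W, ∃ C, 0 ≤ C ∧ ∀ ħ, 0 < ħ → ħ ≤ 1 → ∀ i z, ‖oscInt Φ ħ a (f i) z‖ ≤ C * wt ħ i)
    (k : ℕ) {a : Z × E d → ℂ} (ha : a ∈ W) :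
    ∃ C, 0 ≤ C ∧ ∀ ħ, 0 < ħ → ħ ≤ 1 → ∀ i z,
      ħ ^ k * ‖iteratedFDeriv ℝ k (oscInt Φ ħ a (f i)) z‖ ≤ C * wt ħ i := by
  induction k generalizing a with
  | zero =>
    simpa using hwt a ha
  | succ k ih =>
    obtain ⟨n, b, B, hB0, hB⟩ := exists_deriv_succ_le_sum Z
    choose C₁ h10 h1 using fun i : Fin n => ih (hW1 a ha (b i))
    choose C₂ h20 h2 using fun i : Fin n => ih (hW2 a ha (b i))
    refine ⟨B * ∑ i, (C₁ i + C₂ i), mul_nonneg hB0 (sum_nonneg fun i _ =>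
      add_nonneg (h10 i) (h20 i)), fun ħ hħ hħ1 i z => ?_⟩
    have hs := contDiff_oscInt hΦ (hW a ha).1 (hW a ha).2 (hf i) ħ
    calc ħ ^ (k + 1) * ‖iteratedFDeriv ℝ (k + 1) (oscInt Φ ħ a (f i)) z‖
        ≤ ħ ^ (k + 1) * (B * ∑ j, ‖iteratedFDeriv ℝ k
            (fun z => fderiv ℝ (oscInt Φ ħ a (f i)) z (b j)) z‖) := by gcongr; exact hB _ hs k z
      _ = B * ∑ j, ħ ^ (k + 1) * ‖iteratedFDeriv ℝ k
            (fun z => fderiv ℝ (oscInt Φ ħ a (f i)) z (b j)) z‖ := by rw [← mul_sum]; ring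
      _ ≤ B * ∑ j, (C₁ j + C₂ j) * wt ħ i := by
        refine mul_le_mul_of_nonneg_left (sum_le_sum fun j _ => ?_) hB0
        simp only [fderiv_oscInt hΦ (hW a ha).1 (hW a ha).2 (hf i)]
        have s1 : ContDiff ℝ k (oscInt Φ ħ
            (fun p => I * (fderiv ℝ Φ p (b j, 0) : ℂ) * a p) (f i)) :=
          (contDiff_oscInt hΦ (hW _ (hW1 a ha (b j))).1 (hW _ (hW1 a ha (b j))).2 (hf i) ħ).of_le
            (by exact_mod_cast le_top)
        have s2 : ContDiff ℝ k (oscInt Φ ħ (fun p => fderiv ℝ a p (b j, 0)) (f i)) :=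
          (contDiff_oscInt hΦ (hW _ (hW2 a ha (b j))).1 (hW _ (hW2 a ha (b j))).2 (hf i) ħ).of_le
            (by exact_mod_cast le_top)
        rw [fun_iteratedFDeriv_add_apply (contDiff_const.mul s1).contDiffAt s2.contDiffAt]
        have e1 : iteratedFDeriv ℝ k (fun z => (ħ : ℂ)⁻¹ * oscInt Φ ħ
            (fun p => I * (fderiv ℝ Φ p (b j, 0) : ℂ) * a p) (f i) z) z
            = (ħ : ℂ)⁻¹ • iteratedFDeriv ℝ k (oscInt Φ ħ
            (fun p => I * (fderiv ℝ Φ p (b j, 0) : ℂ) * a p) (f i)) z :=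
          iteratedFDeriv_const_smul_apply (a := (ħ : ℂ)⁻¹) s1.contDiffAt
        rw [e1]
        have t1 := h1 j ħ hħ hħ1 i z
        have t2 := h2 j ħ hħ hħ1 i z
        refine (mul_le_mul_of_nonneg_left (norm_add_le _ _) (by positivity)).trans ?_
        rw [norm_smul, norm_inv, norm_real, norm_of_nonneg hħ.le, mul_add, add_mul]
        refine add_le_add (le_trans (le_of_eq ?_) t1) (le_trans ?_ t2)
        · rw [pow_succ]; field_simp
        · rw [pow_succ]
          refine mul_le_mul_of_nonneg_right ?_ (norm_nonneg _)
          exact mul_le_of_le_one_right (by positivity) hħ1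
      _ = _ := by rw [← sum_mul, mul_assoc]

end OscDeriv

end

section

/-! ### Symbol classes -/

section Symbols

variable {d : ℕ}

/-- All derivatives of `p` are `O(⟪z⟫^m)`. -/
def SymBound (m : ℕ) (p : Phase d → ℂ) : Prop :=
  C^∞ p ∧ ∀ k : ℕ, ∃ C, 0 ≤ C ∧ ∀ z, ‖iteratedFDeriv ℝ k p z‖ ≤ C * ⟪z⟫ ^ m

lemma IsSymbol.exists_hasSymbolBound {p : Phase d → ℂ} (hp : IsSymbol p) : ∃ m, SymBound m p := by
  obtain ⟨h1, m, hm⟩ := hp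
  refine ⟨m, h1, fun k => ?_⟩
  obtain ⟨C, hC⟩ := hm k
  refine ⟨max C 0, le_max_right _ _, fun z => (hC z).trans ?_⟩
  gcongr
  exact le_max_left _ _

lemma SymBound.norm_le {m : ℕ} {p : Phase d → ℂ} (hp : SymBound m p) :
    ∃ C, 0 ≤ C ∧ ∀ z, ‖p z‖ ≤ C * ⟪z⟫ ^ m := by
  obtain ⟨C, hC0, hC⟩ := hp.2 0
  exact ⟨C, hC0, fun z => by simpa using hC z⟩

lemma SymBound.fderiv_apply {m : ℕ} {p : Phase d → ℂ} (hp : SymBound m p)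
    (v : Phase d) : SymBound m (fun z => fderiv ℝ p z v) := by
  refine ⟨smooth_dir hp.1 v, fun k => ?_⟩
  obtain ⟨C, hC0, hC⟩ := hp.2 (k + 1)
  refine ⟨‖v‖ * C, by positivity, fun z => ?_⟩
  refine (norm_iteratedFDeriv_dir_le hp.1 v k z).trans ?_
  rw [mul_assoc]
  gcongr
  exact hC z

lemma SymBound.mul {m n : ℕ} {p q : Phase d → ℂ} (hp : SymBound m p)
    (hq : SymBound n q) : SymBound (m + n) (fun z => p z * q z) := by
  refine ⟨hp.1.mul hq.1, fun k => ?_⟩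
  choose C hC0 hC using hp.2
  choose D hD0 hD using hq.2
  refine ⟨∑ i ∈ Finset.range (k + 1), (k.choose i : ℝ) * C i * D (k - i),
    sum_nonneg fun i _ => by have := hC0 i; have := hD0 (k - i); positivity, fun z => ?_⟩
  refine (norm_iteratedFDeriv_mul_le hp.1 hq.1 z (n := k) (by exact_mod_cast le_top)).trans ?_
  rw [sum_mul]
  refine sum_le_sum fun i _ => ?_
  calc (k.choose i : ℝ) * ‖iteratedFDeriv ℝ i p z‖ * ‖iteratedFDeriv ℝ (k - i) q z‖
      ≤ (k.choose i : ℝ) * (C i * ⟪z⟫ ^ m) * (D (k - i) * ⟪z⟫ ^ n) := by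
        have := hC0 i
        gcongr
        · exact hC i z
        · exact hD _ z
    _ = _ := by rw [pow_add]; ring

lemma hasSymbolBound_comp {f : E d → ℂ} (hf : C^∞ f) (hc : HasCompactSupport f)
    (L : Phase d →L[ℝ] E d) : SymBound 0 (fun z => f (L z)) := by
  refine ⟨hf.comp L.contDiff, fun k => ?_⟩
  obtain ⟨B, hB0, hB⟩ := exists_bound hf hc k
  refine ⟨B * ‖L‖ ^ k, by positivity, fun z => ?_⟩
  have := norm_iteratedFDeriv_affine hf L 0 k z
  simp only [zero_add] at this
  rw [pow_zero, mul_one]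
  exact this.trans (by gcongr; exact hB _)

lemma SymBound.sub {m : ℕ} {p q : Phase d → ℂ} (hp : SymBound m p)
    (hq : SymBound m q) : SymBound m (fun z => p z - q z) := by
  refine ⟨hp.1.sub hq.1, fun k => ?_⟩
  obtain ⟨C, hC0, hC⟩ := hp.2 k
  obtain ⟨D, hD0, hD⟩ := hq.2 k
  refine ⟨C + D, by positivity, fun z => ?_⟩
  have h1 : iteratedFDeriv ℝ k (fun z => p z - q z) z
      = iteratedFDeriv ℝ k p z - iteratedFDeriv ℝ k q z :=
    iteratedFDeriv_sub_apply (hp.1.of_le (by exact_mod_cast le_top)).contDiffAt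
      (hq.1.of_le (by exact_mod_cast le_top)).contDiffAt
  rw [h1, add_mul]
  exact (norm_sub_le _ _).trans (add_le_add (hC z) (hD z))

lemma hasSymbolBound_one : SymBound 0 (fun _ : Phase d => (1 : ℂ)) := by
  refine ⟨contDiff_const, fun k => ⟨1, zero_le_one, fun z => ?_⟩⟩
  rcases k with _ | k
  · simp
  · simp [iteratedFDeriv_const_of_ne]

lemma one_add_norm_midpoint_le (x y ξ : E d) : 1 + ‖(½ • (x + y), ξ)‖ ≤ ⟪x⟫ * ⟪y⟫ * ⟪ξ⟫ := by
  have h1 : ‖½ • (x + y)‖ ≤ ‖x‖ + ‖y‖ := by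
    rw [norm_smul]
    have := norm_add_le x y
    norm_num
    linarith [norm_nonneg x, norm_nonneg y, norm_nonneg (x + y)]
  have hx := norm_nonneg x
  have hy := norm_nonneg y
  have hξ := norm_nonneg ξ
  rw [Prod.norm_def]
  have h2 : ⟪x⟫ * ⟪y⟫ * ⟪ξ⟫ ≥ 1 + ‖x‖ + ‖y‖ + ‖ξ‖ := by
    nlinarith [mul_nonneg hx hy, mul_nonneg hx hξ, mul_nonneg hy hξ,
      mul_nonneg (mul_nonneg hx hy) hξ]
  rcases max_cases ‖½ • (x + y)‖ ‖ξ‖ with h | h <;> simp only at h ⊢ <;> linarith [h.1]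

end Symbols

/-! ### The inner integral of a Weyl operator -/

section Inner

variable {d : ℕ}

/-- The inner integral in the definition of `weylOp`. -/
noncomputable def wInt (ħ : ℝ) (p : Phase d → ℂ) (v : E d → ℂ) (x ξ : E d) : ℂ :=
  ∫ y : E d, osc ħ (inner ℝ (x - y) ξ) * p (½ • (x + y), ξ) * v y

lemma weylOp_eq_wInt (ħ : ℝ) (p : Phase d → ℂ) (v : E d → ℂ) (x : E d) :
    weylOp ħ p v x = planck d ħ * ∫ ξ, wInt ħ p v x ξ := rfl

lemma integrable_weight_mul (v : 𝓢(E d, ℂ)) (n : ℕ) : Integrable (fun y => ⟪y⟫ ^ n * ‖v y‖) := by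
  have h1 : Integrable (fun y : E d => 2 ^ n * (‖v y‖ + ‖y‖ ^ n * ‖v y‖)) :=
    (v.integrable.norm.add (v.integrable_pow_mul volume n)).const_mul _
  refine h1.mono' ?_ (.of_forall fun y => ?_)
  · exact (((continuous_const.add continuous_norm).pow n).mul v.continuous.norm).aestronglyMeasurable
  · rw [norm_of_nonneg (by positivity)]
    have h2 : ⟪y⟫ ^ n ≤ 2 ^ n * (1 + ‖y‖ ^ n) := by
      rcases le_total ‖y‖ 1 with h | h
      · calc ⟪y⟫ ^ n ≤ 2 ^ n := by gcongr; linarith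
          _ ≤ 2 ^ n * (1 + ‖y‖ ^ n) := le_mul_of_one_le_right (by positivity)
              (by linarith [pow_nonneg (norm_nonneg y) n])
      · calc ⟪y⟫ ^ n ≤ (2 * ‖y‖) ^ n := by gcongr; linarith
          _ = 2 ^ n * ‖y‖ ^ n := mul_pow _ _ _
          _ ≤ _ := by gcongr; linarith
    calc ⟪y⟫ ^ n * ‖v y‖ ≤ (2 ^ n * (1 + ‖y‖ ^ n)) * ‖v y‖ := by gcongr
      _ = _ := by ring

variable {m : ℕ} {p : Phase d → ℂ}

lemma norm_symbol_midpoint_le {C : ℝ} (hC0 : 0 ≤ C) (hC : ∀ z, ‖p z‖ ≤ C * ⟪z⟫ ^ m)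
    (x y ξ : E d) : ‖p (½ • (x + y), ξ)‖ ≤ C * ⟪x⟫ ^ m * ⟪ξ⟫ ^ m * ⟪y⟫ ^ m := by
  refine (hC _).trans ?_
  calc C * ⟪(½ • (x + y), ξ)⟫ ^ m
      ≤ C * (⟪x⟫ * ⟪y⟫ * ⟪ξ⟫) ^ m := by
        gcongr; exact one_add_norm_midpoint_le x y ξ
    _ = _ := by rw [mul_pow, mul_pow]; ring

lemma continuous_wInt_integrand (hp : C^∞ p) (ħ : ℝ) (x : E d) {v : E d → ℂ}
    (hv : Continuous v) : Continuous (fun q : E d × E d =>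
      osc ħ (inner ℝ (x - q.2) q.1) * p (½ • (x + q.2), q.1) * v q.2) := by
  have := hp.continuous
  fun_prop

lemma norm_wInt_integrand_le {C : ℝ} (hC0 : 0 ≤ C) (hC : ∀ z, ‖p z‖ ≤ C * ⟪z⟫ ^ m)
    (ħ : ℝ) (v : E d → ℂ) (x ξ y : E d) :
    ‖osc ħ (inner ℝ (x - y) ξ) * p (½ • (x + y), ξ) * v y‖
      ≤ C * ⟪x⟫ ^ m * ⟪ξ⟫ ^ m * (⟪y⟫ ^ m * ‖v y‖) := by
  rw [norm_mul, norm_mul, norm_osc, one_mul, ← mul_assoc]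
  gcongr
  exact norm_symbol_midpoint_le hC0 hC x y ξ

lemma integrable_wInt (hp : SymBound m p) (ħ : ℝ) (v : 𝓢(E d, ℂ)) (x ξ : E d) :
    Integrable (fun y => osc ħ (inner ℝ (x - y) ξ) * p (½ • (x + y), ξ) * v y) := by
  obtain ⟨C, hC0, hC⟩ := hp.norm_le
  refine ((integrable_weight_mul v m).const_mul (C * ⟪x⟫ ^ m * ⟪ξ⟫ ^ m)).mono' ?_
    (.of_forall fun y => norm_wInt_integrand_le hC0 hC ħ v x ξ y)
  have h1 := continuous_wInt_integrand hp.1 ħ x v.continuous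
  have h2 : Continuous (fun y : E d => (ξ, y)) := Continuous.prodMk_right ξ
  have h3 := Continuous.comp' h1 h2
  exact h3.aestronglyMeasurable

lemma norm_wInt_le {C : ℝ} (hC0 : 0 ≤ C) (hC : ∀ z, ‖p z‖ ≤ C * ⟪z⟫ ^ m) (ħ : ℝ)
    (v : 𝓢(E d, ℂ)) (x ξ : E d) : ‖wInt ħ p v x ξ‖
      ≤ C * ⟪x⟫ ^ m * ⟪ξ⟫ ^ m * ∫ y, ⟪y⟫ ^ m * ‖v y‖ := by
  rw [← integral_const_mul]
  exact norm_integral_le_of_norm_le ((integrable_weight_mul v m).const_mul _)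
    (.of_forall fun y => norm_wInt_integrand_le hC0 hC ħ v x ξ y)

/-- The derivative of the inner integral with respect to the frequency. -/
lemma hasFDerivAt_wInt (hp : SymBound m p) {ħ : ℝ} (v : 𝓢(E d, ℂ)) (x ξ : E d) :
    DifferentiableAt ℝ (wInt ħ p v x) ξ ∧ ∀ (j : Fin d) (w : 𝓢(E d, ℂ)),
      (∀ y, w y = (y j : ℂ) * v y) →
      fderiv ℝ (wInt ħ p v x) ξ (single j 1) = I / ħ * ((x j : ℂ) * wInt ħ p v x ξ - wInt ħ p w x ξ)
          + wInt ħ (fun z => fderiv ℝ p z (0, single j 1)) v x ξ := by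
  obtain ⟨C, hC0, hC⟩ := hp.norm_le
  obtain ⟨D, hD0, hD⟩ := hp.2 1
  have hps : C^∞ p := hp.1
  let H' : E d → E d → (E d →L[ℝ] ℂ) := fun ξ y =>
    (osc ħ (inner ℝ (x - y) ξ) * v y) • ((p (½ • (x + y), ξ) * (I / ħ)) •
          (Complex.ofRealCLM.comp (innerSL ℝ (x - y)))
        + (fderiv ℝ p (½ • (x + y), ξ)).comp (inr ℝ (E d) (E d)))
  have hd : ∀ ξ y, HasFDerivAt (fun ξ =>
      osc ħ (inner ℝ (x - y) ξ) * p (½ • (x + y), ξ) * v y) (H' ξ y) ξ := by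
    intro ξ y
    have h1 : HasFDerivAt (fun ξ => osc ħ (inner ℝ (x - y) ξ))
        ((I / ħ * osc ħ (inner ℝ (x - y) ξ)) • (Complex.ofRealCLM.comp (innerSL ℝ (x - y)))) ξ := by
      have := (hasDerivAt_osc ħ (inner ℝ (x - y) ξ)).hasFDerivAt.comp ξ
        (innerSL ℝ (x - y)).hasFDerivAt
      refine this.congr_fderiv ?_
      ext t
      simp
      ring
    have h2 : HasFDerivAt (fun ξ => p (½ • (x + y), ξ))
        ((fderiv ℝ p (½ • (x + y), ξ)).comp (inr ℝ (E d) (E d))) ξ :=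
      hasFDerivAt_right hps _ ξ
    refine ((h1.mul h2).mul_const (v y)).congr_fderiv ?_
    ext t
    simp [H']
    ring
  have hHc : Continuous (fun q : E d × E d => H' q.1 q.2) := by
    have c1 := hps.continuous
    have c2 : Continuous (fderiv ℝ p) := hps.continuous_fderiv (by simp)
    have c3 := v.continuous
    have c4 : Continuous (fun q : E d × E d => innerSL ℝ (x - q.2)) :=
      (innerSL ℝ).continuous.comp (by fun_prop)
    have c5 : Continuous (fun q : E d × E d => (½ • (x + q.2), q.1)) := by fun_prop
    have c6 : Continuous (fun q : E d × E d => osc ħ (inner ℝ (x - q.2) q.1) * v q.2) := by fun_prop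
    have c7 : Continuous (fun q : E d × E d =>
        p (½ • (x + q.2), q.1) * (I / ħ)) := by fun_prop
    exact c6.smul ((c7.smul (continuous_const.clm_comp c4)).add
      ((Continuous.comp' c2 c5).clm_comp continuous_const))
  let bound : E d → ℝ := fun y =>
    ⟪x⟫ ^ m * (2 + ‖ξ‖) ^ m * (C * |ħ|⁻¹ * ⟪x⟫ + D) * (⟪y⟫ ^ (m + 1) * ‖v y‖)
  have hbound : ∀ y, ∀ ξ' ∈ ball ξ 1, ‖H' ξ' y‖ ≤ bound y := by
    intro y ξ' hξ'
    have hn : 1 + ‖ξ'‖ ≤ 2 + ‖ξ‖ := by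
      have h1 := norm_sub_norm_le ξ' ξ
      rw [mem_ball_iff_norm] at hξ'
      linarith
    have b1 : ‖p (½ • (x + y), ξ')‖ ≤ C * (⟪x⟫ ^ m * (2 + ‖ξ‖) ^ m * ⟪y⟫ ^ m) := by
      refine (norm_symbol_midpoint_le hC0 hC x y ξ').trans ?_
      rw [mul_assoc, mul_assoc, mul_assoc]
      gcongr
    have b2 : ‖fderiv ℝ p (½ • (x + y), ξ')‖ ≤ D * (⟪x⟫ ^ m * (2 + ‖ξ‖) ^ m * ⟪y⟫ ^ m) := by
      have h1 := hD (½ • (x + y), ξ')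
      rw [norm_iteratedFDeriv_one] at h1
      refine h1.trans ?_
      gcongr
      calc ⟪(½ • (x + y), ξ')⟫ ^ m
          ≤ (⟪x⟫ * ⟪y⟫ * ⟪ξ'⟫) ^ m := by
            gcongr; exact one_add_norm_midpoint_le x y ξ'
        _ ≤ (⟪x⟫ * ⟪y⟫ * (2 + ‖ξ‖)) ^ m := by gcongr
        _ = _ := by rw [mul_pow, mul_pow]; ring
    have b3 : ‖x - y‖ ≤ ⟪x⟫ * ⟪y⟫ := by
      have := norm_sub_le x y
      nlinarith [norm_nonneg x, norm_nonneg y, mul_nonneg (norm_nonneg x) (norm_nonneg y)]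
    refine ContinuousLinearMap.opNorm_le_bound _ (by positivity) fun t => ?_
    have e1 : H' ξ' y t = (osc ħ (inner ℝ (x - y) ξ') * v y) *
        (p (½ • (x + y), ξ') * (I / ħ) * ((inner ℝ (x - y) t : ℝ) : ℂ)
          + fderiv ℝ p (½ • (x + y), ξ') (0, t)) := by
      simp only [H', _root_.smul_apply, _root_.add_apply, ContinuousLinearMap.comp_apply,
        smul_eq_mul, innerSL_apply_apply, Complex.ofRealCLM_apply, ContinuousLinearMap.inr_apply]
    have b4 : |inner ℝ (x - y) t| ≤ ⟪x⟫ * ⟪y⟫ * ‖t‖ :=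
      (abs_real_inner_le_norm _ _).trans (by gcongr)
    have b5 : ‖fderiv ℝ p (½ • (x + y), ξ') (0, t)‖
        ≤ D * (⟪x⟫ ^ m * (2 + ‖ξ‖) ^ m * ⟪y⟫ ^ m) * ‖t‖ := by
      refine (ContinuousLinearMap.le_opNorm _ _).trans ?_
      have : ‖((0 : E d), t)‖ = ‖t‖ := by simp [Prod.norm_def]
      rw [this]
      gcongr
    rw [e1, norm_mul, norm_mul, norm_osc, one_mul]
    refine (mul_le_mul_of_nonneg_left (norm_add_le _ _) (norm_nonneg _)).trans ?_
    rw [norm_mul, norm_mul, norm_div, norm_I, norm_real, norm_real,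
      Real.norm_eq_abs, Real.norm_eq_abs, one_div |ħ|]
    calc ‖v y‖ * (‖p (½ • (x + y), ξ')‖ * |ħ|⁻¹ * |inner ℝ (x - y) t|
          + ‖fderiv ℝ p (½ • (x + y), ξ') (0, t)‖)
        ≤ ‖v y‖ * (C * (⟪x⟫ ^ m * (2 + ‖ξ‖) ^ m * ⟪y⟫ ^ m) * |ħ|⁻¹ * (⟪x⟫ * ⟪y⟫ * ‖t‖)
          + D * (⟪x⟫ ^ m * (2 + ‖ξ‖) ^ m * ⟪y⟫ ^ m) * ‖t‖) := by gcongr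
      _ ≤ ‖v y‖ * (C * (⟪x⟫ ^ m * (2 + ‖ξ‖) ^ m * ⟪y⟫ ^ m) * |ħ|⁻¹
            * (⟪x⟫ * ⟪y⟫ * ‖t‖)
          + D * (⟪x⟫ ^ m * (2 + ‖ξ‖) ^ m * ⟪y⟫ ^ m) * (⟪y⟫ * ‖t‖)) := by
        gcongr
        exact le_mul_of_one_le_left (norm_nonneg t) (by linarith [norm_nonneg y])
      _ = bound y * ‖t‖ := by simp only [bound]; ring
  have hbi : Integrable bound := (integrable_weight_mul v (m + 1)).const_mul _
  have hξ : Continuous (fun y : E d => (ξ, y)) := Continuous.prodMk_right ξ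
  have hmain : HasFDerivAt (wInt ħ p v x) (∫ y, H' ξ y) ξ := by
    refine hasFDerivAt_integral_of_dominated_of_fderiv_le (s := ball ξ 1)
      (F := fun ξ y => osc ħ (inner ℝ (x - y) ξ) * p (½ • (x + y), ξ) * v y)
      (F' := H') (bound := bound) (ball_mem_nhds ξ one_pos) ?_ ?_ ?_ ?_ hbi ?_
    · exact .of_forall fun ξ' => (integrable_wInt hp ħ v x ξ').aestronglyMeasurable
    · exact integrable_wInt hp ħ v x ξ
    · exact (Continuous.comp' hHc hξ).aestronglyMeasurable
    · exact .of_forall hbound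
    · exact .of_forall fun y ξ' _ => hd ξ' y
  refine ⟨hmain.differentiableAt, fun j w hw => ?_⟩
  have hHi : Integrable (fun y => H' ξ y) :=
    hbi.mono' (Continuous.comp' hHc hξ).aestronglyMeasurable
      (.of_forall fun y => hbound y ξ (mem_ball_self one_pos))
  rw [hmain.fderiv, ContinuousLinearMap.integral_apply hHi]
  have i1 := integrable_wInt hp ħ v x ξ
  have i2 := integrable_wInt hp ħ w x ξ
  have i3 := integrable_wInt (hp.fderiv_apply (0, single j 1)) ħ v x ξ
  have i4 : Integrable (fun y => (x j : ℂ) * (osc ħ (inner ℝ (x - y) ξ) * p (½ • (x + y), ξ) * v y)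
      - osc ħ (inner ℝ (x - y) ξ) * p (½ • (x + y), ξ) * w y) := (i1.const_mul _).sub i2
  unfold wInt
  rw [← integral_const_mul, ← integral_sub (i1.const_mul _) i2, ← integral_const_mul,
    ← integral_add (i4.const_mul _) i3]
  congr 1
  funext y
  have e2 : inner ℝ (x - y) (single j (1 : ℝ)) = x j - y j := by
    rw [EuclideanSpace.inner_single_right]; simp
  simp only [H', hw]
  simp only [_root_.smul_apply, _root_.add_apply, ContinuousLinearMap.comp_apply, smul_eq_mul,
    innerSL_apply_apply, e2, Complex.ofRealCLM_apply, ContinuousLinearMap.inr_apply]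
  push_cast
  ring

end Inner

end

section

/-! ### High frequencies are negligible -/

section HighFrequency

variable {d : ℕ}

lemma planck_le {ħ : ℝ} (hħ : 0 < ħ) : ‖planck d ħ‖ * ħ ^ d ≤ 1 := by
  rw [norm_planck hħ, mul_pow, mul_inv, mul_assoc, inv_mul_cancel₀ (by positivity), mul_one]
  exact inv_le_one_of_one_le₀ (one_le_pow₀ (by linarith [Real.pi_gt_three]))

lemma wInt_ibp {m : ℕ} {p : Phase d → ℂ} (hp : SymBound m p) {ħ : ℝ} (v w : 𝓢(E d, ℂ))
    (e : E d) (hw : ∀ y, w y = fderiv ℝ v y e) (x ξ : E d) :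
    I / ħ * (inner ℝ e ξ : ℝ) * wInt ħ p v x ξ
      = 1 / 2 * wInt ħ (fun z => fderiv ℝ p z (e, 0)) v x ξ + wInt ħ p w x ξ := by
  have i1 := integrable_wInt hp ħ v x ξ
  have i2 := integrable_wInt (hp.fderiv_apply (e, 0)) ħ v x ξ
  have i3 := integrable_wInt hp ħ w x ξ
  have hps : C^∞ p := hp.1
  have d1 : ∀ y, HasFDerivAt (fun y => (inner ℝ (x - y) ξ : ℝ)) (-(innerSL ℝ ξ)) y := by
    intro y
    have h1 := ((innerSL ℝ ξ).hasFDerivAt (x := x - y)).comp y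
      ((hasFDerivAt_id (𝕜 := ℝ) y).const_sub x)
    refine (h1.congr_of_eventuallyEq (.of_forall fun t => ?_)).congr_fderiv ?_
    · simp [real_inner_comm]
    · ext t; simp
  have d2 : ∀ y, HasFDerivAt (fun y => (½ • (x + y), ξ)) ((inl ℝ (E d) (E d)).comp
        (½ • ContinuousLinearMap.id ℝ (E d))) y := by
    intro y
    have h1 := (((hasFDerivAt_id (𝕜 := ℝ) y).const_add x).const_smul ½).prodMk
      (hasFDerivAt_const ξ y)
    refine h1.congr_fderiv ?_
    ext t <;> simp
  have d3 : ∀ y, HasFDerivAt (fun y =>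
      osc ħ (inner ℝ (x - y) ξ) * p (½ • (x + y), ξ) * v y) _ y := fun y =>
    ((((hasDerivAt_osc ħ (inner ℝ (x - y) ξ)).hasFDerivAt.comp y (d1 y)).mul
      ((hps.differentiable (by simp) _).hasFDerivAt.comp y (d2 y))).mul v.differentiableAt.hasFDerivAt)
  have e1 : ∀ y, fderiv ℝ (fun y =>
      osc ħ (inner ℝ (x - y) ξ) * p (½ • (x + y), ξ) * v y) y e
      = (1 / 2 * (osc ħ (inner ℝ (x - y) ξ) * fderiv ℝ p (½ • (x + y), ξ) (e, 0) * v y)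
        + osc ħ (inner ℝ (x - y) ξ) * p (½ • (x + y), ξ) * w y)
        - I / ħ * (inner ℝ e ξ : ℝ) * (osc ħ (inner ℝ (x - y) ξ) * p (½ • (x + y), ξ) * v y) := by
    intro y
    rw [(d3 y).fderiv, hw]
    simp only [Pi.mul_apply, real_inner_comm ξ e, _root_.smul_apply, _root_.add_apply, ContinuousLinearMap.comp_apply, smul_eq_mul,
      innerSL_apply_apply, ContinuousLinearMap.inl_apply, _root_.neg_apply,
      ContinuousLinearMap.id_apply, Function.comp_apply, ContinuousLinearMap.toSpanSingleton_apply,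
      map_smul, Complex.real_smul]
    push_cast
    ring
  have i4 : Integrable (fun y => 1 / 2 * (osc ħ (inner ℝ (x - y) ξ)
      * fderiv ℝ p (½ • (x + y), ξ) (e, 0) * v y)
        + osc ħ (inner ℝ (x - y) ξ) * p (½ • (x + y), ξ) * w y) :=
    (i2.const_mul _).add i3
  have i5 : Integrable (fun y => I / ħ * (inner ℝ e ξ : ℝ)
          * (osc ħ (inner ℝ (x - y) ξ) * p (½ • (x + y), ξ) * v y)) := i1.const_mul _
  have h := integral_fderiv_apply_eq_zero (μ := volume) (F := fun y =>
    osc ħ (inner ℝ (x - y) ξ) * p (½ • (x + y), ξ) * v y)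
    (fun y => (d3 y).differentiableAt) e i1 (by simp only [e1]; exact i4.sub i5)
  simp only [e1] at h
  rw [integral_sub i4 i5, integral_add (i2.const_mul _) i3, integral_const_mul, integral_const_mul,
    sub_eq_zero] at h
  exact h.symm

/-! Semiclassical bounds for functions of the frequency. -/

/-- `ħ^j ‖D^j F‖ ≤ B` for `j ≤ k`. -/
def FreqBound (ħ : ℝ) (k : ℕ) (B : ℝ) (F : E d → ℂ) : Prop :=
  ∀ j ≤ k, ∀ η, ħ ^ j * ‖iteratedFDeriv ℝ j F η‖ ≤ B

/-- Smooth functions supported in the ball of radius `R`. -/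
def FreqSupp (R : ℝ) (F : E d → ℂ) : Prop := C^∞ F ∧ ∀ η, R < ‖η‖ → F η = 0

lemma FreqSupp.hasCompactSupport {R : ℝ} {F : E d → ℂ} (hF : FreqSupp R F) : HasCompactSupport F :=
  .intro (isCompact_closedBall 0 R) fun η hη => hF.2 η (by simpa using hη)

lemma FreqSupp.fderiv_apply {R : ℝ} {F : E d → ℂ} (hF : FreqSupp R F) (e : E d) :
    FreqSupp R (fun η => fderiv ℝ F η e) := by
  refine ⟨smooth_dir hF.1 e, fun η hη => ?_⟩
  have : F =ᶠ[𝓝 η] fun _ => 0 := by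
    filter_upwards [(isOpen_lt continuous_const continuous_norm).mem_nhds hη] with t ht
    exact hF.2 t ht
  simp [this.fderiv_eq]

lemma FreqSupp.mul {R : ℝ} {F a : E d → ℂ} (hF : FreqSupp R F) (ha : C^∞ a) :
    FreqSupp R (fun η => a η * F η) :=
  ⟨ha.mul hF.1, fun η hη => by simp [hF.2 η hη]⟩

lemma FreqBound.mul {ħ : ℝ} (hħ : 0 < ħ) (hħ1 : ħ ≤ 1) {k : ℕ} {A B : ℝ} {F a : E d → ℂ}
    (hF : C^∞ F) (ha : C^∞ a) (hB : FreqBound ħ k B F)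
    (hA : ∀ j ≤ k, ∀ η, ‖iteratedFDeriv ℝ j a η‖ ≤ A) :
    FreqBound ħ k (2 ^ k * A * B) (fun η => a η * F η) := by
  intro j hj η
  have hA0 : 0 ≤ A := (norm_nonneg _).trans (hA 0 (Nat.zero_le _) η)
  have hB0 : 0 ≤ B := (by positivity : (0 : ℝ) ≤ ħ ^ 0 * ‖iteratedFDeriv ℝ 0 F η‖).trans
    (hB 0 (Nat.zero_le _) η)
  calc ħ ^ j * ‖iteratedFDeriv ℝ j (fun η => a η * F η) η‖
      ≤ ħ ^ j * ∑ i ∈ Finset.range (j + 1), (j.choose i : ℝ) * ‖iteratedFDeriv ℝ i a η‖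
          * ‖iteratedFDeriv ℝ (j - i) F η‖ := by
        gcongr
        exact norm_iteratedFDeriv_mul_le ha hF η (n := j) (by exact_mod_cast le_top)
    _ ≤ ∑ i ∈ Finset.range (j + 1), (j.choose i : ℝ) * (A * B) := by
        rw [mul_sum]
        refine sum_le_sum fun i hi => ?_
        have hi' : i ≤ j := Nat.lt_succ_iff.1 (Finset.mem_range.1 hi)
        have h1 : ħ ^ j ≤ ħ ^ (j - i) := pow_le_pow_of_le_one hħ.le hħ1 (Nat.sub_le _ _)
        calc ħ ^ j * ((j.choose i : ℝ) * ‖iteratedFDeriv ℝ i a η‖ * ‖iteratedFDeriv ℝ (j - i) F η‖)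
            = (j.choose i : ℝ) * (‖iteratedFDeriv ℝ i a η‖
                * (ħ ^ j * ‖iteratedFDeriv ℝ (j - i) F η‖)) := by ring
          _ ≤ (j.choose i : ℝ) * (A * (ħ ^ (j - i) * ‖iteratedFDeriv ℝ (j - i) F η‖)) := by
            gcongr; exact hA i (hi'.trans hj) η
          _ ≤ _ := by gcongr; exact hB _ ((Nat.sub_le _ _).trans hj) η
    _ = 2 ^ j * (A * B) := by
        rw [← sum_mul, ← Nat.cast_sum, Nat.sum_range_choose]; push_cast; ring
    _ ≤ 2 ^ k * (A * B) := by gcongr; norm_num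
    _ = _ := by ring

lemma FreqBound.mono {ħ : ℝ} {k l : ℕ} {B : ℝ} {F : E d → ℂ} (h : FreqBound ħ k B F)
    (hl : l ≤ k) : FreqBound ħ l B F := fun j hj => h j (hj.trans hl)

lemma FreqBound.fderiv_apply {ħ : ℝ} (hħ : 0 < ħ) {k : ℕ} {B : ℝ} {F : E d → ℂ}
    (hF : C^∞ F) (h : FreqBound ħ (k + 1) B F) (i : Fin d) :
    FreqBound ħ k B (fun η => I * ħ * fderiv ℝ F η (single i 1)) := by
  intro j hj η
  have h1 := norm_iteratedFDeriv_dir_le hF (single i (1 : ℝ)) j η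
  have h2 : iteratedFDeriv ℝ j (fun η => I * ħ * fderiv ℝ F η (single i 1)) η
      = (I * ħ) • iteratedFDeriv ℝ j (fun η => fderiv ℝ F η (single i 1)) η :=
    iteratedFDeriv_const_smul_apply (a := I * (ħ : ℂ))
      ((smooth_dir hF _).of_le (by exact_mod_cast le_top)).contDiffAt
  rw [PiLp.norm_single, norm_one, one_mul] at h1
  rw [h2, norm_smul, norm_mul, norm_I, one_mul, norm_real, norm_of_nonneg hħ.le]
  calc ħ ^ j * (ħ * _) ≤ ħ ^ j * (ħ * ‖iteratedFDeriv ℝ (j + 1) F η‖) := by gcongr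
    _ = ħ ^ (j + 1) * ‖iteratedFDeriv ℝ (j + 1) F η‖ := by ring
    _ ≤ B := h _ (by omega) η

lemma exists_pow_mul_invFourierH_le {R : ℝ} (n : ℕ) : ∃ C, 0 ≤ C ∧ ∀ ħ, 0 < ħ →
    ∀ (F : E d → ℂ) (B : ℝ), FreqSupp R F → FreqBound ħ n B F → ∀ y,
      ⟪y⟫ ^ n * ‖invFourierH ħ F y‖ ≤ C * ‖planck d ħ‖ * B := by
  set V := volume.real (closedBall (0 : E d) R)
  refine ⟨2 ^ n * (V + V), by positivity, fun ħ hħ F B hF hB y => ?_⟩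
  have key : ∀ k ≤ n, ‖y‖ ^ k * ‖∫ η, osc ħ (inner ℝ y η) * F η‖ ≤ B * V := by
    intro k hk
    have h1 := norm_pow_mul_integral_osc_le (ρ := R) (B := B / ħ ^ k) k hF.1 hF.2 (fun t => by
      rw [le_div_iff₀ (by positivity), mul_comm]; exact hB k hk t) hħ y
    simp only [real_inner_comm y] at h1
    calc _ ≤ ħ ^ k * (B / ħ ^ k * V) := h1
      _ = _ := by field_simp
  have k0 := key 0 (Nat.zero_le _)
  have kn := key n le_rfl
  rw [pow_zero, one_mul] at k0
  unfold invFourierH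
  rw [norm_mul]
  set J := ‖∫ η, osc ħ (inner ℝ y η) * F η‖
  have hJ : 0 ≤ J := norm_nonneg _
  have h2 : ⟪y⟫ ^ n * J ≤ 2 ^ n * (B * V + B * V) := by
    rcases le_total ‖y‖ 1 with h | h
    · calc ⟪y⟫ ^ n * J ≤ 2 ^ n * (B * V) := by gcongr; linarith
        _ ≤ _ := by gcongr; linarith
    · calc ⟪y⟫ ^ n * J ≤ (2 * ‖y‖) ^ n * J := by gcongr; linarith
        _ = 2 ^ n * (‖y‖ ^ n * J) := by rw [mul_pow]; ring
        _ ≤ _ := by gcongr; linarith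
  calc _ = ‖planck d ħ‖ * (⟪y⟫ ^ n * J) := by ring
    _ ≤ ‖planck d ħ‖ * (2 ^ n * (B * V + B * V)) := by gcongr
    _ = _ := by ring

lemma fderiv_invFourierH {F : E d → ℂ} (hF : C^∞ F) (hc : HasCompactSupport F) {ħ : ℝ}
    (y e : E d) : fderiv ℝ (invFourierH ħ F) y e
      = I / ħ * invFourierH ħ (fun η => ((inner ℝ e η : ℝ) : ℂ) * F η) y := by
  have hH : C^∞ (fun q : E d × E d => osc ħ (inner ℝ q.1 q.2) * F q.2) :=
    ((contDiff_osc ħ).comp (contDiff_fst.inner ℝ contDiff_snd)).mul (hF.comp contDiff_snd)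
  have hs : ∀ z₀ : E d, ∃ k : Set (E d), IsCompact k ∧ ∀ z ∈ ball z₀ 1, ∀ t ∉ k,
      (fun q : E d × E d => osc ħ (inner ℝ q.1 q.2) * F q.2) (z, t) = 0 := fun _ =>
    ⟨tsupport F, hc, fun z _ t ht => by simp [image_eq_zero_of_notMem_tsupport ht]⟩
  have h1 := hasFDerivAt_integral (μ := volume) hH hs y
  have h2 : fderiv ℝ (invFourierH ħ F) y = _ := (h1.1.const_mul (planck d ħ)).fderiv
  rw [h2, _root_.smul_apply, smul_eq_mul, h1.2, invFourierH, mul_left_comm (I / (ħ : ℂ)),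
    ← integral_const_mul (I / (ħ : ℂ))]
  congr 2
  funext η
  rw [← fderiv_left hH]
  have d1 : DifferentiableAt ℝ (fun z : E d => (inner ℝ z η : ℝ)) y :=
    differentiableAt_id.inner ℝ (differentiableAt_const _)
  have d2 : HasFDerivAt (fun z : E d => osc ħ (inner ℝ z η)) _ y :=
    (((contDiff_osc ħ (n := 1)).differentiable (by simp) _).comp y d1).hasFDerivAt
  have h3 : fderiv ℝ (fun z : E d => osc ħ (inner ℝ z η) * F η) y = _ := (d2.mul_const (F η)).fderiv
  rw [h3]
  have h4 := fderiv_osc_comp ħ d1 e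
  simp only [Function.comp_def]
  rw [_root_.smul_apply, h4, fderiv_inner_right_apply, smul_eq_mul]
  ring

lemma coord_mul_invFourierH {F : E d → ℂ} (hF : C^∞ F) (hc : HasCompactSupport F) {ħ : ℝ}
    (hħ : ħ ≠ 0) (y : E d) (j : Fin d) : (y j : ℂ) * invFourierH ħ F y
      = invFourierH ħ (fun η => I * ħ * fderiv ℝ F η (single j 1)) y := by
  have h1 := integral_osc_mul_fderiv (μ := volume) hħ (θ := fun η : E d => (inner ℝ η y : ℝ))
    (hF.of_le (by exact_mod_cast le_top)) hc
    (fun t _ => (contDiff_id.inner ℝ contDiff_const).contDiffAt) (single j 1)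
  have h2 : ∀ η : E d, fderiv ℝ (fun η : E d => (inner ℝ η y : ℝ)) η (single j 1) = y j := by
    intro η
    rw [fderiv_inner_right_apply, EuclideanSpace.inner_single_left]
    simp
  simp only [h2] at h1
  simp only [real_inner_comm y] at h1
  rw [invFourierH_const_mul]
  unfold invFourierH
  rw [mul_left_comm, mul_left_comm _ (planck d ħ), ← h1, ← integral_const_mul]
  congr 2
  funext η
  ring

lemma exists_inv_one_sub_inner {R : ℝ} (hR : 0 < R) : ∃ a : E d × E d → ℂ, C^∞ a ∧
    HasCompactSupport a ∧ ∀ u η, ‖u‖ ≤ 1 / (2 * R) → ‖η‖ ≤ R →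
      (1 - ((inner ℝ u η : ℝ) : ℂ)) * a (u, η) = 1 := by
  let b₁ : ContDiffBump (0 : E d) := ⟨1 / (2 * R), 5 / 4 * (1 / (2 * R)), by positivity, by
    have : 0 < 1 / (2 * R) := by positivity
    linarith⟩
  let b₂ : ContDiffBump (0 : E d) := ⟨R, 5 / 4 * R, hR, by linarith⟩
  let K : Set (E d × E d) := closedBall 0 (5 / 4 * (1 / (2 * R))) ×ˢ closedBall 0 (5 / 4 * R)
  let a : E d × E d → ℝ := fun p => (1 - inner ℝ p.1 p.2)⁻¹ * (b₁ p.1 * b₂ p.2)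
  have hK : IsCompact K := (isCompact_closedBall _ _).prod (isCompact_closedBall _ _)
  have ha0 : ∀ p ∉ K, a p = 0 := by
    intro p hp
    simp only [K, Set.mem_prod, not_and_or, mem_closedBall_zero_iff, not_le] at hp
    rcases hp with hp | hp
    · simp [a, b₁.zero_of_le_dist (x := p.1) (by rw [dist_zero_right]; exact hp.le)]
    · simp [a, b₂.zero_of_le_dist (x := p.2) (by rw [dist_zero_right]; exact hp.le)]
  have hne : ∀ p ∈ K, (1 - inner ℝ p.1 p.2 : ℝ) ≠ 0 := by
    rintro p ⟨h1, h2⟩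
    rw [mem_closedBall_zero_iff] at h1 h2
    have h3 : (inner ℝ p.1 p.2 : ℝ) ≤ 25 / 32 := by
      refine (real_inner_le_norm _ _).trans ?_
      calc ‖p.1‖ * ‖p.2‖ ≤ (5 / 4 * (1 / (2 * R))) * (5 / 4 * R) := by gcongr
        _ = 25 / 32 := by field_simp; norm_num
    exact (by linarith : (0 : ℝ) < 1 - inner ℝ p.1 p.2).ne'
  have has : C^∞ a := contDiff_of_contDiffAt hK.isClosed subset_rfl
    (fun p hp => ((contDiffAt_const.sub (contDiffAt_fst.inner ℝ contDiffAt_snd)).inv (hne p hp)).mul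
      ((b₁.contDiff.comp contDiff_fst).mul (b₂.contDiff.comp contDiff_snd)).contDiffAt) ha0
  refine ⟨fun p => a p, Complex.ofRealCLM.contDiff.comp has,
    .intro hK fun p hp => by simp [ha0 p hp], fun u η hu hη => ?_⟩
  have h1 : b₁ u = 1 := b₁.one_of_mem_closedBall (by rw [mem_closedBall_zero_iff]; exact hu)
  have h2 : b₂ η = 1 := b₂.one_of_mem_closedBall (by rw [mem_closedBall_zero_iff]; exact hη)
  have h3 := hne (u, η) ⟨by
    rw [mem_closedBall_zero_iff]
    have : 0 < 1 / (2 * R) := by positivity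
    linarith, by rw [mem_closedBall_zero_iff]; linarith⟩
  simp only [a, h1, h2, mul_one]
  rw [← Complex.ofReal_one, ← Complex.ofReal_sub, ← Complex.ofReal_mul, mul_inv_cancel₀ h3]

lemma exists_norm_wInt_invFourierH_le {R : ℝ} (hR : 0 < R) (m N : ℕ) : ∃ C, 0 ≤ C ∧
    ∀ p : Phase d → ℂ, SymBound m p →
    ∀ A, 0 ≤ A → (∀ z, ‖iteratedFDeriv ℝ N p z‖ ≤ A * ⟪z⟫ ^ m) →
    ∀ ħ, 0 < ħ → ħ ≤ 1 → ∀ (F : E d → ℂ) (B : ℝ), FreqSupp R F → FreqBound ħ (m + (d + 1)) B F →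
    ∀ x ξ, 2 * R ≤ ‖ξ‖ → ‖wInt ħ p (invFourierH ħ F) x ξ‖
      ≤ C * A * B * ‖planck d ħ‖ * (ħ / ‖ξ‖) ^ N * ⟪x⟫ ^ m * ⟪ξ⟫ ^ m := by
  induction N with
  | zero =>
    obtain ⟨C, hC0, hC⟩ := exists_pow_mul_invFourierH_le (d := d) (R := R) (m + (d + 1))
    set I₀ := ∫ y : E d, (⟪y⟫ ^ (d + 1))⁻¹
    have hI0 : 0 ≤ I₀ := integral_nonneg fun y => by positivity
    refine ⟨C * I₀, by positivity, fun p hp A hA0 hA ħ hħ hħ1 F B hF hB x ξ _ => ?_⟩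
    obtain ⟨v, hv, -⟩ := exists_schwartz hħ hF.1 hF.hasCompactSupport
    rw [← funext hv]
    refine (norm_wInt_le hA0 (fun z => by simpa using hA z) ħ v x ξ).trans ?_
    have h1 : ∫ y, ⟪y⟫ ^ m * ‖v y‖ ≤ (C * ‖planck d ħ‖ * B) * I₀ := by
      rw [← integral_const_mul]
      refine integral_mono (integrable_weight_mul v m)
        ((integrable_inv_pow d).const_mul _) fun y => ?_
      have h2 := hC ħ hħ F B hF hB y
      rw [← hv, pow_add] at h2
      simp only
      rw [← div_eq_mul_inv, le_div_iff₀ (by positivity)]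
      linarith
    calc _ ≤ A * ⟪x⟫ ^ m * ⟪ξ⟫ ^ m * ((C * ‖planck d ħ‖ * B) * I₀) := by gcongr
      _ = _ := by rw [pow_zero]; ring
  | succ N ih =>
    obtain ⟨C, hC0, hC⟩ := ih
    obtain ⟨a, ha, hac, ha1⟩ := exists_inv_one_sub_inner (d := d) hR
    choose M hM0 hM using fun j => exists_deriv_section_le ha hac j
    set M' := ∑ j ∈ Finset.range (m + (d + 1) + 1), M j
    have hM' : ∀ j ≤ m + (d + 1), ∀ u η, ‖iteratedFDeriv ℝ j (fun η => a (u, η)) η‖ ≤ M' :=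
      fun j hj u η => (hM j u η).trans (single_le_sum (fun i _ => hM0 i)
        (Finset.mem_range.2 (by omega)))
    have hM'0 : 0 ≤ M' := sum_nonneg fun i _ => hM0 i
    refine ⟨C * (2 ^ (m + (d + 1)) * M'), by positivity,
      fun p hp A hA0 hA ħ hħ hħ1 F B hF hB x ξ hξ => ?_⟩
    have hξ0 : 0 < ‖ξ‖ := by linarith
    set e := ‖ξ‖⁻¹ • ξ with he
    set u := ‖ξ‖⁻¹ • e with hu
    have hen : ‖e‖ = 1 := by rw [he, norm_smul, norm_inv, norm_norm, inv_mul_cancel₀ hξ0.ne']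
    have hun : ‖u‖ ≤ 1 / (2 * R) := by
      rw [hu, norm_smul, hen, mul_one, norm_inv, norm_norm, one_div]
      exact inv_anti₀ (by positivity) hξ
    have heξ : inner ℝ e ξ = ‖ξ‖ := by
      rw [he, real_inner_smul_left, real_inner_self_eq_norm_sq]; field_simp
    have has : C^∞ (fun η => a (u, η)) :=
      ha.comp (by fun_prop : C^∞ fun η : E d => (u, η))
    set F' : E d → ℂ := fun η => a (u, η) * F η with hF'
    have hF's : FreqSupp R F' := hF.mul has
    have hF'b : FreqBound ħ (m + (d + 1)) (2 ^ (m + (d + 1)) * M' * B) F' :=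
      FreqBound.mul hħ hħ1 hF.1 has hB fun j hj η => hM' j hj u η
    set F'' : E d → ℂ := fun η => ((inner ℝ e η : ℝ) : ℂ) * F' η with hF''
    have hF''s : FreqSupp R F'' := hF's.mul
      (Complex.ofRealCLM.contDiff.comp (contDiff_const.inner ℝ contDiff_id))
    obtain ⟨v, hv, -⟩ := exists_schwartz hħ hF.1 hF.hasCompactSupport
    obtain ⟨v', hv', -⟩ := exists_schwartz hħ hF's.1 hF's.hasCompactSupport
    obtain ⟨v'', hv'', -⟩ := exists_schwartz hħ hF''s.1 hF''s.hasCompactSupport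
    have hFF : ∀ η, F η = F' η + (-(‖ξ‖⁻¹ : ℝ) : ℂ) * F'' η := by
      intro η
      rcases le_or_gt ‖η‖ R with h | h
      · have h1 := ha1 u η hun h
        have h2 : (inner ℝ u η : ℝ) = ‖ξ‖⁻¹ * inner ℝ e η := by rw [hu, real_inner_smul_left]
        rw [h2] at h1
        push_cast at h1
        simp only [hF'', hF']
        push_cast
        linear_combination (-F η) * h1
      · rw [hF.2 η h, hF''s.2 η h, hF's.2 η h]
        simp
    have hvv : ∀ y, v y = v' y + (-(‖ξ‖⁻¹ : ℝ) : ℂ) * v'' y := by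
      intro y
      rw [hv, hv', hv'', ← invFourierH_const_mul, funext hFF]
      exact invFourierH_add (hF's.1.continuous.integrable_of_hasCompactSupport hF's.hasCompactSupport)
        ((hF''s.1.continuous.integrable_of_hasCompactSupport hF''s.hasCompactSupport).const_mul _) y
    have hd : ∀ y, ((I / ħ) • v'') y = fderiv ℝ v' y e := by
      intro y
      rw [funext hv', fderiv_invFourierH hF's.1 hF's.hasCompactSupport]
      simp [hv'', hF'']
    have h1 := wInt_ibp hp (ħ := ħ) v' ((I / ħ) • v'') e hd x ξ
    have i1 := integrable_wInt hp ħ v' x ξ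
    have i2 := integrable_wInt hp ħ v'' x ξ
    have h2 : wInt ħ p v x ξ = wInt ħ p v' x ξ + (-(‖ξ‖⁻¹ : ℝ) : ℂ) * wInt ħ p v'' x ξ := by
      unfold wInt
      rw [← integral_const_mul, ← integral_add i1 (i2.const_mul _)]
      congr 1
      funext y
      rw [hvv]
      ring
    have h3 : wInt ħ p ((I / ħ) • v'' : 𝓢(E d, ℂ)) x ξ = I / ħ * wInt ħ p v'' x ξ := by
      unfold wInt
      rw [← integral_const_mul]
      congr 1
      funext y
      simp only [smul_apply, smul_eq_mul]
      ring
    have hħc : (ħ : ℂ) ≠ 0 := by exact_mod_cast hħ.ne'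
    have hξc : ((‖ξ‖ : ℝ) : ℂ) ≠ 0 := by exact_mod_cast hξ0.ne'
    have h4 : wInt ħ p v x ξ = (-I * (ħ / 2) * (‖ξ‖⁻¹ : ℝ))
        * wInt ħ (fun z => fderiv ℝ p z (e, 0)) v' x ξ := by
      rw [h3, heξ] at h1
      rw [h2]
      have h5 : wInt ħ p v' x ξ = -I * ħ * (‖ξ‖⁻¹ : ℝ) * (I / ħ * (‖ξ‖ : ℝ) * wInt ħ p v' x ξ) := by
        push_cast
        field_simp
        rw [Complex.I_sq]
        ring
      rw [h5, h1]
      push_cast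
      field_simp
      ring_nf
      rw [Complex.I_sq]
      ring
    rw [← funext hv, h4, norm_mul]
    have h5 := hC _ (hp.fderiv_apply (e, 0)) A hA0 (fun z => by
      refine (norm_iteratedFDeriv_dir_le hp.1 (e, 0) N z).trans ?_
      have : ‖((e, 0) : Phase d)‖ = 1 := by simp [Prod.norm_def, hen]
      rw [this, one_mul]
      exact hA z) ħ hħ hħ1 F' _ hF's hF'b x ξ hξ
    rw [← funext hv'] at h5
    have h6 : ‖(-I * (ħ / 2) * (‖ξ‖⁻¹ : ℝ) : ℂ)‖ ≤ ħ / ‖ξ‖ := by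
      rw [norm_mul, norm_mul, norm_neg, norm_I, one_mul, norm_div, norm_real,
        norm_real, norm_of_nonneg hħ.le, norm_inv, norm_norm, div_eq_mul_inv ħ ‖ξ‖]
      gcongr
      norm_num
      linarith
    calc _ ≤ (ħ / ‖ξ‖) * (C * A * (2 ^ (m + (d + 1)) * M' * B) * ‖planck d ħ‖ * (ħ / ‖ξ‖) ^ N
          * ⟪x⟫ ^ m * ⟪ξ⟫ ^ m) := by gcongr
      _ = _ := by ring

end HighFrequency

end

section

section HighFrequencyOp

variable {d : ℕ}

/-- The symbol vanishes for frequencies of norm less than `ρ`. -/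
def VanishesBelow (ρ : ℝ) (p : Phase d → ℂ) : Prop := ∀ z : Phase d, ‖z.2‖ < ρ → p z = 0

lemma VanishesBelow.fderiv_apply {ρ : ℝ} {p : Phase d → ℂ} (hp : VanishesBelow ρ p) (v : Phase d) :
    VanishesBelow ρ (fun z => fderiv ℝ p z v) := by
  intro z hz
  have h1 : p =ᶠ[𝓝 z] fun _ => 0 := by
    filter_upwards [(isOpen_lt (continuous_norm.comp continuous_snd) continuous_const).mem_nhds hz]
      with t ht
    exact hp t ht
  simp [h1.fderiv_eq]

lemma VanishesBelow.wInt_eq_zero {ρ : ℝ} {p : Phase d → ℂ} (hp : VanishesBelow ρ p) (ħ : ℝ)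
    (v : E d → ℂ) (x : E d) {ξ : E d} (hξ : ‖ξ‖ < ρ) : wInt ħ p v x ξ = 0 := by
  unfold wInt
  have h : ∀ y : E d, p (½ • (x + y), ξ) = 0 := fun y => hp _ hξ
  simp only [h, mul_zero, zero_mul, integral_zero]

lemma exists_norm_wInt_highFreq_le {R : ℝ} (hR : 0 < R) {m : ℕ} {p : Phase d → ℂ}
    (hp : SymBound m p) (hv : VanishesBelow (2 * R) p) (N : ℕ) : ∃ C, 0 ≤ C ∧
    ∀ ħ, 0 < ħ → ħ ≤ 1 → ∀ (F : E d → ℂ) (B : ℝ), FreqSupp R F → FreqBound ħ (m + (d + 1)) B F →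
    ∀ x ξ, ‖wInt ħ p (invFourierH ħ F) x ξ‖ ≤ C * B * ħ ^ N * ⟪x⟫ ^ m * (⟪ξ⟫ ^ (d + 1))⁻¹ := by
  let N' := N + d + m + (d + 1)
  obtain ⟨C, hC0, hC⟩ := exists_norm_wInt_invFourierH_le (d := d) hR m N'
  obtain ⟨A, hA0, hA⟩ := hp.2 N'
  let c : ℝ := (1 + 2 * R) / (2 * R)
  have hc : 0 < c := by positivity
  refine ⟨C * A * c ^ N', by positivity, fun ħ hħ hħ1 F B hF hB x ξ => ?_⟩
  have hB0 : 0 ≤ B := (by positivity : (0 : ℝ) ≤ ħ ^ 0 * ‖iteratedFDeriv ℝ 0 F 0‖).trans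
    (hB 0 (Nat.zero_le _) 0)
  rcases lt_or_ge ‖ξ‖ (2 * R) with h | h
  · rw [hv.wInt_eq_zero _ _ _ h, norm_zero]
    positivity
  · have hξ : 0 < ‖ξ‖ := by linarith
    refine (hC p hp A hA0 hA ħ hħ hħ1 F B hF hB x ξ h).trans ?_
    have h1 : ħ / ‖ξ‖ ≤ ħ * (c * ⟪ξ⟫⁻¹) := by
      rw [div_eq_mul_inv]
      gcongr
      rw [← div_eq_mul_inv, le_div_iff₀ (by positivity), ← div_eq_inv_mul, div_le_div_iff₀ hξ (by positivity)]
      linarith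
    have h2 : ‖planck d ħ‖ * ħ ^ d ≤ 1 := planck_le hħ
    have h3 : (⟪ξ⟫⁻¹) ^ N' * ⟪ξ⟫ ^ m ≤ (⟪ξ⟫ ^ (d + 1))⁻¹ := by
      have h4 : (⟪ξ⟫⁻¹) ^ N' = (⟪ξ⟫⁻¹) ^ (N + d) * (⟪ξ⟫ ^ m)⁻¹ * (⟪ξ⟫ ^ (d + 1))⁻¹ := by
        rw [pow_add, pow_add _ (N + d) m, inv_pow _ m, inv_pow _ (d + 1)]
      have h5 : (⟪ξ⟫⁻¹) ^ (N + d) ≤ 1 :=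
        pow_le_one₀ (by positivity) (inv_le_one_of_one_le₀ (by linarith))
      rw [h4]
      calc _ = (⟪ξ⟫⁻¹) ^ (N + d) * (⟪ξ⟫ ^ (d + 1))⁻¹ := by field_simp
        _ ≤ 1 * (⟪ξ⟫ ^ (d + 1))⁻¹ := by gcongr
        _ = _ := one_mul _
    have h6 : ħ ^ N' ≤ ħ ^ d * ħ ^ N := by
      rw [← pow_add]
      exact pow_le_pow_of_le_one hħ.le hħ1 (by omega)
    calc C * A * B * ‖planck d ħ‖ * (ħ / ‖ξ‖) ^ N' * ⟪x⟫ ^ m * ⟪ξ⟫ ^ m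
        ≤ C * A * B * ‖planck d ħ‖ * (ħ * (c * ⟪ξ⟫⁻¹)) ^ N' * ⟪x⟫ ^ m
          * ⟪ξ⟫ ^ m := by gcongr
      _ = C * A * B * (‖planck d ħ‖ * ħ ^ N') * c ^ N' * ⟪x⟫ ^ m
          * ((⟪ξ⟫⁻¹) ^ N' * ⟪ξ⟫ ^ m) := by rw [mul_pow, mul_pow]; ring
      _ ≤ C * A * B * (‖planck d ħ‖ * (ħ ^ d * ħ ^ N)) * c ^ N' * ⟪x⟫ ^ m
          * (⟪ξ⟫ ^ (d + 1))⁻¹ := by gcongr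
      _ = C * A * B * (‖planck d ħ‖ * ħ ^ d) * ħ ^ N * c ^ N' * ⟪x⟫ ^ m
          * (⟪ξ⟫ ^ (d + 1))⁻¹ := by ring
      _ ≤ C * A * B * 1 * ħ ^ N * c ^ N' * ⟪x⟫ ^ m
          * (⟪ξ⟫ ^ (d + 1))⁻¹ := by gcongr
      _ = _ := by ring

lemma continuous_wInt {m : ℕ} {p : Phase d → ℂ} (hp : SymBound m p) (ħ : ℝ) (v : 𝓢(E d, ℂ))
    (x : E d) : Continuous (wInt ħ p v x) :=
  continuous_iff_continuousAt.2 fun ξ => (hasFDerivAt_wInt hp v x ξ).1.continuousAt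

lemma FreqBound.of_hasCompactSupport {R : ℝ} {F : E d → ℂ} (hF : FreqSupp R F) (ħ : ℝ) (k : ℕ) :
    ∃ B, FreqBound ħ k B F := by
  choose M hM0 hM using fun j => exists_bound hF.1 hF.hasCompactSupport j
  refine ⟨∑ j ∈ Finset.range (k + 1), |ħ ^ j| * M j, fun j hj η => ?_⟩
  calc ħ ^ j * ‖iteratedFDeriv ℝ j F η‖ ≤ |ħ ^ j| * M j := by
        gcongr
        · exact le_abs_self _
        · exact hM j η
    _ ≤ _ := single_le_sum (f := fun j => |ħ ^ j| * M j)
        (fun i _ => mul_nonneg (abs_nonneg _) (hM0 i)) (Finset.mem_range.2 (by omega))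

lemma integrable_wInt_highFreq {R : ℝ} (hR : 0 < R) {m : ℕ} {p : Phase d → ℂ}
    (hp : SymBound m p) (hv : VanishesBelow (2 * R) p) {ħ : ℝ} (hħ : 0 < ħ) (hħ1 : ħ ≤ 1)
    {F : E d → ℂ} (hF : FreqSupp R F) (x : E d) :
    Integrable (wInt ħ p (invFourierH ħ F) x) := by
  obtain ⟨C, hC0, hC⟩ := exists_norm_wInt_highFreq_le hR hp hv 0
  obtain ⟨B, hB⟩ := FreqBound.of_hasCompactSupport hF ħ (m + (d + 1))
  obtain ⟨v, hv', -⟩ := exists_schwartz hħ hF.1 hF.hasCompactSupport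
  refine ((integrable_inv_pow d).const_mul (C * B * ħ ^ 0 * ⟪x⟫ ^ m)).mono' ?_
    (.of_forall fun ξ => hC ħ hħ hħ1 F B hF hB x ξ)
  rw [← funext hv']
  exact (continuous_wInt hp ħ v x).aestronglyMeasurable

lemma FreqSupp.coord {R : ℝ} {F : E d → ℂ} (hF : FreqSupp R F) (ħ : ℝ) (j : Fin d) :
    FreqSupp R (fun η => I * ħ * fderiv ℝ F η (single j 1)) :=
  (hF.fderiv_apply _).mul (a := fun _ => I * ħ) contDiff_const

lemma coord_mul_weylOp_highFreq {R : ℝ} (hR : 0 < R) {m : ℕ} {p : Phase d → ℂ}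
    (hp : SymBound m p) (hv : VanishesBelow (2 * R) p) {ħ : ℝ} (hħ : 0 < ħ) (hħ1 : ħ ≤ 1)
    {F : E d → ℂ} (hF : FreqSupp R F) (x : E d) (j : Fin d) :
    (x j : ℂ) * weylOp ħ p (invFourierH ħ F) x = weylOp ħ p (invFourierH ħ
          (fun η => I * ħ * fderiv ℝ F η (single j 1))) x
        + I * ħ * weylOp ħ (fun z => fderiv ℝ p z (0, single j 1)) (invFourierH ħ F) x := by
  have hG := hF.coord ħ j
  obtain ⟨v, hv', -⟩ := exists_schwartz hħ hF.1 hF.hasCompactSupport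
  obtain ⟨w, hw', -⟩ := exists_schwartz hħ hG.1 hG.hasCompactSupport
  have hw : ∀ y, w y = (y j : ℂ) * v y := fun y => by
    rw [hw', hv', coord_mul_invFourierH hF.1 hF.hasCompactSupport hħ.ne']
  have i1 := integrable_wInt_highFreq hR hp hv hħ hħ1 hF x
  have i2 := integrable_wInt_highFreq hR hp hv hħ hħ1 hG x
  have i3 := integrable_wInt_highFreq hR (hp.fderiv_apply (0, single j 1))
    (hv.fderiv_apply _) hħ hħ1 hF x
  rw [weylOp_eq_wInt, weylOp_eq_wInt, weylOp_eq_wInt]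
  rw [← funext hv'] at i1 i3 ⊢
  rw [← funext hw'] at i2 ⊢
  have hd := fun ξ => hasFDerivAt_wInt hp (ħ := ħ) v x ξ
  have i4 : Integrable (fun ξ => (x j : ℂ) * wInt ħ p v x ξ - wInt ħ p w x ξ) :=
    (i1.const_mul _).sub i2
  have i5 : Integrable (fun ξ => I / ħ * ((x j : ℂ) * wInt ħ p v x ξ - wInt ħ p w x ξ)) :=
    i4.const_mul _
  have h1 := integral_fderiv_apply_eq_zero (μ := volume) (F := wInt ħ p v x)
    (fun ξ => (hd ξ).1) (single j 1) i1 (by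
      simp only [fun ξ => (hd ξ).2 j w hw]
      exact i5.add i3)
  simp only [fun ξ => (hd ξ).2 j w hw] at h1
  rw [integral_add i5 i3, integral_const_mul, integral_sub (i1.const_mul _) i2,
    integral_const_mul] at h1
  have hħc : (ħ : ℂ) ≠ 0 := by exact_mod_cast hħ.ne'
  have h2 : ∀ a b c X : ℂ, I / ħ * (X * a - b) + c = 0 → X * a = b + I * ħ * c := by
    intro a b c X h
    field_simp at h
    linear_combination (-I) * h + (X * a - b) * Complex.I_sq
  rw [mul_left_comm, h2 _ _ _ _ h1]
  ring

lemma exists_pow_mul_weylOp_highFreq_le {R : ℝ} (hR : 0 < R) (m n : ℕ) : ∃ k : ℕ,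
    ∀ p : Phase d → ℂ, SymBound m p → VanishesBelow (2 * R) p → ∀ N : ℕ, ∃ C, 0 ≤ C ∧
    ∀ ħ, 0 < ħ → ħ ≤ 1 → ∀ (F : E d → ℂ) (B : ℝ), FreqSupp R F → FreqBound ħ k B F →
    ∀ x, ‖x‖ ^ n * ‖weylOp ħ p (invFourierH ħ F) x‖ ≤ C * B * ħ ^ N * ⟪x⟫ ^ m := by
  induction n with
  | zero =>
    refine ⟨m + (d + 1), fun p hp hv N => ?_⟩
    obtain ⟨C, hC0, hC⟩ := exists_norm_wInt_highFreq_le hR hp hv (d + N)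
    have hI0 : 0 ≤ ∫ ξ : E d, (⟪ξ⟫ ^ (d + 1))⁻¹ := integral_nonneg fun y => by positivity
    refine ⟨C * ∫ ξ : E d, (⟪ξ⟫ ^ (d + 1))⁻¹, by positivity,
      fun ħ hħ hħ1 F B hF hB x => ?_⟩
    have hB0 : 0 ≤ B := (by positivity : (0 : ℝ) ≤ ħ ^ 0 * ‖iteratedFDeriv ℝ 0 F 0‖).trans
      (hB 0 (Nat.zero_le _) 0)
    rw [pow_zero, one_mul, weylOp_eq_wInt, norm_mul]
    have h1 : ‖∫ ξ, wInt ħ p (invFourierH ħ F) x ξ‖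
        ≤ C * B * ħ ^ (d + N) * ⟪x⟫ ^ m * ∫ ξ : E d, (⟪ξ⟫ ^ (d + 1))⁻¹ := by
      rw [← integral_const_mul]
      exact norm_integral_le_of_norm_le ((integrable_inv_pow d).const_mul _)
        (.of_forall fun ξ => hC ħ hħ hħ1 F B hF hB x ξ)
    calc _ ≤ ‖planck d ħ‖ * (C * B * ħ ^ (d + N) * ⟪x⟫ ^ m
          * ∫ ξ : E d, (⟪ξ⟫ ^ (d + 1))⁻¹) := by gcongr
      _ = (‖planck d ħ‖ * ħ ^ d) * (C * (∫ ξ : E d, (⟪ξ⟫ ^ (d + 1))⁻¹) * B * ħ ^ N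
          * ⟪x⟫ ^ m) := by rw [pow_add]; ring
      _ ≤ 1 * (C * (∫ ξ : E d, (⟪ξ⟫ ^ (d + 1))⁻¹) * B * ħ ^ N * ⟪x⟫ ^ m) := by
        gcongr; exact planck_le hħ
      _ = _ := one_mul _
  | succ n ih =>
    obtain ⟨k, hk⟩ := ih
    refine ⟨k + 1, fun p hp hv N => ?_⟩
    obtain ⟨C, hC0, hC⟩ := hk p hp hv N
    choose D hD0 hD using fun j : Fin d => hk _ (hp.fderiv_apply (0, single j 1))
      (hv.fderiv_apply _) N
    refine ⟨∑ j, (C + D j), sum_nonneg fun j _ => add_nonneg hC0 (hD0 j),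
      fun ħ hħ hħ1 F B hF hB x => ?_⟩
    have hB0 : 0 ≤ B := (by positivity : (0 : ℝ) ≤ ħ ^ 0 * ‖iteratedFDeriv ℝ 0 F 0‖).trans
      (hB 0 (Nat.zero_le _) 0)
    have h1 : ∀ j, ‖x‖ ^ n * (|x j| * ‖weylOp ħ p (invFourierH ħ F) x‖)
        ≤ (C + D j) * (B * ħ ^ N * ⟪x⟫ ^ m) := by
      intro j
      have h2 : |x j| * ‖weylOp ħ p (invFourierH ħ F) x‖
          = ‖(x j : ℂ) * weylOp ħ p (invFourierH ħ F) x‖ := by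
        rw [norm_mul, norm_real, Real.norm_eq_abs]
      rw [h2, coord_mul_weylOp_highFreq hR hp hv hħ hħ1 hF]
      have h3 := hC ħ hħ hħ1 _ B (hF.coord ħ j) (hB.fderiv_apply hħ hF.1 j) x
      have h4 := hD j ħ hħ hħ1 F B hF (hB.mono (Nat.le_succ k)) x
      refine (mul_le_mul_of_nonneg_left (norm_add_le _ _) (by positivity)).trans ?_
      rw [mul_add, add_mul]
      refine add_le_add (h3.trans_eq (by ring)) ?_
      rw [norm_mul, norm_mul, norm_I, one_mul, norm_real, norm_of_nonneg hħ.le]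
      calc _ = ħ * (‖x‖ ^ n * ‖weylOp ħ (fun z => fderiv ℝ p z (0, single j 1))
            (invFourierH ħ F) x‖) := by ring
        _ ≤ 1 * (D j * B * ħ ^ N * ⟪x⟫ ^ m) := by gcongr
        _ = _ := by ring
    calc ‖x‖ ^ (n + 1) * ‖weylOp ħ p (invFourierH ħ F) x‖
        = ‖x‖ ^ n * (‖x‖ * ‖weylOp ħ p (invFourierH ħ F) x‖) := by ring
      _ ≤ ‖x‖ ^ n * ((∑ j, |x j|) * ‖weylOp ħ p (invFourierH ħ F) x‖) := by
        gcongr; exact norm_le_sum_abs x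
      _ = ∑ j, ‖x‖ ^ n * (|x j| * ‖weylOp ħ p (invFourierH ħ F) x‖) := by
        rw [sum_mul, mul_sum]
      _ ≤ ∑ j, (C + D j) * (B * ħ ^ N * ⟪x⟫ ^ m) := sum_le_sum fun j _ => h1 j
      _ = _ := by rw [← sum_mul]; ring

lemma exists_weight_mul_weylOp_highFreq_le {R : ℝ} (hR : 0 < R) {m : ℕ}
    {p : Phase d → ℂ} (hp : SymBound m p) (hv : VanishesBelow (2 * R) p) (n N : ℕ) :
    ∃ (k : ℕ) (C : ℝ), 0 ≤ C ∧
    ∀ ħ, 0 < ħ → ħ ≤ 1 → ∀ (F : E d → ℂ) (B : ℝ), FreqSupp R F → FreqBound ħ k B F →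
    ∀ x, ⟪x⟫ ^ n * ‖weylOp ħ p (invFourierH ħ F) x‖ ≤ C * ħ ^ N * B := by
  obtain ⟨k₁, h₁⟩ := exists_pow_mul_weylOp_highFreq_le (d := d) hR m 0
  obtain ⟨k₂, h₂⟩ := exists_pow_mul_weylOp_highFreq_le (d := d) hR m (n + m)
  obtain ⟨C₁, hC₁0, hC₁⟩ := h₁ p hp hv N
  obtain ⟨C₂, hC₂0, hC₂⟩ := h₂ p hp hv N
  refine ⟨max k₁ k₂, 2 ^ (n + m) * (C₁ + C₂), by positivity, fun ħ hħ hħ1 F B hF hB x => ?_⟩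
  have hB0 : 0 ≤ B := (by positivity : (0 : ℝ) ≤ ħ ^ 0 * ‖iteratedFDeriv ℝ 0 F 0‖).trans
    (hB 0 (Nat.zero_le _) 0)
  have e1 := hC₁ ħ hħ hħ1 F B hF (hB.mono (le_max_left _ _)) x
  have e2 := hC₂ ħ hħ hħ1 F B hF (hB.mono (le_max_right _ _)) x
  rw [pow_zero, one_mul] at e1
  have e3 : ⟪x⟫ ^ (n + m) * ‖weylOp ħ p (invFourierH ħ F) x‖
      ≤ 2 ^ (n + m) * (C₁ + C₂) * ħ ^ N * B * ⟪x⟫ ^ m := by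
    rcases le_total ‖x‖ 1 with h | h
    · calc _ ≤ 2 ^ (n + m) * (C₁ * B * ħ ^ N * ⟪x⟫ ^ m) := by
            gcongr; linarith
        _ = 2 ^ (n + m) * C₁ * ħ ^ N * B * ⟪x⟫ ^ m := by ring
        _ ≤ _ := by gcongr; linarith
    · calc _ ≤ (2 * ‖x‖) ^ (n + m) * ‖weylOp ħ p (invFourierH ħ F) x‖ := by
            gcongr; linarith
        _ = 2 ^ (n + m) * (‖x‖ ^ (n + m) * ‖weylOp ħ p (invFourierH ħ F) x‖) := by
            rw [mul_pow]; ring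
        _ ≤ 2 ^ (n + m) * (C₂ * B * ħ ^ N * ⟪x⟫ ^ m) := by gcongr
        _ = 2 ^ (n + m) * C₂ * ħ ^ N * B * ⟪x⟫ ^ m := by ring
        _ ≤ _ := by gcongr; linarith
  rw [pow_add] at e3
  refine le_of_mul_le_mul_right ?_ (by positivity : 0 < ⟪x⟫ ^ m)
  linarith

end HighFrequencyOp

end

section

/-! ### Kernels of Weyl operators with compact frequency support -/

section Kernel

variable {d : ℕ}

lemma one_add_pow_le {t : ℝ} (ht : 0 ≤ t) (n : ℕ) : (1 + t) ^ n ≤ 2 ^ n * (1 + t ^ n) := by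
  have h := add_pow_le zero_le_one ht n
  rw [one_pow] at h
  refine h.trans ?_
  gcongr
  · norm_num
  · exact Nat.sub_le n 1

lemma one_add_norm_le_mul_sub (x y : E d) : 1 + ‖x‖ ≤ ⟪x - y⟫ * ⟪y⟫ := by
  have h : ‖x‖ ≤ ‖x - y‖ + ‖y‖ := by simpa using norm_add_le (x - y) y
  nlinarith [mul_nonneg (norm_nonneg (x - y)) (norm_nonneg y)]

/-- The Schwartz kernel of a Weyl operator, up to the factor `planck d ħ`. -/
noncomputable def wKer (ħ : ℝ) (p : Phase d → ℂ) (x y : E d) : ℂ :=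
  ∫ ξ : E d, osc ħ (inner ℝ (x - y) ξ) * p (½ • (x + y), ξ)

/-- The symbol vanishes for frequencies of norm larger than `ρ`. -/
def VanishesAbove (ρ : ℝ) (p : Phase d → ℂ) : Prop := ∀ z : Phase d, ρ < ‖z.2‖ → p z = 0

lemma VanishesAbove.iteratedFDeriv_eq_zero {ρ : ℝ} {p : Phase d → ℂ} (hp : VanishesAbove ρ p)
    (k : ℕ) {z : Phase d} (hz : ρ < ‖z.2‖) : iteratedFDeriv ℝ k p z = 0 := by
  have h1 : p =ᶠ[𝓝 z] 0 := by
    filter_upwards [(isOpen_lt continuous_const (continuous_norm.comp continuous_snd)).mem_nhds hz]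
      with t ht
    exact hp t ht
  rw [(Filter.EventuallyEq.iteratedFDeriv ℝ h1 k).eq_of_nhds]
  simp

lemma norm_iteratedFDeriv_right_le {p : Phase d → ℂ} (hp : C^∞ p) (k : ℕ) (X ξ : E d) :
    ‖iteratedFDeriv ℝ k (fun ξ => p (X, ξ)) ξ‖ ≤ ‖iteratedFDeriv ℝ k p (X, ξ)‖ := by
  have h := norm_iteratedFDeriv_affine hp (inr ℝ (E d) (E d)) (X, 0) k ξ
  have h1 : ‖inr ℝ (E d) (E d)‖ ≤ 1 :=
    ContinuousLinearMap.opNorm_le_bound _ zero_le_one fun t => by simp [Prod.norm_def]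
  simp only [ContinuousLinearMap.inr_apply, Prod.mk_add_mk, add_zero, zero_add] at h
  exact h.trans (mul_le_of_le_one_right (norm_nonneg _) (pow_le_one₀ (norm_nonneg _) h1))

lemma exists_pow_mul_wKer_le {m : ℕ} {ρ : ℝ} {p : Phase d → ℂ} (hp : SymBound m p)
    (hρ : VanishesAbove ρ p) (N : ℕ) : ∃ C, 0 ≤ C ∧ ∀ ħ, 0 < ħ → ∀ x y : E d,
      ‖x - y‖ ^ N * ‖wKer ħ p x y‖ ≤ C * ħ ^ N * (⟪x⟫ * ⟪y⟫) ^ m := by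
  obtain ⟨A, hA0, hA⟩ := hp.2 N
  refine ⟨A * (1 + |ρ|) ^ m * volume.real (closedBall (0 : E d) ρ), by positivity,
    fun ħ hħ x y => ?_⟩
  obtain ⟨X, hXd⟩ : ∃ X, ½ • (x + y) = X := ⟨_, rfl⟩
  have hz : ∀ t : E d, ρ < ‖t‖ → p (X, t) = 0 := fun t ht => hρ (X, t) ht
  have hX : C^∞ (fun ξ : E d => (X, ξ)) := contDiff_prodMk_right X
  have hs : C^∞ (fun ξ : E d => p (X, ξ)) := ContDiff.fun_comp hp.1 hX
  have h1 := norm_pow_mul_integral_osc_le (ρ := ρ)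
    (B := A * (1 + |ρ|) ^ m * (⟪x⟫ * ⟪y⟫) ^ m) N hs hz (fun t => by
      rcases lt_or_ge ρ ‖t‖ with h | h
      · refine (norm_iteratedFDeriv_right_le hp.1 N X t).trans ?_
        rw [hρ.iteratedFDeriv_eq_zero (z := (X, t)) N h, norm_zero]
        positivity
      · refine ((norm_iteratedFDeriv_right_le hp.1 N X t).trans (hA _)).trans ?_
        rw [mul_assoc, ← mul_pow]
        gcongr
        have := one_add_norm_midpoint_le x y t
        rw [hXd] at this
        refine this.trans ?_
        rw [mul_comm]
        gcongr
        exact h.trans (le_abs_self ρ)) hħ (x - y)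
  simp only [real_inner_comm (x - y)] at h1
  rw [wKer, hXd]
  refine h1.trans_eq ?_
  ring

lemma exists_weight_mul_wKer_le {m : ℕ} {ρ : ℝ} {p : Phase d → ℂ}
    (hp : SymBound m p) (hρ : VanishesAbove ρ p) (N : ℕ) : ∃ C, 0 ≤ C ∧ ∀ ħ, 0 < ħ → ħ ≤ 1 →
      ∀ x y : E d, ⟪x - y⟫ ^ N * ‖wKer ħ p x y‖ ≤ C * (⟪x⟫ * ⟪y⟫) ^ m := by
  obtain ⟨C₁, hC₁0, hC₁⟩ := exists_pow_mul_wKer_le hp hρ 0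
  obtain ⟨C₂, hC₂0, hC₂⟩ := exists_pow_mul_wKer_le hp hρ N
  refine ⟨2 ^ N * (C₁ + C₂), by positivity, fun ħ hħ hħ1 x y => ?_⟩
  have h1 := hC₁ ħ hħ x y
  have h2 := hC₂ ħ hħ x y
  rw [pow_zero, one_mul, pow_zero, mul_one] at h1
  have h3 : ħ ^ N ≤ 1 := pow_le_one₀ hħ.le hħ1
  calc _ ≤ 2 ^ N * (1 + ‖x - y‖ ^ N) * ‖wKer ħ p x y‖ := by
        gcongr; exact one_add_pow_le (norm_nonneg _) N
    _ = 2 ^ N * (‖wKer ħ p x y‖ + ‖x - y‖ ^ N * ‖wKer ħ p x y‖) := by ring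
    _ ≤ 2 ^ N * (C₁ * (⟪x⟫ * ⟪y⟫) ^ m + C₂ * 1 * (⟪x⟫ * ⟪y⟫) ^ m) :=
        mul_le_mul_of_nonneg_left (add_le_add h1 (h2.trans (by gcongr))) (by positivity)
    _ = _ := by ring

lemma weylOp_eq_wKer {m : ℕ} {ρ : ℝ} {p : Phase d → ℂ} (hp : SymBound m p)
    (hρ : VanishesAbove ρ p) (ħ : ℝ) {u : E d → ℂ} (hu : AEStronglyMeasurable u)
    (hi : Integrable (fun y => ⟪y⟫ ^ m * ‖u y‖)) (x : E d) :
    weylOp ħ p u x = planck d ħ * ∫ y, wKer ħ p x y * u y ∧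
      Integrable (fun y => wKer ħ p x y * u y) ∧ Integrable (wInt ħ p u x) := by
  obtain ⟨C, hC0, hC⟩ := hp.norm_le
  have hq : Integrable (fun q : E d × E d => osc ħ (inner ℝ (x - q.2) q.1)
      * p (½ • (x + q.2), q.1) * u q.2) (volume.prod volume) := by
    have h1 : Integrable (fun ξ : E d => (closedBall (0 : E d) ρ).indicator
        (fun _ => C * ⟪x⟫ ^ m * (1 + |ρ|) ^ m) ξ) :=
      (integrable_indicator_iff isClosed_closedBall.measurableSet).2
        (integrableOn_const (isCompact_closedBall _ _).measure_lt_top.ne)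
    refine (h1.mul_prod hi).mono' ?_ (.of_forall fun q => ?_)
    · have h2 := continuous_wInt_integrand hp.1 ħ x (v := fun _ => 1) continuous_const
      simp only [mul_one] at h2
      exact h2.aestronglyMeasurable.mul hu.comp_snd
    · rcases lt_or_ge ρ ‖q.1‖ with h | h
      · rw [hρ (½ • (x + q.2), q.1) h, mul_zero, zero_mul, norm_zero]
        refine mul_nonneg (Set.indicator_nonneg (fun _ _ => by positivity) _) (by positivity)
      · rw [Set.indicator_of_mem (by rwa [mem_closedBall_zero_iff])]
        refine (norm_wInt_integrand_le hC0 hC ħ u x q.1 q.2).trans ?_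
        gcongr
        exact h.trans (le_abs_self ρ)
  have h4 : ∀ y, ∫ ξ, osc ħ (inner ℝ (x - y) ξ) * p (½ • (x + y), ξ) * u y
      = wKer ħ p x y * u y := fun y => by rw [integral_mul_const]; rfl
  refine ⟨?_, ?_, hq.integral_prod_left⟩
  · unfold weylOp
    rw [integral_integral_swap hq]
    simp only [h4]
  · have := hq.integral_prod_right
    simp only [h4] at this
    exact this

end Kernel

section SpatialCutoff

variable {d : ℕ}

lemma exists_weight_mul_weylOp_farSpace_le {m : ℕ} {ρ c : ℝ} (hc : 0 ≤ c)
    {p : Phase d → ℂ} (hp : SymBound m p) (hρ : VanishesAbove ρ p)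
    (h1 : ∀ z : Phase d, ‖z.1‖ < c + 1 → p z = 0) (n N : ℕ) : ∃ (n' N' : ℕ) (C : ℝ), 0 ≤ C ∧
    ∀ ħ, 0 < ħ → ħ ≤ 1 → ∀ (v : 𝓢(E d, ℂ)) (B : ℝ), 0 ≤ B → (∀ y, ħ ^ d * ‖v y‖ ≤ B) →
      (∀ y, c ≤ ‖y‖ → ⟪y⟫ ^ n' * ‖v y‖ ≤ ħ ^ N' * B) → ∀ x,
      ⟪x⟫ ^ n * ‖weylOp ħ p v x‖ ≤ C * ħ ^ N * B := by
  let M := n + m + (N + d + d)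
  obtain ⟨C₁, hC₁0, hC₁⟩ := exists_pow_mul_wKer_le hp hρ M
  obtain ⟨C₂, hC₂0, hC₂⟩ := exists_weight_mul_wKer_le hp hρ (n + m)
  let K₁ := C₁ * ((c + 3) / 2) ^ M * (1 + c) ^ m * (1 + c) ^ (d + 1)
  let I₀ := ∫ y : E d, (⟪y⟫ ^ (d + 1))⁻¹
  have hI0 : 0 ≤ I₀ := integral_nonneg fun y => by positivity
  have hK : 0 ≤ K₁ := by positivity
  refine ⟨n + m + m + (d + 1), N + d, (K₁ + C₂) * I₀, by positivity,
    fun ħ hħ hħ1 v B hB0 hv hv' x => ?_⟩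
  have key : ∀ y, ⟪x⟫ ^ n * ‖wKer ħ p x y * v y‖
      ≤ (K₁ + C₂) * ħ ^ (N + d) * B * (⟪y⟫ ^ (d + 1))⁻¹ := by
    intro y
    rw [← div_eq_mul_inv, le_div_iff₀ (by positivity), norm_mul]
    rcases lt_or_ge ‖y‖ c with h | h
    · rcases lt_or_ge ‖½ • (x + y)‖ (c + 1) with h2 | h2
      · have h3 : wKer ħ p x y = 0 := by
          unfold wKer
          have h4 : ∀ ξ, p (½ • (x + y), ξ) = 0 := fun ξ => h1 _ h2
          simp only [h4, mul_zero, integral_zero]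
        rw [h3, norm_zero]
        simp only [zero_mul, mul_zero]
        positivity
      · rw [norm_smul] at h2
        norm_num at h2
        have h3 := norm_add_le x y
        have h4 : ‖x‖ - ‖y‖ ≤ ‖x - y‖ := norm_sub_norm_le x y
        have h5 : 1 + ‖x‖ ≤ (c + 3) / 2 * ‖x - y‖ := by nlinarith
        have h6 := hC₁ ħ hħ x y
        have h7 : ⟪x⟫ ^ n * ‖wKer ħ p x y‖ ≤ C₁ * ((c + 3) / 2) ^ M * (1 + c) ^ m * ħ ^ M := by
          refine le_of_mul_le_mul_right ?_ (by positivity : 0 < ⟪x⟫ ^ m)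
          calc ⟪x⟫ ^ n * ‖wKer ħ p x y‖ * ⟪x⟫ ^ m
              = ⟪x⟫ ^ (n + m) * ‖wKer ħ p x y‖ := by rw [pow_add]; ring
            _ ≤ ⟪x⟫ ^ M * ‖wKer ħ p x y‖ := by
              gcongr
              · linarith [norm_nonneg x]
              · omega
            _ ≤ ((c + 3) / 2 * ‖x - y‖) ^ M * ‖wKer ħ p x y‖ := by gcongr
            _ = ((c + 3) / 2) ^ M * (‖x - y‖ ^ M * ‖wKer ħ p x y‖) := by rw [mul_pow]; ring
            _ ≤ ((c + 3) / 2) ^ M * (C₁ * ħ ^ M * (⟪x⟫ * ⟪y⟫) ^ m) := by gcongr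
            _ ≤ ((c + 3) / 2) ^ M * (C₁ * ħ ^ M * (⟪x⟫ * (1 + c)) ^ m) := by gcongr
            _ = _ := by rw [mul_pow]; ring
        have h8 : ħ ^ M ≤ ħ ^ (N + d) * ħ ^ d := by
          rw [← pow_add]
          exact pow_le_pow_of_le_one hħ.le hħ1 (by omega)
        calc ⟪x⟫ ^ n * (‖wKer ħ p x y‖ * ‖v y‖) * ⟪y⟫ ^ (d + 1)
            = (⟪x⟫ ^ n * ‖wKer ħ p x y‖) * ‖v y‖ * ⟪y⟫ ^ (d + 1) := by ring
          _ ≤ (C₁ * ((c + 3) / 2) ^ M * (1 + c) ^ m * (ħ ^ (N + d) * ħ ^ d)) * ‖v y‖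
              * (1 + c) ^ (d + 1) := by
            have h9 : ⟪x⟫ ^ n * ‖wKer ħ p x y‖
                ≤ C₁ * ((c + 3) / 2) ^ M * (1 + c) ^ m * (ħ ^ (N + d) * ħ ^ d) :=
              h7.trans (by gcongr)
            exact mul_le_mul (mul_le_mul_of_nonneg_right h9 (norm_nonneg _)) (by gcongr)
              (by positivity) (by positivity)
          _ = K₁ * ħ ^ (N + d) * (ħ ^ d * ‖v y‖) := by simp only [K₁]; ring
          _ ≤ K₁ * ħ ^ (N + d) * B := by gcongr; exact hv y
          _ ≤ _ := by gcongr; linarith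
    · have h2 := hC₂ ħ hħ hħ1 x y
      have h3 : ⟪x⟫ ^ n * ‖wKer ħ p x y‖ ≤ C₂ * ⟪y⟫ ^ (n + m + m) := by
        refine le_of_mul_le_mul_right ?_ (by positivity : 0 < ⟪x⟫ ^ m)
        calc ⟪x⟫ ^ n * ‖wKer ħ p x y‖ * ⟪x⟫ ^ m
            = ⟪x⟫ ^ (n + m) * ‖wKer ħ p x y‖ := by rw [pow_add]; ring
          _ ≤ (⟪x - y⟫ * ⟪y⟫) ^ (n + m) * ‖wKer ħ p x y‖ := by
            gcongr; exact one_add_norm_le_mul_sub x y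
          _ = ⟪y⟫ ^ (n + m) * (⟪x - y⟫ ^ (n + m) * ‖wKer ħ p x y‖) := by
            rw [mul_pow]; ring
          _ ≤ ⟪y⟫ ^ (n + m) * (C₂ * (⟪x⟫ * ⟪y⟫) ^ m) := by gcongr
          _ = _ := by rw [mul_pow, pow_add ⟪y⟫ (n + m) m]; ring
      calc ⟪x⟫ ^ n * (‖wKer ħ p x y‖ * ‖v y‖) * ⟪y⟫ ^ (d + 1)
          = (⟪x⟫ ^ n * ‖wKer ħ p x y‖) * ‖v y‖ * ⟪y⟫ ^ (d + 1) := by ring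
        _ ≤ (C₂ * ⟪y⟫ ^ (n + m + m)) * ‖v y‖ * ⟪y⟫ ^ (d + 1) := by gcongr
        _ = C₂ * (⟪y⟫ ^ (n + m + m + (d + 1)) * ‖v y‖) := by
          rw [pow_add ⟪y⟫ (n + m + m)]; ring
        _ ≤ C₂ * (ħ ^ (N + d) * B) := mul_le_mul_of_nonneg_left (hv' y h) hC₂0
        _ = C₂ * ħ ^ (N + d) * B := by ring
        _ ≤ _ := by gcongr; linarith
  rw [(weylOp_eq_wKer hp hρ ħ v.continuous.aestronglyMeasurable
    (integrable_weight_mul v m) x).1, norm_mul]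
  have h2 : ⟪x⟫ ^ n * ‖∫ y, wKer ħ p x y * v y‖ ≤ (K₁ + C₂) * ħ ^ (N + d) * B * I₀ := by
    have h3 : ⟪x⟫ ^ n * ‖∫ y, wKer ħ p x y * v y‖
        = ‖∫ y, ((⟪x⟫ ^ n : ℝ) : ℂ) * (wKer ħ p x y * v y)‖ := by
      rw [integral_const_mul, norm_mul, norm_real, norm_of_nonneg (by positivity)]
    rw [h3, ← integral_const_mul]
    refine norm_integral_le_of_norm_le ((integrable_inv_pow d).const_mul _) (.of_forall fun y => ?_)
    rw [norm_mul, norm_real, norm_of_nonneg (by positivity)]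
    exact key y
  calc _ = ‖planck d ħ‖ * (⟪x⟫ ^ n * ‖∫ y, wKer ħ p x y * v y‖) := by ring
    _ ≤ ‖planck d ħ‖ * ((K₁ + C₂) * ħ ^ (N + d) * B * I₀) := by gcongr
    _ = (‖planck d ħ‖ * ħ ^ d) * ((K₁ + C₂) * I₀ * ħ ^ N * B) := by rw [pow_add]; ring
    _ ≤ 1 * ((K₁ + C₂) * I₀ * ħ ^ N * B) := by gcongr; exact planck_le hħ
    _ = _ := one_mul _

end SpatialCutoff

end

section

/-! ### Cut-off operators on functions of polynomial growth -/

section CutoffOp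

variable {d : ℕ}

lemma exists_eLpNorm_le_of_weight (d : ℕ) : ∃ C, 0 ≤ C ∧ ∀ (f : E d → ℂ) (B : ℝ), 0 ≤ B →
    (∀ x, ⟪x⟫ ^ (d + 1) * ‖f x‖ ≤ B) → eLpNorm f 2 volume ≤ ENNReal.ofReal (C * B) := by
  let w : E d → ℝ := fun x => (⟪x⟫ ^ (d + 1))⁻¹
  have hw : MemLp w 2 volume := by
    have h1 := integrable_inv_pow d
    refine (memLp_two_iff_integrable_sq h1.aestronglyMeasurable).2 ?_
    refine h1.mono' (h1.aestronglyMeasurable.pow 2) (.of_forall fun x => ?_)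
    have h2 : 1 ≤ ⟪x⟫ ^ (d + 1) := one_le_pow₀ (by linarith [norm_nonneg x])
    have h3 := inv_le_one_of_one_le₀ h2
    rw [norm_of_nonneg (by positivity), sq]
    exact mul_le_of_le_one_left (by positivity) h3
  refine ⟨(eLpNorm w 2 volume).toReal, ENNReal.toReal_nonneg, fun f B hB hf => ?_⟩
  have h1 : eLpNorm f 2 volume ≤ eLpNorm (B • w) 2 volume := by
    refine eLpNorm_mono_real fun x => ?_
    simp only [w, Pi.smul_apply, smul_eq_mul]
    rw [← div_eq_mul_inv, le_div_iff₀ (by positivity), mul_comm]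
    exact hf x
  refine h1.trans ?_
  rw [eLpNorm_const_smul, ENNReal.ofReal_mul ENNReal.toReal_nonneg, ENNReal.ofReal_toReal hw.2.ne,
    mul_comm, Real.enorm_eq_ofReal hB]

/-- Measurable functions with `‖u x‖ ≤ B ⟪x⟫^m`. -/
def PolyGrowth (m : ℕ) (B : ℝ) (u : E d → ℂ) : Prop :=
  AEStronglyMeasurable u ∧ ∀ x, ‖u x‖ ≤ B * ⟪x⟫ ^ m

lemma PolyGrowth.nonneg {m : ℕ} {B : ℝ} {u : E d → ℂ} (h : PolyGrowth m B u) : 0 ≤ B := by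
  simpa using (norm_nonneg _).trans (h.2 0)

lemma exists_radius_phase {χ : Phase d → ℂ} (hc : HasCompactSupport χ) :
    ∃ ρ, 0 < ρ ∧ ∀ z : Phase d, (ρ < ‖z.1‖ ∨ ρ < ‖z.2‖) → χ z = 0 := by
  obtain ⟨r, hr⟩ := hc.isCompact.isBounded.subset_closedBall 0
  refine ⟨max r 1, by positivity, fun z hz => image_eq_zero_of_notMem_tsupport fun h => ?_⟩
  have h1 := hr h
  rw [mem_closedBall_zero_iff] at h1
  have h2 := (norm_fst_le z).trans h1
  have h3 := (norm_snd_le z).trans h1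
  have h4 := le_max_left r 1
  rcases hz with hz | hz <;> linarith

lemma hasSymbolBound_of_hasCompactSupport {χ : Phase d → ℂ} (hχ : C^∞ χ)
    (hc : HasCompactSupport χ) : SymBound 0 χ :=
  ⟨hχ, fun k => by
    obtain ⟨C, hC0, hC⟩ := exists_bound hχ hc k
    exact ⟨C, hC0, fun z => by simpa using hC z⟩⟩

lemma weylOp_eq_wKer_of_growth {χ : Phase d → ℂ} (hχ : C^∞ χ)
    (hc : HasCompactSupport χ) (ħ : ℝ) {m : ℕ} {B : ℝ} {u : E d → ℂ} (hu : PolyGrowth m B u)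
    (x : E d) : weylOp ħ χ u x = planck d ħ * ∫ y, wKer ħ χ x y * u y ∧
      Integrable (fun y => wKer ħ χ x y * u y) := by
  obtain ⟨ρ, hρ0, hρ⟩ := exists_radius_phase hc
  let S : Set (E d) := closedBall 0 (2 * ρ + ‖x‖)
  have hS : MeasurableSet S := isClosed_closedBall.measurableSet
  have h0 : ∀ y ∉ S, ∀ ξ, χ (½ • (x + y), ξ) = 0 := by
    intro y hy ξ
    refine hρ (½ • (x + y), ξ) (Or.inl ?_)
    rw [mem_closedBall_zero_iff, not_le] at hy
    have h1 : ‖y‖ - ‖x‖ ≤ ‖x + y‖ := by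
      have := norm_sub_norm_le y (-x)
      rwa [norm_neg, sub_neg_eq_add, add_comm y x] at this
    simp only [norm_smul]
    norm_num
    linarith
  have hu' : ∀ y ξ, χ (½ • (x + y), ξ) * S.indicator u y = χ (½ • (x + y), ξ) * u y := by
    intro y ξ
    by_cases hy : y ∈ S
    · rw [Set.indicator_of_mem hy]
    · rw [h0 y hy ξ, zero_mul, zero_mul]
  have hk : ∀ y, wKer ħ χ x y * S.indicator u y = wKer ħ χ x y * u y := by
    intro y
    unfold wKer
    rw [← integral_mul_const, ← integral_mul_const]
    simp only [mul_assoc, hu']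
  have hi : Integrable (fun y => ⟪y⟫ ^ 0 * ‖S.indicator u y‖) := by
    simp only [pow_zero, one_mul]
    refine Integrable.norm ((integrable_indicator_iff hS).2 ?_)
    refine Measure.integrableOn_of_bounded (M := B * (1 + (2 * ρ + ‖x‖)) ^ m)
      (isCompact_closedBall _ _).measure_lt_top.ne hu.1 ?_
    filter_upwards [ae_restrict_mem hS] with y hy
    refine (hu.2 y).trans ?_
    have := hu.nonneg
    rw [mem_closedBall_zero_iff] at hy
    gcongr
  obtain ⟨h1, h2, -⟩ := weylOp_eq_wKer (hasSymbolBound_of_hasCompactSupport hχ hc)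
    (fun z hz => hρ z (Or.inr hz)) ħ (hu.1.indicator hS) hi x
  simp only [hk] at h1 h2
  refine ⟨?_, h2⟩
  rw [← h1]
  unfold weylOp
  simp only [mul_assoc, hu']

lemma weylOp_add_of_polyGrowth {χ : Phase d → ℂ} (hχ : C^∞ χ)
    (hc : HasCompactSupport χ) (ħ : ℝ) {m n : ℕ} {A B : ℝ} {u v : E d → ℂ} (hu : PolyGrowth m A u)
    (hv : PolyGrowth n B v) (x : E d) :
    weylOp ħ χ (fun x => u x + v x) x = weylOp ħ χ u x + weylOp ħ χ v x := by
  have huv : PolyGrowth (m + n) (A + B) (fun x => u x + v x) := by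
    refine ⟨hu.1.add hv.1, fun x => (norm_add_le _ _).trans ?_⟩
    rw [add_mul]
    have h1 : 1 ≤ 1 + ‖x‖ := by linarith [norm_nonneg x]
    have := hu.nonneg
    have := hv.nonneg
    refine add_le_add ((hu.2 x).trans ?_) ((hv.2 x).trans ?_)
    · gcongr
      omega
    · gcongr
      omega
  have h1 := weylOp_eq_wKer_of_growth hχ hc ħ hu x
  have h2 := weylOp_eq_wKer_of_growth hχ hc ħ hv x
  rw [h1.1, h2.1, (weylOp_eq_wKer_of_growth hχ hc ħ huv x).1, ← mul_add, ← integral_add h1.2 h2.2]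
  simp only [mul_add]

lemma exists_eLpNorm_weylOp_le {χ : Phase d → ℂ} (hχ : C^∞ χ)
    (hc : HasCompactSupport χ) (m : ℕ) : ∃ C, 0 ≤ C ∧ ∀ ħ, 0 < ħ → ħ ≤ 1 → ∀ (B : ℝ) (u : E d → ℂ),
      PolyGrowth m B u →
      eLpNorm (weylOp ħ χ u) 2 volume ≤ ENNReal.ofReal (C * ‖planck d ħ‖ * B) := by
  obtain ⟨ρ, hρ0, hρ⟩ := exists_radius_phase hc
  obtain ⟨C₁, hC₁0, hC₁⟩ := exists_eLpNorm_le_of_weight d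
  obtain ⟨C₂, hC₂0, hC₂⟩ := exists_weight_mul_wKer_le
    (hasSymbolBound_of_hasCompactSupport hχ hc) (fun z hz => hρ z (Or.inr hz))
    ((d + 1) + (d + 1 + m))
  let I₀ := ∫ y : E d, (⟪y⟫ ^ (d + 1))⁻¹
  have hI0 : 0 ≤ I₀ := integral_nonneg fun y => by positivity
  let c := (1 + ρ) ^ ((d + 1) + (d + 1 + m))
  have hc0 : 0 ≤ c := by positivity
  refine ⟨C₁ * (c * C₂ * I₀), by positivity, fun ħ hħ hħ1 B u hu => ?_⟩
  have hB := hu.nonneg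
  refine (hC₁ _ (‖planck d ħ‖ * (c * C₂ * B * I₀)) (by positivity) fun x => ?_).trans
    (ENNReal.ofReal_le_ofReal (by ring_nf; rfl))
  have key : ∀ y, ⟪x⟫ ^ (d + 1) * ‖wKer ħ χ x y * u y‖ ≤ c * C₂ * B * (⟪y⟫ ^ (d + 1))⁻¹ := by
    intro y
    rw [← div_eq_mul_inv, le_div_iff₀ (by positivity), norm_mul]
    rcases lt_or_ge ρ ‖½ • (x + y)‖ with h | h
    · have h3 : wKer ħ χ x y = 0 := by
        unfold wKer
        have h4 : ∀ ξ, χ (½ • (x + y), ξ) = 0 := fun ξ =>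
          hρ (½ • (x + y), ξ) (Or.inl h)
        simp only [h4, mul_zero, integral_zero]
      rw [h3, norm_zero]
      simp only [zero_mul, mul_zero]
      positivity
    · have hn := norm_nonneg (x - y)
      have hx : 1 + ‖x‖ ≤ (1 + ρ) * ⟪x - y⟫ := by
        have h1 : x = ½ • (x + y) + ½ • (x - y) := by module
        have h2 := norm_add_le (½ • (x + y)) (½ • (x - y))
        rw [← h1, norm_smul _ (x - y)] at h2
        norm_num at h2 h
        nlinarith [mul_nonneg hρ0.le hn]
      have hy : 1 + ‖y‖ ≤ (1 + ρ) * ⟪x - y⟫ := by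
        have h1 : y = ½ • (x + y) - ½ • (x - y) := by module
        have h2 := norm_sub_le (½ • (x + y)) (½ • (x - y))
        rw [← h1, norm_smul _ (x - y)] at h2
        norm_num at h2 h
        nlinarith [mul_nonneg hρ0.le hn]
      have h2 := hC₂ ħ hħ hħ1 x y
      rw [pow_zero, mul_one] at h2
      calc ⟪x⟫ ^ (d + 1) * (‖wKer ħ χ x y‖ * ‖u y‖) * ⟪y⟫ ^ (d + 1)
          ≤ ⟪x⟫ ^ (d + 1) * (‖wKer ħ χ x y‖ * (B * ⟪y⟫ ^ m)) * ⟪y⟫ ^ (d + 1) := by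
            gcongr; exact hu.2 y
        _ = ⟪x⟫ ^ (d + 1) * ⟪y⟫ ^ (d + 1 + m) * ‖wKer ħ χ x y‖ * B := by
            rw [pow_add ⟪y⟫]; ring
        _ ≤ ((1 + ρ) * ⟪x - y⟫) ^ (d + 1) * ((1 + ρ) * ⟪x - y⟫) ^ (d + 1 + m)
            * ‖wKer ħ χ x y‖ * B := by gcongr
        _ = c * (⟪x - y⟫ ^ ((d + 1) + (d + 1 + m)) * ‖wKer ħ χ x y‖) * B := by
            rw [← pow_add, mul_pow]; ring
        _ ≤ c * C₂ * B := by gcongr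
  rw [(weylOp_eq_wKer_of_growth hχ hc ħ hu x).1, norm_mul]
  have h3 : ⟪x⟫ ^ (d + 1) * ‖∫ y, wKer ħ χ x y * u y‖
      = ‖∫ y, ((⟪x⟫ ^ (d + 1) : ℝ) : ℂ) * (wKer ħ χ x y * u y)‖ := by
    rw [integral_const_mul, norm_mul, norm_real, norm_of_nonneg (by positivity)]
  have h4 : ⟪x⟫ ^ (d + 1) * ‖∫ y, wKer ħ χ x y * u y‖ ≤ c * C₂ * B * I₀ := by
    rw [h3, ← integral_const_mul]
    refine norm_integral_le_of_norm_le ((integrable_inv_pow d).const_mul _) (.of_forall fun y => ?_)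
    rw [norm_mul, norm_real, norm_of_nonneg (by positivity)]
    exact key y
  calc _ = ‖planck d ħ‖ * (⟪x⟫ ^ (d + 1) * ‖∫ y, wKer ħ χ x y * u y‖) := by ring
    _ ≤ _ := by gcongr

end CutoffOp

/-! ### Cutting off the Fourier transform of a symbol near zero -/

section NearDiagonal

variable {d : ℕ}

lemma norm_fourierH_eq (ħ : ℝ) (q : E d → ℂ) (θ : E d) :
    ‖fourierH ħ q θ‖ = ‖∫ x, osc ħ (inner ℝ x (-θ)) * q x‖ := by
  unfold fourierH
  simp only [inner_neg_right]

lemma exists_pow_mul_fourierH_section_le {p : Phase d → ℂ} (hp : C^∞ p)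
    (hc : HasCompactSupport p) (N : ℕ) : ∃ C, 0 ≤ C ∧ ∀ ħ, 0 < ħ → ∀ ζ θ : E d,
      ‖θ‖ ^ N * ‖fourierH ħ (fun X => p (X, ζ)) θ‖ ≤ C * ħ ^ N := by
  obtain ⟨ρ, hρ0, hρ⟩ := exists_radius_phase hc
  obtain ⟨A, hA0, hA⟩ := exists_bound hp hc N
  refine ⟨A * volume.real (closedBall (0 : E d) ρ), by positivity, fun ħ hħ ζ θ => ?_⟩
  have h0 : C^∞ (fun X : E d => (X, ζ)) := contDiff_prodMk_left ζ
  have hs : C^∞ (fun X : E d => p (X, ζ)) := ContDiff.fun_comp hp h0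
  have hz : ∀ X : E d, ρ < ‖X‖ → p (X, ζ) = 0 := fun X hX => hρ (X, ζ) (Or.inl hX)
  have hd : ∀ X : E d, ‖iteratedFDeriv ℝ N (fun X => p (X, ζ)) X‖ ≤ A := by
    intro X
    have h := norm_iteratedFDeriv_affine hp (inl ℝ (E d) (E d)) (0, ζ) N X
    have h1 : ‖inl ℝ (E d) (E d)‖ ≤ 1 :=
      ContinuousLinearMap.opNorm_le_bound _ zero_le_one fun t => by simp [Prod.norm_def]
    simp only [ContinuousLinearMap.inl_apply, Prod.mk_add_mk, add_zero, zero_add] at h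
    exact (h.trans (mul_le_of_le_one_right (norm_nonneg _)
      (pow_le_one₀ (norm_nonneg _) h1))).trans (hA _)
  have h1 := norm_pow_mul_integral_osc_le (ρ := ρ) (B := A) N hs hz hd hħ (-θ)
  rw [norm_neg] at h1
  rw [norm_fourierH_eq]
  refine h1.trans_eq ?_
  ring

/-- The symbol `p` with its Fourier transform in the position cut off by `b`. -/
noncomputable def nearAmp (p : Phase d → ℂ) (b : E d → ℂ) (q : Phase d × E d) : ℂ := p q.1 * b q.2

lemma qHat_nearAmp (p : Phase d → ℂ) (b : E d → ℂ) (ħ : ℝ) (ζ θ : E d) :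
    qHat (nearAmp p b) ħ ζ θ = b θ * fourierH ħ (fun X => p (X, ζ)) θ := by
  unfold qHat nearAmp fourierH
  rw [← integral_const_mul]
  congr 1
  funext x
  ring

lemma exists_norm_sub_symS_nearAmp_le {p : Phase d → ℂ} (hp : C^∞ p)
    (hc : HasCompactSupport p) {b : E d → ℂ} (hb : C^∞ b) (hbc : HasCompactSupport b)
    {δ : ℝ} (hδ : 0 < δ) (hb1 : ∀ θ, ‖θ‖ < δ → b θ = 1) (N : ℕ) : ∃ C, 0 ≤ C ∧ ∀ ħ, 0 < ħ → ħ ≤ 1 →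
      ∀ z, ‖p z - symS (nearAmp p b) ħ z‖ ≤ C * ħ ^ N := by
  let N' := N + d + (d + 1)
  obtain ⟨C, hC0, hC⟩ := exists_pow_mul_fourierH_section_le hp hc N'
  obtain ⟨M, hM0, hM⟩ := exists_bound hb hbc 0
  simp only [norm_iteratedFDeriv_zero] at hM
  let I₀ := ∫ y : E d, (⟪y⟫ ^ (d + 1))⁻¹
  have hI0 : 0 ≤ I₀ := integral_nonneg fun y => by positivity
  let K := (1 + M) * ((1 + δ) / δ) ^ N' * C
  have hK : 0 ≤ K := by positivity
  refine ⟨K * I₀, by positivity, fun ħ hħ hħ1 z => ?_⟩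
  have h0 : C^∞ (fun X : E d => (X, z.2)) := contDiff_prodMk_left z.2
  have hs : C^∞ (fun X : E d => p (X, z.2)) := ContDiff.fun_comp hp h0
  have hsc : HasCompactSupport (fun X : E d => p (X, z.2)) := by
    obtain ⟨ρ, hρ0, hρ⟩ := exists_radius_phase hc
    exact .intro (isCompact_closedBall 0 ρ) fun X hX =>
      hρ (X, z.2) (Or.inl (by simpa using hX))
  have hS : ∃ q : 𝓢(E d, ℂ), ∀ X, q X = p (X, z.2) :=
    ⟨hsc.toSchwartzMap hs, fun X => rfl⟩
  obtain ⟨q, hq⟩ := hS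
  have hi := integrable_fourierH hħ q
  have e1 : p z = invFourierH ħ (fourierH ħ q) z.1 := by
    rw [invFourierH_fourierH hħ, hq]
  have hqf : (fun X => p (X, z.2)) = q := (funext hq).symm
  have e2 : symS (nearAmp p b) ħ z = invFourierH ħ (fun θ => b θ * fourierH ħ q θ) z.1 := by
    unfold symS
    congr 1
    funext θ
    rw [qHat_nearAmp, hqf]
  have hi2 : Integrable (fun θ => b θ * fourierH ħ q θ) :=
    hi.bdd_mul hb.continuous.aestronglyMeasurable (.of_forall hM)
  have e3 : p z - symS (nearAmp p b) ħ z
      = invFourierH ħ (fun θ => (1 - b θ) * fourierH ħ q θ) z.1 := by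
    rw [e1, e2, sub_eq_add_neg, ← neg_one_mul, ← invFourierH_const_mul,
      ← invFourierH_add hi (hi2.const_mul _)]
    congr 1
    funext θ
    ring
  rw [e3]
  refine (norm_invFourierH_le _ _).trans ?_
  have key : ∀ θ, ‖(1 - b θ) * fourierH ħ q θ‖ ≤ K * ħ ^ N' * (⟪θ⟫ ^ (d + 1))⁻¹ := by
    intro θ
    rw [norm_mul]
    rcases lt_or_ge ‖θ‖ δ with h | h
    · rw [hb1 θ h, sub_self, norm_zero, zero_mul]
      positivity
    · have h1 := hC ħ hħ z.2 θ
      rw [hqf] at h1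
      have h2 : 1 + ‖θ‖ ≤ (1 + δ) / δ * ‖θ‖ := by
        rw [div_mul_eq_mul_div, le_div_iff₀ hδ]
        nlinarith
      have h3 : ‖1 - b θ‖ ≤ 1 + M := (norm_sub_le _ _).trans (by rw [norm_one]; linarith [hM θ])
      rw [← div_eq_mul_inv, le_div_iff₀ (by positivity)]
      have h4 : ⟪θ⟫ ^ (d + 1) ≤ ⟪θ⟫ ^ N' :=
        pow_le_pow_right₀ (by linarith [norm_nonneg θ]) (by omega)
      calc ‖1 - b θ‖ * ‖fourierH ħ q θ‖ * ⟪θ⟫ ^ (d + 1)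
          ≤ (1 + M) * ‖fourierH ħ q θ‖ * ((1 + δ) / δ * ‖θ‖) ^ N' := by
            gcongr
            exact h4.trans (by gcongr)
        _ = (1 + M) * ((1 + δ) / δ) ^ N' * (‖θ‖ ^ N' * ‖fourierH ħ q θ‖) := by rw [mul_pow]; ring
        _ ≤ (1 + M) * ((1 + δ) / δ) ^ N' * (C * ħ ^ N') := by gcongr
        _ = _ := by ring
  have h2 : ∫ θ, ‖(1 - b θ) * fourierH ħ q θ‖ ≤ K * ħ ^ N' * I₀ := by
    rw [← integral_const_mul]
    exact integral_mono_of_nonneg (.of_forall fun θ => norm_nonneg _)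
      ((integrable_inv_pow d).const_mul _) (.of_forall key)
  have h3 : ħ ^ N' ≤ ħ ^ d * ħ ^ N := by
    rw [← pow_add]
    exact pow_le_pow_of_le_one hħ.le hħ1 (by omega)
  calc _ ≤ ‖planck d ħ‖ * (K * (ħ ^ d * ħ ^ N) * I₀) := by
        gcongr
        refine h2.trans ?_
        gcongr
    _ = (‖planck d ħ‖ * ħ ^ d) * (K * I₀ * ħ ^ N) := by ring
    _ ≤ 1 * (K * I₀ * ħ ^ N) := by gcongr; exact planck_le hħ
    _ = _ := one_mul _

lemma exists_norm_symS_nearAmp_le {p : Phase d → ℂ} (hp : C^∞ p)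
    (hc : HasCompactSupport p) {b : E d → ℂ} (hb : C^∞ b) (hbc : HasCompactSupport b)
    {ρ : ℝ} (hρ0 : 0 < ρ) (hρ : ∀ z : Phase d, ρ < ‖z.1‖ → p z = 0) (N : ℕ) : ∃ C, 0 ≤ C ∧
      ∀ ħ, 0 < ħ → ħ ≤ 1 → ∀ z : Phase d, 2 * ρ ≤ ‖z.1‖ →
        ⟪z.1⟫ ^ N * ‖symS (nearAmp p b) ħ z‖ ≤ C * ħ ^ N := by
  let N' := N + d
  obtain ⟨r, hr⟩ := hbc.isCompact.isBounded.subset_closedBall 0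
  have hbr : ∀ t, r < ‖t‖ → b t = 0 := fun t ht => image_eq_zero_of_notMem_tsupport fun h => by
    have := hr h
    rw [mem_closedBall_zero_iff] at this
    linarith
  obtain ⟨A, hA0, hA⟩ := exists_bound hb hbc N'
  obtain ⟨M, hM0, hM⟩ := exists_bound hp hc 0
  simp only [norm_iteratedFDeriv_zero] at hM
  let V := A * volume.real (closedBall (0 : E d) r)
  let W := volume.real (closedBall (0 : E d) ρ)
  let c := 2 * (1 + 2 * ρ) / (2 * ρ)
  have hV : 0 ≤ V := by positivity
  have hW : 0 ≤ W := by positivity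
  have hc0 : 0 ≤ c := by positivity
  refine ⟨W * (M * (c ^ N' * V)), by positivity, fun ħ hħ hħ1 z hz => ?_⟩
  have e1 : symS (nearAmp p b) ħ z = planck d ħ * ∫ x in closedBall (0 : E d) ρ,
      p (x, z.2) * ∫ θ, osc ħ (inner ℝ θ (z.1 - x)) * b θ := by
    unfold symS invFourierH
    congr 1
    have h1 : ∀ θ, osc ħ (inner ℝ z.1 θ) * qHat (nearAmp p b) ħ z.2 θ
        = ∫ x, p (x, z.2) * (osc ħ (inner ℝ θ (z.1 - x)) * b θ) := by
      intro θ
      rw [qHat_nearAmp, fourierH, ← mul_assoc, ← integral_const_mul]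
      congr 1
      funext x
      rw [inner_sub_right, sub_eq_add_neg, osc_add, real_inner_comm z.1 θ, real_inner_comm x θ]
      ring
    simp only [h1]
    rw [integral_integral_swap_of_hasCompactSupport]
    · rw [setIntegral_eq_integral_of_forall_compl_eq_zero]
      · simp only [integral_const_mul]
      · intro x hx
        rw [mem_closedBall_zero_iff, not_le] at hx
        rw [hρ (x, z.2) hx, zero_mul]
    · have h2 := hp.continuous
      have h3 := hb.continuous
      have h4 : Continuous (fun q : E d × E d => p (q.2, z.2)) :=
        Continuous.comp' h2 (by fun_prop : Continuous fun q : E d × E d => (q.2, z.2))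
      have h5 : Continuous (fun q : E d × E d => osc ħ (inner ℝ q.1 (z.1 - q.2)) * b q.1) := by
        fun_prop
      exact h4.mul h5
    · refine .intro ((isCompact_closedBall (0 : E d) r).prod
        (isCompact_closedBall (0 : E d) ρ)) fun q hq => ?_
      rw [Set.mem_prod, not_and_or, mem_closedBall_zero_iff, mem_closedBall_zero_iff, not_le,
        not_le] at hq
      simp only [Function.uncurry]
      rcases hq with hq | hq
      · rw [hbr _ hq, mul_zero, mul_zero]
      · rw [hρ (q.2, z.2) hq, zero_mul]
  have key : ∀ x ∈ closedBall (0 : E d) ρ,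
      ‖((⟪z.1⟫ ^ N' : ℝ) : ℂ) * (p (x, z.2) * ∫ θ, osc ħ (inner ℝ θ (z.1 - x)) * b θ)‖
        ≤ M * (c ^ N' * V) * ħ ^ N' := by
    intro x hx
    rw [mem_closedBall_zero_iff] at hx
    have h1 := norm_pow_mul_integral_osc_le N' hb hbr hA hħ (z.1 - x)
    have h2 : ‖z.1‖ - ‖x‖ ≤ ‖z.1 - x‖ := norm_sub_norm_le _ _
    have h3 : 1 + ‖z.1‖ ≤ c * ‖z.1 - x‖ := by
      have h4 : ‖z.1‖ / 2 ≤ ‖z.1 - x‖ := by linarith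
      calc 1 + ‖z.1‖ ≤ c * (‖z.1‖ / 2) := by
            simp only [c]
            rw [div_mul_div_comm, le_div_iff₀ (by positivity)]
            nlinarith
        _ ≤ _ := by gcongr
    rw [norm_mul, norm_mul, norm_real, norm_of_nonneg (by positivity)]
    calc _ ≤ (c * ‖z.1 - x‖) ^ N' * (M * ‖∫ θ, osc ħ (inner ℝ θ (z.1 - x)) * b θ‖) := by
          gcongr; exact hM _
      _ = M * c ^ N' * (‖z.1 - x‖ ^ N' * ‖∫ θ, osc ħ (inner ℝ θ (z.1 - x)) * b θ‖) := by
          rw [mul_pow]; ring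
      _ ≤ M * c ^ N' * (ħ ^ N' * V) := by gcongr
      _ = _ := by ring
  have h5 : ⟪z.1⟫ ^ N' * ‖∫ x in closedBall (0 : E d) ρ,
      p (x, z.2) * ∫ θ, osc ħ (inner ℝ θ (z.1 - x)) * b θ‖ ≤ M * (c ^ N' * V) * ħ ^ N' * W := by
    have h6 : ⟪z.1⟫ ^ N' * ‖∫ x in closedBall (0 : E d) ρ,
        p (x, z.2) * ∫ θ, osc ħ (inner ℝ θ (z.1 - x)) * b θ‖
        = ‖∫ x in closedBall (0 : E d) ρ, ((⟪z.1⟫ ^ N' : ℝ) : ℂ) *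
          (p (x, z.2) * ∫ θ, osc ħ (inner ℝ θ (z.1 - x)) * b θ)‖ := by
      rw [integral_const_mul, norm_mul, norm_real, norm_of_nonneg (by positivity)]
    rw [h6]
    exact norm_setIntegral_le_of_norm_le_const (isCompact_closedBall _ _).measure_lt_top key
  rw [e1, norm_mul]
  have h6 : ⟪z.1⟫ ^ N ≤ ⟪z.1⟫ ^ N' :=
    pow_le_pow_right₀ (by linarith [norm_nonneg z.1]) (by omega)
  refine (mul_le_mul_of_nonneg_right h6 (by positivity)).trans ?_
  rw [mul_left_comm]
  calc ‖planck d ħ‖ * _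
    _ ≤ ‖planck d ħ‖ * (M * (c ^ N' * V) * ħ ^ N' * W) := by gcongr
    _ = (‖planck d ħ‖ * ħ ^ d) * (W * (M * (c ^ N' * V)) * ħ ^ N) := by
        simp only [N', pow_add ħ]; ring
    _ ≤ 1 * (W * (M * (c ^ N' * V)) * ħ ^ N) := by gcongr; exact planck_le hħ
    _ = _ := one_mul _

lemma exists_weight_mul_sub_symS_nearAmp_le {p : Phase d → ℂ} (hp : C^∞ p)
    (hc : HasCompactSupport p) {b : E d → ℂ} (hb : C^∞ b) (hbc : HasCompactSupport b)
    {δ : ℝ} (hδ : 0 < δ) (hb1 : ∀ θ, ‖θ‖ < δ → b θ = 1) (n N : ℕ) : ∃ C, 0 ≤ C ∧ ∀ ħ, 0 < ħ →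
      ħ ≤ 1 → ∀ z : Phase d, ⟪z.1⟫ ^ n * ‖p z - symS (nearAmp p b) ħ z‖ ≤ C * ħ ^ N := by
  obtain ⟨ρ, hρ0, hρ⟩ := exists_radius_phase hc
  obtain ⟨C₁, hC₁0, hC₁⟩ := exists_norm_sub_symS_nearAmp_le hp hc hb hbc hδ hb1 N
  obtain ⟨C₂, hC₂0, hC₂⟩ := exists_norm_symS_nearAmp_le hp hc hb hbc hρ0
    (fun z hz => hρ z (Or.inl hz)) (n + N)
  refine ⟨(1 + 2 * ρ) ^ n * C₁ + C₂, by positivity, fun ħ hħ hħ1 z => ?_⟩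
  rcases le_total ‖z.1‖ (2 * ρ) with h | h
  · calc _ ≤ (1 + 2 * ρ) ^ n * (C₁ * ħ ^ N) := by gcongr; exact hC₁ ħ hħ hħ1 z
      _ = (1 + 2 * ρ) ^ n * C₁ * ħ ^ N := by ring
      _ ≤ _ := by gcongr; linarith
  · rw [hρ z (Or.inl (by linarith)), zero_sub, norm_neg]
    calc _ ≤ ⟪z.1⟫ ^ (n + N) * ‖symS (nearAmp p b) ħ z‖ := by
          gcongr
          · linarith [norm_nonneg z.1]
          · omega
      _ ≤ C₂ * ħ ^ (n + N) := hC₂ ħ hħ hħ1 z h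
      _ ≤ C₂ * ħ ^ N := by
          gcongr C₂ * ?_
          exact pow_le_pow_of_le_one hħ.le hħ1 (by omega)
      _ ≤ _ := by gcongr; exact le_add_of_nonneg_left (by positivity)

/-- A Weyl operator whose symbol is small in a weighted norm. -/
lemma exists_weight_mul_weylOp_small_le (ρ : ℝ) (n : ℕ) : ∃ C, 0 ≤ C ∧
    ∀ ħ, 0 < ħ → ∀ (e : Phase d → ℂ) (A B : ℝ), Continuous e → VanishesAbove ρ e → 0 ≤ A →
      (∀ z : Phase d, ⟪z.1⟫ ^ n * ‖e z‖ ≤ A) → ∀ v : 𝓢(E d, ℂ), 0 ≤ B →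
      (∀ y, ⟪y⟫ ^ (n + (d + 1)) * ‖v y‖ ≤ B) → ∀ x,
      ⟪x⟫ ^ n * ‖weylOp ħ e v x‖ ≤ C * ‖planck d ħ‖ * A * B := by
  let I₀ := ∫ y : E d, (⟪y⟫ ^ (d + 1))⁻¹
  have hI0 : 0 ≤ I₀ := integral_nonneg fun y => by positivity
  let W := volume.real (closedBall (0 : E d) ρ)
  have hW : 0 ≤ W := by positivity
  refine ⟨2 ^ n * I₀ * W, by positivity, fun ħ hħ e A B he hρ hA0 hA v hB0 hB x => ?_⟩
  have key : ∀ ξ y, ‖((⟪x⟫ ^ n : ℝ) : ℂ) * (osc ħ (inner ℝ (x - y) ξ)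
      * e (½ • (x + y), ξ) * v y)‖ ≤ 2 ^ n * A * B * (⟪y⟫ ^ (d + 1))⁻¹ := by
    intro ξ y
    rw [norm_mul, norm_mul, norm_mul, norm_osc, one_mul, norm_real,
      norm_of_nonneg (by positivity), ← div_eq_mul_inv, le_div_iff₀ (by positivity)]
    have h1 : 1 + ‖x‖ ≤ 2 * ⟪½ • (x + y)⟫ * ⟪y⟫ := by
      have h2 : x = (2 : ℝ) • (½ • (x + y)) - y := by module
      have h3 : ‖x‖ ≤ 2 * ‖½ • (x + y)‖ + ‖y‖ := by
        conv_lhs => rw [h2]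
        refine (norm_sub_le _ _).trans ?_
        rw [norm_smul]
        norm_num
      nlinarith [norm_nonneg y, norm_nonneg (½ • (x + y)),
        mul_nonneg (norm_nonneg y) (norm_nonneg (½ • (x + y)))]
    have h2 := hA (½ • (x + y), ξ)
    have h3 := hB y
    calc _ ≤ (2 * ⟪½ • (x + y)⟫ * ⟪y⟫) ^ n
          * (‖e (½ • (x + y), ξ)‖ * ‖v y‖) * ⟪y⟫ ^ (d + 1) := by gcongr
      _ = 2 ^ n * (⟪½ • (x + y)⟫ ^ n * ‖e (½ • (x + y), ξ)‖)
          * (⟪y⟫ ^ (n + (d + 1)) * ‖v y‖) := by rw [mul_pow, mul_pow, pow_add]; ring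
      _ ≤ 2 ^ n * A * B := by
        have : 0 ≤ ⟪y⟫ ^ (n + (d + 1)) * ‖v y‖ := by positivity
        exact mul_le_mul (mul_le_mul_of_nonneg_left h2 (by positivity)) h3 this (by positivity)
  have h1 : ∀ ξ, ‖((⟪x⟫ ^ n : ℝ) : ℂ) * wInt ħ e v x ξ‖ ≤ 2 ^ n * A * B * I₀ := by
    intro ξ
    unfold wInt
    rw [← integral_const_mul, ← integral_const_mul]
    exact norm_integral_le_of_norm_le ((integrable_inv_pow d).const_mul _) (.of_forall (key ξ))
  have h2 : weylOp ħ e v x = planck d ħ * ∫ ξ in closedBall (0 : E d) ρ, wInt ħ e v x ξ := by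
    rw [weylOp_eq_wInt, setIntegral_eq_integral_of_forall_compl_eq_zero]
    intro ξ hξ
    rw [mem_closedBall_zero_iff, not_le] at hξ
    have h3 : ∀ y, e (½ • (x + y), ξ) = 0 := fun y => hρ (½ • (x + y), ξ) hξ
    unfold wInt
    simp only [h3, mul_zero, zero_mul, integral_zero]
  have h4 : ⟪x⟫ ^ n * ‖∫ ξ in closedBall (0 : E d) ρ, wInt ħ e v x ξ‖ ≤ 2 ^ n * A * B * I₀ * W := by
    have h5 : ⟪x⟫ ^ n * ‖∫ ξ in closedBall (0 : E d) ρ, wInt ħ e v x ξ‖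
        = ‖∫ ξ in closedBall (0 : E d) ρ, ((⟪x⟫ ^ n : ℝ) : ℂ) * wInt ħ e v x ξ‖ := by
      rw [integral_const_mul, norm_mul, norm_real, norm_of_nonneg (by positivity)]
    rw [h5]
    exact norm_setIntegral_le_of_norm_le_const (isCompact_closedBall _ _).measure_lt_top
      fun ξ _ => h1 ξ
  rw [h2, norm_mul]
  calc _ = ‖planck d ħ‖ * (⟪x⟫ ^ n
        * ‖∫ ξ in closedBall (0 : E d) ρ, wInt ħ e v x ξ‖) := by ring
    _ ≤ ‖planck d ħ‖ * (2 ^ n * A * B * I₀ * W) := by gcongr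
    _ = _ := by ring

end NearDiagonal

end

section

/-! ### The operator with amplitude `Q` -/

section AmplitudeOp

variable {d : ℕ} {Q : Phase d × E d → ℂ}

lemma compactSupp_comp_zero (hc : HasCompactSupport Q) :
    HasCompactSupport (fun z : Phase d => Q (z, 0)) := by
  obtain ⟨ρ, -, hρ⟩ := exists_radius hc
  refine .intro (isCompact_closedBall 0 ρ) fun z hz => hρ _ ?_
  rw [mem_closedBall_zero_iff, not_le] at hz
  exact hz.trans_le (norm_fst_le (z, (0 : E d)))

lemma compactSupp_subPart (hc : HasCompactSupport Q) : HasCompactSupport (subPart Q) := by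
  obtain ⟨ρ, hρ⟩ := hc.isCompact.isBounded.exists_norm_le
  refine .intro (isCompact_closedBall 0 ρ) fun z hz => ?_
  rw [mem_closedBall_zero_iff, not_le] at hz
  have h1 : (z, (0 : E d)) ∉ tsupport Q := fun h =>
    absurd (hρ _ h) (not_le.2 (hz.trans_le (norm_fst_le (z, (0 : E d)))))
  unfold subPart
  rw [sum_eq_zero, mul_zero]
  intro j _
  exact dir_eq_zero_of_notMem (fun h => h1 (tsupport_fderiv_apply_subset' Q _ h)) _

lemma exists_deriv_symS_le (hQ : C^∞ Q) (hc : HasCompactSupport Q) (k : ℕ) :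
    ∃ C, 0 ≤ C ∧ ∀ ħ, 0 < ħ → ħ ≤ 1 → ∀ z, ‖iteratedFDeriv ℝ k (symS Q ħ) z‖ ≤ C := by
  have h0 : C^∞ (fun z : Phase d => Q (z, 0)) :=
    hQ.comp (by fun_prop : C^∞ fun z : Phase d => (z, (0 : E d)))
  have h1 := contDiff_subPart hQ
  obtain ⟨C₀, hC₀0, hC₀⟩ := exists_bound h0 (compactSupp_comp_zero hc) k
  obtain ⟨C₁, hC₁0, hC₁⟩ := exists_bound h1 (compactSupp_subPart hc) k
  obtain ⟨C₂, hC₂0, hC₂⟩ := exists_deriv_symErr_le k hQ hc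
  refine ⟨C₂ + (C₀ + C₁), by positivity, fun ħ hħ hħ1 z => ?_⟩
  have hk : ((k : ℕ) : WithTop ℕ∞) ≤ ∞ := by exact_mod_cast le_top
  have e1 : symS Q ħ = fun z => symErr Q ħ z + (Q (z, 0) + (ħ : ℂ) * subPart Q z) := by
    funext z
    simp only [symErr]
    ring
  have hs1 : C^∞ (fun z => (ħ : ℂ) * subPart Q z) := contDiff_const.mul h1
  rw [e1, fun_iteratedFDeriv_add_apply ((contDiff_symErr hQ hc ħ).of_le hk).contDiffAt
    ((h0.add hs1).of_le hk).contDiffAt,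
    fun_iteratedFDeriv_add_apply (h0.of_le hk).contDiffAt (hs1.of_le hk).contDiffAt]
  have e2 : iteratedFDeriv ℝ k (fun z => (ħ : ℂ) * subPart Q z) z
      = (ħ : ℂ) • iteratedFDeriv ℝ k (subPart Q) z :=
    iteratedFDeriv_const_smul_apply (a := (ħ : ℂ)) (h1.of_le hk).contDiffAt
  rw [e2]
  refine (norm_add_le _ _).trans (add_le_add ?_ ((norm_add_le _ _).trans (add_le_add (hC₀ z) ?_)))
  · refine (hC₂ ħ hħ z).trans ?_
    exact mul_le_of_le_one_right hC₂0 (pow_le_one₀ hħ.le hħ1)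
  · rw [norm_smul, norm_real, norm_of_nonneg hħ.le]
    exact (mul_le_of_le_one_left (norm_nonneg _) hħ1).trans (hC₁ z)

lemma hasSymbolBound_symS (hQ : C^∞ Q) (hc : HasCompactSupport Q) {ħ : ℝ} (hħ : 0 < ħ)
    (hħ1 : ħ ≤ 1) : SymBound 0 (symS Q ħ) := by
  refine ⟨contDiff_symS hQ hc ħ, fun k => ?_⟩
  obtain ⟨C, hC0, hC⟩ := exists_deriv_symS_le hQ hc k
  exact ⟨C, hC0, fun z => by simpa using hC ħ hħ hħ1 z⟩

lemma vanishesAbove_symS {ρ : ℝ} (hρ : ∀ t, ρ < ‖t‖ → Q t = 0) (ħ : ℝ) :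
    VanishesAbove ρ (symS Q ħ) := by
  intro z hz
  unfold symS invFourierH
  have h : ∀ θ, qHat Q ħ z.2 θ = 0 := fun θ => qHat_eq_zero hρ (Or.inl hz)
  simp only [h, mul_zero, integral_zero]

/-- The operator with amplitude `Q`, on the Fourier side. -/
noncomputable def ampOp (Q : Phase d × E d → ℂ) (ħ : ℝ) (f : E d → ℂ) (ξ : E d) : ℂ :=
  planck d ħ * ∫ ξ' : E d, qHat Q ħ (½ • (ξ + ξ')) (ξ - ξ') * f ξ'

lemma contDiff_ampOp (hQ : C^∞ Q) (hc : HasCompactSupport Q) (ħ : ℝ) {f : E d → ℂ}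
    (hf : C^∞ f) (hfc : HasCompactSupport f) : C^∞ (ampOp Q ħ f) := by
  refine contDiff_const.mul (contDiff_integral_compact (μ := volume) (H := fun p : E d × E d =>
    qHat Q ħ (½ • (p.1 + p.2)) (p.1 - p.2) * f p.2) ?_ ?_)
  · have h1 := contDiff_qHat hQ hc ħ
    have h2 : C^∞ (fun p : E d × E d => (½ • (p.1 + p.2), p.1 - p.2)) := by
      fun_prop
    have h3 := ContDiff.fun_comp h1 h2
    exact h3.mul (hf.comp contDiff_snd)
  · exact fun z₀ => ⟨tsupport f, hfc, fun z _ t ht => by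
      simp only [image_eq_zero_of_notMem_tsupport ht, mul_zero]⟩

lemma ampOp_eq_zero {ρ r : ℝ} {ξ₀ : E d} (hρ : ∀ z θ, ρ ≤ ‖θ‖ → Q (z, θ) = 0) (ħ : ℝ)
    {f : E d → ℂ} (hf : ∀ ξ, r ≤ ‖ξ - ξ₀‖ → f ξ = 0) {ξ : E d} (hξ : r + ρ ≤ ‖ξ - ξ₀‖) :
    ampOp Q ħ f ξ = 0 := by
  have h : ∀ ξ', qHat Q ħ (½ • (ξ + ξ')) (ξ - ξ') * f ξ' = 0 := by
    intro ξ'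
    rcases le_or_gt r ‖ξ' - ξ₀‖ with h | h
    · rw [hf _ h, mul_zero]
    · have h1 : ρ ≤ ‖ξ - ξ'‖ := by
        have h2 : ‖ξ - ξ₀‖ ≤ ‖ξ - ξ'‖ + ‖ξ' - ξ₀‖ := norm_sub_le_norm_sub_add_norm_sub _ _ _
        linarith
      have h3 : ∀ x, Q ((x, ½ • (ξ + ξ')), ξ - ξ') = 0 := fun x => hρ _ _ h1
      unfold qHat
      simp only [h3, mul_zero, integral_zero, zero_mul]
  unfold ampOp
  simp only [h, integral_zero, mul_zero]

lemma compactSupp_ampOp (hc : HasCompactSupport Q) (ħ : ℝ) {f : E d → ℂ}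
    (hfc : HasCompactSupport f) : HasCompactSupport (ampOp Q ħ f) := by
  obtain ⟨ρ, hρ0, hρ⟩ := exists_radius hc
  obtain ⟨r, hr0, hr⟩ := exists_radius hfc
  refine .intro (isCompact_closedBall 0 ((r + 1) + (ρ + 1))) fun ξ hξ => ?_
  rw [mem_closedBall_zero_iff, not_le] at hξ
  refine ampOp_eq_zero (ρ := ρ + 1) (r := r + 1) (ξ₀ := 0) (fun z θ hθ => hρ _ ?_) ħ
    (fun ξ hξ => hr _ ?_) ?_
  · exact (lt_of_lt_of_le (by linarith) hθ).trans_le (norm_snd_le (z, θ))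
  · rw [sub_zero] at hξ; linarith
  · rw [sub_zero]; exact hξ.le

lemma wInt_symS_invFourierH (hQ : C^∞ Q) (hc : HasCompactSupport Q) {ħ : ℝ} (hħ : 0 < ħ)
    {f : E d → ℂ} (hf : C^∞ f) (hfc : HasCompactSupport f) (x ξ : E d) :
    wInt ħ (symS Q ħ) (invFourierH ħ f) x ξ = planck d ħ * ∫ θ,
      qHat Q ħ ξ θ * osc ħ (inner ℝ x (ξ + ½ • θ)) * f (ξ - ½ • θ) := by
  obtain ⟨v, hv, hv'⟩ := exists_schwartz hħ hf hfc
  rw [← funext hv]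
  have hq := integrable_qHat hQ hc ħ ξ
  have hint : Integrable (fun p : E d × E d => osc ħ (inner ℝ (x - p.1) ξ)
      * (osc ħ (inner ℝ (½ • (x + p.1)) p.2) * qHat Q ħ ξ p.2) * v p.1)
      (volume.prod volume) := by
    have h1 := (v.integrable (μ := volume)).mul_prod hq
    refine h1.norm.mono' ?_ (.of_forall fun p => ?_)
    · have h2 : Continuous (fun p : E d × E d => qHat Q ħ ξ p.2) :=
        Continuous.comp' (continuous_qHat_right hQ hc ħ ξ) continuous_snd
      have h3 : Continuous (fun p : E d × E d => v p.1) :=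
        Continuous.comp' v.continuous continuous_fst
      have h4 : Continuous (fun p : E d × E d => osc ħ (inner ℝ (x - p.1) ξ)
        * (osc ħ (inner ℝ (½ • (x + p.1)) p.2) * qHat Q ħ ξ p.2) * v p.1) := by fun_prop
      exact h4.aestronglyMeasurable
    · simp only [norm_mul, norm_osc, one_mul]
      rw [mul_comm]
  have e1 : wInt ħ (symS Q ħ) v x ξ = planck d ħ * ∫ y, ∫ θ, osc ħ (inner ℝ (x - y) ξ)
      * (osc ħ (inner ℝ (½ • (x + y)) θ) * qHat Q ħ ξ θ) * v y := by
    unfold wInt symS invFourierH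
    rw [← integral_const_mul]
    congr 1
    funext y
    simp only [mul_assoc, integral_const_mul]
    rw [← integral_mul_const]
    simp only [mul_assoc]
    ring
  rw [e1, integral_integral_swap hint]
  congr 2
  funext θ
  rw [← hv', fourierH, ← integral_const_mul]
  congr 1
  funext y
  have e2 : inner ℝ (x - y) ξ + inner ℝ (½ • (x + y)) θ
      = inner ℝ x (ξ + ½ • θ) + -(inner ℝ y (ξ - ½ • θ)) := by
    simp only [inner_sub_left, inner_sub_right, inner_add_left, inner_add_right,
      real_inner_smul_left, real_inner_smul_right]
    ring
  have e3 := congrArg (osc ħ) e2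
  rw [osc_add, osc_add] at e3
  linear_combination (qHat Q ħ ξ θ * v y) * e3

lemma weylOp_symS_invFourierH (hQ : C^∞ Q) (hc : HasCompactSupport Q) {ħ : ℝ}
    (hħ : 0 < ħ) {f : E d → ℂ} (hf : C^∞ f) (hfc : HasCompactSupport f) (x : E d) :
    weylOp ħ (symS Q ħ) (invFourierH ħ f) x = invFourierH ħ (ampOp Q ħ f) x := by
  obtain ⟨ρ, hρ0, hρ⟩ := exists_radius hc
  obtain ⟨r, hr0, hr⟩ := exists_radius hfc
  have hqc : Continuous (fun p : E d × E d => qHat Q ħ p.1 p.2) := (contDiff_qHat hQ hc ħ).continuous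
  have hfc' := hf.continuous
  rw [weylOp_eq_wInt]
  simp only [wInt_symS_invFourierH hQ hc hħ hf hfc, integral_const_mul]
  rw [integral_integral_swap_of_hasCompactSupport]
  rotate_left
  · have h1 : Continuous (fun p : E d × E d => osc ħ (inner ℝ x (p.1 + ½ • p.2))
      * f (p.1 - ½ • p.2)) := by fun_prop
    have h2 := hqc.mul h1
    exact h2.congr fun p => by simp only [Function.uncurry, Pi.mul_apply]; ring
  · refine .intro ((isCompact_closedBall (0 : E d) ρ).prod
      (isCompact_closedBall (0 : E d) ρ)) fun q hq => ?_
    rw [Set.mem_prod, not_and_or, mem_closedBall_zero_iff, mem_closedBall_zero_iff, not_le,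
      not_le] at hq
    simp only [Function.uncurry]
    rw [qHat_eq_zero hρ hq, zero_mul, zero_mul]
  have e1 : ∀ θ, ∫ ξ, qHat Q ħ ξ θ * osc ħ (inner ℝ x (ξ + ½ • θ)) * f (ξ - ½ • θ)
      = ∫ ξ', qHat Q ħ (ξ' + ½ • θ) θ * osc ħ (inner ℝ x (ξ' + θ)) * f ξ' := by
    intro θ
    rw [← integral_add_right_eq_self _ (½ • θ)]
    congr 1
    funext ξ'
    rw [add_sub_cancel_right, add_assoc, ← add_smul]
    norm_num
  simp only [e1]
  rw [integral_integral_swap_of_hasCompactSupport]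
  rotate_left
  · have h1 : Continuous (fun p : E d × E d => osc ħ (inner ℝ x (p.2 + p.1)) * f p.2) := by fun_prop
    have h3 : Continuous (fun p : E d × E d => (p.2 + ½ • p.1, p.1)) := by fun_prop
    have h2 := (Continuous.comp' hqc h3).mul h1
    exact h2.congr fun p => by simp only [Function.uncurry, Pi.mul_apply]; ring
  · refine .intro ((isCompact_closedBall (0 : E d) ρ).prod
      (isCompact_closedBall (0 : E d) r)) fun q hq => ?_
    rw [Set.mem_prod, not_and_or, mem_closedBall_zero_iff, mem_closedBall_zero_iff, not_le,
      not_le] at hq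
    simp only [Function.uncurry]
    rcases hq with hq | hq
    · rw [qHat_eq_zero hρ (Or.inr hq), zero_mul, zero_mul]
    · rw [hr _ hq, mul_zero]
  have e2 : ∀ ξ', ∫ θ, qHat Q ħ (ξ' + ½ • θ) θ * osc ħ (inner ℝ x (ξ' + θ)) * f ξ'
      = ∫ η, osc ħ (inner ℝ x η) * (qHat Q ħ (½ • (η + ξ')) (η - ξ') * f ξ') := by
    intro ξ'
    rw [← integral_sub_right_eq_self _ ξ']
    congr 1
    funext η
    have h1 : ξ' + ½ • (η - ξ') = ½ • (η + ξ') := by module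
    rw [h1, add_sub_cancel]
    ring
  simp only [e2]
  rw [integral_integral_swap_of_hasCompactSupport]
  rotate_left
  · have h1 : Continuous (fun p : E d × E d => osc ħ (inner ℝ x p.2)) := by fun_prop
    have h3 : Continuous (fun p : E d × E d => (½ • (p.2 + p.1), p.2 - p.1)) := by fun_prop
    have h4 : Continuous (fun p : E d × E d => f p.1) := by fun_prop
    have h2 := h1.mul ((Continuous.comp' hqc h3).mul h4)
    exact h2
  · refine .intro ((isCompact_closedBall (0 : E d) r).prod
      (isCompact_closedBall (0 : E d) (ρ + r))) fun q hq => ?_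
    rw [Set.mem_prod, not_and_or, mem_closedBall_zero_iff, mem_closedBall_zero_iff, not_le,
      not_le] at hq
    simp only [Function.uncurry]
    rcases lt_or_ge r ‖q.1‖ with h | h
    · rw [hr _ h, mul_zero, mul_zero]
    · rcases hq with hq | hq
      · linarith
      · have h5 : ρ < ‖q.2 - q.1‖ := by
          have := norm_sub_norm_le q.2 q.1
          linarith
        rw [qHat_eq_zero hρ (Or.inr h5), zero_mul, mul_zero]
  unfold invFourierH ampOp
  simp only [integral_const_mul]
  rw [← integral_const_mul (planck d ħ)]
  congr 2
  funext η
  ring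

end AmplitudeOp

/-! ### Reduction to a compactly supported symbol -/

section Reduction

variable {d : ℕ}

lemma exists_weylOp_sub_nearAmp_le {m : ℕ} {p : Phase d → ℂ} (hp : SymBound m p) {R c : ℝ}
    (hR : 0 < R) (hc : 0 < c) : ∃ q : Phase d → ℂ, C^∞ q ∧ HasCompactSupport q ∧
      (∀ z : Phase d, ‖z.1‖ ≤ c + 1 → ‖z.2‖ ≤ 2 * R → q z = p z) ∧
      ∀ (b : E d → ℂ) (δ : ℝ), C^∞ b → HasCompactSupport b → 0 < δ →
      (∀ θ, ‖θ‖ < δ → b θ = 1) → ∀ n N : ℕ, ∃ (k n' N' : ℕ) (C : ℝ), 0 ≤ C ∧ ∀ ħ, 0 < ħ → ħ ≤ 1 →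
      ∀ (F : E d → ℂ) (B : ℝ), FreqSupp R F → FreqBound ħ k B F →
      (∀ y, c ≤ ‖y‖ → ⟪y⟫ ^ n' * ‖invFourierH ħ F y‖ ≤ ħ ^ N' * B) → ∀ x,
      ⟪x⟫ ^ n * ‖weylOp ħ p (invFourierH ħ F) x
        - weylOp ħ (symS (nearAmp q b) ħ) (invFourierH ħ F) x‖ ≤ C * ħ ^ N * B := by
  let β₁ : ContDiffBump (0 : E d) := ⟨c + 1, c + 2, by linarith, by linarith⟩
  let β₂ : ContDiffBump (0 : E d) := ⟨2 * R, 3 * R, by linarith, by linarith⟩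
  let θ₁ : E d → ℂ := fun x => (β₁ x : ℂ)
  let θ₂ : E d → ℂ := fun x => (β₂ x : ℂ)
  have hθ₁ : C^∞ θ₁ := Complex.ofRealCLM.contDiff.comp β₁.contDiff
  have hθ₂ : C^∞ θ₂ := Complex.ofRealCLM.contDiff.comp β₂.contDiff
  have hz₁ : ∀ x, c + 2 ≤ ‖x‖ → θ₁ x = 0 := fun x hx => by
    simp only [θ₁]; rw [β₁.zero_of_le_dist (by rw [dist_zero_right]; exact hx), Complex.ofReal_zero]
  have hz₂ : ∀ x, 3 * R ≤ ‖x‖ → θ₂ x = 0 := fun x hx => by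
    simp only [θ₂]; rw [β₂.zero_of_le_dist (by rw [dist_zero_right]; exact hx), Complex.ofReal_zero]
  have ho₁ : ∀ x, ‖x‖ ≤ c + 1 → θ₁ x = 1 := fun x hx => by
    simp only [θ₁]
    rw [β₁.one_of_mem_closedBall (by rw [mem_closedBall_zero_iff]; exact hx), Complex.ofReal_one]
  have ho₂ : ∀ x, ‖x‖ ≤ 2 * R → θ₂ x = 1 := fun x hx => by
    simp only [θ₂]
    rw [β₂.one_of_mem_closedBall (by rw [mem_closedBall_zero_iff]; exact hx), Complex.ofReal_one]
  have hc₁ : HasCompactSupport θ₁ := .intro (isCompact_closedBall 0 (c + 2))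
    fun x hx => hz₁ x (by rw [mem_closedBall_zero_iff, not_le] at hx; exact hx.le)
  have hc₂ : HasCompactSupport θ₂ := .intro (isCompact_closedBall 0 (3 * R))
    fun x hx => hz₂ x (by rw [mem_closedBall_zero_iff, not_le] at hx; exact hx.le)
  have hb₁ : SymBound 0 (fun z : Phase d => θ₁ z.1) :=
    hasSymbolBound_comp hθ₁ hc₁ (ContinuousLinearMap.fst ℝ (E d) (E d))
  have hb₂ : SymBound 0 (fun z : Phase d => θ₂ z.2) :=
    hasSymbolBound_comp hθ₂ hc₂ (ContinuousLinearMap.snd ℝ (E d) (E d))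
  let p₂ : Phase d → ℂ := fun z => p z * (1 - θ₂ z.2)
  let p₃ : Phase d → ℂ := fun z => p z * θ₂ z.2 * (1 - θ₁ z.1)
  let q : Phase d → ℂ := fun z => p z * θ₂ z.2 * θ₁ z.1
  have hp₂ : SymBound (m + 0) p₂ := hp.mul (hasSymbolBound_one.sub hb₂)
  have hp₃ : SymBound (m + 0 + 0) p₃ := (hp.mul hb₂).mul (hasSymbolBound_one.sub hb₁)
  have hq : SymBound (m + 0 + 0) q := (hp.mul hb₂).mul hb₁
  have hqc : HasCompactSupport q := by
    refine .intro ((isCompact_closedBall (0 : E d) (c + 2)).prod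
      (isCompact_closedBall (0 : E d) (3 * R))) fun z hz => ?_
    rw [Set.mem_prod, not_and_or, mem_closedBall_zero_iff, mem_closedBall_zero_iff, not_le,
      not_le] at hz
    simp only [q]
    rcases hz with hz | hz
    · rw [hz₁ _ hz.le, mul_zero]
    · rw [hz₂ _ hz.le, mul_zero, zero_mul]
  have hv₂ : VanishesBelow (2 * R) p₂ := fun z hz => by
    simp only [p₂]; rw [ho₂ _ hz.le, sub_self, mul_zero]
  have hv₃ : VanishesAbove (3 * R) p₃ := fun z hz => by
    simp only [p₃]; rw [hz₂ _ hz.le, mul_zero, zero_mul]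
  have hvq : VanishesAbove (3 * R) q := fun z hz => by
    simp only [q]; rw [hz₂ _ hz.le, mul_zero, zero_mul]
  have hx₃ : ∀ z : Phase d, ‖z.1‖ < c + 1 → p₃ z = 0 := fun z hz => by
    simp only [p₃]; rw [ho₁ _ hz.le, sub_self, mul_zero]
  refine ⟨q, hq.1, hqc, fun z h1 h2 => by simp only [q]; rw [ho₁ _ h1, ho₂ _ h2]; ring,
    fun b δ hb hbc hδ hb1 n N => ?_⟩
  have hA : C^∞ (nearAmp q b) := (hq.1.comp contDiff_fst).mul (hb.comp contDiff_snd)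
  obtain ⟨ρ₁, -, hρ₁⟩ := exists_radius hqc
  obtain ⟨ρ₂, -, hρ₂⟩ := exists_radius hbc
  have hA0 : ∀ t, max ρ₁ ρ₂ < ‖t‖ → nearAmp q b t = 0 := by
    intro t ht
    rw [Prod.norm_def] at ht
    unfold nearAmp
    rcases lt_or_ge ρ₁ ‖t.1‖ with h | h
    · rw [hρ₁ _ h, zero_mul]
    · rcases lt_or_ge ρ₂ ‖t.2‖ with h' | h'
      · rw [hρ₂ _ h', mul_zero]
      · exact absurd ht (not_lt.2 (max_le_max h h'))
  have hAc : HasCompactSupport (nearAmp q b) :=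
    .intro (isCompact_closedBall 0 (max ρ₁ ρ₂)) fun t ht =>
      hA0 t (by simpa using ht)
  obtain ⟨k₂, C₂, hC₂0, hC₂⟩ := exists_weight_mul_weylOp_highFreq_le hR hp₂ hv₂ n N
  obtain ⟨n', N', C₃, hC₃0, hC₃⟩ := exists_weight_mul_weylOp_farSpace_le hc.le hp₃ hv₃ hx₃ n N
  obtain ⟨C₄, hC₄0, hC₄⟩ := exists_weight_mul_sub_symS_nearAmp_le hq.1 hqc hb hbc hδ hb1 n
    (N + d + d)
  let ρ₃ := max (3 * R) (max ρ₁ ρ₂)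
  obtain ⟨C₅, hC₅0, hC₅⟩ := exists_weight_mul_weylOp_small_le (d := d) ρ₃ n
  obtain ⟨C₀, hC₀0, hC₀⟩ := exists_pow_mul_invFourierH_le (d := d) (R := R) 0
  obtain ⟨C₁, hC₁0, hC₁⟩ := exists_pow_mul_invFourierH_le (d := d) (R := R) (n + (d + 1))
  refine ⟨max k₂ (n + (d + 1)), n', N', C₂ + (C₃ * (C₀ + 1) + C₅ * C₄ * C₁), by positivity,
    fun ħ hħ hħ1 F B hF hB ht x => ?_⟩
  have hB0 : 0 ≤ B := (by positivity : (0 : ℝ) ≤ ħ ^ 0 * ‖iteratedFDeriv ℝ 0 F 0‖).trans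
    (hB 0 (Nat.zero_le _) 0)
  obtain ⟨v, hv, -⟩ := exists_schwartz hħ hF.1 hF.hasCompactSupport
  have hvF : invFourierH ħ F = v := (funext hv).symm
  have hpl : ‖planck d ħ‖ * ħ ^ d ≤ 1 := planck_le hħ
  have i₂ := integrable_wInt_highFreq hR hp₂ hv₂ hħ hħ1 hF x
  have e₂ := hC₂ ħ hħ hħ1 F B hF (hB.mono (le_max_left _ _)) x
  have v₀ := fun y => hC₀ ħ hħ F B hF (hB.mono (Nat.zero_le _)) y
  have v₁ := fun y => hC₁ ħ hħ F B hF (hB.mono (le_max_right _ _)) y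
  rw [hvF] at i₂ e₂ v₀ v₁ ht ⊢
  obtain ⟨-, -, i₃⟩ := weylOp_eq_wKer hp₃ hv₃ ħ v.continuous.aestronglyMeasurable
    (integrable_weight_mul v _) x
  obtain ⟨-, -, iq⟩ := weylOp_eq_wKer hq hvq ħ v.continuous.aestronglyMeasurable
    (integrable_weight_mul v _) x
  have hS := hasSymbolBound_symS hA hAc hħ hħ1
  obtain ⟨-, -, iS⟩ := weylOp_eq_wKer hS (vanishesAbove_symS hA0 ħ) ħ
    v.continuous.aestronglyMeasurable (integrable_weight_mul v _) x
  have w1 : ∀ ξ, wInt ħ p v x ξ = wInt ħ p₂ v x ξ + (wInt ħ p₃ v x ξ + wInt ħ q v x ξ) := by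
    intro ξ
    have j₂ := integrable_wInt hp₂ ħ v x ξ
    have j₃ := integrable_wInt hp₃ ħ v x ξ
    have jq := integrable_wInt hq ħ v x ξ
    unfold wInt
    have j₄ : Integrable (fun y => osc ħ (inner ℝ (x - y) ξ) * p₃ (½ • (x + y), ξ) * v y
      + osc ħ (inner ℝ (x - y) ξ) * q (½ • (x + y), ξ) * v y) := j₃.add jq
    rw [← integral_add j₃ jq, ← integral_add j₂ j₄]
    congr 1
    funext y
    simp only [p₂, p₃, q]
    ring
  have w2 : ∀ ξ, wInt ħ q v x ξ - wInt ħ (symS (nearAmp q b) ħ) v x ξ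
      = wInt ħ (fun z => q z - symS (nearAmp q b) ħ z) v x ξ := by
    intro ξ
    have jq := integrable_wInt hq ħ v x ξ
    have jS := integrable_wInt hS ħ v x ξ
    unfold wInt
    rw [← integral_sub jq jS]
    congr 1
    funext y
    ring
  have w3 : weylOp ħ p v x - weylOp ħ (symS (nearAmp q b) ħ) v x
      = weylOp ħ p₂ v x + (weylOp ħ p₃ v x
        + weylOp ħ (fun z => q z - symS (nearAmp q b) ħ z) v x) := by
    simp only [weylOp_eq_wInt, ← w2]
    rw [integral_sub iq iS]
    have i₄ : Integrable (fun ξ => wInt ħ p₃ v x ξ + wInt ħ q v x ξ) := i₃.add iq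
    simp only [w1]
    rw [integral_add i₂ i₄, integral_add i₃ iq]
    ring
  have e₃ := hC₃ ħ hħ hħ1 v ((C₀ + 1) * B) (by positivity) (fun y => by
    have h1 := v₀ y
    rw [pow_zero, one_mul] at h1
    calc ħ ^ d * ‖v y‖ ≤ ħ ^ d * (C₀ * ‖planck d ħ‖ * B) := by gcongr
      _ = (‖planck d ħ‖ * ħ ^ d) * (C₀ * B) := by ring
      _ ≤ 1 * (C₀ * B) := by gcongr
      _ ≤ _ := by rw [one_mul]; gcongr; linarith) (fun y hy => by
    refine (ht y hy).trans ?_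
    gcongr
    exact le_mul_of_one_le_left hB0 (by linarith)) x
  have e₄ := hC₅ ħ hħ (fun z => q z - symS (nearAmp q b) ħ z) (C₄ * ħ ^ (N + d + d))
    (C₁ * ‖planck d ħ‖ * B) (hq.1.continuous.sub hS.1.continuous) (fun z hz => by
      simp only
      rw [hvq z (lt_of_le_of_lt (le_max_left _ _) hz),
        vanishesAbove_symS hA0 ħ z (lt_of_le_of_lt (le_max_right _ _) hz), sub_zero])
    (by positivity) (fun z => hC₄ ħ hħ hħ1 z) v (by positivity) v₁ x
  have e₅ : ⟪x⟫ ^ n * ‖weylOp ħ (fun z => q z - symS (nearAmp q b) ħ z) v x‖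
      ≤ C₅ * C₄ * C₁ * ħ ^ N * B := by
    refine e₄.trans ?_
    calc C₅ * ‖planck d ħ‖ * (C₄ * ħ ^ (N + d + d)) * (C₁ * ‖planck d ħ‖ * B)
        = (‖planck d ħ‖ * ħ ^ d) * (‖planck d ħ‖ * ħ ^ d) * (C₅ * C₄ * C₁ * ħ ^ N * B) := by
          rw [pow_add, pow_add]; ring
      _ ≤ 1 * 1 * (C₅ * C₄ * C₁ * ħ ^ N * B) := by gcongr
      _ = _ := by ring
  rw [w3]
  calc _ ≤ ⟪x⟫ ^ n * (‖weylOp ħ p₂ v x‖ + (‖weylOp ħ p₃ v x‖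
        + ‖weylOp ħ (fun z => q z - symS (nearAmp q b) ħ z) v x‖)) := by
        gcongr
        exact (norm_add_le _ _).trans (by gcongr; exact norm_add_le _ _)
    _ = ⟪x⟫ ^ n * ‖weylOp ħ p₂ v x‖ + (⟪x⟫ ^ n * ‖weylOp ħ p₃ v x‖
        + ⟪x⟫ ^ n * ‖weylOp ħ (fun z => q z - symS (nearAmp q b) ħ z) v x‖) := by ring
    _ ≤ C₂ * ħ ^ N * B + (C₃ * ħ ^ N * ((C₀ + 1) * B) + C₅ * C₄ * C₁ * ħ ^ N * B) :=
        add_le_add e₂ (add_le_add e₃ e₅)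
    _ = _ := by ring

end Reduction

end

section

/-! ### The amplitude of the conjugated operator -/

section ConjAmp

variable {d : ℕ} (G : GeneralLinearGroup (Fin (d + 1)) ℝ)

/-- The two frequencies with midpoint `ζ` and difference `θ`. -/
noncomputable def freqPair (ζ θ : E d) : E d × E d := (ζ + ½ • θ, ζ - ½ • θ)

lemma freqPair_zero (ζ : E d) : freqPair ζ 0 = (ζ, ζ) := by simp [freqPair]

lemma freqPair_midpoint (ξ ξ' : E d) : freqPair (½ • (ξ + ξ')) (ξ - ξ') = (ξ, ξ') := by
  unfold freqPair
  congr 1 <;> module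

lemma contDiff_freqPair : C^∞ (fun p : Phase d × E d => freqPair p.1.2 p.2) := by
  unfold freqPair
  fun_prop

/-- The part of the amplitude that is even in the difference `θ` of the frequencies. -/
noncomputable def evenAmp (q : Phase d → ℂ) (p : Phase d × E d) : ℂ :=
  ((|(kur G (freqPair p.1.2 p.2).1 (freqPair p.1.2 p.2).2).det|⁻¹ : ℝ) : ℂ) * q ((adjoint
        (kur G (freqPair p.1.2 p.2).1 (freqPair p.1.2 p.2).2)).inverse p.1.1,
      ½ • (gMap G (freqPair p.1.2 p.2).1 + gMap G (freqPair p.1.2 p.2).2))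

/-- The determinant factor of the amplitude. -/
noncomputable def detAmp (ξ : E d) : ℝ := |(kur G ξ ξ).det|

/-- The amplitude of the conjugated operator: `β`, `ρ` and `b` are cut-offs. -/
noncomputable def conjAmp (q : Phase d → ℂ) (b β ρ : E d → ℂ) (p : Phase d × E d) : ℂ :=
  β p.2 * ρ p.1.2 * b (gMap G (freqPair p.1.2 p.2).1 - gMap G (freqPair p.1.2 p.2).2)
    * ((detAmp G (freqPair p.1.2 p.2).1 : ℂ) * evenAmp G q p)

lemma evenAmp_neg (q : Phase d → ℂ) (z : Phase d) (θ : E d) :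
    evenAmp G q (z, -θ) = evenAmp G q (z, θ) := by
  have h : freqPair z.2 (-θ) = ((freqPair z.2 θ).2, (freqPair z.2 θ).1) := by
    unfold freqPair
    simp only [smul_neg, sub_neg_eq_add]
    rfl
  unfold evenAmp
  simp only [h]
  rw [kur_comm, add_comm (gMap G _)]

lemma evenAmp_zero (q : Phase d → ℂ) {z : Phase d} (hz : ‖z.2‖ < 1) :
    evenAmp G q (z, 0) = ((detAmp G z.2)⁻¹ : ℂ) * q (kappa G z) := by
  unfold evenAmp detAmp
  simp only [freqPair_zero]
  rw [kappa_eq G hz, ← two_smul ℝ (gMap G z.2), smul_smul]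
  norm_num

variable {q : Phase d → ℂ}

lemma contDiffAt_evenAmp (hq : C^∞ q) {p : Phase d × E d}
    (hp : freqPair p.1.2 p.2 ∈ goodPairs G) : ContDiffAt ℝ ∞ (evenAmp G q) p := by
  obtain ⟨h1, h2, h3⟩ := hp
  have hL : ContDiffAt ℝ ∞ (fun p : Phase d × E d => freqPair p.1.2 p.2) p :=
    contDiff_freqPair.contDiffAt
  have hk : ContDiffAt ℝ ∞ (fun p : Phase d × E d =>
      kur G (freqPair p.1.2 p.2).1 (freqPair p.1.2 p.2).2) p :=
    ContDiffAt.comp (g := fun t : E d × E d => kur G t.1 t.2)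
      (f := fun p : Phase d × E d => freqPair p.1.2 p.2) p (contDiffAt_kur G h1 h2) hL
  have hi : ContDiffAt ℝ ∞ (fun p : Phase d × E d => (adjoint
      (kur G (freqPair p.1.2 p.2).1 (freqPair p.1.2 p.2).2)).inverse) p :=
    ContDiffAt.comp (g := fun t : E d × E d => (adjoint (kur G t.1 t.2)).inverse)
      (f := fun p : Phase d × E d => freqPair p.1.2 p.2) p
      (contDiffAt_inverse_adjoint_kur G h1 h2 h3) hL
  have hd : ContDiffAt ℝ ∞ (fun p : Phase d × E d =>
      (kur G (freqPair p.1.2 p.2).1 (freqPair p.1.2 p.2).2).det) p :=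
    ContDiffAt.fun_comp p contDiff_clm_det.contDiffAt hk
  have hg1 : ContDiffAt ℝ ∞ (fun p : Phase d × E d => gMap G (freqPair p.1.2 p.2).1) p :=
    ContDiffAt.fun_comp p (contDiffAt_gMap G h1) (contDiffAt_fst.comp p hL)
  have hg2 : ContDiffAt ℝ ∞ (fun p : Phase d × E d => gMap G (freqPair p.1.2 p.2).2) p :=
    ContDiffAt.fun_comp p (contDiffAt_gMap G h2) (contDiffAt_snd.comp p hL)
  have hx : ContDiffAt ℝ ∞ (fun p : Phase d × E d => p.1.1) p := by fun_prop
  have harg : ContDiffAt ℝ ∞ (fun p : Phase d × E d => ((adjoint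
        (kur G (freqPair p.1.2 p.2).1 (freqPair p.1.2 p.2).2)).inverse p.1.1,
      ½ • (gMap G (freqPair p.1.2 p.2).1 + gMap G (freqPair p.1.2 p.2).2))) p :=
    (hi.clm_apply hx).prodMk ((hg1.add hg2).const_smul _)
  exact (ContDiffAt.fun_comp p Complex.ofRealCLM.contDiff.contDiffAt
    (contDiffAt_inv_abs hd h3)).mul (ContDiffAt.fun_comp p hq.contDiffAt harg)

lemma contDiffAt_detAmp {ξ : E d} (h : (ξ, ξ) ∈ goodPairs G) : ContDiffAt ℝ ∞ (detAmp G) ξ :=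
  (contDiffAt_det_kur G h.1).abs h.2.2

variable {b β ρ : E d → ℂ}

lemma contDiffAt_conjAmp (hq : C^∞ q) (hb : C^∞ b) (hβ : C^∞ β)
    (hρ : C^∞ ρ) {p : Phase d × E d} (hp : freqPair p.1.2 p.2 ∈ goodPairs G)
    (hp' : ((freqPair p.1.2 p.2).1, (freqPair p.1.2 p.2).1) ∈ goodPairs G) :
    ContDiffAt ℝ ∞ (conjAmp G q b β ρ) p := by
  obtain ⟨h1, h2, h3⟩ := hp
  have hL : ContDiffAt ℝ ∞ (fun p : Phase d × E d => freqPair p.1.2 p.2) p :=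
    contDiff_freqPair.contDiffAt
  have hg1 : ContDiffAt ℝ ∞ (fun p : Phase d × E d => gMap G (freqPair p.1.2 p.2).1) p :=
    ContDiffAt.fun_comp p (contDiffAt_gMap G h1) (contDiffAt_fst.comp p hL)
  have hg2 : ContDiffAt ℝ ∞ (fun p : Phase d × E d => gMap G (freqPair p.1.2 p.2).2) p :=
    ContDiffAt.fun_comp p (contDiffAt_gMap G h2) (contDiffAt_snd.comp p hL)
  have hd : ContDiffAt ℝ ∞ (fun p : Phase d × E d => detAmp G (freqPair p.1.2 p.2).1) p :=
    ContDiffAt.fun_comp p (contDiffAt_detAmp G hp') (contDiffAt_fst.comp p hL)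
  have e1 : ContDiffAt ℝ ∞ (fun p : Phase d × E d => β p.2) p :=
    ContDiffAt.fun_comp p hβ.contDiffAt contDiffAt_snd
  have e2 : ContDiffAt ℝ ∞ (fun p : Phase d × E d => ρ p.1.2) p :=
    ContDiffAt.fun_comp p hρ.contDiffAt (contDiffAt_snd.comp p contDiffAt_fst)
  have e3 : ContDiffAt ℝ ∞ (fun p : Phase d × E d =>
      b (gMap G (freqPair p.1.2 p.2).1 - gMap G (freqPair p.1.2 p.2).2)) p :=
    ContDiffAt.fun_comp p hb.contDiffAt (hg1.sub hg2)
  have e4 : ContDiffAt ℝ ∞ (fun p : Phase d × E d =>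
      (detAmp G (freqPair p.1.2 p.2).1 : ℂ)) p :=
    ContDiffAt.fun_comp p Complex.ofRealCLM.contDiff.contDiffAt hd
  exact ((e1.mul e2).mul e3).mul (e4.mul (contDiffAt_evenAmp G hq ⟨h1, h2, h3⟩))

/-- The cut-offs `ρ` in the mean frequency and `β` in the difference of the frequencies restrict
to pairs of frequencies at which everything is smooth. -/
def CutoffsGood (β ρ : E d → ℂ) : Prop :=
  ∀ ζ ∈ tsupport ρ, ∀ θ ∈ tsupport β, freqPair ζ θ ∈ goodPairs G ∧
    ((freqPair ζ θ).1, (freqPair ζ θ).1) ∈ goodPairs G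

lemma exists_compact_conjAmp (hq : HasCompactSupport q) (hβc : HasCompactSupport β)
    (hρc : HasCompactSupport ρ) (hgood : CutoffsGood G β ρ) (b : E d → ℂ) :
    ∃ r, ∀ p ∉ (closedBall (0 : E d) r ×ˢ tsupport ρ) ×ˢ tsupport β, conjAmp G q b β ρ p = 0 := by
  have hk : IsCompact (tsupport ρ ×ˢ tsupport β) := hρc.prod hβc
  have hcont : ContinuousOn (fun t : E d × E d => adjoint
      (kur G (freqPair t.1 t.2).1 (freqPair t.1 t.2).2)) (tsupport ρ ×ˢ tsupport β) := by
    intro t ht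
    obtain ⟨⟨h1, h2, -⟩, -⟩ := hgood t.1 ht.1 t.2 ht.2
    have hL : Continuous (fun t : E d × E d => freqPair t.1 t.2) := by
      unfold freqPair
      fun_prop
    have h3 := (contDiffAt_kur G (p := freqPair t.1 t.2) h1 h2).continuousAt
    have h4 : ContinuousAt (fun t : E d × E d => kur G (freqPair t.1 t.2).1 (freqPair t.1 t.2).2) t :=
      ContinuousAt.comp (g := fun p : E d × E d => kur G p.1 p.2) h3 hL.continuousAt
    exact (ContinuousAt.comp
      (adjoint (𝕜 := ℝ) (E := E d) (F := E d)).continuous.continuousAt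
      h4).continuousWithinAt
  obtain ⟨M, hM⟩ := hk.exists_bound_of_continuousOn hcont
  obtain ⟨ρ₀, hρ₀0, hρ₀⟩ := exists_radius_phase hq
  refine ⟨M * ρ₀, fun p hp => ?_⟩
  unfold conjAmp
  by_cases h1 : p.2 ∈ tsupport β
  · by_cases h2 : p.1.2 ∈ tsupport ρ
    · obtain ⟨⟨-, -, h3⟩, -⟩ := hgood _ h2 _ h1
      have h4 : M * ρ₀ < ‖p.1.1‖ := by
        by_contra h
        exact hp ⟨⟨by rw [mem_closedBall_zero_iff]; exact not_lt.1 h, h2⟩, h1⟩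
      have h5 := hM (p.1.2, p.2) ⟨h2, h1⟩
      simp only at h5
      have h6 := isInvertible_adjoint (isInvertible_of_det h3)
      have h7 : ρ₀ < ‖(adjoint (kur G (freqPair p.1.2 p.2).1
          (freqPair p.1.2 p.2).2)).inverse p.1.1‖ := by
        by_contra h
        have h8 : p.1.1 = adjoint (kur G (freqPair p.1.2 p.2).1
            (freqPair p.1.2 p.2).2) ((adjoint (kur G (freqPair p.1.2 p.2).1
            (freqPair p.1.2 p.2).2)).inverse p.1.1) := by
          obtain ⟨e, he⟩ := h6
          rw [← he]
          simp
        have h9 : ‖p.1.1‖ ≤ M * ρ₀ := by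
          rw [h8]
          refine (ContinuousLinearMap.le_opNorm _ _).trans ?_
          exact mul_le_mul h5 (not_lt.1 h) (norm_nonneg _) ((norm_nonneg _).trans h5)
        linarith
      unfold evenAmp
      have h8 := hρ₀ ((adjoint (kur G (freqPair p.1.2 p.2).1
          (freqPair p.1.2 p.2).2)).inverse p.1.1, ½ •
            (gMap G (freqPair p.1.2 p.2).1 + gMap G (freqPair p.1.2 p.2).2)) (Or.inl h7)
      simp only [h8, mul_zero]
    · rw [image_eq_zero_of_notMem_tsupport h2]
      simp
  · rw [image_eq_zero_of_notMem_tsupport h1]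
    simp

lemma contDiff_conjAmp (hq : C^∞ q) (hqc : HasCompactSupport q) (hb : C^∞ b)
    (hβ : C^∞ β) (hβc : HasCompactSupport β) (hρ : C^∞ ρ)
    (hρc : HasCompactSupport ρ) (hgood : CutoffsGood G β ρ) :
    C^∞ (conjAmp G q b β ρ) ∧ HasCompactSupport (conjAmp G q b β ρ) := by
  obtain ⟨r, hr⟩ := exists_compact_conjAmp G hqc hβc hρc hgood b
  have hk : IsCompact ((closedBall (0 : E d) r ×ˢ tsupport ρ) ×ˢ tsupport β) :=
    ((isCompact_closedBall _ _).prod hρc).prod hβc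
  refine ⟨contDiff_of_contDiffAt hk.isClosed subset_rfl (fun p hp => ?_) hr, .intro hk hr⟩
  obtain ⟨h1, h2⟩ := hgood _ hp.1.2 _ hp.2
  exact contDiffAt_conjAmp G hq hb hβ hρ h1 h2

/-- Near the points where the cut-offs are one. -/
lemma conjAmp_zero (hβ0 : β 0 = 1) (hb0 : b 0 = 1) {z : Phase d} (hρ1 : ρ z.2 = 1)
    (hz : (z.2, z.2) ∈ goodPairs G) : conjAmp G q b β ρ (z, 0) = r0 G q z := by
  unfold conjAmp
  rw [evenAmp_zero G q hz.1]
  simp only [freqPair_zero]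
  rw [sub_self, hβ0, hb0, hρ1]
  have h : (detAmp G z.2 : ℂ) ≠ 0 := by
    unfold detAmp
    exact_mod_cast abs_ne_zero.2 hz.2.2
  simp only [one_mul]
  rw [← mul_assoc, mul_inv_cancel₀ h, one_mul, r0]

lemma fderiv_conjAmp_zero (hq : C^∞ q) (hQ : C^∞ (conjAmp G q b β ρ))
    (hβ1 : ∀ᶠ θ in 𝓝 0, β θ = 1) (hb1 : ∀ᶠ s in 𝓝 0, b s = 1) {z : Phase d}
    (hρ1 : ∀ᶠ ζ in 𝓝 z.2, ρ ζ = 1) (hz : (z.2, z.2) ∈ goodPairs G) (e : E d) :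
    fderiv ℝ (conjAmp G q b β ρ) (z, 0) (0, e)
      = ((1 / 2 * fderiv ℝ (detAmp G) z.2 e * (detAmp G z.2)⁻¹ : ℝ) : ℂ) * r0 G q z := by
  have hline : HasFDerivAt (fun t : ℝ => (z, t • e)) ((inr ℝ (Phase d) (E d)).comp
        (ContinuousLinearMap.toSpanSingleton ℝ e)) 0 := by
    have h1 := (hasFDerivAt_const z (0 : ℝ)).prodMk
      (ContinuousLinearMap.toSpanSingleton ℝ e).hasFDerivAt
    refine h1.congr_fderiv ?_
    ext <;> simp
  have h0 : (z, (0 : ℝ) • e) = (z, (0 : E d)) := by rw [zero_smul]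
  have hQd : HasFDerivAt (conjAmp G q b β ρ) (fderiv ℝ (conjAmp G q b β ρ) (z, 0))
      (z, (0 : ℝ) • e) := by
    rw [h0]
    exact (hQ.differentiable (by simp) _).hasFDerivAt
  have hQl : HasDerivAt (fun t : ℝ => conjAmp G q b β ρ (z, t • e))
      (fderiv ℝ (conjAmp G q b β ρ) (z, 0) (0, e)) 0 := by
    have h2 := (HasFDerivAt.comp (0 : ℝ) hQd hline).hasDerivAt
    simpa [Function.comp_def] using h2
  have hgood0 : freqPair z.2 (0 : E d) ∈ goodPairs G := by rw [freqPair_zero]; exact hz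
  have hEd : DifferentiableAt ℝ (evenAmp G q) (z, (0 : ℝ) • e) := by
    rw [h0]
    exact (contDiffAt_evenAmp G hq (p := (z, 0)) hgood0).differentiableAt (by simp)
  obtain ⟨ε, hE⟩ : ∃ ε, HasDerivAt (fun t : ℝ => evenAmp G q (z, t • e)) ε 0 :=
    ⟨_, (HasFDerivAt.comp (g := evenAmp G q) (f := fun t : ℝ => (z, t • e)) (0 : ℝ)
      hEd.hasFDerivAt hline).hasDerivAt⟩
  have hε : ε = 0 := by
    have h2 : HasDerivAt (fun t : ℝ => evenAmp G q (z, t • e)) (-ε) 0 := by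
      have h3 : HasDerivAt (fun t : ℝ => evenAmp G q (z, t • e)) ε (-0) := by
        rw [neg_zero]; exact hE
      have h4 := h3.scomp (0 : ℝ) (hasDerivAt_neg (0 : ℝ))
      have h5 : (fun t : ℝ => evenAmp G q (z, t • e)) ∘ Neg.neg
          = fun t : ℝ => evenAmp G q (z, t • e) := by
        funext t
        simp only [Function.comp_apply, neg_smul, evenAmp_neg]
      rw [h5] at h4
      simpa using h4
    have h6 := hE.unique h2
    exact self_eq_neg.1 h6
  have hW : HasDerivAt (fun t : ℝ => (detAmp G (freqPair z.2 (t • e)).1 : ℂ))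
      ((1 / 2 * fderiv ℝ (detAmp G) z.2 e : ℝ) : ℂ) 0 := by
    have h1 : HasDerivAt (fun t : ℝ => (freqPair z.2 (t • e)).1) (½ • e) 0 := by
      have := (((hasDerivAt_id (0 : ℝ)).smul_const e).const_smul ½).const_add z.2
      simpa [freqPair] using this
    have h2 : HasFDerivAt (detAmp G) (fderiv ℝ (detAmp G) z.2) (freqPair z.2 ((0 : ℝ) • e)).1 := by
      rw [zero_smul, freqPair_zero]
      exact ((contDiffAt_detAmp G hz).differentiableAt (by simp)).hasFDerivAt
    have h3 := (h2.comp_hasDerivAt (0 : ℝ) h1).ofReal_comp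
    rw [map_smul, smul_eq_mul] at h3
    exact h3
  have hprod := hW.mul hE
  rw [hε, mul_zero, add_zero, zero_smul, evenAmp_zero G q hz.1] at hprod
  have hev : (fun t : ℝ => conjAmp G q b β ρ (z, t • e))
      =ᶠ[𝓝 0] fun t : ℝ => (detAmp G (freqPair z.2 (t • e)).1 : ℂ) * evenAmp G q (z, t • e) := by
    have c1 : Tendsto (fun t : ℝ => t • e) (𝓝 0) (𝓝 0) := by
      have : Continuous (fun t : ℝ => t • e) := by fun_prop
      simpa using this.tendsto 0
    have c2 : Tendsto (fun t : ℝ => gMap G (freqPair z.2 (t • e)).1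
        - gMap G (freqPair z.2 (t • e)).2) (𝓝 0) (𝓝 0) := by
      have h7 := continuous_gMap G
      have h8 : Continuous (fun t : ℝ => (freqPair z.2 (t • e)).1) := by unfold freqPair; fun_prop
      have h9 : Continuous (fun t : ℝ => (freqPair z.2 (t • e)).2) := by unfold freqPair; fun_prop
      have h10 : Tendsto (fun t : ℝ => gMap G (freqPair z.2 (t • e)).1
          - gMap G (freqPair z.2 (t • e)).2) (𝓝 0) _ :=
        ((Continuous.comp' h7 h8).sub (Continuous.comp' h7 h9)).tendsto 0
      simpa [freqPair_zero] using h10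
    filter_upwards [c1.eventually hβ1, c2.eventually hb1] with t t1 t2
    unfold conjAmp
    simp only
    rw [t1, t2, hρ1.self_of_nhds]
    ring
  have hfin := hQl.unique (hprod.congr_of_eventuallyEq hev)
  rw [hfin, r0]
  push_cast
  ring

lemma subPart_conjAmp (hq : C^∞ q) (hQ : C^∞ (conjAmp G q b β ρ))
    (hβ1 : ∀ᶠ θ in 𝓝 0, β θ = 1) (hb1 : ∀ᶠ s in 𝓝 0, b s = 1) {z : Phase d}
    (hρ1 : ∀ᶠ ζ in 𝓝 z.2, ρ ζ = 1) (hz : (z.2, z.2) ∈ goodPairs G) :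
    subPart (conjAmp G q b β ρ) z = r1 G q z := by
  have hev : ∀ᶠ w : Phase d in 𝓝 z, (∀ᶠ ζ in 𝓝 w.2, ρ ζ = 1) ∧ (w.2, w.2) ∈ goodPairs G := by
    refine (continuous_snd.continuousAt.eventually (eventually_eventually_nhds.2 hρ1)).and ?_
    have h1 : Continuous (fun w : Phase d => (w.2, w.2)) := by fun_prop
    exact h1.continuousAt.eventually ((isOpen_goodPairs G).mem_nhds hz)
  have hr : DifferentiableAt ℝ (r0 G q) z :=
    (ContDiffAt.fun_comp z hq.contDiffAt (contDiffAt_kappa G hz.1 hz.2.2)).differentiableAt (by simp)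
  have hJ : DifferentiableAt ℝ (jac G) z.2 :=
    (contDiffAt_jac G hz.1 hz.2.2).differentiableAt (by simp)
  have hD : DifferentiableAt ℝ (detAmp G) z.2 :=
    (contDiffAt_detAmp G hz).differentiableAt (by simp)
  have hD0 : detAmp G z.2 ≠ 0 := abs_ne_zero.2 hz.2.2
  have hJ0 : jac G z.2 ≠ 0 := by rw [jac_eq G hz.1]; exact inv_ne_zero hz.2.2
  have hlog : ∀ e, fderiv ℝ (detAmp G) z.2 e * (detAmp G z.2)⁻¹
      = -(fderiv ℝ (jac G) z.2 e * (jac G z.2)⁻¹) := by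
    intro e
    have hgn : ∀ᶠ ξ in 𝓝 z.2, (ξ, ξ) ∈ goodPairs G := by
      have h1 : Continuous (fun ξ : E d => (ξ, ξ)) := by fun_prop
      exact h1.continuousAt.eventually ((isOpen_goodPairs G).mem_nhds hz)
    have hdd : DifferentiableAt ℝ (fun ξ => (kur G ξ ξ).det) z.2 :=
      (contDiffAt_det_kur G hz.1).differentiableAt (by simp)
    have hc : ∃ s : ℝ, s ≠ 0 ∧ ∀ᶠ ξ in 𝓝 z.2, detAmp G ξ * jac G ξ = s := by
      rcases lt_or_gt_of_ne hz.2.2 with h | h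
      · refine ⟨-1, by norm_num, ?_⟩
        filter_upwards [hgn, hdd.continuousAt.eventually (isOpen_Iio.mem_nhds h)] with ξ h1 h2
        rw [detAmp, jac_eq G h1.1, abs_of_neg h2, neg_mul, mul_inv_cancel₀ h1.2.2]
      · refine ⟨1, by norm_num, ?_⟩
        filter_upwards [hgn, hdd.continuousAt.eventually (isOpen_Ioi.mem_nhds h)] with ξ h1 h2
        rw [detAmp, jac_eq G h1.1, abs_of_pos h2, mul_inv_cancel₀ h1.2.2]
    obtain ⟨s, -, hs⟩ := hc
    have h1 : fderiv ℝ (fun ξ => detAmp G ξ * jac G ξ) z.2 = 0 := by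
      have h2 : (fun ξ => detAmp G ξ * jac G ξ) =ᶠ[𝓝 z.2] fun _ => s := hs
      rw [h2.fderiv_eq, fderiv_fun_const]
      rfl
    rw [fderiv_fun_mul hD hJ] at h1
    have h2 := congrArg (fun L => L e) h1
    simp only [_root_.add_apply, _root_.smul_apply, smul_eq_mul, _root_.zero_apply] at h2
    field_simp
    linear_combination h2
  have hterm : ∀ j : Fin d, fderiv ℝ (fun p => fderiv ℝ (conjAmp G q b β ρ) p
        (0, single j 1)) (z, 0) ((single j 1, 0), 0)
      = ((1 / 2 * fderiv ℝ (detAmp G) z.2 (single j 1) * (detAmp G z.2)⁻¹ : ℝ) : ℂ)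
        * fderiv ℝ (r0 G q) z (single j 1, 0) := by
    intro j
    rw [← fderiv_comp_zero (smooth_dir hQ _)]
    have h1 : (fun w : Phase d => fderiv ℝ (conjAmp G q b β ρ) (w, 0)
          (0, single j 1)) =ᶠ[𝓝 z] fun w =>
        ((1 / 2 * fderiv ℝ (detAmp G) w.2 (single j 1) * (detAmp G w.2)⁻¹ : ℝ) : ℂ) * r0 G q w := by
      filter_upwards [hev] with w hw
      exact fderiv_conjAmp_zero G hq hQ hβ1 hb1 hw.1 hw.2 _
    rw [h1.fderiv_eq]
    have hV : DifferentiableAt ℝ (fun ξ => ((1 / 2 * fderiv ℝ (detAmp G) ξ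
        (single j 1) * (detAmp G ξ)⁻¹ : ℝ) : ℂ)) z.2 := by
      have h2 : ContDiffAt ℝ 1 (fderiv ℝ (detAmp G)) z.2 :=
        (contDiffAt_detAmp G hz).fderiv_right (m := 1) (by norm_cast)
      have h3 : DifferentiableAt ℝ (fun ξ => fderiv ℝ (detAmp G) ξ (single j 1)) z.2 :=
        (h2.differentiableAt (by simp)).clm_apply (differentiableAt_const _)
      exact Complex.ofRealCLM.differentiableAt.comp z.2 ((h3.const_mul _).mul (hD.inv hD0))
    have hVz : HasFDerivAt (fun w : Phase d => ((1 / 2 * fderiv ℝ (detAmp G) w.2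
        (single j 1) * (detAmp G w.2)⁻¹ : ℝ) : ℂ)) _ z :=
      HasFDerivAt.comp z hV.hasFDerivAt (hasFDerivAt_snd (𝕜 := ℝ) (p := z))
    have h4 := (hVz.fun_mul hr.hasFDerivAt).fderiv
    have h5 := congrArg (fun L : Phase d →L[ℝ] ℂ => L (single j 1, 0)) h4
    simp only [_root_.add_apply, _root_.smul_apply, ContinuousLinearMap.comp_apply,
      ContinuousLinearMap.coe_snd', map_zero, smul_eq_mul] at h5
    simpa using h5
  have hpj : ∀ j : Fin d, fderiv ℝ (fun w : Phase d => (jac G w.2 : ℂ)) z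
        (0, single j 1) = (fderiv ℝ (jac G) z.2 (single j 1) : ℝ)
      ∧ fderiv ℝ (fun w : Phase d => (jac G w.2 : ℂ)) z (single j 1, 0) = 0 := by
    intro j
    have h1 : HasFDerivAt (fun w : Phase d => (jac G w.2 : ℂ)) _ z :=
      HasFDerivAt.comp z Complex.ofRealCLM.hasFDerivAt
        (HasFDerivAt.comp (g := jac G) z hJ.hasFDerivAt (hasFDerivAt_snd (𝕜 := ℝ) (p := z)))
    rw [h1.fderiv]
    simp
  unfold subPart r1 poisson
  simp only [hterm, (hpj _).1, (hpj _).2, zero_mul, sub_zero]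
  rw [mul_sum, mul_sum]
  refine sum_congr rfl fun j _ => ?_
  rw [mul_assoc ½, hlog]
  have hJc : (jac G z.2 : ℂ) ≠ 0 := by exact_mod_cast hJ0
  push_cast
  field_simp

end ConjAmp

end

section

/-! ### Charts of frequency space adapted to the propagator -/

section FreqChart

variable {d : ℕ} (G : GeneralLinearGroup (Fin (d + 1)) ℝ)

/-- All pairs of points of the ball are good. -/
def GoodBall (ξ₀ : E d) (r : ℝ) : Prop :=
  0 < r ∧ ∀ ξ ∈ ball ξ₀ r, ∀ ξ' ∈ ball ξ₀ r, (ξ, ξ') ∈ goodPairs G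

/-- A globally defined smooth inverse `h` of `g` near `ξ₀`, and a cut-off Jacobian `D` of it. -/
structure FreqChart (ξ₀ : E d) (r : ℝ) (h : E d → E d) (D : E d → ℂ) : Prop where
  good : GoodBall G ξ₀ r
  smooth : C^∞ h
  smooth_jac : C^∞ D
  compact_jac : HasCompactSupport D
  bound : ∃ Λ, 0 ≤ Λ ∧ ∀ η, ‖fderiv ℝ h η‖ ≤ Λ
  left_inv : ∀ ξ ∈ ball ξ₀ (3 / 4 * r), h (gMap G ξ) = ξ
  jac_eq : ∀ ξ ∈ ball ξ₀ (5 / 8 * r), D (gMap G ξ) = ((|(kur G ξ ξ).det|⁻¹ : ℝ) : ℂ)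
  exists_of_jac : ∀ η, D η ≠ 0 → ∃ ξ ∈ ball ξ₀ (3 / 4 * r), gMap G ξ = η
  exists_ball : ∃ δ > 0, ∀ ξ ∈ closedBall ξ₀ (r / 4), ball (gMap G ξ) δ ⊆ gMap G '' ball ξ₀ (r / 2)

variable {G}

lemma GoodBall.exists_pullback {ξ₀ : E d} {r : ℝ} (hr : GoodBall G ξ₀ r)
    {F : Type*} [NormedAddCommGroup F] [NormedSpace ℝ F] {s : E d → F} {ρ : ℝ} (hρ : ρ < r)
    (hs : ∀ ξ ∈ ball ξ₀ r, ContDiffAt ℝ ∞ s ξ) (h0 : ∀ ξ ∉ ball ξ₀ ρ, s ξ = 0) :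
    ∃ S : E d → F, C^∞ S ∧ HasCompactSupport S ∧ (∀ ξ ∈ ball ξ₀ r, S (gMap G ξ) = s ξ) ∧
      ∀ η, S η ≠ 0 → ∃ ξ ∈ ball ξ₀ ρ, gMap G ξ = η := by
  classical
  obtain ⟨-, hopen, k, hk, hkd⟩ := exists_chart G isOpen_ball
    (fun ξ hξ => (hr.2 ξ hξ ξ hξ).1) (fun ξ hξ ξ' hξ' => (hr.2 ξ hξ ξ' hξ').2.2)
  set V := gMap G '' ball ξ₀ r with hV
  let S : E d → F := fun η => if η ∈ V then s (k η) else 0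
  have hS1 : ∀ η ∈ V, S η = s (k η) := fun η hη => if_pos hη
  have hS2 : ∀ ξ ∈ ball ξ₀ r, S (gMap G ξ) = s ξ := fun ξ hξ => by
    rw [hS1 _ ⟨ξ, hξ, rfl⟩, hk ξ hξ]
  have hS3 : ∀ η, S η ≠ 0 → ∃ ξ ∈ ball ξ₀ ρ, gMap G ξ = η := by
    intro η hη
    have h1 : η ∈ V := by
      by_contra h
      exact hη (if_neg h)
    obtain ⟨ξ, hξ, rfl⟩ := h1
    refine ⟨ξ, ?_, rfl⟩
    by_contra h
    exact hη (by rw [hS2 ξ hξ, h0 ξ h])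
  have hcomp : IsCompact (gMap G '' closedBall ξ₀ ρ) :=
    (isCompact_closedBall _ _).image (continuous_gMap G)
  have hz : ∀ η ∉ gMap G '' closedBall ξ₀ ρ, S η = 0 := by
    intro η hη
    by_contra h
    obtain ⟨ξ, hξ, rfl⟩ := hS3 η h
    exact hη ⟨ξ, ball_subset_closedBall hξ, rfl⟩
  refine ⟨S, contDiff_of_contDiffAt hcomp.isClosed
    (Set.image_mono (closedBall_subset_ball hρ)) (V := V) (fun η hη => ?_) hz,
    .intro hcomp hz, hS2, hS3⟩
  have h1 : S =ᶠ[𝓝 η] fun η => s (k η) :=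
    Filter.eventuallyEq_of_mem (hopen.mem_nhds hη) hS1
  refine ContDiffAt.congr_of_eventuallyEq ?_ h1
  have h2 := hkd η hη
  obtain ⟨ξ, hξ, rfl⟩ := hη
  refine ContDiffAt.fun_comp _ ?_ h2
  rw [hk ξ hξ]
  exact hs ξ hξ

lemma GoodBall.isOpen_image {ξ₀ : E d} {r s : ℝ} (hr : GoodBall G ξ₀ r) (hs : s ≤ r) :
    IsOpen (gMap G '' ball ξ₀ s) :=
  (exists_chart G isOpen_ball
    (fun ξ hξ => (hr.2 ξ (ball_subset_ball hs hξ) ξ (ball_subset_ball hs hξ)).1)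
    (fun ξ hξ ξ' hξ' => (hr.2 ξ (ball_subset_ball hs hξ) ξ' (ball_subset_ball hs hξ')).2.2)).2.1

lemma GoodBall.exists_freqChart {ξ₀ : E d} {r : ℝ} (hr : GoodBall G ξ₀ r) :
    ∃ (h : E d → E d) (D : E d → ℂ), FreqChart G ξ₀ r h D := by
  have r0 := hr.1
  let κ₁ : ContDiffBump ξ₀ := ⟨3 / 4 * r, 7 / 8 * r, by linarith, by linarith⟩
  let κ₂ : ContDiffBump ξ₀ := ⟨5 / 8 * r, 3 / 4 * r, by linarith, by linarith⟩
  obtain ⟨S, hS, hSc, hS1, -⟩ := hr.exists_pullback (s := fun ξ => κ₁ ξ • (ξ - ξ₀))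
    (ρ := 7 / 8 * r) (by linarith)
    (fun ξ _ => κ₁.contDiff.contDiffAt.smul (contDiffAt_id.sub contDiffAt_const))
    (fun ξ hξ => by
      have h1 : κ₁ ξ = 0 := κ₁.zero_of_le_dist (not_lt.1 hξ)
      simp only [h1, zero_smul])
  obtain ⟨D, hD, hDc, hD1, hD2⟩ := hr.exists_pullback
    (s := fun ξ => ((κ₂ ξ * |(kur G ξ ξ).det|⁻¹ : ℝ) : ℂ)) (ρ := 3 / 4 * r) (by linarith)
    (fun ξ hξ => by
      have h1 := hr.2 ξ hξ ξ hξ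
      exact ContDiffAt.fun_comp ξ Complex.ofRealCLM.contDiff.contDiffAt
        (κ₂.contDiff.contDiffAt.mul (contDiffAt_inv_abs (contDiffAt_det_kur G h1.1) h1.2.2)))
    (fun ξ hξ => by
      have h1 : κ₂ ξ = 0 := κ₂.zero_of_le_dist (not_lt.1 hξ)
      simp only [h1, zero_mul, Complex.ofReal_zero])
  refine ⟨fun η => ξ₀ + S η, D, hr, contDiff_const.add hS, hD, hDc, ?_, ?_, ?_, hD2, ?_⟩
  · obtain ⟨C, hC⟩ := (hSc.fderiv (𝕜 := ℝ)).exists_bound_of_continuous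
      (hS.continuous_fderiv (by simp))
    refine ⟨C, (norm_nonneg _).trans (hC 0), fun η => ?_⟩
    rw [fderiv_const_add]
    exact hC η
  · intro ξ hξ
    have h1 : κ₁ ξ = 1 := κ₁.one_of_mem_closedBall (ball_subset_closedBall hξ)
    show ξ₀ + S (gMap G ξ) = ξ
    rw [hS1 ξ (ball_subset_ball (by linarith) hξ), h1, one_smul, add_sub_cancel]
  · intro ξ hξ
    have h1 : κ₂ ξ = 1 := κ₂.one_of_mem_closedBall (ball_subset_closedBall hξ)
    rw [hD1 ξ (ball_subset_ball (by linarith) hξ), h1, one_mul]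
  · have hcomp : IsCompact (gMap G '' closedBall ξ₀ (r / 4)) :=
      (isCompact_closedBall _ _).image (continuous_gMap G)
    obtain ⟨δ, hδ, h1⟩ := hcomp.exists_thickening_subset_open
      (hr.isOpen_image (s := r / 2) (by linarith))
      (Set.image_mono (closedBall_subset_ball (by linarith)))
    refine ⟨δ, hδ, fun ξ hξ => subset_trans ?_ h1⟩
    exact ball_subset_thickening (Set.mem_image_of_mem _ hξ) _

variable {ξ₀ : E d} {r : ℝ} {h : E d → E d} {D : E d → ℂ}

lemma FreqChart.exists_ball_of_ne_zero (H : FreqChart G ξ₀ r h D) {η : E d} (hη : D η ≠ 0) :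
    h η ∈ ball ξ₀ (3 / 4 * r) ∧ gMap G (h η) = η := by
  obtain ⟨ξ, hξ, rfl⟩ := H.exists_of_jac η hη
  rw [H.left_inv ξ hξ]
  exact ⟨hξ, rfl⟩

lemma GoodBall.norm_lt_one (H : GoodBall G ξ₀ r) {ξ : E d} (hξ : ξ ∈ ball ξ₀ r) :
    ‖ξ‖ < 1 := (H.2 ξ hξ ξ hξ).1

lemma FreqChart.integral_eq (H : FreqChart G ξ₀ r h D) (F : E d → ℂ) {f : E d → ℂ}
    (hf : ∀ ξ, r / 2 ≤ ‖ξ - ξ₀‖ → f ξ = 0) :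
    ∫ η, F η * (f (h η) * D η) = ∫ ξ, F (gMap G ξ) * f ξ := by
  have r0 := H.good.1
  have hsub : ball ξ₀ (5 / 8 * r) ⊆ ball ξ₀ r := ball_subset_ball (by linarith)
  have hsub' : ball ξ₀ (5 / 8 * r) ⊆ ball ξ₀ (3 / 4 * r) :=
    ball_subset_ball (by linarith)
  have h1 : ∫ η, F η * (f (h η) * D η)
      = ∫ η in gMap G '' ball ξ₀ (5 / 8 * r), F η * (f (h η) * D η) := by
    refine (setIntegral_eq_integral_of_forall_compl_eq_zero fun η hη => ?_).symm
    by_cases hD : D η = 0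
    · rw [hD, mul_zero, mul_zero]
    · obtain ⟨h2, h3⟩ := H.exists_ball_of_ne_zero hD
      rw [hf _ ?_, zero_mul, mul_zero]
      by_contra h4
      exact hη ⟨h η, by rw [mem_ball_iff_norm]; linarith, h3⟩
  rw [h1, setIntegral_image_gMap G isOpen_ball
    (fun ξ hξ ξ' hξ' => H.good.2 ξ (hsub hξ) ξ' (hsub hξ'))]
  rw [setIntegral_congr_fun (g := fun ξ => F (gMap G ξ) * f ξ) isOpen_ball.measurableSet
    fun ξ hξ => ?_]
  · refine setIntegral_eq_integral_of_forall_compl_eq_zero fun ξ hξ => ?_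
    rw [hf ξ ?_, mul_zero]
    by_contra h4
    exact hξ (by rw [mem_ball_iff_norm]; linarith)
  · have h2 := (H.good.2 ξ (hsub hξ) ξ (hsub hξ)).2.2
    simp only
    rw [H.left_inv ξ (hsub' hξ), H.jac_eq ξ hξ]
    have h3 : ((|(kur G ξ ξ).det| : ℝ) : ℂ) ≠ 0 := by exact_mod_cast abs_ne_zero.2 h2
    push_cast at h3 ⊢
    field_simp

lemma FreqChart.uHat_eq (H : FreqChart G ξ₀ r h D) (ħ : ℝ) {f : E d → ℂ}
    (hf : ∀ ξ, r / 2 ≤ ‖ξ - ξ₀‖ → f ξ = 0) :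
    uHat G ħ f = invFourierH ħ (fun η => f (h η) * D η) := by
  funext y
  unfold uHat invFourierH
  congr 1
  rw [H.integral_eq (fun η => osc ħ (inner ℝ y η)) hf]

end FreqChart

end

section

/-! ### Conjugation of the near diagonal operator -/

section Conjugation

variable {d : ℕ} {G : GeneralLinearGroup (Fin (d + 1)) ℝ}

lemma integral_comp_inverse {A : E d →L[ℝ] E d} (hA : A.det ≠ 0) (F : E d → ℂ) :
    ∫ x, F (A.inverse x) = ((|A.det| : ℝ) : ℂ) * ∫ x, F x := by
  have hinv := isInvertible_of_det hA
  obtain ⟨e, he⟩ := hinv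
  have hl : ∀ x, A.inverse (A x) = x := fun x => by rw [← he]; simp
  have hr : ∀ x, A (A.inverse x) = x := fun x => by rw [← he]; simp
  have h1 := integral_image_eq_integral_abs_det_fderiv_smul volume MeasurableSet.univ
    (f := A) (f' := fun _ => A) (fun x _ => A.hasFDerivAt.hasFDerivWithinAt)
    (fun x _ y _ hxy => by rw [← hl x, ← hl y]; exact congrArg _ hxy) (fun x => F (A.inverse x))
  have h2 : (A : E d → E d) '' Set.univ = Set.univ := by
    rw [Set.image_univ]
    exact Set.range_eq_univ.2 fun x => ⟨A.inverse x, hr x⟩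
  rw [h2, setIntegral_univ, setIntegral_univ] at h1
  rw [h1, integral_smul, Complex.real_smul]
  simp only [hl]

lemma fourierH_comp_inverse_adjoint {M : E d →L[ℝ] E d} (hM : M.det ≠ 0) (ħ : ℝ) (a : E d → ℂ)
    (θ : E d) : fourierH ħ (fun x => a ((adjoint M).inverse x)) θ
      = ((|M.det| : ℝ) : ℂ) * fourierH ħ a (M θ) := by
  have hA : (adjoint M).det ≠ 0 := by rwa [det_adjoint]
  have hinv := isInvertible_of_det hA
  unfold fourierH
  have h1 := integral_comp_inverse hA (fun X => osc ħ (-(inner ℝ (adjoint M X) θ)) * a X)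
  rw [det_adjoint] at h1
  have h2 : ∀ x, adjoint M ((adjoint M).inverse x) = x := by
    obtain ⟨e, he⟩ := hinv
    intro x
    rw [← he]
    simp
  simp only [h2] at h1
  rw [h1]
  simp only [ContinuousLinearMap.adjoint_inner_left]

variable {ξ₀ : E d} {r : ℝ} {h : E d → E d} {D : E d → ℂ} {b β ρ : E d → ℂ}

/-- The cut-offs are adapted to the chart. -/
structure CutoffsAdapted (G : GeneralLinearGroup (Fin (d + 1)) ℝ) (ξ₀ : E d) (r : ℝ)
    (b β ρ : E d → ℂ) : Prop where
  mem_image : ∀ ξ ∈ ball ξ₀ (r / 4), ∀ η, b (η - gMap G ξ) ≠ 0 → η ∈ gMap G '' ball ξ₀ (r / 2)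
  diff_eq_one : ∀ ξ ∈ ball ξ₀ (r / 2), ∀ ξ' ∈ ball ξ₀ (r / 4),
    b (gMap G ξ - gMap G ξ') ≠ 0 → β (ξ - ξ') = 1
  mean_eq_one : ∀ ζ ∈ ball ξ₀ (r / 2), ρ ζ = 1
  diff_eq_zero : ∀ θ, r / 8 ≤ ‖θ‖ → β θ = 0

lemma qHat_conjAmp (q : Phase d → ℂ) (ħ : ℝ) {ξ ξ' : E d} (hg : (ξ, ξ') ∈ goodPairs G)
    (hβ : β (ξ - ξ') = 1) (hρ : ρ (½ • (ξ + ξ')) = 1) :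
    qHat (conjAmp G q b β ρ) ħ (½ • (ξ + ξ')) (ξ - ξ') = detAmp G ξ
      * qHat (nearAmp q b) ħ (½ • (gMap G ξ + gMap G ξ')) (gMap G ξ - gMap G ξ') := by
  rw [qHat_nearAmp]
  unfold qHat conjAmp evenAmp
  simp only [freqPair_midpoint, hβ, hρ]
  have h1 := fourierH_comp_inverse_adjoint hg.2.2 ħ
    (fun X => q (X, ½ • (gMap G ξ + gMap G ξ'))) (ξ - ξ')
  rw [gMap_sub_gMap G hg.1 hg.2.1]
  have h3 : ((|(kur G ξ ξ').det| : ℝ) : ℂ) ≠ 0 := by exact_mod_cast abs_ne_zero.2 hg.2.2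
  have h4 : fourierH ħ (fun X => q (X, ½ • (gMap G ξ + gMap G ξ'))) (kur G ξ ξ' (ξ - ξ'))
      = ((|(kur G ξ ξ').det| : ℝ) : ℂ)⁻¹ * fourierH ħ (fun x =>
        q ((adjoint (kur G ξ ξ')).inverse x, ½ • (gMap G ξ + gMap G ξ'))) (ξ - ξ') := by
    rw [h1, ← mul_assoc, inv_mul_cancel₀ h3, one_mul]
  rw [h4]
  unfold fourierH
  rw [← integral_const_mul, ← integral_const_mul, ← integral_const_mul]
  refine integral_congr_ae (.of_forall fun x => ?_)
  simp only
  push_cast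
  ring

lemma FreqChart.ampOp_nearAmp (H : FreqChart G ξ₀ r h D) (hc : CutoffsAdapted G ξ₀ r b β ρ)
    (q : Phase d → ℂ) (ħ : ℝ) {f : E d → ℂ} (hf : ∀ ξ, r / 4 ≤ ‖ξ - ξ₀‖ → f ξ = 0) (η : E d) :
    ampOp (nearAmp q b) ħ (fun η => f (h η) * D η) η
      = ampOp (conjAmp G q b β ρ) ħ f (h η) * D η := by
  have r0 := H.good.1
  unfold ampOp
  rw [H.integral_eq (fun η' => qHat (nearAmp q b) ħ (½ • (η + η')) (η - η'))
    (fun ξ hξ => hf ξ (by linarith)), mul_assoc, ← integral_mul_const]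
  congr 1
  refine integral_congr_ae (.of_forall fun ξ' => ?_)
  simp only
  by_cases hξ' : r / 4 ≤ ‖ξ' - ξ₀‖
  · simp only [hf _ hξ', mul_zero, zero_mul]
  have m1 : ξ' ∈ ball ξ₀ (r / 4) := by rw [mem_ball_iff_norm]; linarith
  have hD : ∀ ξ ∈ ball ξ₀ (3 / 4 * r), gMap G ξ = η → h η = ξ := by
    rintro ξ hξ rfl
    exact H.left_inv ξ hξ
  by_cases hb : b (η - gMap G ξ') = 0
  · rw [qHat_nearAmp, hb, zero_mul, zero_mul]
    by_cases hDη : D η = 0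
    · rw [hDη, mul_zero]
    · obtain ⟨ξ, hξ, rfl⟩ := H.exists_of_jac η hDη
      rw [H.left_inv ξ hξ]
      unfold qHat conjAmp
      simp only [freqPair_midpoint, hb, mul_zero, zero_mul, integral_zero]
  · obtain ⟨ξ, hξ, rfl⟩ := hc.mem_image ξ' m1 η hb
    rw [H.left_inv ξ (ball_subset_ball (by linarith) hξ),
      H.jac_eq ξ (ball_subset_ball (by linarith) hξ)]
    have hgood := H.good.2 ξ (ball_subset_ball (by linarith) hξ) ξ'
      (ball_subset_ball (by linarith) m1)
    have hgood' := H.good.2 ξ (ball_subset_ball (by linarith) hξ) ξ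
      (ball_subset_ball (by linarith) hξ)
    have hmid : ½ • (ξ + ξ') ∈ ball ξ₀ (r / 2) := by
      rw [smul_add]
      exact convex_ball ξ₀ (r / 2) hξ (ball_subset_ball (by linarith) m1) (by norm_num)
        (by norm_num) (by norm_num)
    rw [qHat_conjAmp q ħ hgood (hc.diff_eq_one ξ hξ ξ' m1 hb) (hc.mean_eq_one _ hmid)]
    have h3 : (detAmp G ξ : ℂ) ≠ 0 := by
      unfold detAmp
      exact_mod_cast abs_ne_zero.2 hgood'.2.2
    unfold detAmp at h3 ⊢
    push_cast
    field_simp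

end Conjugation

end

section

/-! ### Transported wave packets -/

section Transport

variable {d : ℕ}

lemma meas_invFourierH (ħ : ℝ) {F : E d → ℂ} (hF : StronglyMeasurable F) :
    StronglyMeasurable (invFourierH ħ F) := by
  have h1 : StronglyMeasurable (fun p : E d × E d => osc ħ (inner ℝ p.1 p.2) * F p.2) :=
    (Continuous.comp' (contDiff_osc ħ (n := 0)).continuous (by fun_prop)).stronglyMeasurable.mul
      (hF.comp_measurable measurable_snd)
  exact (StronglyMeasurable.integral_prod_right h1).const_mul _

lemma stronglyMeasurable_fourierH (ħ : ℝ) {F : E d → ℂ} (hF : StronglyMeasurable F) :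
    StronglyMeasurable (fourierH ħ F) := by
  have h1 : StronglyMeasurable (fun p : E d × E d => osc ħ (-(inner ℝ p.2 p.1)) * F p.2) :=
    (Continuous.comp' (contDiff_osc ħ (n := 0)).continuous (by fun_prop)).stronglyMeasurable.mul
      (hF.comp_measurable measurable_snd)
  exact StronglyMeasurable.integral_prod_right h1

lemma contDiff_osc_neg_inner {h : E d → E d} (hh : C^∞ h) :
    C^∞ (fun p : E d × E d => -(inner ℝ p.2 (h p.1) : ℝ)) :=
  (contDiff_snd.inner ℝ (ContDiff.fun_comp hh contDiff_fst)).neg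

lemma contDiff_transport_amp {χ : Phase d → ℂ} (hχ : C^∞ χ) {h : E d → E d}
    (hh : C^∞ h) {D : E d → ℂ} (hD : C^∞ D) :
    C^∞ (fun p : E d × E d => χ (p.1, h p.2) * D p.2) :=
  (ContDiff.fun_comp hχ (contDiff_fst.prodMk (ContDiff.fun_comp hh contDiff_snd))).mul
    (ContDiff.fun_comp hD contDiff_snd)

lemma compactSupp_transport {χ : Phase d → ℂ} (hc : HasCompactSupport χ) (h : E d → E d)
    {D : E d → ℂ} (hDc : HasCompactSupport D) :
    HasCompactSupport (fun p : E d × E d => χ (p.1, h p.2) * D p.2) := by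
  obtain ⟨ρ, -, hρ⟩ := exists_radius_phase hc
  refine .intro ((isCompact_closedBall (0 : E d) ρ).prod hDc) fun p hp => ?_
  by_cases h1 : p.2 ∈ tsupport D
  · rw [hρ (p.1, h p.2) (Or.inl ?_), zero_mul]
    by_contra h2
    exact hp ⟨by rw [mem_closedBall_zero_iff]; exact not_lt.1 h2, h1⟩
  · rw [image_eq_zero_of_notMem_tsupport h1, mul_zero]

lemma packet_comp_mul_eq_oscInt (χ : Phase d → ℂ) (h : E d → E d) (D : E d → ℂ) (ħ : ℝ)
    (ψ : E d → ℂ) : (fun η => packet χ ħ ψ (h η) * D η)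
      = oscInt (fun p : E d × E d => -(inner ℝ p.2 (h p.1) : ℝ)) ħ
        (fun p : E d × E d => χ (p.2, h p.1) * D p.1) ψ := by
  funext η
  unfold packet oscInt
  rw [← integral_mul_const]
  congr 1
  funext w
  ring

lemma exists_norm_oscInt_le_l2 {a : E d × E d → ℂ} (ha : Continuous a) (hc : HasCompactSupport a)
    (Φ : E d × E d → ℝ) : ∃ C, 0 ≤ C ∧ ∀ (ħ : ℝ) (ψ : 𝓢(E d, ℂ)) (z : E d),
      ‖oscInt Φ ħ a ψ z‖ ≤ C * l2 ψ := by
  obtain ⟨A, hA⟩ := hc.exists_bound_of_continuous ha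
  have hA0 : 0 ≤ A := (norm_nonneg _).trans (hA 0)
  have hk : IsCompact (Prod.snd '' tsupport a) := IsCompact.image hc continuous_snd
  obtain ⟨C, hC0, hC⟩ := exists_setIntegral_norm_le_l2 hk
  refine ⟨A * C, mul_nonneg hA0 hC0, fun ħ ψ z => ?_⟩
  unfold oscInt
  have h0 : ∀ t ∉ Prod.snd '' tsupport a, osc ħ (Φ (z, t)) * (a (z, t) * ψ t) = 0 := by
    intro t ht
    rw [image_eq_zero_of_notMem_tsupport (f := a) fun h => ht ⟨_, h, rfl⟩, zero_mul, mul_zero]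
  rw [← setIntegral_eq_integral_of_forall_compl_eq_zero h0]
  refine (norm_integral_le_integral_norm _).trans ?_
  have h1 : ∫ t in Prod.snd '' tsupport a, ‖osc ħ (Φ (z, t)) * (a (z, t) * ψ t)‖
      ≤ ∫ t in Prod.snd '' tsupport a, A * ‖ψ t‖ := by
    refine integral_mono_of_nonneg (.of_forall fun t => norm_nonneg _)
      ((ψ.integrable (μ := volume)).norm.const_mul A).integrableOn
      (.of_forall fun t => ?_)
    simp only [norm_mul, norm_osc, one_mul]
    exact mul_le_mul_of_nonneg_right (hA _) (norm_nonneg _)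
  rw [integral_const_mul] at h1
  calc _ ≤ A * ∫ t in Prod.snd '' tsupport a, ‖ψ t‖ := h1
    _ ≤ A * (C * l2 ψ) := mul_le_mul_of_nonneg_left (hC ψ) hA0
    _ = A * C * l2 ψ := by ring

variable {χ : Phase d → ℂ} {h : E d → E d} {D : E d → ℂ}

lemma compactSupp_transport_amp' (hc : HasCompactSupport χ) (h : E d → E d)
    (hDc : HasCompactSupport D) :
    HasCompactSupport (fun p : E d × E d => χ (p.2, h p.1) * D p.1) :=
  (compactSupp_transport hc h hDc).comp_homeomorph (Homeomorph.prodComm (E d) (E d))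

lemma contDiff_transport_amp' (hχ : C^∞ χ) (hh : C^∞ h) (hD : C^∞ D) :
    C^∞ (fun p : E d × E d => χ (p.2, h p.1) * D p.1) :=
  ContDiff.fun_comp (g := fun p : E d × E d => χ (p.1, h p.2) * D p.2)
    (contDiff_transport_amp hχ hh hD) (contDiff_snd.prodMk contDiff_fst)

lemma freqSupp_transport {R : ℝ} (hχ : C^∞ χ) (hc : HasCompactSupport χ)
    (hh : C^∞ h) (hD : FreqSupp R D) (ħ : ℝ) (ψ : 𝓢(E d, ℂ)) :
    FreqSupp R (fun η => packet χ ħ ψ (h η) * D η) :=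
  ⟨(ContDiff.fun_comp (contDiff_packet hχ hc ħ ψ) hh).mul hD.1, fun η hη => by
    simp only [hD.2 η hη, mul_zero]⟩

lemma exists_freqBound_transport (hχ : C^∞ χ) (hc : HasCompactSupport χ)
    (hh : C^∞ h) (hD : C^∞ D) (hDc : HasCompactSupport D) (k : ℕ) :
    ∃ C, 0 ≤ C ∧ ∀ ħ, 0 < ħ → ħ ≤ 1 → ∀ ψ : 𝓢(E d, ℂ),
      FreqBound ħ k (C * l2 ψ) (fun η => packet χ ħ ψ (h η) * D η) := by
  have hΦ := contDiff_osc_neg_inner hh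
  have key := fun j : ℕ => exists_deriv_oscInt_le (ι := 𝓢(E d, ℂ)) hΦ
    (W := {a | C^∞ a ∧ HasCompactSupport a}) (fun a ha => ha)
    (fun a ha v => ⟨(contDiff_const.mul (Complex.ofRealCLM.contDiff.comp
        ((hΦ.fderiv_right (m := ∞) (by simp)).clm_apply contDiff_const))).mul ha.1,
      ha.2.mul_left⟩)
    (fun a ha v => ⟨smooth_dir ha.1 _, compactSupp_dir ha.2 _⟩)
    (f := fun ψ => ψ) (fun ψ => ψ.smooth ⊤) (wt := fun _ ψ => l2 ψ)
    (fun a ha => by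
      obtain ⟨C, h0, h1⟩ := exists_norm_oscInt_le_l2 ha.1.continuous ha.2
        (fun p : E d × E d => -(inner ℝ p.2 (h p.1) : ℝ))
      exact ⟨C, h0, fun ħ _ _ ψ z => h1 ħ ψ z⟩) j
    (a := fun p : E d × E d => χ (p.2, h p.1) * D p.1)
    ⟨contDiff_transport_amp' hχ hh hD, compactSupp_transport_amp' hc h hDc⟩
  choose C hC0 hC using key
  refine ⟨∑ j ∈ Finset.range (k + 1), C j, sum_nonneg fun j _ => hC0 j, fun ħ h0 h1 ψ j hj η => ?_⟩
  rw [packet_comp_mul_eq_oscInt]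
  refine (hC j ħ h0 h1 ψ η).trans (mul_le_mul_of_nonneg_right ?_ (l2_nonneg ψ))
  exact single_le_sum (f := C) (fun i _ => hC0 i) (Finset.mem_range.2 (by omega))

lemma exists_pow_mul_transport_le (hχ : C^∞ χ) (hc : HasCompactSupport χ)
    (hh : C^∞ h) (hD : C^∞ D) (hDc : HasCompactSupport D) (n : ℕ) :
    ∃ C, 0 ≤ C ∧ ∀ ħ, 0 < ħ → ħ ≤ 1 → ∀ (ψ : 𝓢(E d, ℂ)) y, ⟪y⟫ ^ n
      * ‖invFourierH ħ (fun η => packet χ ħ ψ (h η) * D η) y‖ * ħ ^ d ≤ C * l2 ψ := by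
  obtain ⟨R, -, hR⟩ := exists_radius hDc
  obtain ⟨C₁, h10, h1⟩ := exists_pow_mul_invFourierH_le (d := d) (R := R) n
  obtain ⟨C₂, h20, h2⟩ := exists_freqBound_transport hχ hc hh hD hDc n
  refine ⟨C₁ * C₂, mul_nonneg h10 h20, fun ħ p0 p1 ψ y => ?_⟩
  have h3 := h1 ħ p0 _ _ (freqSupp_transport hχ hc hh ⟨hD, hR⟩ ħ ψ) (h2 ħ p0 p1 ψ) y
  calc _ ≤ C₁ * ‖planck d ħ‖ * (C₂ * l2 ψ) * ħ ^ d := mul_le_mul_of_nonneg_right h3 (by positivity)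
    _ = C₁ * (C₂ * l2 ψ) * (‖planck d ħ‖ * ħ ^ d) := by ring
    _ ≤ C₁ * (C₂ * l2 ψ) * 1 := mul_le_mul_of_nonneg_left (planck_le p0)
        (mul_nonneg h10 (mul_nonneg h20 (l2_nonneg ψ)))
    _ = C₁ * C₂ * l2 ψ := by ring

/-- Fubini for oscillatory superpositions. -/
lemma invFourierH_superposition {m : E d × E d → ℂ} (hm : Continuous m) {A R : ℝ}
    (hA : ∀ p, ‖m p‖ ≤ A) (hR : ∀ w η, R < ‖η‖ → m (w, η) = 0) (hh : Continuous h) {v : E d → ℂ}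
    (hv : Integrable v) (ħ : ℝ) (y : E d) :
    invFourierH ħ (fun η => ∫ w, osc ħ (-(inner ℝ w (h η))) * (m (w, η) * v w)) y
      = planck d ħ * ∫ w, propKer h m ħ y w w * v w := by
  unfold invFourierH propKer
  congr 1
  have hosc := (contDiff_osc ħ (n := 0)).continuous
  have hA0 : 0 ≤ A := (norm_nonneg _).trans (hA 0)
  have hint : Integrable (fun p : E d × E d => osc ħ (inner ℝ y p.1 - inner ℝ p.2 (h p.1))
      * m (p.2, p.1) * v p.2) (volume.prod volume) := by
    have h1 : Integrable (fun p : E d × E d =>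
        (closedBall (0 : E d) R).indicator (fun _ => A) p.1 * ‖v p.2‖)
        (volume.prod volume) := by
      refine Integrable.mul_prod ?_ hv.norm
      exact (integrable_indicator_iff isClosed_closedBall.measurableSet).2
        (integrableOn_const (isCompact_closedBall _ _).measure_lt_top.ne)
    refine h1.mono' ?_ (.of_forall fun p => ?_)
    · refine AEStronglyMeasurable.mul (Continuous.aestronglyMeasurable ?_)
        (hv.aestronglyMeasurable.comp_snd)
      refine Continuous.mul (Continuous.comp' hosc ?_) (Continuous.comp' hm (by fun_prop))
      exact (continuous_const.inner continuous_fst).sub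
        (continuous_snd.inner (Continuous.comp' hh continuous_fst))
    · rw [norm_mul, norm_mul, norm_osc, one_mul]
      refine mul_le_mul_of_nonneg_right ?_ (norm_nonneg _)
      by_cases h2 : ‖p.1‖ ≤ R
      · rw [Set.indicator_of_mem (by rwa [mem_closedBall_zero_iff])]
        exact hA _
      · rw [hR _ _ (not_le.1 h2), norm_zero]
        exact Set.indicator_nonneg (fun _ _ => hA0) _
  have h3 := integral_integral_swap (f := fun η w =>
    osc ħ (inner ℝ y η - inner ℝ w (h η)) * m (w, η) * v w) hint
  have h4 : ∀ η, osc ħ (inner ℝ y η) * ∫ w, osc ħ (-(inner ℝ w (h η))) * (m (w, η) * v w)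
      = ∫ w, osc ħ (inner ℝ y η - inner ℝ w (h η)) * m (w, η) * v w := by
    intro η
    rw [← integral_const_mul]
    congr 1
    funext w
    rw [sub_eq_add_neg, osc_add]
    ring
  have h5 : ∀ w, (∫ η, osc ħ (inner ℝ y η - inner ℝ w (h η)) * m (w, η)) * v w
      = ∫ η, osc ħ (inner ℝ y η - inner ℝ w (h η)) * m (w, η) * v w := fun w =>
    (integral_mul_const _ _).symm
  simp only [h4, h5]
  exact h3

lemma invFourierH_transport (hχ : C^∞ χ) (hc : HasCompactSupport χ)
    (hh : C^∞ h) (hD : C^∞ D) (hDc : HasCompactSupport D) (ħ : ℝ)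
    (ψ : 𝓢(E d, ℂ)) (y : E d) : invFourierH ħ (fun η => packet χ ħ ψ (h η) * D η) y
      = planck d ħ * ∫ w, propKer h (fun p : E d × E d => χ (p.1, h p.2) * D p.2) ħ y w w * ψ w := by
  have hm := (contDiff_transport_amp hχ hh hD).continuous
  obtain ⟨A, hA⟩ := (compactSupp_transport hc h hDc).exists_bound_of_continuous hm
  obtain ⟨R, -, hR⟩ := exists_radius hDc
  rw [← invFourierH_superposition (R := R) hm hA (fun w η hη => by simp only [hR η hη, mul_zero])
    hh.continuous ψ.integrable]
  congr 1
  funext η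
  unfold packet
  rw [← integral_mul_const]
  congr 1
  funext w
  ring

lemma exists_weight_mul_transport_tail_le (hχ : C^∞ χ)
    (hc : HasCompactSupport χ) (hh : C^∞ h) (hD : C^∞ D)
    (hDc : HasCompactSupport D) {Λ : ℝ} (hΛ : 0 ≤ Λ) (hb : ∀ η, ‖fderiv ℝ h η‖ ≤ Λ) {w₀ c : ℝ}
    (hw₀ : ∀ w ξ, w₀ < ‖w‖ → χ (w, ξ) = 0) (hw0 : 0 ≤ w₀) (hcw : (2 * Λ + 1) * (1 + w₀) ≤ c)
    (n N : ℕ) : ∃ C, 0 ≤ C ∧ ∀ ħ, 0 < ħ → ħ ≤ 1 → ∀ (ψ : 𝓢(E d, ℂ)) y, c ≤ ‖y‖ →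
      ⟪y⟫ ^ n * ‖invFourierH ħ (fun η => packet χ ħ ψ (h η) * D η) y‖ ≤ C * ħ ^ N * l2 ψ := by
  set m : E d × E d → ℂ := fun p => χ (p.1, h p.2) * D p.2 with hm
  obtain ⟨C₁, h10, h1⟩ := exists_norm_propKer_le hh (contDiff_transport_amp hχ hh hD)
    (compactSupp_transport hc h hDc) hΛ (fun p _ => hb p.2) (n + N + d)
  obtain ⟨C₂, h20, h2⟩ := exists_setIntegral_norm_le_l2 (isCompact_closedBall (0 : E d) w₀)
  refine ⟨2 ^ n * C₁ * C₂, by positivity, fun ħ p0 p1 ψ y hy => ?_⟩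
  rw [invFourierH_transport hχ hc hh hD hDc]
  have hy1 : 1 ≤ ‖y‖ := by nlinarith
  have hy0 : 0 < ‖y‖ := by linarith
  have h3 : ∀ w ∉ closedBall (0 : E d) w₀, propKer h m ħ y w w * ψ w = 0 := by
    intro w hw
    have h4 : ∀ η, m (w, η) = 0 := fun η => by
      simp only [hm]
      rw [hw₀ w _ (by rw [mem_closedBall_zero_iff] at hw; exact not_le.1 hw), zero_mul]
    unfold propKer
    simp only [h4, mul_zero, integral_zero, zero_mul]
  rw [← setIntegral_eq_integral_of_forall_compl_eq_zero h3, norm_mul]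
  have h5 : ‖∫ w in closedBall (0 : E d) w₀, propKer h m ħ y w w * ψ w‖
      ≤ C₁ * (ħ / ‖y‖) ^ (n + N + d) * (C₂ * l2 ψ) := by
    have h6 : ‖∫ w in closedBall (0 : E d) w₀, propKer h m ħ y w w * ψ w‖
        ≤ ∫ w in closedBall (0 : E d) w₀, C₁ * (ħ / ‖y‖) ^ (n + N + d) * ‖ψ w‖ := by
      refine norm_integral_le_of_norm_le
        ((ψ.integrable (μ := volume)).norm.const_mul _).integrableOn
        ((ae_restrict_iff' isClosed_closedBall.measurableSet).2 (.of_forall fun w hw => ?_))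
      rw [norm_mul]
      refine mul_le_mul_of_nonneg_right (h1 ħ p0 y w w ?_) (norm_nonneg _)
      rw [mem_closedBall_zero_iff] at hw
      refine le_trans (le_trans ?_ hcw) hy
      exact mul_le_mul_of_nonneg_left (by linarith) (by linarith)
    rw [integral_const_mul] at h6
    exact h6.trans (mul_le_mul_of_nonneg_left (h2 ψ) (by positivity))
  have h7 : ⟪y⟫ ^ n ≤ 2 ^ n * ‖y‖ ^ n := by
    rw [← mul_pow]
    exact pow_le_pow_left₀ (by positivity) (by linarith) n
  have h8 : ‖y‖ ^ n * (ħ / ‖y‖) ^ (n + N + d) ≤ ħ ^ N * ħ ^ d := by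
    have e1 : ‖y‖ ^ n * (ħ / ‖y‖) ^ (n + N + d) = ħ ^ n * ((ħ / ‖y‖) ^ N * (ħ / ‖y‖) ^ d) := by
      rw [pow_add, pow_add, mul_assoc, ← mul_assoc, ← mul_pow, mul_div_cancel₀ _ hy0.ne']
    have e2 : ħ / ‖y‖ ≤ ħ := div_le_self p0.le hy1
    have e3 : 0 ≤ ħ / ‖y‖ := by positivity
    rw [e1]
    calc _ ≤ 1 * (ħ ^ N * ħ ^ d) := mul_le_mul (pow_le_one₀ p0.le p1)
          (mul_le_mul (pow_le_pow_left₀ e3 e2 _) (pow_le_pow_left₀ e3 e2 _) (by positivity)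
            (by positivity)) (by positivity) zero_le_one
      _ = _ := one_mul _
  have hpl := planck_le (d := d) p0
  have hl := l2_nonneg ψ
  calc ⟪y⟫ ^ n * (‖planck d ħ‖
        * ‖∫ w in closedBall (0 : E d) w₀, propKer h m ħ y w w * ψ w‖)
      ≤ (2 ^ n * ‖y‖ ^ n) * (‖planck d ħ‖ * (C₁ * (ħ / ‖y‖) ^ (n + N + d) * (C₂ * l2 ψ))) :=
        mul_le_mul h7 (mul_le_mul_of_nonneg_left h5 (norm_nonneg _)) (by positivity) (by positivity)
    _ = 2 ^ n * C₁ * C₂ * l2 ψ * ‖planck d ħ‖ * (‖y‖ ^ n * (ħ / ‖y‖) ^ (n + N + d)) := by ring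
    _ ≤ 2 ^ n * C₁ * C₂ * l2 ψ * ‖planck d ħ‖ * (ħ ^ N * ħ ^ d) :=
        mul_le_mul_of_nonneg_left h8 (by positivity)
    _ = 2 ^ n * C₁ * C₂ * l2 ψ * ħ ^ N * (‖planck d ħ‖ * ħ ^ d) := by ring
    _ ≤ 2 ^ n * C₁ * C₂ * l2 ψ * ħ ^ N * 1 := mul_le_mul_of_nonneg_left hpl (by positivity)
    _ = 2 ^ n * C₁ * C₂ * ħ ^ N * l2 ψ := by ring

end Transport

end

section

/-! ### Tempered and negligible families of functions -/

section Families

variable {d : ℕ}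

/-- Families, indexed by `ħ` and by Schwartz functions `ψ`, that decay rapidly in space and are
bounded by a power of `ħ⁻¹` relative to the `L²` norm of `ψ`. -/
structure Temp (u : ℝ → 𝓢(E d, ℂ) → E d → ℂ) : Prop where
  meas : ∀ ħ, 0 < ħ → ħ ≤ 1 → ∀ ψ, StronglyMeasurable (u ħ ψ)
  bound : ∀ n : ℕ, ∃ (M : ℕ) (C : ℝ), 0 ≤ C ∧ ∀ ħ, 0 < ħ → ħ ≤ 1 → ∀ ψ x,
    ⟪x⟫ ^ n * ‖u ħ ψ x‖ * ħ ^ M ≤ C * l2 ψ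

/-- Families that decay rapidly in space and are `O(ħ^∞)` relative to the `L²` norm of `ψ`. -/
structure Negl (u : ℝ → 𝓢(E d, ℂ) → E d → ℂ) : Prop where
  meas : ∀ ħ, 0 < ħ → ħ ≤ 1 → ∀ ψ, StronglyMeasurable (u ħ ψ)
  bound : ∀ n N : ℕ, ∃ C : ℝ, 0 ≤ C ∧ ∀ ħ, 0 < ħ → ħ ≤ 1 → ∀ ψ x,
    ⟪x⟫ ^ n * ‖u ħ ψ x‖ ≤ C * ħ ^ N * l2 ψ

variable {u v : ℝ → 𝓢(E d, ℂ) → E d → ℂ}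

lemma Negl.temp (hu : Negl u) : Temp u := by
  refine ⟨hu.meas, fun n => ?_⟩
  obtain ⟨C, h0, h⟩ := hu.bound n 0
  exact ⟨0, C, h0, fun ħ p0 p1 ψ x => by simpa using h ħ p0 p1 ψ x⟩

lemma Temp.add (hu : Temp u) (hv : Temp v) : Temp (fun ħ ψ x => u ħ ψ x + v ħ ψ x) := by
  refine ⟨fun ħ p0 p1 ψ => (hu.meas ħ p0 p1 ψ).add (hv.meas ħ p0 p1 ψ), fun n => ?_⟩
  obtain ⟨M, C, h0, h⟩ := hu.bound n
  obtain ⟨M', C', h0', h'⟩ := hv.bound n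
  refine ⟨M + M', C + C', by positivity, fun ħ p0 p1 ψ x => ?_⟩
  have h1 : ⟪x⟫ ^ n * ‖u ħ ψ x + v ħ ψ x‖ ≤ ⟪x⟫ ^ n * ‖u ħ ψ x‖ + ⟪x⟫ ^ n * ‖v ħ ψ x‖ := by
    rw [← mul_add]
    exact mul_le_mul_of_nonneg_left (norm_add_le _ _) (by positivity)
  have hl := l2_nonneg ψ
  have hM : ħ ^ M ≤ 1 := pow_le_one₀ p0.le p1
  have hM' : ħ ^ M' ≤ 1 := pow_le_one₀ p0.le p1
  calc _ ≤ (⟪x⟫ ^ n * ‖u ħ ψ x‖ + ⟪x⟫ ^ n * ‖v ħ ψ x‖) * ħ ^ (M + M') :=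
        mul_le_mul_of_nonneg_right h1 (by positivity)
    _ = ⟪x⟫ ^ n * ‖u ħ ψ x‖ * ħ ^ M * ħ ^ M'
        + ⟪x⟫ ^ n * ‖v ħ ψ x‖ * ħ ^ M' * ħ ^ M := by ring
    _ ≤ C * l2 ψ * 1 + C' * l2 ψ * 1 := by
        refine add_le_add (mul_le_mul (h ħ p0 p1 ψ x) hM' (by positivity) (by positivity))
          (mul_le_mul (h' ħ p0 p1 ψ x) hM (by positivity) (by positivity))
    _ = (C + C') * l2 ψ := by ring

lemma negl_zero : Negl (fun (_ : ℝ) (_ : 𝓢(E d, ℂ)) (_ : E d) => (0 : ℂ)) :=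
  ⟨fun _ _ _ _ => stronglyMeasurable_const, fun n N => ⟨0, le_rfl, fun ħ _ _ ψ x => by simp⟩⟩

lemma Temp.congr (hu : Temp u) (h : ∀ ħ, 0 < ħ → ħ ≤ 1 → ∀ ψ x, v ħ ψ x = u ħ ψ x) : Temp v := by
  refine ⟨fun ħ p0 p1 ψ => ?_, fun n => ?_⟩
  · rw [show v ħ ψ = u ħ ψ from funext (h ħ p0 p1 ψ)]
    exact hu.meas ħ p0 p1 ψ
  · obtain ⟨M, C, h0, h1⟩ := hu.bound n
    exact ⟨M, C, h0, fun ħ p0 p1 ψ x => by rw [h ħ p0 p1 ψ x]; exact h1 ħ p0 p1 ψ x⟩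

/-- Rapidly decaying functions are integrable against polynomial weights. -/
lemma integrable_of_weight {f : E d → ℂ} (hf : StronglyMeasurable f) (n : ℕ) {B : ℝ}
    (hB : ∀ x, ⟪x⟫ ^ (n + (d + 1)) * ‖f x‖ ≤ B) :
    Integrable (fun x => ⟪x⟫ ^ n * ‖f x‖) ∧
      ∫ x, ⟪x⟫ ^ n * ‖f x‖ ≤ B * ∫ x : E d, (⟪x⟫ ^ (d + 1))⁻¹ := by
  have h1 := (integrable_inv_pow d).const_mul B
  have h2 : ∀ x : E d, ⟪x⟫ ^ n * ‖f x‖ ≤ B * (⟪x⟫ ^ (d + 1))⁻¹ := by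
    intro x
    rw [← div_eq_mul_inv, le_div_iff₀ (by positivity)]
    calc _ = ⟪x⟫ ^ (n + (d + 1)) * ‖f x‖ := by rw [pow_add]; ring
      _ ≤ B := hB x
  have h3 : Integrable (fun x => ⟪x⟫ ^ n * ‖f x‖) := by
    refine h1.mono' ?_ (.of_forall fun x => ?_)
    · have hc : Continuous (fun x : E d => ⟪x⟫ ^ n) := by fun_prop
      exact (hc.stronglyMeasurable.mul hf.norm).aestronglyMeasurable
    · rw [norm_of_nonneg (by positivity)]
      exact h2 x
  refine ⟨h3, ?_⟩
  rw [← integral_const_mul]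
  exact integral_mono h3 h1 h2

lemma Temp.exists_weight (hu : Temp u) {ħ : ℝ} (p0 : 0 < ħ) (p1 : ħ ≤ 1) (ψ : 𝓢(E d, ℂ))
    (n : ℕ) : ∃ B, ∀ x, ⟪x⟫ ^ n * ‖u ħ ψ x‖ ≤ B := by
  obtain ⟨M, C, -, h⟩ := hu.bound n
  refine ⟨C * l2 ψ / ħ ^ M, fun x => ?_⟩
  rw [le_div_iff₀ (by positivity)]
  exact h ħ p0 p1 ψ x

lemma Temp.integrable (hu : Temp u) {ħ : ℝ} (p0 : 0 < ħ) (p1 : ħ ≤ 1) (ψ : 𝓢(E d, ℂ)) :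
    Integrable (u ħ ψ) := by
  obtain ⟨B, hB⟩ := hu.exists_weight p0 p1 ψ (0 + (d + 1))
  have h1 := (integrable_of_weight (hu.meas ħ p0 p1 ψ) 0 hB).1
  simp only [pow_zero, one_mul] at h1
  exact (integrable_norm_iff (hu.meas ħ p0 p1 ψ).aestronglyMeasurable).1 h1

variable (d) in
lemma exists_cutoff (x₀ : E d) {s t : ℝ} (hs : 0 < s) (ht : s < t) : ∃ c : E d → ℂ,
    C^∞ c ∧ HasCompactSupport c ∧ (∀ x, ‖x - x₀‖ ≤ s → c x = 1) ∧
      (∀ x, t ≤ ‖x - x₀‖ → c x = 0) ∧ ∀ x, ‖c x‖ ≤ 1 := by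
  let κ : ContDiffBump x₀ := ⟨s, t, hs, ht⟩
  refine ⟨fun x => (κ x : ℂ), Complex.ofRealCLM.contDiff.comp κ.contDiff,
    κ.hasCompactSupport.comp_left (g := fun t : ℝ => (t : ℂ)) Complex.ofReal_zero,
    fun x hx => ?_, fun x hx => ?_, fun x => ?_⟩
  · have h1 : κ x = 1 := κ.one_of_mem_closedBall (by rwa [mem_closedBall_iff_norm])
    simp only [h1, Complex.ofReal_one]
  · have h1 : κ x = 0 := κ.zero_of_le_dist (by rwa [dist_eq_norm])
    simp only [h1, Complex.ofReal_zero]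
  · rw [norm_real, norm_of_nonneg κ.nonneg]
    exact κ.le_one

lemma Negl.superposition (hv : Negl v) {h : E d → E d} (hh : C^∞ h) {D : E d → ℂ}
    (hD : C^∞ D) (hDc : HasCompactSupport D) {Λ : ℝ} (hΛ : 0 ≤ Λ)
    (hb : ∀ η, ‖fderiv ℝ h η‖ ≤ Λ) :
    Negl (fun ħ ψ => invFourierH ħ (fun η => fourierH ħ (v ħ ψ) (h η) * D η)) := by
  refine ⟨fun ħ p0 p1 ψ => meas_invFourierH ħ
    (((stronglyMeasurable_fourierH ħ (hv.meas ħ p0 p1 ψ)).comp_measurable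
      hh.continuous.measurable).mul hD.continuous.stronglyMeasurable), fun n N => ?_⟩
  let m : E 0 × E d → ℂ := fun p => D p.2
  have hm : HasCompactSupport m := by
    refine .intro (isCompact_univ.prod hDc) fun p hp => ?_
    exact image_eq_zero_of_notMem_tsupport (f := D) fun h => hp ⟨Set.mem_univ _, h⟩
  obtain ⟨C₁, h10, h1⟩ := exists_weight_mul_propKer_le hh (m := m)
    (ContDiff.fun_comp hD contDiff_snd) hm hΛ (fun p _ => hb p.2) n
  obtain ⟨C₂, h20, h2⟩ := hv.bound (n + (d + 1)) (N + d)
  obtain ⟨A, hA⟩ := hDc.exists_bound_of_continuous hD.continuous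
  obtain ⟨R, -, hR⟩ := exists_radius hDc
  set I := ∫ x : E d, (⟪x⟫ ^ (d + 1))⁻¹ with hI
  have hI0 : 0 ≤ I := integral_nonneg fun x => by positivity
  refine ⟨C₁ * C₂ * I, by positivity, fun ħ p0 p1 ψ y => ?_⟩
  have h3 : invFourierH ħ (fun η => fourierH ħ (v ħ ψ) (h η) * D η) y
      = planck d ħ * ∫ w, propKer h m ħ y w 0 * v ħ ψ w := by
    have e0 : ∀ w, propKer h m ħ y w 0 = propKer h (fun p : E d × E d => D p.2) ħ y w w :=
      fun w => rfl
    simp only [e0]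
    rw [← invFourierH_superposition (m := fun p => D p.2) (R := R)
      (Continuous.comp' hD.continuous continuous_snd) (fun p => hA p.2) (fun w η hη => hR η hη)
      hh.continuous (hv.temp.integrable p0 p1 ψ)]
    congr 1
    funext η
    unfold fourierH
    rw [← integral_mul_const]
    congr 1
    funext w
    ring
  have h4 := integrable_of_weight (hv.meas ħ p0 p1 ψ) n (h2 ħ p0 p1 ψ)
  have h5 : ⟪y⟫ ^ n * ‖∫ w, propKer h m ħ y w 0 * v ħ ψ w‖
      ≤ C₁ * (C₂ * ħ ^ (N + d) * l2 ψ * I) := by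
    have h6 : ‖(⟪y⟫ ^ n : ℝ) • ∫ w, propKer h m ħ y w 0 * v ħ ψ w‖
        ≤ ∫ w, C₁ * (⟪w⟫ ^ n * ‖v ħ ψ w‖) := by
      rw [← integral_smul]
      refine norm_integral_le_of_norm_le (h4.1.const_mul _) (.of_forall fun w => ?_)
      rw [norm_smul, norm_of_nonneg (by positivity), norm_mul, ← mul_assoc, ← mul_assoc]
      exact mul_le_mul_of_nonneg_right (h1 ħ p0 p1 y w 0) (norm_nonneg _)
    rw [norm_smul, norm_of_nonneg (by positivity), integral_const_mul] at h6
    exact h6.trans (mul_le_mul_of_nonneg_left h4.2 h10)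
  have hl := l2_nonneg ψ
  rw [h3, norm_mul]
  calc _ = ‖planck d ħ‖ * (⟪y⟫ ^ n * ‖∫ w, propKer h m ħ y w 0 * v ħ ψ w‖) := by ring
    _ ≤ ‖planck d ħ‖ * (C₁ * (C₂ * ħ ^ (N + d) * l2 ψ * I)) :=
        mul_le_mul_of_nonneg_left h5 (norm_nonneg _)
    _ = C₁ * C₂ * I * ħ ^ N * l2 ψ * (‖planck d ħ‖ * ħ ^ d) := by rw [pow_add]; ring
    _ ≤ C₁ * C₂ * I * ħ ^ N * l2 ψ * 1 :=
        mul_le_mul_of_nonneg_left (planck_le p0) (by positivity)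
    _ = C₁ * C₂ * I * ħ ^ N * l2 ψ := mul_one _

/-! ### Pseudodifferential operators acting on wave packets -/

variable {Q : Phase d × E d → ℂ} {χ : Phase d → ℂ}

lemma exists_norm_pow_mul_wKer_symS_le (hQ : C^∞ Q) (hc : HasCompactSupport Q) (N : ℕ) :
    ∃ C, 0 ≤ C ∧ ∀ ħ, 0 < ħ → ħ ≤ 1 → ∀ x y : E d,
      ‖x - y‖ ^ N * ‖wKer ħ (symS Q ħ) x y‖ ≤ C * ħ ^ N := by
  obtain ⟨ρ, -, hρ⟩ := exists_radius hc
  obtain ⟨C, h0, h⟩ := exists_deriv_symS_le hQ hc N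
  refine ⟨C * volume.real (closedBall (0 : E d) ρ), by positivity, fun ħ p0 p1 x y => ?_⟩
  have hS := contDiff_symS hQ hc ħ
  have h1 := norm_pow_mul_integral_osc_le N (a := fun ξ => symS Q ħ (½ • (x + y), ξ))
    (ContDiff.fun_comp hS (contDiff_const.prodMk contDiff_id))
    (fun t ht => vanishesAbove_symS hρ ħ (½ • (x + y), t) ht)
    (fun ξ => (norm_iteratedFDeriv_right_le hS N _ ξ).trans (h ħ p0 p1 _)) p0 (x - y)
  unfold wKer
  simp only [real_inner_comm (_ : E d) (x - y)]
  rw [mul_comm _ (ħ ^ N)]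
  exact h1

lemma one_add_pow_le_mul_pow {δ t : ℝ} (hδ : 0 < δ) (ht : δ ≤ t) (n : ℕ) :
    (1 + t) ^ n ≤ (1 + δ⁻¹) ^ n * t ^ n := by
  have h0 : 0 < t := hδ.trans_le ht
  rw [← mul_pow]
  refine pow_le_pow_left₀ (by positivity) ?_ n
  have h1 : 1 ≤ δ⁻¹ * t := by
    rw [inv_mul_eq_div, le_div_iff₀ hδ]
    linarith
  nlinarith

lemma exists_pow_mul_wKer_symS_le (hQ : C^∞ Q) (hc : HasCompactSupport Q)
    (n : ℕ) : ∃ C, 0 ≤ C ∧ ∀ ħ, 0 < ħ → ħ ≤ 1 → ∀ x y : E d,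
      ⟪x - y⟫ ^ n * ‖wKer ħ (symS Q ħ) x y‖ ≤ C := by
  obtain ⟨C, h0, h⟩ := exists_norm_pow_mul_wKer_symS_le hQ hc 0
  obtain ⟨C', h0', h'⟩ := exists_norm_pow_mul_wKer_symS_le hQ hc n
  refine ⟨2 ^ n * (C + C'), by positivity, fun ħ p0 p1 x y => ?_⟩
  have h1 := h ħ p0 p1 x y
  have h2 := (h' ħ p0 p1 x y).trans (mul_le_mul_of_nonneg_left (pow_le_one₀ p0.le p1) h0')
  simp only [pow_zero, one_mul, mul_one] at h1 h2
  calc _ ≤ (2 ^ n * (1 + ‖x - y‖ ^ n)) * ‖wKer ħ (symS Q ħ) x y‖ :=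
        mul_le_mul_of_nonneg_right (one_add_pow_le (norm_nonneg _) n) (norm_nonneg _)
    _ = 2 ^ n * (‖wKer ħ (symS Q ħ) x y‖ + ‖x - y‖ ^ n * ‖wKer ħ (symS Q ħ) x y‖) := by ring
    _ ≤ 2 ^ n * (C + C') := mul_le_mul_of_nonneg_left (add_le_add h1 h2) (by positivity)

lemma exists_weight_mul_wKer_symS_far_le (hQ : C^∞ Q)
    (hc : HasCompactSupport Q) {δ : ℝ} (hδ : 0 < δ) (n N : ℕ) : ∃ C, 0 ≤ C ∧ ∀ ħ, 0 < ħ → ħ ≤ 1 →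
      ∀ x y : E d, δ ≤ ‖x - y‖ → ⟪x - y⟫ ^ n * ‖wKer ħ (symS Q ħ) x y‖ ≤ C * ħ ^ N := by
  obtain ⟨C, h0, h⟩ := exists_norm_pow_mul_wKer_symS_le hQ hc (n + N)
  refine ⟨(1 + δ⁻¹) ^ n * (δ⁻¹ ^ N * C), by positivity, fun ħ p0 p1 x y hxy => ?_⟩
  have ht : 0 < ‖x - y‖ := hδ.trans_le hxy
  have h1 := h ħ p0 p1 x y
  have h2 : (1 : ℝ) ≤ δ⁻¹ ^ N * ‖x - y‖ ^ N := by
    rw [← mul_pow]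
    refine one_le_pow₀ ?_
    rw [inv_mul_eq_div, le_div_iff₀ hδ]
    linarith
  have h3 : ħ ^ (n + N) ≤ ħ ^ N := pow_le_pow_of_le_one p0.le p1 (by omega)
  calc _ ≤ ((1 + δ⁻¹) ^ n * ‖x - y‖ ^ n) * ‖wKer ħ (symS Q ħ) x y‖ :=
        mul_le_mul_of_nonneg_right (one_add_pow_le_mul_pow hδ hxy n) (norm_nonneg _)
    _ = (1 + δ⁻¹) ^ n * (‖x - y‖ ^ n * ‖wKer ħ (symS Q ħ) x y‖) * 1 := by ring
    _ ≤ (1 + δ⁻¹) ^ n * (‖x - y‖ ^ n * ‖wKer ħ (symS Q ħ) x y‖) * (δ⁻¹ ^ N * ‖x - y‖ ^ N) :=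
        mul_le_mul_of_nonneg_left h2 (by positivity)
    _ = (1 + δ⁻¹) ^ n * δ⁻¹ ^ N * (‖x - y‖ ^ (n + N) * ‖wKer ħ (symS Q ħ) x y‖) := by
        rw [pow_add]; ring
    _ ≤ (1 + δ⁻¹) ^ n * δ⁻¹ ^ N * (C * ħ ^ N) := mul_le_mul_of_nonneg_left
        (h1.trans (mul_le_mul_of_nonneg_left h3 h0)) (by positivity)
    _ = _ := by ring

lemma exists_rightOp_eq_transport (hc : HasCompactSupport χ) : ∃ D : E d → ℂ,
    C^∞ D ∧ HasCompactSupport D ∧ ∀ (ħ : ℝ) (ψ : E d → ℂ),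
      (fun η => packet χ ħ ψ η * D η) = packet χ ħ ψ := by
  obtain ⟨ρ, hρ0, hρ⟩ := exists_radius_phase hc
  obtain ⟨D, h1, h2, h3, -, -⟩ := exists_cutoff d 0 hρ0 (by linarith : ρ < ρ + 1)
  refine ⟨D, h1, h2, fun ħ ψ => funext fun η => ?_⟩
  by_cases h : ‖η‖ ≤ ρ
  · rw [h3 η (by simpa using h), mul_one]
  · rw [packet_eq_zero (fun w => hρ (w, η) (Or.inr (not_le.1 h))), zero_mul]

lemma exists_pow_mul_rightOp_le (hχ : C^∞ χ) (hc : HasCompactSupport χ)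
    (n : ℕ) : ∃ C, 0 ≤ C ∧ ∀ ħ, 0 < ħ → ħ ≤ 1 → ∀ (ψ : 𝓢(E d, ℂ)) y,
      ⟪y⟫ ^ n * ‖rightOp ħ χ ψ y‖ * ħ ^ d ≤ C * l2 ψ := by
  obtain ⟨D, h1, h2, h3⟩ := exists_rightOp_eq_transport hc
  obtain ⟨C, h0, h⟩ := exists_pow_mul_transport_le hχ hc (h := fun η => η) contDiff_id h1 h2 n
  refine ⟨C, h0, fun ħ p0 p1 ψ y => ?_⟩
  have h4 := h ħ p0 p1 ψ y
  rw [h3] at h4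
  rwa [rightOp_eq_invFourierH]

lemma exists_weight_mul_rightOp_far_le (hχ : C^∞ χ) (hc : HasCompactSupport χ)
    {x₀ : E d} {s δ : ℝ} (hs : ∀ w ξ, s ≤ ‖w - x₀‖ → χ (w, ξ) = 0) (hs0 : 0 < s) (hδ : 0 < δ)
    (n N : ℕ) : ∃ C, 0 ≤ C ∧ ∀ ħ, 0 < ħ → ħ ≤ 1 → ∀ (ψ : 𝓢(E d, ℂ)) y,
      s + δ ≤ ‖y - x₀‖ → ⟪y⟫ ^ n * ‖rightOp ħ χ ψ y‖ ≤ C * ħ ^ N * l2 ψ := by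
  obtain ⟨ρ, -, hρ⟩ := exists_radius_phase hc
  obtain ⟨A, hA⟩ := hc.exists_bound_of_continuous hχ.continuous
  obtain ⟨B, hB0, hB⟩ := exists_deriv_section_le hχ hc (n + N + d)
  obtain ⟨C₂, h20, h2⟩ := exists_setIntegral_norm_le_l2 (isCompact_closedBall x₀ s)
  set V := volume.real (closedBall (0 : E d) ρ) with hV
  have hV0 : 0 ≤ V := measureReal_nonneg
  set K := (1 + δ⁻¹) ^ n * (1 + (‖x₀‖ + s)) ^ n * δ⁻¹ ^ (N + d) * (B * V) with hK
  have hK0 : 0 ≤ K := by positivity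
  refine ⟨K * C₂, by positivity, fun ħ p0 p1 ψ y hy => ?_⟩
  have h3 : rightOp ħ χ ψ y = planck d ħ * ∫ w, propKer (fun η => η) χ ħ y w w * ψ w := by
    rw [rightOp_eq_invFourierH, ← invFourierH_superposition (R := ρ) (h := fun η => η)
      hχ.continuous hA (fun w η hη => hρ (w, η) (Or.inr hη)) continuous_id ψ.integrable]
    rfl
  have h4 : ∀ w ∉ closedBall x₀ s, propKer (fun η => η) χ ħ y w w * ψ w = 0 := by
    intro w hw
    have h5 : ∀ η, χ (w, η) = 0 := fun η => hs w η (by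
      rw [mem_closedBall_iff_norm] at hw
      exact (not_le.1 hw).le)
    unfold propKer
    simp only [h5, mul_zero, integral_zero, zero_mul]
  have h5 : ∀ w ∈ closedBall x₀ s,
      ⟪y⟫ ^ n * ‖propKer (fun η => η) χ ħ y w w‖ ≤ K * ħ ^ (N + d) := by
    intro w hw
    rw [mem_closedBall_iff_norm] at hw
    have e1 : δ ≤ ‖y - w‖ := by
      have := norm_sub_le_norm_sub_add_norm_sub y w x₀
      linarith
    have e0 : 0 < ‖y - w‖ := hδ.trans_le e1
    have e2 : 1 + ‖y‖ ≤ ⟪y - w⟫ * (1 + (‖x₀‖ + s)) := by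
      refine (one_add_norm_le_mul_sub y w).trans (mul_le_mul_of_nonneg_left ?_ (by positivity))
      have : ‖w‖ ≤ ‖w - x₀‖ + ‖x₀‖ := by simpa using norm_add_le (w - x₀) x₀
      linarith
    have e3 := norm_pow_mul_integral_osc_le (n + N + d) (a := fun ξ => χ (w, ξ))
      (ContDiff.fun_comp hχ (contDiff_const.prodMk contDiff_id))
      (fun t ht => hρ (w, t) (Or.inr ht)) (hB w) p0 (y - w)
    have e4 : propKer (fun η => η) χ ħ y w w = ∫ t, osc ħ (inner ℝ t (y - w)) * χ (w, t) := by
      unfold propKer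
      simp only [inner_sub_right, real_inner_comm]
    rw [← e4] at e3
    have e5 : (1 : ℝ) ≤ δ⁻¹ ^ (N + d) * ‖y - w‖ ^ (N + d) := by
      rw [← mul_pow]
      refine one_le_pow₀ ?_
      rw [inv_mul_eq_div, le_div_iff₀ hδ]
      linarith
    set P := ‖propKer (fun η => η) χ ħ y w w‖ with hP
    have hP0 : 0 ≤ P := norm_nonneg _
    have e6 : ħ ^ (n + N + d) ≤ ħ ^ (N + d) := pow_le_pow_of_le_one p0.le p1 (by omega)
    have e7 : ⟪y⟫ ^ n ≤ (1 + δ⁻¹) ^ n * ‖y - w‖ ^ n * (1 + (‖x₀‖ + s)) ^ n := by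
      refine (pow_le_pow_left₀ (by positivity) e2 n).trans ?_
      rw [mul_pow]
      exact mul_le_mul_of_nonneg_right (one_add_pow_le_mul_pow hδ e1 n) (by positivity)
    calc ⟪y⟫ ^ n * P
        ≤ ((1 + δ⁻¹) ^ n * ‖y - w‖ ^ n * (1 + (‖x₀‖ + s)) ^ n) * P * 1 := by
          rw [mul_one]
          exact mul_le_mul_of_nonneg_right e7 hP0
      _ ≤ ((1 + δ⁻¹) ^ n * ‖y - w‖ ^ n * (1 + (‖x₀‖ + s)) ^ n) * P
          * (δ⁻¹ ^ (N + d) * ‖y - w‖ ^ (N + d)) := mul_le_mul_of_nonneg_left e5 (by positivity)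
      _ = (1 + δ⁻¹) ^ n * (1 + (‖x₀‖ + s)) ^ n * δ⁻¹ ^ (N + d) * (‖y - w‖ ^ (n + N + d) * P) := by
          rw [add_assoc n N d, pow_add ‖y - w‖ n]; ring
      _ ≤ (1 + δ⁻¹) ^ n * (1 + (‖x₀‖ + s)) ^ n * δ⁻¹ ^ (N + d) * (ħ ^ (n + N + d) * (B * V)) :=
          mul_le_mul_of_nonneg_left e3 (by positivity)
      _ = K * ħ ^ (n + N + d) := by rw [hK]; ring
      _ ≤ K * ħ ^ (N + d) := mul_le_mul_of_nonneg_left e6 hK0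
  have h6 : ⟪y⟫ ^ n * ‖∫ w in closedBall x₀ s, propKer (fun η => η) χ ħ y w w * ψ w‖
      ≤ K * ħ ^ (N + d) * (C₂ * l2 ψ) := by
    have h7 : ‖(⟪y⟫ ^ n : ℝ) • ∫ w in closedBall x₀ s, propKer (fun η => η) χ ħ y w w * ψ w‖
        ≤ ∫ w in closedBall x₀ s, K * ħ ^ (N + d) * ‖ψ w‖ := by
      rw [← integral_smul]
      refine norm_integral_le_of_norm_le
        ((ψ.integrable (μ := volume)).norm.const_mul _).integrableOn
        ((ae_restrict_iff' isClosed_closedBall.measurableSet).2 (.of_forall fun w hw => ?_))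
      rw [norm_smul, norm_of_nonneg (by positivity), norm_mul, ← mul_assoc]
      exact mul_le_mul_of_nonneg_right (h5 w hw) (norm_nonneg _)
    rw [norm_smul, norm_of_nonneg (by positivity), integral_const_mul] at h7
    exact h7.trans (mul_le_mul_of_nonneg_left (h2 ψ) (by positivity))
  have hl := l2_nonneg ψ
  rw [h3, ← setIntegral_eq_integral_of_forall_compl_eq_zero h4, norm_mul]
  calc _ = ‖planck d ħ‖ * (⟪y⟫ ^ n
        * ‖∫ w in closedBall x₀ s, propKer (fun η => η) χ ħ y w w * ψ w‖) := by ring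
    _ ≤ ‖planck d ħ‖ * (K * ħ ^ (N + d) * (C₂ * l2 ψ)) :=
        mul_le_mul_of_nonneg_left h6 (norm_nonneg _)
    _ = K * C₂ * ħ ^ N * l2 ψ * (‖planck d ħ‖ * ħ ^ d) := by rw [pow_add]; ring
    _ ≤ K * C₂ * ħ ^ N * l2 ψ * 1 :=
        mul_le_mul_of_nonneg_left (planck_le p0) (by positivity)
    _ = K * C₂ * ħ ^ N * l2 ψ := mul_one _

end Families

end

section

section SymbolPacket

variable {d : ℕ} {Q : Phase d × E d → ℂ} {χ : Phase d → ℂ}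

lemma norm_weylOp_symS_le (hQ : C^∞ Q) (hc : HasCompactSupport Q) {ħ : ℝ} (p0 : 0 < ħ)
    (p1 : ħ ≤ 1) {φ : E d → ℂ} (hφ : Integrable φ) {x : E d} {a B : ℝ} (ha : 0 ≤ a)
    (hB : ∀ y, a * (⟪y⟫ ^ (d + 1) * (‖wKer ħ (symS Q ħ) x y‖ * ‖φ y‖)) ≤ B) :
    a * ‖weylOp ħ (symS Q ħ) φ x‖ ≤ ‖planck d ħ‖ * (B * ∫ y : E d, (⟪y⟫ ^ (d + 1))⁻¹) := by
  obtain ⟨ρ, -, hρ⟩ := exists_radius hc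
  have h1 := (weylOp_eq_wKer (hasSymbolBound_symS hQ hc p0 p1) (vanishesAbove_symS hρ ħ) ħ
    hφ.aestronglyMeasurable (by simpa using hφ.norm) x).1
  have h2 : ‖(a : ℝ) • ∫ y, wKer ħ (symS Q ħ) x y * φ y‖ ≤ ∫ y : E d, B * (⟪y⟫ ^ (d + 1))⁻¹ := by
    rw [← integral_smul]
    refine norm_integral_le_of_norm_le ((integrable_inv_pow d).const_mul B) (.of_forall fun y => ?_)
    rw [norm_smul, norm_of_nonneg ha, norm_mul, ← div_eq_mul_inv,
      le_div_iff₀ (by positivity)]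
    calc _ = a * (⟪y⟫ ^ (d + 1) * (‖wKer ħ (symS Q ħ) x y‖ * ‖φ y‖)) := by ring
      _ ≤ B := hB y
  rw [norm_smul, norm_of_nonneg ha, integral_const_mul] at h2
  rw [h1, norm_mul]
  calc _ = ‖planck d ħ‖ * (a * ‖∫ y, wKer ħ (symS Q ħ) x y * φ y‖) := by ring
    _ ≤ _ := mul_le_mul_of_nonneg_left h2 (norm_nonneg _)

/-- The operator with amplitude `Q` applied to a wave packet. -/
noncomputable def symPacket (Q : Phase d × E d → ℂ) (χ : Phase d → ℂ) (ħ : ℝ) (ψ : 𝓢(E d, ℂ)) :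
    E d → ℂ := invFourierH ħ (ampOp Q ħ (packet χ ħ ψ))

lemma contDiff_ampOp_packet (hQ : C^∞ Q) (hc : HasCompactSupport Q)
    (hχ : C^∞ χ) (hχc : HasCompactSupport χ) (ħ : ℝ) (ψ : 𝓢(E d, ℂ)) :
    C^∞ (ampOp Q ħ (packet χ ħ ψ)) :=
  contDiff_ampOp hQ hc ħ (contDiff_packet hχ hχc ħ ψ) (compactSupp_packet hχc ħ ψ)

lemma weylOp_rightOp_eq_symPacket (hQ : C^∞ Q) (hc : HasCompactSupport Q)
    (hχ : C^∞ χ) (hχc : HasCompactSupport χ) {ħ : ℝ} (p0 : 0 < ħ) (ψ : 𝓢(E d, ℂ))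
    (x : E d) : weylOp ħ (symS Q ħ) (rightOp ħ χ ψ) x = symPacket Q χ ħ ψ x := by
  rw [rightOp_eq_invFourierH, weylOp_symS_invFourierH hQ hc p0 (contDiff_packet hχ hχc ħ ψ)
    (compactSupp_packet hχc ħ ψ)]
  rfl

lemma temp_rightOp (hχ : C^∞ χ) (hχc : HasCompactSupport χ) : Temp (fun ħ ψ => rightOp ħ χ ψ) := by
  refine ⟨fun ħ _ _ ψ => ?_, fun n => ?_⟩
  · rw [rightOp_eq_invFourierH]
    exact meas_invFourierH ħ (contDiff_packet hχ hχc ħ ψ).continuous.stronglyMeasurable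
  · obtain ⟨C, h0, h⟩ := exists_pow_mul_rightOp_le hχ hχc n
    exact ⟨d, C, h0, h⟩

lemma weight_mul_le {x y : E d} {n : ℕ} {K P A B : ℝ} (hK : 0 ≤ K) (hP : 0 ≤ P)
    (h1 : ⟪x - y⟫ ^ n * K ≤ A) (h2 : ⟪y⟫ ^ (n + (d + 1)) * P ≤ B) :
    ⟪x⟫ ^ n * (⟪y⟫ ^ (d + 1) * (K * P)) ≤ A * B := by
  have h3 := pow_le_pow_left₀ (by positivity) (one_add_norm_le_mul_sub x y) n
  calc _ ≤ (⟪x - y⟫ * ⟪y⟫) ^ n * (⟪y⟫ ^ (d + 1) * (K * P)) :=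
        mul_le_mul_of_nonneg_right h3 (by positivity)
    _ = (⟪x - y⟫ ^ n * K) * (⟪y⟫ ^ (n + (d + 1)) * P) := by
        rw [mul_pow, pow_add]; ring
    _ ≤ A * B := mul_le_mul h1 h2 (by positivity) (le_trans (by positivity) h1)

lemma temp_symPacket (hQ : C^∞ Q) (hc : HasCompactSupport Q)
    (hχ : C^∞ χ) (hχc : HasCompactSupport χ) : Temp (symPacket Q χ) := by
  refine ⟨fun ħ _ _ ψ => meas_invFourierH ħ
    (contDiff_ampOp_packet hQ hc hχ hχc ħ ψ).continuous.stronglyMeasurable, fun n => ?_⟩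
  obtain ⟨C₁, h10, h1⟩ := exists_pow_mul_wKer_symS_le hQ hc n
  obtain ⟨C₂, h20, h2⟩ := exists_pow_mul_rightOp_le hχ hχc (n + (d + 1))
  set I := ∫ x : E d, (⟪x⟫ ^ (d + 1))⁻¹ with hI
  have hI0 : 0 ≤ I := integral_nonneg fun x => by positivity
  refine ⟨d + d, C₁ * C₂ * I, by positivity, fun ħ p0 p1 ψ x => ?_⟩
  have h3 : ∀ y, ⟪y⟫ ^ (n + (d + 1)) * ‖rightOp ħ χ ψ y‖ ≤ C₂ * l2 ψ / ħ ^ d := fun y => by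
    rw [le_div_iff₀ (by positivity)]
    exact h2 ħ p0 p1 ψ y
  have h4 := norm_weylOp_symS_le hQ hc p0 p1 ((temp_rightOp hχ hχc).integrable p0 p1 ψ)
    (x := x) (a := ⟪x⟫ ^ n) (by positivity)
    (fun y => weight_mul_le (norm_nonneg _) (norm_nonneg _) (h1 ħ p0 p1 x y) (h3 y))
  rw [weylOp_rightOp_eq_symPacket hQ hc hχ hχc p0] at h4
  have hl := l2_nonneg ψ
  calc _ ≤ ‖planck d ħ‖ * (C₁ * (C₂ * l2 ψ / ħ ^ d) * I) * ħ ^ (d + d) :=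
        mul_le_mul_of_nonneg_right h4 (by positivity)
    _ = C₁ * C₂ * I * l2 ψ * (‖planck d ħ‖ * ħ ^ d) := by rw [pow_add]; field_simp
    _ ≤ C₁ * C₂ * I * l2 ψ * 1 :=
        mul_le_mul_of_nonneg_left (planck_le p0) (by positivity)
    _ = C₁ * C₂ * I * l2 ψ := mul_one _

lemma negl_symPacket_far (hQ : C^∞ Q) (hc : HasCompactSupport Q)
    (hχ : C^∞ χ) (hχc : HasCompactSupport χ) {x₀ : E d} {s δ : ℝ}
    (hs : ∀ w ξ, s ≤ ‖w - x₀‖ → χ (w, ξ) = 0) (hs0 : 0 < s) (hδ : 0 < δ) {a : E d → ℂ}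
    (ha : Continuous a) {A : ℝ} (hA : ∀ x, ‖a x‖ ≤ A) (ha0 : ∀ x, ‖x - x₀‖ ≤ s + 2 * δ → a x = 0) :
    Negl (fun ħ ψ x => a x * symPacket Q χ ħ ψ x) := by
  refine ⟨fun ħ p0 p1 ψ => ha.stronglyMeasurable.mul
    ((temp_symPacket hQ hc hχ hχc).meas ħ p0 p1 ψ), fun n N => ?_⟩
  have hA0 : 0 ≤ A := (norm_nonneg _).trans (hA 0)
  obtain ⟨C₁, h10, h1⟩ := exists_pow_mul_wKer_symS_le hQ hc n
  obtain ⟨C₂, h20, h2⟩ := exists_pow_mul_rightOp_le hχ hχc (n + (d + 1))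
  obtain ⟨C₃, h30, h3⟩ := exists_weight_mul_wKer_symS_far_le hQ hc hδ n (N + d + d)
  obtain ⟨C₄, h40, h4⟩ := exists_weight_mul_rightOp_far_le hχ hχc hs hs0 hδ (n + (d + 1)) (N + d)
  set I := ∫ x : E d, (⟪x⟫ ^ (d + 1))⁻¹ with hI
  have hI0 : 0 ≤ I := integral_nonneg fun x => by positivity
  refine ⟨A * ((C₁ * C₄ + C₃ * C₂) * I), by positivity, fun ħ p0 p1 ψ x => ?_⟩
  have hl := l2_nonneg ψ
  by_cases hx : ‖x - x₀‖ ≤ s + 2 * δ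
  · rw [ha0 x hx, zero_mul, norm_zero, mul_zero]
    positivity
  have h5 : ∀ y, ⟪x⟫ ^ n * (⟪y⟫ ^ (d + 1) * (‖wKer ħ (symS Q ħ) x y‖ * ‖rightOp ħ χ ψ y‖))
      ≤ (C₁ * C₄ + C₃ * C₂) * ħ ^ (N + d) * l2 ψ := by
    intro y
    by_cases hy : s + δ ≤ ‖y - x₀‖
    · refine (weight_mul_le (norm_nonneg _) (norm_nonneg _) (h1 ħ p0 p1 x y)
        (h4 ħ p0 p1 ψ y hy)).trans ?_
      have : 0 ≤ C₃ * C₂ * ħ ^ (N + d) * l2 ψ := by positivity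
      linarith
    · have hxy : δ ≤ ‖x - y‖ := by
        have := norm_sub_le_norm_sub_add_norm_sub x y x₀
        linarith
      have h6 : ⟪y⟫ ^ (n + (d + 1)) * ‖rightOp ħ χ ψ y‖ ≤ C₂ * l2 ψ / ħ ^ d := by
        rw [le_div_iff₀ (by positivity)]
        exact h2 ħ p0 p1 ψ y
      refine (weight_mul_le (norm_nonneg _) (norm_nonneg _) (h3 ħ p0 p1 x y hxy) h6).trans ?_
      have h7 : C₃ * ħ ^ (N + d + d) * (C₂ * l2 ψ / ħ ^ d) = C₃ * C₂ * ħ ^ (N + d) * l2 ψ := by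
        rw [pow_add ħ (N + d)]
        field_simp
      rw [h7]
      have : 0 ≤ C₁ * C₄ * ħ ^ (N + d) * l2 ψ := by positivity
      linarith
  have h6 := norm_weylOp_symS_le hQ hc p0 p1 ((temp_rightOp hχ hχc).integrable p0 p1 ψ)
    (x := x) (a := ⟪x⟫ ^ n) (by positivity) h5
  rw [weylOp_rightOp_eq_symPacket hQ hc hχ hχc p0] at h6
  rw [norm_mul]
  calc _ = ‖a x‖ * (⟪x⟫ ^ n * ‖symPacket Q χ ħ ψ x‖) := by ring
    _ ≤ A * (‖planck d ħ‖ * ((C₁ * C₄ + C₃ * C₂) * ħ ^ (N + d) * l2 ψ * I)) :=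
        mul_le_mul (hA x) h6 (by positivity) hA0
    _ = A * ((C₁ * C₄ + C₃ * C₂) * I) * ħ ^ N * l2 ψ * (‖planck d ħ‖ * ħ ^ d) := by
        rw [pow_add]; ring
    _ ≤ A * ((C₁ * C₄ + C₃ * C₂) * I) * ħ ^ N * l2 ψ * 1 :=
        mul_le_mul_of_nonneg_left (planck_le p0) (by positivity)
    _ = A * ((C₁ * C₄ + C₃ * C₂) * I) * ħ ^ N * l2 ψ := mul_one _

lemma Temp.exists_l2_le {u : ℝ → 𝓢(E d, ℂ) → E d → ℂ} (hu : Temp u) {Ψ : ℝ → 𝓢(E d, ℂ) → 𝓢(E d, ℂ)}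
    (hΨ : ∀ ħ, 0 < ħ → ∀ ψ x, Ψ ħ ψ x = u ħ ψ x) : ∃ (M : ℕ) (C : ℝ), 0 ≤ C ∧
      ∀ ħ, 0 < ħ → ħ ≤ 1 → ∀ ψ, l2 (Ψ ħ ψ) * ħ ^ M ≤ C * l2 ψ := by
  obtain ⟨C₁, h10, h1⟩ := exists_eLpNorm_le_of_weight d
  obtain ⟨M, C₂, h20, h2⟩ := hu.bound (d + 1)
  refine ⟨M, C₁ * C₂, by positivity, fun ħ p0 p1 ψ => ?_⟩
  have hl := l2_nonneg ψ
  have h3 := h1 (Ψ ħ ψ) (C₂ * l2 ψ / ħ ^ M) (by positivity) (fun x => by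
    rw [hΨ ħ p0, le_div_iff₀ (by positivity)]
    exact h2 ħ p0 p1 ψ x)
  have h4 : l2 (Ψ ħ ψ) ≤ C₁ * (C₂ * l2 ψ / ħ ^ M) :=
    ENNReal.toReal_le_of_le_ofReal (by positivity) h3
  calc _ ≤ C₁ * (C₂ * l2 ψ / ħ ^ M) * ħ ^ M := mul_le_mul_of_nonneg_right h4 (by positivity)
    _ = C₁ * C₂ * l2 ψ := by field_simp

end SymbolPacket

/-! ### Tempered operators -/

section TemperedOperators

variable {d : ℕ}

/-- Functions that decay rapidly. -/
def Rapid (u : E d → ℂ) : Prop :=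
  StronglyMeasurable u ∧ ∀ n : ℕ, ∃ B, ∀ x, ⟪x⟫ ^ n * ‖u x‖ ≤ B

lemma Temp.rapid {u : ℝ → 𝓢(E d, ℂ) → E d → ℂ} (hu : Temp u) {ħ : ℝ} (p0 : 0 < ħ) (p1 : ħ ≤ 1)
    (ψ : 𝓢(E d, ℂ)) : Rapid (u ħ ψ) :=
  ⟨hu.meas ħ p0 p1 ψ, hu.exists_weight p0 p1 ψ⟩

/-- Operators, additive on rapidly decaying functions, that lose at most powers of `ħ` and of the
position. -/
structure TemperedOp (A : ℝ → (E d → ℂ) → E d → ℂ) : Prop where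
  add : ∀ᶠ ħ in 𝓝[>] (0 : ℝ), ∀ u v, Rapid u → Rapid v →
    A ħ (fun x => u x + v x) = fun x => A ħ u x + A ħ v x
  bound : ∃ (n M : ℕ) (C : ℝ), 0 ≤ C ∧ ∀ᶠ ħ in 𝓝[>] (0 : ℝ), ∀ (u : E d → ℂ) (B : ℝ), Rapid u →
    (∀ x, ⟪x⟫ ^ n * ‖u x‖ ≤ B) → PolyGrowth M (C * B / ħ ^ M) (A ħ u)

/-- `A u = w` up to `O(ħ^∞)` after microlocal cut-off. -/
structure AgreesTo (A : ℝ → (E d → ℂ) → E d → ℂ) (χ₁ : Phase d → ℂ)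
    (u w : ℝ → 𝓢(E d, ℂ) → E d → ℂ) : Prop where
  left : Temp u
  right : Temp w
  bound : ∀ N : ℕ, ∃ C : ℝ, ∀ᶠ ħ in 𝓝[>] (0 : ℝ), ∀ ψ : 𝓢(E d, ℂ),
    eLpNorm (weylOp ħ χ₁ (fun x => A ħ (u ħ ψ) x - w ħ ψ x)) 2 volume
      ≤ ENNReal.ofReal (C * ħ ^ N) * eLpNorm ψ 2 volume

lemma eventually_small : ∀ᶠ ħ : ℝ in 𝓝[>] 0, 0 < ħ ∧ ħ ≤ 1 := by
  filter_upwards [Ioc_mem_nhdsGT (zero_lt_one (α := ℝ))] with ħ h using h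

lemma stronglyMeasurable_weylOp {χ : Phase d → ℂ} (hχ : Continuous χ) (ħ : ℝ) {u : E d → ℂ}
    (hu : StronglyMeasurable u) : StronglyMeasurable (weylOp ħ χ u) := by
  have h2 : StronglyMeasurable (fun p : (E d × E d) × E d =>
      osc ħ (inner ℝ (p.1.1 - p.2) p.1.2) * χ (½ • (p.1.1 + p.2), p.1.2) * u p.2) := by
    refine StronglyMeasurable.mul (Continuous.stronglyMeasurable ?_)
      (hu.comp_measurable measurable_snd)
    exact (Continuous.comp' (contDiff_osc ħ (n := 0)).continuous (by fun_prop)).mul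
      (Continuous.comp' hχ (by fun_prop))
  exact (h2.integral_prod_right' (ν := (volume : Measure (E d)))).integral_prod_right'
    (ν := (volume : Measure (E d))) |>.const_mul (planck d ħ)

lemma aestronglyMeasurable_weylOp {χ : Phase d → ℂ} (hχ : Continuous χ) (ħ : ℝ) {u : E d → ℂ}
    (hu : AEStronglyMeasurable u) : AEStronglyMeasurable (weylOp ħ χ u) := by
  have h1 : weylOp ħ χ u = weylOp ħ χ (hu.mk u) := by
    funext x
    unfold weylOp
    congr 2
    funext ξ
    refine integral_congr_ae ?_
    filter_upwards [hu.ae_eq_mk] with y hy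
    rw [hy]
  rw [h1]
  exact (stronglyMeasurable_weylOp hχ ħ hu.stronglyMeasurable_mk).aestronglyMeasurable

lemma PolyGrowth.sub {m n : ℕ} {A B : ℝ} {u v : E d → ℂ} (hu : PolyGrowth m A u)
    (hv : PolyGrowth n B v) : PolyGrowth (m + n) (A + B) (fun x => u x - v x) := by
  refine ⟨hu.1.sub hv.1, fun x => ?_⟩
  have hA := hu.nonneg
  have hB := hv.nonneg
  have h1 : ⟪x⟫ ^ m ≤ ⟪x⟫ ^ (m + n) :=
    pow_le_pow_right₀ (by linarith [norm_nonneg x]) (by omega)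
  have h2 : ⟪x⟫ ^ n ≤ ⟪x⟫ ^ (m + n) :=
    pow_le_pow_right₀ (by linarith [norm_nonneg x]) (by omega)
  calc _ ≤ ‖u x‖ + ‖v x‖ := norm_sub_le _ _
    _ ≤ A * ⟪x⟫ ^ m + B * ⟪x⟫ ^ n := add_le_add (hu.2 x) (hv.2 x)
    _ ≤ A * ⟪x⟫ ^ (m + n) + B * ⟪x⟫ ^ (m + n) :=
        add_le_add (mul_le_mul_of_nonneg_left h1 hA) (mul_le_mul_of_nonneg_left h2 hB)
    _ = _ := by ring

lemma polyGrowth_of_bound {u : E d → ℂ} (hu : StronglyMeasurable u) {B : ℝ}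
    (hB : ∀ x, ‖u x‖ ≤ B) : PolyGrowth 0 B u :=
  ⟨hu.aestronglyMeasurable, fun x => by simpa using hB x⟩

variable {A : ℝ → (E d → ℂ) → E d → ℂ} {χ₁ : Phase d → ℂ} {u v w z : ℝ → 𝓢(E d, ℂ) → E d → ℂ}

lemma TemperedOp.polyGrowth_sub (hA : TemperedOp A) : ∃ (n M : ℕ) (C : ℝ), 0 ≤ C ∧
    ∀ᶠ ħ in 𝓝[>] (0 : ℝ), ∀ (u w : E d → ℂ) (B : ℝ), Rapid u → Rapid w →
      (∀ x, ⟪x⟫ ^ n * ‖u x‖ ≤ B) → (∀ x, ‖w x‖ ≤ B) →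
      PolyGrowth M (C * B / ħ ^ M) (fun x => A ħ u x - w x) := by
  obtain ⟨n, M, C, h0, h⟩ := hA.bound
  refine ⟨n, M, C + 1, by positivity, ?_⟩
  filter_upwards [h, eventually_small] with ħ h p u w B hu hw hu' hw'
  have h1 := (h u B hu hu').sub (polyGrowth_of_bound hw.1 hw')
  refine ⟨h1.1, fun x => (h1.2 x).trans (mul_le_mul_of_nonneg_right ?_ (by positivity))⟩
  have hB : 0 ≤ B := (norm_nonneg _).trans (hw' 0)
  have h2 : B ≤ B / ħ ^ M := le_div_self hB (pow_pos p.1 M) (pow_le_one₀ p.1.le p.2)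
  have h3 : (C + 1) * B / ħ ^ M = C * B / ħ ^ M + B / ħ ^ M := by ring
  linarith

lemma AgreesTo.add (hA : TemperedOp A) (hχ : C^∞ χ₁) (hc : HasCompactSupport χ₁)
    (h : AgreesTo A χ₁ u w) (h' : AgreesTo A χ₁ v z) :
    AgreesTo A χ₁ (fun ħ ψ x => u ħ ψ x + v ħ ψ x) (fun ħ ψ x => w ħ ψ x + z ħ ψ x) := by
  refine ⟨h.left.add h'.left, h.right.add h'.right, fun N => ?_⟩
  obtain ⟨C, hC⟩ := h.bound N
  obtain ⟨C', hC'⟩ := h'.bound N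
  obtain ⟨n, M, K, -, hK⟩ := hA.polyGrowth_sub
  refine ⟨|C| + |C'|, ?_⟩
  filter_upwards [hC, hC', hK, hA.add, eventually_small] with ħ hC hC' hK hadd p ψ
  have ex : ∀ {u w : ℝ → 𝓢(E d, ℂ) → E d → ℂ}, AgreesTo A χ₁ u w →
      ∃ B, PolyGrowth M B (fun x => A ħ (u ħ ψ) x - w ħ ψ x) := by
    intro u w h
    obtain ⟨B, hB⟩ := h.left.exists_weight p.1 p.2 ψ n
    obtain ⟨B', hB'⟩ := h.right.exists_weight p.1 p.2 ψ 0
    exact ⟨_, hK _ _ (max B B') (h.left.rapid p.1 p.2 ψ) (h.right.rapid p.1 p.2 ψ)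
      (fun x => (hB x).trans (le_max_left _ _))
      (fun x => by simpa using (hB' x).trans (le_max_right B B'))⟩
  obtain ⟨B, hB⟩ := ex h
  obtain ⟨B', hB'⟩ := ex h'
  have e1 : (fun x => A ħ (fun x => u ħ ψ x + v ħ ψ x) x - (w ħ ψ x + z ħ ψ x))
      = fun x => (A ħ (u ħ ψ) x - w ħ ψ x) + (A ħ (v ħ ψ) x - z ħ ψ x) := by
    rw [hadd _ _ (h.left.rapid p.1 p.2 ψ) (h'.left.rapid p.1 p.2 ψ)]
    funext x
    ring
  have e2 : weylOp ħ χ₁ (fun x => (A ħ (u ħ ψ) x - w ħ ψ x) + (A ħ (v ħ ψ) x - z ħ ψ x))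
      = weylOp ħ χ₁ (fun x => A ħ (u ħ ψ) x - w ħ ψ x)
        + weylOp ħ χ₁ (fun x => A ħ (v ħ ψ) x - z ħ ψ x) :=
    funext fun x => weylOp_add_of_polyGrowth hχ hc ħ hB hB' x
  have e3 : ∀ c : ℝ, ENNReal.ofReal (c * ħ ^ N) ≤ ENNReal.ofReal (|c| * ħ ^ N) := fun c =>
    ENNReal.ofReal_le_ofReal (mul_le_mul_of_nonneg_right (le_abs_self c) (pow_nonneg p.1.le N))
  rw [e1, e2]
  refine (eLpNorm_add_le (aestronglyMeasurable_weylOp hχ.continuous ħ hB.1)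
    (aestronglyMeasurable_weylOp hχ.continuous ħ hB'.1) (by norm_num)).trans ?_
  rw [add_mul, ENNReal.ofReal_add (mul_nonneg (abs_nonneg _) (pow_nonneg p.1.le N))
    (mul_nonneg (abs_nonneg _) (pow_nonneg p.1.le N)), add_mul]
  exact add_le_add ((hC ψ).trans (mul_le_mul_left (e3 C) _))
    ((hC' ψ).trans (mul_le_mul_left (e3 C') _))

lemma AgreesTo.of_negl (hA : TemperedOp A) (hχ : C^∞ χ₁) (hc : HasCompactSupport χ₁)
    (hu : Negl u) (hw : Negl w) : AgreesTo A χ₁ u w := by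
  refine ⟨hu.temp, hw.temp, fun N => ?_⟩
  obtain ⟨n, M, K, hK0, hK⟩ := hA.polyGrowth_sub
  obtain ⟨C₁, h10, h1⟩ := hu.bound n (N + M + d)
  obtain ⟨C₂, h20, h2⟩ := hw.bound 0 (N + M + d)
  obtain ⟨C₃, h30, h3⟩ := exists_eLpNorm_weylOp_le hχ hc M
  refine ⟨C₃ * (K * (C₁ + C₂)), ?_⟩
  filter_upwards [hK, eventually_small] with ħ hK p ψ
  have hl := l2_nonneg ψ
  have p0 := p.1
  have h4 := hK (u ħ ψ) (w ħ ψ) ((C₁ + C₂) * ħ ^ (N + M + d) * l2 ψ) (hu.temp.rapid p.1 p.2 ψ)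
    (hw.temp.rapid p.1 p.2 ψ)
    (fun x => (h1 ħ p.1 p.2 ψ x).trans (by
      have : 0 ≤ C₂ * ħ ^ (N + M + d) * l2 ψ := by positivity
      linarith))
    (fun x => by
      have e1 := h2 ħ p.1 p.2 ψ x
      have : 0 ≤ C₁ * ħ ^ (N + M + d) * l2 ψ := by positivity
      rw [pow_zero, one_mul] at e1
      linarith)
  refine (h3 ħ p.1 p.2 _ _ h4).trans ?_
  rw [← ofReal_l2, ← ENNReal.ofReal_mul (by positivity)]
  refine ENNReal.ofReal_le_ofReal ?_
  have e2 : C₃ * ‖planck d ħ‖ * (K * ((C₁ + C₂) * ħ ^ (N + M + d) * l2 ψ) / ħ ^ M)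
      = C₃ * (K * (C₁ + C₂)) * ħ ^ N * l2 ψ * (‖planck d ħ‖ * ħ ^ d) := by
    rw [pow_add, pow_add]
    field_simp
  rw [e2]
  calc _ ≤ C₃ * (K * (C₁ + C₂)) * ħ ^ N * l2 ψ * 1 :=
        mul_le_mul_of_nonneg_left (planck_le p.1) (by positivity)
    _ = _ := mul_one _

lemma AgreesTo.congr (h : AgreesTo A χ₁ u w) (h1 : ∀ ħ, 0 < ħ → ħ ≤ 1 → ∀ ψ x, v ħ ψ x = u ħ ψ x)
    (h2 : ∀ ħ, 0 < ħ → ħ ≤ 1 → ∀ ψ x, z ħ ψ x = w ħ ψ x) : AgreesTo A χ₁ v z := by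
  refine ⟨h.left.congr h1, h.right.congr h2, fun N => ?_⟩
  obtain ⟨C, hC⟩ := h.bound N
  refine ⟨C, ?_⟩
  filter_upwards [hC, eventually_small] with ħ hC p ψ
  rw [show v ħ ψ = u ħ ψ from funext (h1 ħ p.1 p.2 ψ),
    show z ħ ψ = w ħ ψ from funext (h2 ħ p.1 p.2 ψ)]
  exact hC ψ

lemma AgreesTo.sum (hA : TemperedOp A) (hχ : C^∞ χ₁) (hc : HasCompactSupport χ₁)
    {ι : Type*} (s : Finset ι) {u w : ι → ℝ → 𝓢(E d, ℂ) → E d → ℂ}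
    (h : ∀ i, AgreesTo A χ₁ (u i) (w i)) :
    AgreesTo A χ₁ (fun ħ ψ x => ∑ i ∈ s, u i ħ ψ x) (fun ħ ψ x => ∑ i ∈ s, w i ħ ψ x) := by
  classical
  induction s using Finset.induction_on with
  | empty =>
    simp only [Finset.sum_empty]
    exact AgreesTo.of_negl hA hχ hc negl_zero negl_zero
  | insert i s hi ih =>
    simp only [Finset.sum_insert hi]
    exact AgreesTo.add hA hχ hc (h i) ih

end TemperedOperators

end

section

section InverseFIO

variable {d : ℕ} (G : GeneralLinearGroup (Fin (d + 1)) ℝ)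

/-- The inner integral of the inverse Fourier integral operator. -/
noncomputable def fioInt (ħ : ℝ) (b : E d × E d × E d → ℂ) (u : E d → ℂ) (p : E d × E d) : ℂ :=
  ∫ y : E d, osc ħ (inner ℝ p.1 p.2 - inner ℝ y (gMap G p.2)) * b (p.1, y, p.2) * u y

lemma stronglyMeasurable_fioInt (ħ : ℝ) {b : E d × E d × E d → ℂ} (hb : Continuous b)
    {u : E d → ℂ} (hu : StronglyMeasurable u) :
    StronglyMeasurable (fun q : (E d × E d) × E d =>
      osc ħ (inner ℝ q.1.1 q.1.2 - inner ℝ q.2 (gMap G q.1.2)) * b (q.1.1, q.2, q.1.2) * u q.2) ∧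
    StronglyMeasurable (fioInt G ħ b u) := by
  have h1 : StronglyMeasurable (fun q : (E d × E d) × E d =>
      osc ħ (inner ℝ q.1.1 q.1.2 - inner ℝ q.2 (gMap G q.1.2)) * b (q.1.1, q.2, q.1.2) * u q.2) := by
    refine StronglyMeasurable.mul (Continuous.stronglyMeasurable ?_)
      (hu.comp_measurable measurable_snd)
    have hg : Continuous (fun q : (E d × E d) × E d => gMap G q.1.2) :=
      Continuous.comp' (continuous_gMap G) (by fun_prop)
    exact (Continuous.comp' (contDiff_osc ħ (n := 0)).continuous (by fun_prop)).mul
      (Continuous.comp' hb (by fun_prop))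
  exact ⟨h1, StronglyMeasurable.integral_prod_right' (ν := (volume : Measure (E d))) h1⟩

lemma fioInt_bound {ħ : ℝ} {b : E d × E d × E d → ℂ} (hb : Continuous b) {m : ℕ} {K : ℝ}
    {L : Set (E d)} (hL : L ⊆ ball 0 1) (hbL : ∀ w, w.2.2 ∉ L → b w = 0)
    (hK : ∀ w, ‖b w‖ ≤ K * ⟪w⟫ ^ m) {u : E d → ℂ} {B : ℝ} (hu : StronglyMeasurable u)
    (hB : ∀ x, ⟪x⟫ ^ (m + (d + 1)) * ‖u x‖ ≤ B) (x ξ : E d) :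
    Integrable (fun y =>
      osc ħ (inner ℝ x ξ - inner ℝ y (gMap G ξ)) * b (x, y, ξ) * u y) ∧
    ‖fioInt G ħ b u (x, ξ)‖ ≤ K * 2 ^ m * ⟪x⟫ ^ m * (B * ∫ y : E d, (⟪y⟫ ^ (d + 1))⁻¹) := by
  have hK0 : 0 ≤ K := by simpa using (norm_nonneg _).trans (hK 0)
  obtain ⟨h1, h2⟩ := integrable_of_weight hu m hB
  have h3 : ∀ y, ‖osc ħ (inner ℝ x ξ - inner ℝ y (gMap G ξ)) * b (x, y, ξ) * u y‖
      ≤ K * 2 ^ m * ⟪x⟫ ^ m * (⟪y⟫ ^ m * ‖u y‖) := by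
    intro y
    rw [norm_mul, norm_mul, norm_osc, one_mul, ← mul_assoc]
    refine mul_le_mul_of_nonneg_right ?_ (norm_nonneg _)
    by_cases hξ : ξ ∈ L
    · refine (hK _).trans ?_
      have h4 : ‖ξ‖ < 1 := by simpa using hL hξ
      have h5 : 1 + ‖(x, y, ξ)‖ ≤ 2 * ⟪x⟫ * ⟪y⟫ := by
        simp only [Prod.norm_def]
        have hx := norm_nonneg x
        have hy := norm_nonneg y
        rcases max_cases ‖x‖ (max ‖y‖ ‖ξ‖) with h | h <;>
          rcases max_cases ‖y‖ ‖ξ‖ with h' | h' <;> nlinarith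
      rw [mul_assoc K, mul_assoc K, ← mul_pow, ← mul_pow]
      exact mul_le_mul_of_nonneg_left (pow_le_pow_left₀ (by positivity) h5 m) hK0
    · rw [hbL _ hξ, norm_zero]
      positivity
  refine ⟨(h1.const_mul _).mono' ?_ (.of_forall h3), ?_⟩
  · exact ((stronglyMeasurable_fioInt G ħ hb hu).1.comp_measurable
      (measurable_const.prodMk measurable_id : Measurable fun y : E d => ((x, ξ), y))
      ).aestronglyMeasurable
  · refine (norm_integral_le_of_norm_le (h1.const_mul _) (.of_forall h3)).trans ?_
    rw [integral_const_mul]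
    exact mul_le_mul_of_nonneg_left h2 (by positivity)

lemma integrable_fioInt {ħ : ℝ} {b : E d × E d × E d → ℂ} (hb : Continuous b) {m : ℕ} {K : ℝ}
    {L : Set (E d)} (hLc : IsCompact L) (hL : L ⊆ ball 0 1)
    (hbL : ∀ w, w.2.2 ∉ L → b w = 0) (hK : ∀ w, ‖b w‖ ≤ K * ⟪w⟫ ^ m) {u : E d → ℂ} {B : ℝ}
    (hu : StronglyMeasurable u) (hB : ∀ x, ⟪x⟫ ^ (m + (d + 1)) * ‖u x‖ ≤ B) (x : E d) :
    Integrable (fun ξ => fioInt G ħ b u (x, ξ)) ∧ ‖∫ ξ, fioInt G ħ b u (x, ξ)‖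
      ≤ K * 2 ^ m * ⟪x⟫ ^ m * (B * ∫ y : E d, (⟪y⟫ ^ (d + 1))⁻¹) * volume.real L := by
  have h0 : ∀ ξ ∉ L, fioInt G ħ b u (x, ξ) = 0 := fun ξ hξ => by
    unfold fioInt
    simp only [hbL (x, _, ξ) hξ, mul_zero, zero_mul, integral_zero]
  have h1 := fun ξ => (fioInt_bound G (ħ := ħ) hb hL hbL hK hu hB x ξ).2
  have hms := (stronglyMeasurable_fioInt G ħ hb hu).2.comp_measurable
    (measurable_const.prodMk measurable_id : Measurable fun ξ : E d => (x, ξ))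
  constructor
  · rw [← integrableOn_iff_integrable_of_support_subset (s := L)
      (Function.support_subset_iff'.2 h0)]
    exact Measure.integrableOn_of_bounded hLc.measure_lt_top.ne hms.aestronglyMeasurable
      (.of_forall h1)
  · rw [← setIntegral_eq_integral_of_forall_compl_eq_zero h0]
    exact norm_setIntegral_le_of_norm_le_const hLc.measure_lt_top fun ξ _ => h1 ξ

lemma temperedOp_inverseFIO {b : ℝ → E d × E d × E d → ℂ} (hb : IsAmplitude b) :
    TemperedOp (fun ħ u => inverseFIO G ħ (b ħ) u) := by
  obtain ⟨hbs, ⟨L, hLc, hL, hbL⟩, m, hm⟩ := hb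
  obtain ⟨C, hC⟩ := hm 0
  have hK : ∀ᶠ ħ in 𝓝[>] (0 : ℝ), ∀ w, ‖b ħ w‖ ≤ |C| / ħ ^ m * ⟪w⟫ ^ m := by
    filter_upwards [hC, eventually_small] with ħ h p w
    have h1 := h w
    rw [norm_iteratedFDeriv_zero] at h1
    have p0 := p.1
    exact h1.trans (mul_le_mul_of_nonneg_right
      (div_le_div_of_nonneg_right (le_abs_self C) (by positivity)) (by positivity))
  have heq : ∀ ħ u x, inverseFIO G ħ (b ħ) u x = planck d ħ * ∫ ξ, fioInt G ħ (b ħ) u (x, ξ) :=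
    fun ħ u x => inverseFIO_eq G ħ (b ħ) u x
  set I := ∫ y : E d, (⟪y⟫ ^ (d + 1))⁻¹ with hI
  have hI0 : 0 ≤ I := integral_nonneg fun x => by positivity
  refine ⟨?_, m + (d + 1), m + d, |C| * 2 ^ m * I * volume.real L, by positivity, ?_⟩
  · filter_upwards [hK, eventually_small] with ħ hK p u v hu hv
    have hc := (hbs ħ p.1).continuous
    obtain ⟨B, hB⟩ := hu.2 (m + (d + 1))
    obtain ⟨B', hB'⟩ := hv.2 (m + (d + 1))
    funext x
    rw [heq, heq, heq, ← mul_add,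
      ← integral_add (integrable_fioInt G hc hLc hL (hbL ħ p.1) hK hu.1 hB x).1
        (integrable_fioInt G hc hLc hL (hbL ħ p.1) hK hv.1 hB' x).1]
    congr 2
    funext ξ
    unfold fioInt
    rw [← integral_add (fioInt_bound G hc hL (hbL ħ p.1) hK hu.1 hB x ξ).1
      (fioInt_bound G hc hL (hbL ħ p.1) hK hv.1 hB' x ξ).1]
    simp only [mul_add]
  · filter_upwards [hK, eventually_small] with ħ hK p u B hu hB
    have hc := (hbs ħ p.1).continuous
    have p0 := p.1
    have hB0 : 0 ≤ B := le_trans (by positivity) (hB 0)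
    refine ⟨?_, fun x => ?_⟩
    · have h1 := ((stronglyMeasurable_fioInt G ħ hc hu.1).2.integral_prod_right'
        (ν := (volume : Measure (E d)))).const_mul (planck d ħ)
      show AEStronglyMeasurable (inverseFIO G ħ (b ħ) u) _
      rw [show inverseFIO G ħ (b ħ) u = _ from funext (heq ħ u)]
      exact h1.aestronglyMeasurable
    · rw [heq, norm_mul]
      have h1 := (integrable_fioInt G (ħ := ħ) hc hLc hL (hbL ħ p.1) hK hu.1 hB x).2
      have h2 : ‖planck d ħ‖ ≤ 1 / ħ ^ d := by
        rw [le_div_iff₀ (by positivity)]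
        exact planck_le p0
      have h3 : ⟪x⟫ ^ m ≤ ⟪x⟫ ^ (m + d) :=
        pow_le_pow_right₀ (by linarith [norm_nonneg x]) (by omega)
      calc _ ≤ 1 / ħ ^ d * (|C| / ħ ^ m * 2 ^ m * ⟪x⟫ ^ m * (B * I) * volume.real L) :=
            mul_le_mul h2 h1 (norm_nonneg _) (by positivity)
        _ = |C| * 2 ^ m * I * volume.real L * B / ħ ^ (m + d) * ⟪x⟫ ^ m := by
            rw [pow_add]; field_simp
        _ ≤ _ := mul_le_mul_of_nonneg_left h3 (by positivity)

end InverseFIO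

end

section

section LocalEgorov

variable {d : ℕ} {G : GeneralLinearGroup (Fin (d + 1)) ℝ}

lemma Temp.of_l2 {g : ℝ → 𝓢(E d, ℂ) → E d → ℂ} (hg : Temp g)
    {Ψ : ℝ → 𝓢(E d, ℂ) → 𝓢(E d, ℂ)} {M : ℕ} {C : ℝ} (h0 : 0 ≤ C)
    (hΨ : ∀ ħ, 0 < ħ → ħ ≤ 1 → ∀ ψ, l2 (Ψ ħ ψ) * ħ ^ M ≤ C * l2 ψ) :
    Temp (fun ħ ψ => g ħ (Ψ ħ ψ)) := by
  refine ⟨fun ħ p0 p1 ψ => hg.meas ħ p0 p1 _, fun n => ?_⟩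
  obtain ⟨M', C', h0', h'⟩ := hg.bound n
  refine ⟨M' + M, C' * C, by positivity, fun ħ p0 p1 ψ x => ?_⟩
  calc _ = ⟪x⟫ ^ n * ‖g ħ (Ψ ħ ψ) x‖ * ħ ^ M' * ħ ^ M := by rw [pow_add]; ring
    _ ≤ C' * l2 (Ψ ħ ψ) * ħ ^ M := mul_le_mul_of_nonneg_right (h' ħ p0 p1 _ x) (by positivity)
    _ = C' * (l2 (Ψ ħ ψ) * ħ ^ M) := by ring
    _ ≤ C' * (C * l2 ψ) := mul_le_mul_of_nonneg_left (hΨ ħ p0 p1 ψ) h0'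
    _ = C' * C * l2 ψ := by ring

lemma temp_transport {χ : Phase d → ℂ} (hχ : C^∞ χ) (hc : HasCompactSupport χ)
    {h : E d → E d} (hh : C^∞ h) {D : E d → ℂ} (hD : C^∞ D)
    (hDc : HasCompactSupport D) :
    Temp (fun ħ ψ => invFourierH ħ (fun η => packet χ ħ ψ (h η) * D η)) :=
  ⟨fun ħ _ _ ψ => meas_invFourierH ħ (((contDiff_packet hχ hc ħ ψ).continuous.comp'
      hh.continuous).mul hD.continuous).stronglyMeasurable,
    fun n => by
      obtain ⟨C, h0, h1⟩ := exists_pow_mul_transport_le hχ hc hh hD hDc n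
      exact ⟨d, C, h0, h1⟩⟩

variable {ξ₀ : E d} {r : ℝ} {h : E d → E d} {D : E d → ℂ} {b β ρ : E d → ℂ}

lemma fourierH_cutoff_split {θ c : E d → ℂ} (hθ : Continuous θ) (hθ1 : ∀ x, ‖θ x‖ ≤ 1) (ħ : ℝ)
    (Ψ : 𝓢(E d, ℂ)) (ξ : E d) : fourierH ħ Ψ ξ * c ξ = packet (fun p => θ p.1 * c p.2) ħ Ψ ξ
        + fourierH ħ (fun x => (1 - θ x) * Ψ x) ξ * c ξ := by
  have h1 : Integrable (fun x => θ x * Ψ x) :=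
    Ψ.integrable.bdd_mul hθ.aestronglyMeasurable (.of_forall hθ1)
  have h2 : Integrable (fun x => (1 - θ x) * Ψ x) := by
    refine (Ψ.integrable.sub h1).congr (.of_forall fun x => ?_)
    simp only [Pi.sub_apply]
    ring
  have h3 : packet (fun p => θ p.1 * c p.2) ħ Ψ ξ = fourierH ħ (fun x => θ x * Ψ x) ξ * c ξ := by
    unfold packet fourierH
    rw [← integral_mul_const]
    congr 1
    funext w
    ring
  rw [h3, ← add_mul, ← fourierH_add h1 h2]
  congr 2
  funext x
  ring

/-- The local form of the theorem, for wave packets in the domain of a chart. -/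
lemma FreqChart.agreesTo (H : FreqChart G ξ₀ r h D) (hcut : CutoffsAdapted G ξ₀ r b β ρ)
    {q : Phase d → ℂ} (hQ : C^∞ (conjAmp G q b β ρ))
    (hQc : HasCompactSupport (conjAmp G q b β ρ)) {A : ℝ → (E d → ℂ) → E d → ℂ}
    (hA : TemperedOp A) {χ₁ χ : Phase d → ℂ} (hχ₁ : C^∞ χ₁) (hχ₁c : HasCompactSupport χ₁)
    (hχ : C^∞ χ) (hχc : HasCompactSupport χ) {x₀ : E d} {s : ℝ} (hs0 : 0 < s)
    (hs : ∀ w ξ, s ≤ ‖w - x₀‖ → χ (w, ξ) = 0) (hξ : ∀ w ξ, r / 4 ≤ ‖ξ - ξ₀‖ → χ (w, ξ) = 0)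
    (hU : ∀ χ₂ : Phase d → ℂ, C^∞ χ₂ → HasCompactSupport χ₂ →
      tsupport χ₂ ⊆ closedBall x₀ (2 * s) ×ˢ closedBall ξ₀ (r / 2) →
      ∀ N : ℕ, ∃ C : ℝ, ∀ᶠ ħ in 𝓝[>] (0 : ℝ), ∀ ψ : 𝓢(E d, ℂ),
        eLpNorm (weylOp ħ χ₁ (fun x => A ħ (propagator G ħ (rightOp ħ χ₂ ψ)) x
          - rightOp ħ χ₂ ψ x)) 2 volume ≤ ENNReal.ofReal (C * ħ ^ N) * eLpNorm ψ 2 volume) :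
    AgreesTo A χ₁ (fun ħ ψ => invFourierH ħ
      (ampOp (nearAmp q b) ħ (fun η => packet χ ħ ψ (h η) * D η)))
      (symPacket (conjAmp G q b β ρ) χ) := by
  have r0 := H.good.1
  obtain ⟨Λ, hΛ, hb⟩ := H.bound
  obtain ⟨θ, hθ, hθc, hθ1, hθ0, hθb⟩ := exists_cutoff d x₀ (by linarith : 0 < 3 / 2 * s)
    (by linarith : 3 / 2 * s < 2 * s)
  obtain ⟨c, hc, hcc, hc1, hc0, -⟩ := exists_cutoff d ξ₀ (by linarith : 0 < 3 / 8 * r)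
    (by linarith : 3 / 8 * r < r / 2)
  obtain ⟨c₂, hc₂, hcc₂, hc₂1, -, -⟩ := exists_cutoff d ξ₀ (by linarith : 0 < r / 2)
    (by linarith : r / 2 < r)
  set Q := conjAmp G q b β ρ with hQdef
  set χ₂ : Phase d → ℂ := fun p => θ p.1 * c p.2 with hχ₂def
  have hχ₂ : C^∞ χ₂ := (ContDiff.fun_comp hθ contDiff_fst).mul (ContDiff.fun_comp hc contDiff_snd)
  have hχ₂0 : ∀ p ∉ closedBall x₀ (2 * s) ×ˢ closedBall ξ₀ (r / 2), χ₂ p = 0 := by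
    intro p hp
    by_cases h1 : ‖p.1 - x₀‖ ≤ 2 * s
    · have h2 : r / 2 ≤ ‖p.2 - ξ₀‖ := by
        by_contra h3
        exact hp ⟨mem_closedBall_iff_norm.2 h1, mem_closedBall_iff_norm.2 (not_le.1 h3).le⟩
      simp only [hχ₂def, hc0 _ h2, mul_zero]
    · simp only [hχ₂def, hθ0 _ (not_le.1 h1).le, zero_mul]
  have hcb : IsCompact (closedBall x₀ (2 * s) ×ˢ closedBall ξ₀ (r / 2)) :=
    (isCompact_closedBall _ _).prod (isCompact_closedBall _ _)
  have hχ₂c : HasCompactSupport χ₂ := .intro hcb hχ₂0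
  have hχ₂s : tsupport χ₂ ⊆ closedBall x₀ (2 * s) ×ˢ closedBall ξ₀ (r / 2) :=
    closure_minimal (Function.support_subset_iff'.2 hχ₂0) hcb.isClosed
  have hp0 : ∀ ħ (ψ : 𝓢(E d, ℂ)) ξ, r / 2 ≤ ‖ξ - ξ₀‖ → packet χ₂ ħ ψ ξ = 0 := fun ħ ψ ξ h1 =>
    packet_eq_zero (fun w => by simp only [hχ₂def, hc0 _ h1, mul_zero]) ħ ψ
  have htd := fun ħ (ψ : 𝓢(E d, ℂ)) => contDiff_ampOp_packet hQ hQc hχ hχc ħ ψ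
  have htc := fun ħ (ψ : 𝓢(E d, ℂ)) =>
    compactSupp_ampOp hQc ħ (compactSupp_packet hχc ħ ψ)
  have ht0 : ∀ ħ (ψ : 𝓢(E d, ℂ)) ξ, r / 4 + r / 8 ≤ ‖ξ - ξ₀‖ → ampOp Q ħ (packet χ ħ ψ) ξ = 0 :=
    fun ħ ψ ξ h1 => ampOp_eq_zero (ρ := r / 8)
      (fun z ϑ hϑ => by simp only [hQdef, conjAmp, hcut.diff_eq_zero ϑ hϑ, zero_mul]) ħ
      (fun ξ h2 => packet_eq_zero (fun w => hξ w ξ h2) ħ ψ) h1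
  have hex : ∀ ħ (ψ : 𝓢(E d, ℂ)), ∃ Ψ : 𝓢(E d, ℂ), 0 < ħ → (∀ x, Ψ x = symPacket Q χ ħ ψ x) ∧
      ∀ ξ, fourierH ħ Ψ ξ = ampOp Q ħ (packet χ ħ ψ) ξ := by
    intro ħ ψ
    by_cases p0 : 0 < ħ
    · obtain ⟨Ψ, h1⟩ := exists_schwartz p0 (htd ħ ψ) (htc ħ ψ)
      exact ⟨Ψ, fun _ => h1⟩
    · exact ⟨0, fun h => absurd h p0⟩
  choose Ψ hΨ using hex
  obtain ⟨M, C₀, h00, hl2⟩ := (temp_symPacket hQ hQc hχ hχc).exists_l2_le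
    fun ħ p0 ψ => (hΨ ħ ψ p0).1
  set v : ℝ → 𝓢(E d, ℂ) → E d → ℂ := fun ħ ψ x => (1 - θ x) * symPacket Q χ ħ ψ x with hv
  have hvN : Negl v := negl_symPacket_far hQ hQc hχ hχc hs hs0 (δ := s / 4) (by linarith)
    (continuous_const.sub hθ.continuous) (A := 2)
    (fun x => (norm_sub_le _ _).trans (by rw [norm_one]; linarith [hθb x]))
    (fun x hx => by rw [hθ1 x (by linarith), sub_self])
  have key : ∀ ħ, 0 < ħ → ∀ (ψ : 𝓢(E d, ℂ)) ξ, ampOp Q ħ (packet χ ħ ψ) ξ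
      = packet χ₂ ħ (Ψ ħ ψ) ξ + fourierH ħ (v ħ ψ) ξ * c ξ := by
    intro ħ p0 ψ ξ
    have h1 : ampOp Q ħ (packet χ ħ ψ) ξ = fourierH ħ (Ψ ħ ψ) ξ * c ξ := by
      rw [(hΨ ħ ψ p0).2]
      by_cases h2 : ‖ξ - ξ₀‖ ≤ 3 / 8 * r
      · rw [hc1 ξ h2, mul_one]
      · rw [ht0 ħ ψ ξ (by linarith), zero_mul]
    rw [h1, fourierH_cutoff_split hθ.continuous hθb]
    simp only [(hΨ ħ ψ p0).1, hv, hχ₂def]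
  have hsplit : ∀ ħ, 0 < ħ → ∀ (ψ : 𝓢(E d, ℂ)) (k : E d → E d) (_ : C^∞ k) (a : E d → ℂ)
      (_ : C^∞ a) (_ : HasCompactSupport a) x,
      invFourierH ħ (fun η => ampOp Q ħ (packet χ ħ ψ) (k η) * a η) x
        = invFourierH ħ (fun η => packet χ₂ ħ (Ψ ħ ψ) (k η) * a η) x
          + invFourierH ħ (fun η => fourierH ħ (v ħ ψ) (k η) * (c (k η) * a η)) x := by
    intro ħ p0 ψ k hk a ha hac x
    have i1 : Integrable (fun η => ampOp Q ħ (packet χ ħ ψ) (k η) * a η) :=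
      (((htd ħ ψ).continuous.comp' hk.continuous).mul ha.continuous).integrable_of_hasCompactSupport
        hac.mul_left
    have i2 : Integrable (fun η => packet χ₂ ħ (Ψ ħ ψ) (k η) * a η) :=
      (((contDiff_packet hχ₂ hχ₂c ħ (Ψ ħ ψ)).continuous.comp' hk.continuous).mul
        ha.continuous).integrable_of_hasCompactSupport hac.mul_left
    have e1 : ∀ η, ampOp Q ħ (packet χ ħ ψ) (k η) * a η = packet χ₂ ħ (Ψ ħ ψ) (k η) * a η
        + fourierH ħ (v ħ ψ) (k η) * (c (k η) * a η) := fun η => by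
      rw [key ħ p0]
      ring
    have i3 : Integrable (fun η => fourierH ħ (v ħ ψ) (k η) * (c (k η) * a η)) :=
      (i1.sub i2).congr (.of_forall fun η => by
        simp only [Pi.sub_apply, e1]
        ring)
    rw [← invFourierH_add i2 i3]
    simp only [e1]
  have hneg : ∀ (k : E d → E d) (_ : C^∞ k) (Λ : ℝ) (_ : 0 ≤ Λ)
      (_ : ∀ η, ‖fderiv ℝ k η‖ ≤ Λ) (a : E d → ℂ) (_ : C^∞ a) (_ : HasCompactSupport a),
      Negl (fun ħ ψ => invFourierH ħ (fun η => fourierH ħ (v ħ ψ) (k η) * (c (k η) * a η))) :=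
    fun k hk Λ hΛ hb a ha hac => hvN.superposition hk ((ContDiff.fun_comp hc hk).mul ha)
      hac.mul_left hΛ hb
  have hU' : AgreesTo A χ₁ (fun ħ ψ => invFourierH ħ (fun η => packet χ₂ ħ (Ψ ħ ψ) (h η) * D η))
      (fun ħ ψ => rightOp ħ χ₂ (Ψ ħ ψ)) := by
    refine ⟨(temp_transport hχ₂ hχ₂c H.smooth H.smooth_jac H.compact_jac).of_l2 h00 hl2,
      (temp_rightOp hχ₂ hχ₂c).of_l2 h00 hl2, fun N => ?_⟩
    obtain ⟨C, hC⟩ := hU χ₂ hχ₂ hχ₂c hχ₂s (N + M)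
    refine ⟨|C| * C₀, ?_⟩
    filter_upwards [hC, eventually_small] with ħ hC p ψ
    have p0 := p.1
    have e1 : propagator G ħ (rightOp ħ χ₂ (Ψ ħ ψ))
        = invFourierH ħ (fun η => packet χ₂ ħ (Ψ ħ ψ) (h η) * D η) := by
      rw [propagator_eq_uHat G (fourierH_rightOp hχ₂ hχ₂c p.1 (Ψ ħ ψ)) fun ξ h1 => hp0 ħ _ ξ ?_,
        H.uHat_eq ħ (hp0 ħ _)]
      by_contra h2
      exact absurd (H.good.norm_lt_one (ξ := ξ) (by rw [mem_ball_iff_norm]; linarith)) (not_lt.2 h1)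
    have h1 := hC (Ψ ħ ψ)
    rw [e1] at h1
    refine h1.trans ?_
    have hl := l2_nonneg (Ψ ħ ψ)
    rw [← ofReal_l2, ← ofReal_l2, ← ENNReal.ofReal_mul' hl, ← ENNReal.ofReal_mul' (l2_nonneg ψ)]
    refine ENNReal.ofReal_le_ofReal ?_
    calc _ ≤ |C| * ħ ^ (N + M) * l2 (Ψ ħ ψ) := mul_le_mul_of_nonneg_right
          (mul_le_mul_of_nonneg_right (le_abs_self C) (by positivity)) hl
      _ = |C| * ħ ^ N * (l2 (Ψ ħ ψ) * ħ ^ M) := by rw [pow_add]; ring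
      _ ≤ |C| * ħ ^ N * (C₀ * l2 ψ) := mul_le_mul_of_nonneg_left (hl2 ħ p.1 p.2 ψ) (by positivity)
      _ = _ := by ring
  refine (hU'.add hA hχ₁ hχ₁c (AgreesTo.of_negl hA hχ₁ hχ₁c
    (hneg h H.smooth Λ hΛ hb D H.smooth_jac H.compact_jac)
    (hneg (fun η => η) contDiff_id 1 zero_le_one
      (fun η => by rw [fderiv_fun_id]; exact ContinuousLinearMap.norm_id_le) c₂ hc₂ hcc₂))).congr
    (fun ħ p0 _ ψ x => ?_) (fun ħ p0 _ ψ x => ?_)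
  · rw [show ampOp (nearAmp q b) ħ (fun η => packet χ ħ ψ (h η) * D η) = _ from
      funext (H.ampOp_nearAmp hcut q ħ (f := packet χ ħ ψ)
        fun ξ h1 => packet_eq_zero (fun w => hξ w ξ h1) ħ ψ)]
    exact hsplit ħ p0 ψ h H.smooth D H.smooth_jac H.compact_jac x
  · have hmul : ∀ (f : E d → ℂ), (∀ ξ, r / 2 ≤ ‖ξ - ξ₀‖ → f ξ = 0) →
        (fun η => f η * c₂ η) = f := by
      intro f hf
      funext η
      by_cases h1 : ‖η - ξ₀‖ ≤ r / 2
      · rw [hc₂1 η h1, mul_one]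
      · rw [hf η (not_le.1 h1).le, zero_mul]
    have h1 := hsplit ħ p0 ψ (fun η => η) contDiff_id c₂ hc₂ hcc₂ x
    rw [hmul _ fun ξ h2 => ht0 ħ ψ ξ (by linarith), hmul _ (hp0 ħ _),
      ← rightOp_eq_invFourierH] at h1
    exact h1

end LocalEgorov

end

section

section Sums

variable {d : ℕ} {ι : Type*} [Fintype ι]

open scoped Manifold in
lemma exists_smooth_partition {X : Type*} [NormedAddCommGroup X] [NormedSpace ℝ X]
    [FiniteDimensional ℝ X] {χ : X → ℂ} (hχ : C^∞ χ) (hc : HasCompactSupport χ)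
    {U : ι → Set X} (hU : ∀ i, IsOpen (U i)) (hs : tsupport χ ⊆ ⋃ i, U i) :
    ∃ χ' : ι → X → ℂ, (∀ i, C^∞ (χ' i)) ∧ (∀ i, HasCompactSupport (χ' i)) ∧
      (∀ i, ∀ x ∉ U i, χ' i x = 0) ∧ ∀ x, ∑ i, χ' i x = χ x := by
  obtain ⟨f, hf⟩ := SmoothPartitionOfUnity.exists_isSubordinate 𝓘(ℝ, X) (isClosed_tsupport χ) U hU hs
  refine ⟨fun i x => (f i x : ℂ) * χ x, fun i => ?_, fun i => hc.mul_left, fun i x hx => ?_,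
    fun x => ?_⟩
  · exact (Complex.ofRealCLM.contDiff.comp (f i).contMDiff.contDiff).mul hχ
  · have h1 : f i x = 0 := by
      by_contra h
      exact hx (hf i (subset_closure h))
    simp only [h1, Complex.ofReal_zero, zero_mul]
  · rw [← sum_mul, ← Complex.ofReal_sum]
    by_cases hx : x ∈ tsupport χ
    · rw [← finsum_eq_sum_of_fintype, f.sum_eq_one hx, Complex.ofReal_one, one_mul]
    · rw [image_eq_zero_of_notMem_tsupport hx, mul_zero]

lemma packet_sum {χ : ι → Phase d → ℂ} (hχ : ∀ i, C^∞ (χ i))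
    (hc : ∀ i, HasCompactSupport (χ i)) {χ₂ : Phase d → ℂ} (h : ∀ p, ∑ i, χ i p = χ₂ p) (ħ : ℝ)
    (ψ : 𝓢(E d, ℂ)) : packet χ₂ ħ ψ = fun ξ => ∑ i, packet (χ i) ħ ψ ξ := by
  funext ξ
  unfold packet
  rw [← integral_finsetSum]
  · simp only [← h, sum_mul, mul_sum]
  · intro i _
    obtain ⟨B, hB⟩ := (hc i).exists_bound_of_continuous (hχ i).continuous
    refine integrable_osc_mul (ψ.integrable.bdd_mul (Continuous.aestronglyMeasurable ?_)
      (.of_forall fun w => hB (w, ξ))) (by fun_prop)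
    exact (hχ i).continuous.comp' (by fun_prop)

lemma invFourierH_sum {f : ι → E d → ℂ} (hf : ∀ i, Continuous (f i))
    (hc : ∀ i, HasCompactSupport (f i)) (ħ : ℝ) (x : E d) :
    invFourierH ħ (fun ξ => ∑ i, f i ξ) x = ∑ i, invFourierH ħ (f i) x := by
  unfold invFourierH
  rw [← mul_sum, ← integral_finsetSum]
  · simp only [mul_sum]
  · exact fun i _ => integrable_osc_mul ((hf i).integrable_of_hasCompactSupport (hc i))
      (by fun_prop)

lemma uHat_sum (G : GeneralLinearGroup (Fin (d + 1)) ℝ) {f : ι → E d → ℂ}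
    (hf : ∀ i, Continuous (f i)) (hc : ∀ i, HasCompactSupport (f i)) (ħ : ℝ) (x : E d) :
    uHat G ħ (fun ξ => ∑ i, f i ξ) x = ∑ i, uHat G ħ (f i) x := by
  unfold uHat
  rw [← mul_sum, ← integral_finsetSum]
  · simp only [mul_sum]
  · exact fun i _ => integrable_osc_mul ((hf i).integrable_of_hasCompactSupport (hc i))
      (continuous_const.inner (continuous_gMap G))

lemma invFourierH_ampOp_sum {Q : Phase d × E d → ℂ} (hQ : C^∞ Q)
    (hQc : HasCompactSupport Q) {f : ι → E d → ℂ} (hf : ∀ i, C^∞ (f i))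
    (hc : ∀ i, HasCompactSupport (f i)) (ħ : ℝ) (x : E d) :
    invFourierH ħ (ampOp Q ħ (fun ξ => ∑ i, f i ξ)) x = ∑ i, invFourierH ħ (ampOp Q ħ (f i)) x := by
  rw [← invFourierH_sum (fun i => (contDiff_ampOp hQ hQc ħ (hf i) (hc i)).continuous)
    (fun i => compactSupp_ampOp hQc ħ (hc i))]
  congr 1
  funext ξ
  unfold ampOp
  rw [← mul_sum, ← integral_finsetSum]
  · simp only [mul_sum]
  · intro i _
    have h1 : Continuous (fun ξ' : E d => qHat Q ħ (½ • (ξ + ξ')) (ξ - ξ')) :=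
      Continuous.comp' (g := fun p : E d × E d => qHat Q ħ p.1 p.2)
        (f := fun ξ' : E d => (½ • (ξ + ξ'), ξ - ξ')) (contDiff_qHat hQ hQc ħ).continuous
        (by fun_prop)
    exact (h1.mul (hf i).continuous).integrable_of_hasCompactSupport (hc i).mul_left

lemma freqBound_sum {ħ : ℝ} (p0 : 0 < ħ) {k : ℕ} {B : ι → ℝ} {F : ι → E d → ℂ}
    (hF : ∀ i, C^∞ (F i)) (h : ∀ i, FreqBound ħ k (B i) (F i)) :
    FreqBound ħ k (∑ i, B i) (fun η => ∑ i, F i η) := by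
  intro j hj η
  rw [iteratedFDeriv_fun_sum_apply fun i _ => ((hF i).of_le (by exact_mod_cast le_top)).contDiffAt]
  refine (mul_le_mul_of_nonneg_left (norm_sum_le _ _) (by positivity)).trans ?_
  rw [mul_sum]
  exact sum_le_sum fun i _ => h i j hj η

end Sums

section Cutoffs

variable {d : ℕ} {G : GeneralLinearGroup (Fin (d + 1)) ℝ}

open scoped Manifold in
/-- A cut-off that is one near a compact set. -/
lemma exists_cutoff_thickening {k : Set (E d)} (hk : IsCompact k) {r : ℝ} (hr : 0 < r) :
    ∃ ρ : E d → ℂ, C^∞ ρ ∧ HasCompactSupport ρ ∧ (∀ ζ ∈ thickening (r / 2) k, ρ ζ = 1) ∧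
      tsupport ρ ⊆ thickening (3 / 4 * r) k := by
  have hd : Disjoint (thickening (5 / 8 * r) k)ᶜ (cthickening (r / 2) k) :=
    Set.disjoint_left.2 fun x hx h => hx
      (cthickening_subset_thickening' (by positivity) (by linarith) k h)
  obtain ⟨f, hf0, hf1, -⟩ := exists_contMDiffMap_zero_one_of_isClosed (n := ⊤) 𝓘(ℝ, E d)
    isOpen_thickening.isClosed_compl isClosed_cthickening hd
  have h1 : tsupport (fun ζ => (f ζ : ℂ)) ⊆ cthickening (5 / 8 * r) k := by
    refine closure_minimal (fun x hx => ?_) isClosed_cthickening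
    by_contra h
    refine hx ?_
    have h2 : f x = 0 := hf0 fun h' => h (thickening_subset_cthickening _ _ h')
    simp only [h2, Complex.ofReal_zero]
  refine ⟨fun ζ => (f ζ : ℂ), Complex.ofRealCLM.contDiff.comp f.contMDiff.contDiff,
    hk.cthickening.of_isClosed_subset (isClosed_tsupport _) h1, fun ζ hζ => ?_,
    h1.trans (cthickening_subset_thickening' (by positivity) (by linarith) k)⟩
  have h2 : f ζ = 1 := hf1 (thickening_subset_cthickening _ _ hζ)
  simp only [h2, Complex.ofReal_one]

lemma cutoffsGood_of_thickening {k : Set (E d)} {r : ℝ} (h : ∀ ξ ∈ k, GoodBall G ξ r)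
    {ρ β : E d → ℂ} (hρ : tsupport ρ ⊆ thickening (3 / 4 * r) k)
    (hβ : tsupport β ⊆ closedBall 0 (r / 8)) : CutoffsGood G β ρ := by
  intro ζ hζ θ hθ
  obtain ⟨ξ, hξ, h1⟩ := mem_thickening_iff.1 (hρ hζ)
  have h2 : ‖θ‖ ≤ r / 8 := mem_closedBall_zero_iff.1 (hβ hθ)
  have h3 : ‖½ • θ‖ ≤ r / 16 := by
    rw [norm_smul, norm_of_nonneg (by norm_num)]
    linarith
  rw [dist_eq_norm] at h1
  have h4 : ζ + ½ • θ ∈ ball ξ r := by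
    rw [mem_ball_iff_norm, add_sub_right_comm]
    linarith [norm_add_le (ζ - ξ) (½ • θ), (h ξ hξ).1]
  have h5 : ζ - ½ • θ ∈ ball ξ r := by
    rw [mem_ball_iff_norm, sub_right_comm]
    linarith [norm_sub_le (ζ - ξ) (½ • θ), (h ξ hξ).1]
  exact ⟨(h ξ hξ).2 _ h4 _ h5, (h ξ hξ).2 _ h4 _ h4⟩

lemma FreqChart.exists_cutoffsAdapted {ξ₀ : E d} {r : ℝ} {h : E d → E d} {D : E d → ℂ}
    (H : FreqChart G ξ₀ r h D) : ∃ δ > 0, ∀ b β ρ : E d → ℂ, (∀ s, δ ≤ ‖s‖ → b s = 0) →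
      (∀ θ, ‖θ‖ ≤ r / 16 → β θ = 1) → (∀ θ, r / 8 ≤ ‖θ‖ → β θ = 0) →
      (∀ ζ ∈ ball ξ₀ (r / 2), ρ ζ = 1) → CutoffsAdapted G ξ₀ r b β ρ := by
  obtain ⟨Λ, hΛ, hL⟩ := H.bound
  obtain ⟨δ, hδ, hball⟩ := H.exists_ball
  have r0 := H.good.1
  refine ⟨min δ (r / 16 / (Λ + 1)), by positivity, fun b β ρ hb hβ1 hβ0 hρ =>
    ⟨fun ξ hξ η hη => ?_, fun ξ hξ ξ' hξ' hη => hβ1 _ ?_, hρ, hβ0⟩⟩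
  · refine hball ξ (ball_subset_closedBall hξ) ?_
    rw [mem_ball_iff_norm]
    by_contra h1
    exact hη (hb _ ((min_le_left _ _).trans (not_lt.1 h1)))
  · have h1 : ‖gMap G ξ - gMap G ξ'‖ < r / 16 / (Λ + 1) := by
      by_contra h1
      exact hη (hb _ ((min_le_right _ _).trans (not_lt.1 h1)))
    have h2 := convex_univ.norm_image_sub_le_of_norm_fderiv_le (𝕜 := ℝ)
      (fun x _ => (H.smooth.differentiable (by simp)) x) (fun x _ => hL x)
      (Set.mem_univ (gMap G ξ')) (Set.mem_univ (gMap G ξ))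
    rw [H.left_inv ξ (ball_subset_ball (by linarith) hξ),
      H.left_inv ξ' (ball_subset_ball (by linarith) hξ')] at h2
    rw [lt_div_iff₀ (by positivity)] at h1
    nlinarith [norm_nonneg (gMap G ξ - gMap G ξ')]

end Cutoffs

end

section

section Egorov

variable {d : ℕ} {G : GeneralLinearGroup (Fin (d + 1)) ℝ}

/-- Replacing a symbol by an amplitude supported near the diagonal. -/
def ReducesTo (p : Phase d → ℂ) (Q : Phase d × E d → ℂ) (R c : ℝ) : Prop :=
  ∀ n N : ℕ, ∃ (k n' N' : ℕ) (C : ℝ), 0 ≤ C ∧ ∀ ħ, 0 < ħ → ħ ≤ 1 →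
    ∀ (F : E d → ℂ) (B : ℝ), FreqSupp R F → FreqBound ħ k B F →
    (∀ y, c ≤ ‖y‖ → ⟪y⟫ ^ n' * ‖invFourierH ħ F y‖ ≤ ħ ^ N' * B) → ∀ x,
    ⟪x⟫ ^ n * ‖weylOp ħ p (invFourierH ħ F) x
      - weylOp ħ (symS Q ħ) (invFourierH ħ F) x‖ ≤ C * ħ ^ N * B

lemma negl_weylOp_propagator_sub {p : Phase d → ℂ} (hp : Continuous p) {Q : Phase d × E d → ℂ}
    (hQ : C^∞ Q) (hQc : HasCompactSupport Q) {R c : ℝ} (hred : ReducesTo p Q R c)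
    {ι : Type*} [Fintype ι] {ξ₀ : ι → E d} {r : ℝ} {h : ι → E d → E d} {D : ι → E d → ℂ}
    (H : ∀ i, FreqChart G (ξ₀ i) r (h i) (D i)) (hR : ∀ i η, R < ‖η‖ → D i η = 0)
    {w₀ : ℝ} (hw0 : 0 ≤ w₀)
    (hΛ : ∀ i, ∃ Λ, 0 ≤ Λ ∧ (∀ η, ‖fderiv ℝ (h i) η‖ ≤ Λ) ∧ (2 * Λ + 1) * (1 + w₀) ≤ c)
    {χ : ι → Phase d → ℂ} (hχ : ∀ i, C^∞ (χ i)) (hc : ∀ i, HasCompactSupport (χ i))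
    (hξ : ∀ i w ξ, r / 4 ≤ ‖ξ - ξ₀ i‖ → χ i (w, ξ) = 0) (hw : ∀ i w ξ, w₀ < ‖w‖ → χ i (w, ξ) = 0)
    {χ₂ : Phase d → ℂ} (hχ₂ : C^∞ χ₂) (hχ₂c : HasCompactSupport χ₂)
    (hsum : ∀ z, ∑ i, χ i z = χ₂ z) :
    Negl (fun ħ ψ x => weylOp ħ p (propagator G ħ (rightOp ħ χ₂ ψ)) x - ∑ i, invFourierH ħ
      (ampOp Q ħ (fun η => packet (χ i) ħ ψ (h i η) * D i η)) x) := by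
  set F : ι → ℝ → 𝓢(E d, ℂ) → E d → ℂ := fun i ħ ψ η => packet (χ i) ħ ψ (h i η) * D i η with hF
  have hFs : ∀ i ħ ψ, FreqSupp R (F i ħ ψ) := fun i ħ ψ =>
    freqSupp_transport (hχ i) (hc i) (H i).smooth ⟨(H i).smooth_jac, hR i⟩ ħ ψ
  have hz : ∀ i ħ (ψ : 𝓢(E d, ℂ)) ξ, r / 4 ≤ ‖ξ - ξ₀ i‖ → packet (χ i) ħ ψ ξ = 0 :=
    fun i ħ ψ ξ h1 => packet_eq_zero (fun w => hξ i w ξ h1) ħ ψ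
  have e1 : ∀ ħ, 0 < ħ → ∀ ψ : 𝓢(E d, ℂ), propagator G ħ (rightOp ħ χ₂ ψ)
      = invFourierH ħ (fun η => ∑ i, F i ħ ψ η) := by
    intro ħ p0 ψ
    rw [propagator_eq_uHat G (fourierH_rightOp hχ₂ hχ₂c p0 ψ), packet_sum hχ hc hsum]
    · funext y
      rw [uHat_sum G (fun i => (contDiff_packet (hχ i) (hc i) ħ ψ).continuous)
          (fun i => compactSupp_packet (hc i) ħ ψ),
        invFourierH_sum (fun i => (hFs i ħ ψ).1.continuous) (fun i => (hFs i ħ ψ).hasCompactSupport)]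
      refine sum_congr rfl fun i _ => ?_
      rw [(H i).uHat_eq ħ fun ξ h1 => hz i ħ ψ ξ (by linarith [(H i).good.1])]
    · intro ξ h1
      rw [packet_sum hχ hc hsum]
      refine sum_eq_zero fun i _ => hz i ħ ψ ξ ?_
      by_contra h2
      exact absurd ((H i).good.norm_lt_one (ξ := ξ)
        (by rw [mem_ball_iff_norm]; linarith [(H i).good.1])) (not_lt.2 h1)
  have hFsum : ∀ ħ ψ, FreqSupp R (fun η => ∑ i, F i ħ ψ η) := fun ħ ψ =>
    ⟨ContDiff.sum fun i _ => (hFs i ħ ψ).1, fun η h1 =>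
      sum_eq_zero fun i _ => (hFs i ħ ψ).2 η h1⟩
  have e2 : ∀ ħ, 0 < ħ → ∀ (ψ : 𝓢(E d, ℂ)) x,
      weylOp ħ (symS Q ħ) (invFourierH ħ (fun η => ∑ i, F i ħ ψ η)) x
        = ∑ i, invFourierH ħ (ampOp Q ħ (F i ħ ψ)) x := by
    intro ħ p0 ψ x
    rw [weylOp_symS_invFourierH hQ hQc p0 (hFsum ħ ψ).1 (hFsum ħ ψ).hasCompactSupport,
      invFourierH_ampOp_sum hQ hQc (fun i => (hFs i ħ ψ).1) fun i => (hFs i ħ ψ).hasCompactSupport]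
  refine ⟨fun ħ p0 p1 ψ => ?_, fun n N => ?_⟩
  · refine (stronglyMeasurable_weylOp hp ħ ?_).sub ?_
    · rw [e1 ħ p0]
      exact meas_invFourierH ħ (hFsum ħ ψ).1.continuous.stronglyMeasurable
    · exact Finset.stronglyMeasurable_fun_sum _ fun i _ => meas_invFourierH ħ
        (contDiff_ampOp hQ hQc ħ (hFs i ħ ψ).1
          (hFs i ħ ψ).hasCompactSupport).continuous.stronglyMeasurable
  · obtain ⟨k, n', N', C, h0, hC⟩ := hred n N
    choose B hB0 hB using fun i => exists_freqBound_transport (hχ i) (hc i) (H i).smooth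
      (H i).smooth_jac (H i).compact_jac k
    choose Λ hΛ0 hΛb hΛc using hΛ
    choose T hT0 hT using fun i => exists_weight_mul_transport_tail_le (hχ i) (hc i)
      (H i).smooth (H i).smooth_jac (H i).compact_jac (hΛ0 i) (hΛb i) (hw i) hw0 (hΛc i) n' N'
    have sB := sum_nonneg fun i (_ : i ∈ Finset.univ) => hB0 i
    have sT := sum_nonneg fun i (_ : i ∈ Finset.univ) => hT0 i
    refine ⟨C * (∑ i, B i + ∑ i, T i), by positivity, fun ħ p0 p1 ψ x => ?_⟩
    have hl := l2_nonneg ψ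
    have h1 := hC ħ p0 p1 (fun η => ∑ i, F i ħ ψ η) ((∑ i, B i + ∑ i, T i) * l2 ψ) (hFsum ħ ψ)
      (fun j hj η => (freqBound_sum p0 (fun i => (hFs i ħ ψ).1) (fun i => hB i ħ p0 p1 ψ) j hj
        η).trans (by
          rw [← sum_mul]
          exact mul_le_mul_of_nonneg_right (by linarith) hl))
      (fun y hy => by
        rw [invFourierH_sum (fun i => (hFs i ħ ψ).1.continuous)
          (fun i => (hFs i ħ ψ).hasCompactSupport)]
        calc _ ≤ ⟪y⟫ ^ n' * ∑ i, ‖invFourierH ħ (F i ħ ψ) y‖ :=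
              mul_le_mul_of_nonneg_left (norm_sum_le _ _) (by positivity)
          _ = ∑ i, ⟪y⟫ ^ n' * ‖invFourierH ħ (F i ħ ψ) y‖ := mul_sum _ _ _
          _ ≤ ∑ i, T i * ħ ^ N' * l2 ψ := sum_le_sum fun i _ => hT i ħ p0 p1 ψ y hy
          _ = ħ ^ N' * ((∑ i, T i) * l2 ψ) := by
              rw [← sum_mul, ← sum_mul]; ring
          _ ≤ _ := mul_le_mul_of_nonneg_left
              (mul_le_mul_of_nonneg_right (by linarith) hl) (by positivity)) x
    rw [e2 ħ p0, ← e1 ħ p0] at h1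
    exact h1.trans (le_of_eq (by ring))

lemma r1_congr {p q : Phase d → ℂ} {z : Phase d} (h : r0 G p =ᶠ[𝓝 z] r0 G q) :
    r1 G p z = r1 G q z := by
  unfold r1 poisson
  rw [h.fderiv_eq]

/-- The expansion of the symbol. -/
lemma symS_conjAmp_expansion {p₀ q : Phase d → ℂ} (hp : C^∞ p₀) (hq : C^∞ q)
    {b β ρ : E d → ℂ} (hQ : C^∞ (conjAmp G q b β ρ))
    (hQc : HasCompactSupport (conjAmp G q b β ρ)) (hβ1 : ∀ᶠ θ in 𝓝 0, β θ = 1)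
    (hb1 : ∀ᶠ s in 𝓝 0, b s = 1) {Ω : Set (Phase d)} (hΩ : IsOpen Ω)
    (hgood : ∀ z ∈ Ω, (z.2, z.2) ∈ goodPairs G) (hρ : ∀ z ∈ Ω, ∀ᶠ ζ in 𝓝 z.2, ρ ζ = 1)
    (hpq : ∀ z ∈ Ω, q (kappa G z) = p₀ (kappa G z)) :
    ContDiffOn ℝ ∞ (r0 G p₀) Ω ∧ ContDiffOn ℝ ∞ (r1 G p₀) Ω ∧
      ∀ k : ℕ, ∃ C : ℝ, ∀ᶠ ħ in 𝓝[>] (0 : ℝ), ∀ z ∈ Ω,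
        ‖iteratedFDeriv ℝ k (fun w => symS (conjAmp G q b β ρ) ħ w
          - (r0 G p₀ w + (ħ : ℂ) * r1 G p₀ w)) z‖ ≤ C * ħ ^ 2 := by
  have h0 : ∀ z ∈ Ω, conjAmp G q b β ρ (z, 0) = r0 G p₀ z := fun z hz => by
    rw [conjAmp_zero G hβ1.self_of_nhds hb1.self_of_nhds (hρ z hz).self_of_nhds (hgood z hz)]
    exact hpq z hz
  have h1 : ∀ z ∈ Ω, subPart (conjAmp G q b β ρ) z = r1 G p₀ z := fun z hz => by
    rw [subPart_conjAmp G hq hQ hβ1 hb1 (hρ z hz) (hgood z hz)]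
    exact r1_congr (Filter.eventuallyEq_of_mem (hΩ.mem_nhds hz) hpq)
  refine ⟨fun z hz => (ContDiffAt.fun_comp z hp.contDiffAt
    (contDiffAt_kappa G (hgood z hz).1 (hgood z hz).2.2)).contDiffWithinAt,
    (contDiff_subPart hQ).contDiffOn.congr fun z hz => (h1 z hz).symm, fun k => ?_⟩
  obtain ⟨C, -, hC⟩ := exists_deriv_symErr_le k hQ hQc
  refine ⟨C, ?_⟩
  filter_upwards [eventually_small] with ħ p z hz
  have h2 : (fun w => symS (conjAmp G q b β ρ) ħ w - (r0 G p₀ w + (ħ : ℂ) * r1 G p₀ w))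
      =ᶠ[𝓝 z] symErr (conjAmp G q b β ρ) ħ := by
    filter_upwards [hΩ.mem_nhds hz] with w hw
    rw [symErr, h0 w hw, h1 w hw]
  rw [(h2.iteratedFDeriv ℝ k).self_of_nhds]
  exact hC ħ p.1 z

lemma Finset.exists_upper_bound {α : Type*} (t : Finset α) (f : α → ℝ) : ∃ B, ∀ i ∈ t, f i ≤ B := by
  obtain ⟨B, hB⟩ := (t.image f).exists_le
  exact ⟨B, fun i hi => hB _ (Finset.mem_image_of_mem f hi)⟩

end Egorov

end

section

section Main

variable {d : ℕ} {G : GeneralLinearGroup (Fin (d + 1)) ℝ}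

lemma hasWeylSymbolNear_conj {K : Set (Phase d)} (hK : IsCompact K)
    (hKg : ∀ z ∈ K, (z.2, z.2) ∈ goodPairs G) {a : ℝ → E d × E d × E d → ℂ}
    (ha : IsMicrolocalLeftInverse G a K) {p₀ : Phase d → ℂ} (hp : IsSymbol p₀) :
    HasWeylSymbolNear (fun ħ φ => inverseFIO G ħ (a ħ) (weylOp ħ p₀ (propagator G ħ φ)))
      (r0 G p₀) (r1 G p₀) K := by
  obtain ⟨hamp, Ω₀, hΩ₀, hKΩ₀, hinv⟩ := ha
  have hA := temperedOp_inverseFIO G hamp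
  set k := Prod.snd '' K with hkdef
  have hk : IsCompact k := hK.image continuous_snd
  have hmk : ∀ z ∈ K, z.2 ∈ k := fun z hz => ⟨z, hz, rfl⟩
  obtain ⟨r₁, hr₁, hgood₁⟩ := exists_radius_goodPairs G hk
    (by rintro _ ⟨z, hz, rfl⟩; exact hKg z hz)
  obtain ⟨s₁, hs₁, hsΩ⟩ := hK.exists_thickening_subset_open hΩ₀ hKΩ₀
  set r := min r₁ s₁ with hrdef
  have hr : 0 < r := lt_min hr₁ hs₁
  have hG : ∀ ξ ∈ k, GoodBall G ξ r := fun ξ hξ => ⟨hr, fun η hη η' hη' =>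
    hgood₁ ξ hξ η (ball_subset_ball (min_le_left _ _) hη) η'
      (ball_subset_ball (min_le_left _ _) hη')⟩
  set s := s₁ / 4 with hsdef
  have hs0 : 0 < s := by positivity
  choose! h D H using fun ξ (hξ : ξ ∈ k) => (hG ξ hξ).exists_freqChart
  choose! Λ hΛ0 hΛb using fun ξ (hξ : ξ ∈ k) => (H ξ hξ).bound
  choose! R' hR'0 hR' using fun ξ (hξ : ξ ∈ k) =>
    exists_radius (H ξ hξ).compact_jac
  choose! δ hδ hcut using fun ξ (hξ : ξ ∈ k) => (H ξ hξ).exists_cutoffsAdapted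
  set τ := min s (r / 4) with hτdef
  have hτ : 0 < τ := lt_min hs0 (by positivity)
  obtain ⟨t, htK, hcov⟩ := hK.elim_nhds_subcover (fun z => ball z τ) (fun z _ => ball_mem_nhds z hτ)
  obtain ⟨ΛB, hΛB⟩ := Finset.exists_upper_bound t fun z => Λ z.2
  obtain ⟨RB, hRB⟩ := Finset.exists_upper_bound t fun z => R' z.2
  obtain ⟨xB, hxB⟩ := Finset.exists_upper_bound t fun z => ‖z.1‖
  obtain ⟨δB, hδB⟩ := Finset.exists_upper_bound t fun z => (δ z.2)⁻¹
  obtain ⟨Bκ, hBκ⟩ := hK.exists_bound_of_continuousOn (f := kappa G) fun z hz =>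
    (contDiffAt_kappa G (hKg z hz).1 (hKg z hz).2.2).continuousAt.continuousWithinAt
  set δ₀ := (|δB| + 1)⁻¹ with hδ₀def
  have hδ₀ : 0 < δ₀ := by positivity
  have hδle : ∀ z ∈ t, δ₀ ≤ δ z.2 := fun z hz => by
    rw [hδ₀def]
    exact inv_le_of_inv_le₀ (hδ _ (hmk z (htK z hz))) (by linarith [hδB z hz, le_abs_self δB])
  set w₀ := |xB| + s with hw₀def
  have hw0 : 0 ≤ w₀ := by positivity
  set c := (2 * |ΛB| + 1) * (1 + w₀) + |Bκ| with hcdef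
  have hc0 : 0 < c := by positivity
  set R := |RB| + |Bκ| + 1 with hRdef
  have hR0 : 0 < R := by positivity
  obtain ⟨m, hpm⟩ := hp.exists_hasSymbolBound
  obtain ⟨q, hq, hqc, hqp, hred⟩ := exists_weylOp_sub_nearAmp_le hpm hR0 hc0
  obtain ⟨b, hb, hbc, hb1, hb0, -⟩ := exists_cutoff d 0 (half_pos hδ₀) (half_lt_self hδ₀)
  obtain ⟨β, hβ, hβc, hβ1, hβ0, -⟩ := exists_cutoff d 0 (by positivity : 0 < r / 16)
    (by linarith : r / 16 < r / 8)
  obtain ⟨ρ, hρ, hρc, hρ1, hρs⟩ := exists_cutoff_thickening hk hr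
  simp only [sub_zero] at hb1 hb0 hβ1 hβ0
  have hβs : tsupport β ⊆ closedBall 0 (r / 8) := by
    refine closure_minimal (fun θ hθ => ?_) isClosed_closedBall
    rw [mem_closedBall_zero_iff]
    by_contra h1
    exact hθ (hβ0 θ (not_le.1 h1).le)
  obtain ⟨hQ, hQc⟩ := contDiff_conjAmp G hq hqc hb hβ hβc hρ hρc (cutoffsGood_of_thickening hG hρs hβs)
  set Q := conjAmp G q b β ρ with hQdef
  have hN : C^∞ (nearAmp q b) := (ContDiff.fun_comp hq contDiff_fst).mul
    (ContDiff.fun_comp hb contDiff_snd)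
  have hNc : HasCompactSupport (nearAmp q b) := .intro (hqc.prod hbc) fun p hp => by
    by_cases h1 : p.1 ∈ tsupport q
    · have h2 : p.2 ∉ tsupport b := fun h => hp ⟨h1, h⟩
      simp [nearAmp, image_eq_zero_of_notMem_tsupport h2]
    · simp [nearAmp, image_eq_zero_of_notMem_tsupport h1]
  have hred' : ReducesTo p₀ (nearAmp q b) R c := fun n N =>
    hred b (δ₀ / 2) hb hbc (half_pos hδ₀) (fun θ hθ => hb1 θ hθ.le) n N
  have hnear : ∀ {f : E d → ℂ} {ε : ℝ}, 0 < ε → (∀ x, ‖x‖ ≤ ε → f x = 1) → ∀ᶠ x in 𝓝 0, f x = 1 :=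
    fun hε hf => Filter.eventually_of_mem (closedBall_mem_nhds 0 hε)
      fun x hx => hf x (mem_closedBall_zero_iff.1 hx)
  refine ⟨fun ħ => symS Q ħ, ⟨fun ħ _ => contDiff_symS hQ hQc ħ, fun j => ?_⟩, ?_, ?_⟩
  · obtain ⟨C, -, hC⟩ := exists_deriv_symS_le hQ hQc j
    exact ⟨C, eventually_small.mono fun ħ p => hC ħ p.1 p.2⟩
  · refine ⟨Ω₀ ∩ ⋃ i : t, ball (i : Phase d) τ,
      hΩ₀.inter (isOpen_iUnion fun _ => isOpen_ball), fun z hz => ⟨hKΩ₀ hz, ?_⟩, ?_⟩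
    · obtain ⟨i, hi, h1⟩ := Set.mem_iUnion₂.1 (hcov hz)
      exact Set.mem_iUnion.2 ⟨⟨i, hi⟩, h1⟩
    intro χ₁ χ₂ hχ₁ hχ₁c hχ₁s hχ₂ hχ₂c hχ₂s
    obtain ⟨χ, hχ, hχc, hχ0, hsum⟩ := exists_smooth_partition hχ₂ hχ₂c
      (U := fun i : t => ball (i : Phase d) τ) (fun _ => isOpen_ball)
      (hχ₂s.trans Set.inter_subset_right)
    have hmt : ∀ i : t, (i : Phase d).2 ∈ k := fun i => hmk _ (htK _ i.2)
    have hχx : ∀ (i : t) w ξ, s ≤ ‖w - (i : Phase d).1‖ → χ i (w, ξ) = 0 := fun i w ξ h1 =>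
      hχ0 i _ fun h2 => by
        rw [mem_ball, Prod.dist_eq, max_lt_iff, dist_eq_norm] at h2
        linarith [h2.1, min_le_left s (r / 4)]
    have hχξ : ∀ (i : t) w ξ, r / 4 ≤ ‖ξ - (i : Phase d).2‖ → χ i (w, ξ) = 0 := fun i w ξ h1 =>
      hχ0 i _ fun h2 => by
        rw [mem_ball, Prod.dist_eq, max_lt_iff, dist_eq_norm, dist_eq_norm] at h2
        linarith [h2.2, min_le_right s (r / 4)]
    have hχw : ∀ (i : t) w ξ, w₀ < ‖w‖ → χ i (w, ξ) = 0 := fun i w ξ h1 => hχx i w ξ (by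
      linarith [norm_sub_norm_le w (i : Phase d).1, hxB i i.2, le_abs_self xB])
    have hAg : ∀ i : t, AgreesTo (fun ħ u => inverseFIO G ħ (a ħ) u) χ₁
        (fun ħ ψ => invFourierH ħ (ampOp (nearAmp q b) ħ
          (fun η => packet (χ i) ħ ψ (h (i : Phase d).2 η) * D (i : Phase d).2 η)))
        (symPacket Q (χ i)) := by
      intro i
      refine (H _ (hmt i)).agreesTo (hcut _ (hmt i) b β ρ
        (fun s hs => hb0 s ((hδle i i.2).trans hs)) hβ1 hβ0 fun ζ hζ => hρ1 ζ
          (mem_thickening_iff.2 ⟨_, hmt i, hζ⟩)) hQ hQc hA hχ₁ hχ₁c (hχ i) (hχc i)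
        hs0 (hχx i) (hχξ i) fun χ' hχ' hχ'c hχ's => hinv χ₁ χ' hχ₁ hχ₁c
          (hχ₁s.trans Set.inter_subset_left) hχ' hχ'c (hχ's.trans ?_)
      refine subset_trans (fun z hz => ?_) hsΩ
      refine mem_thickening_iff.2 ⟨i, htK _ i.2, ?_⟩
      have h1 := mem_closedBall.1 hz.1
      have h2 := mem_closedBall.1 hz.2
      rw [Prod.dist_eq, max_lt_iff]
      exact ⟨by linarith, by linarith [min_le_right r₁ s₁]⟩
    have hE := negl_weylOp_propagator_sub hp.1.continuous hN hNc hred'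
      (ξ₀ := fun i : t => (i : Phase d).2) (fun i => H _ (hmt i))
      (fun i η hη => hR' _ (hmt i) η (by
        linarith [hRB i i.2, le_abs_self RB, abs_nonneg Bκ])) hw0
      (fun i => ⟨_, hΛ0 _ (hmt i), hΛb _ (hmt i), by
        have h1 : Λ (i : Phase d).2 ≤ |ΛB| := (hΛB i i.2).trans (le_abs_self _)
        nlinarith [abs_nonneg Bκ]⟩) hχ hχc hχξ hχw hχ₂ hχ₂c hsum
    refine ((AgreesTo.sum hA hχ₁ hχ₁c Finset.univ hAg).add hA hχ₁ hχ₁c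
      (AgreesTo.of_negl hA hχ₁ hχ₁c hE negl_zero)).congr (v := fun ħ ψ =>
        weylOp ħ p₀ (propagator G ħ (rightOp ħ χ₂ ψ))) (z := fun ħ ψ =>
        weylOp ħ (symS Q ħ) (rightOp ħ χ₂ ψ)) (fun ħ p0 _ ψ x => ?_) (fun ħ p0 _ ψ x => ?_) |>.bound
    · rw [add_sub_cancel]
    · rw [weylOp_rightOp_eq_symPacket hQ hQc hχ₂ hχ₂c p0, symPacket, packet_sum hχ hχc hsum,
        invFourierH_ampOp_sum hQ hQc (fun i => contDiff_packet (hχ i) (hχc i) ħ ψ)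
          (fun i => compactSupp_packet (hχc i) ħ ψ), add_zero]
      rfl
  · have hVgood : ∀ ξ ∈ thickening (r / 2) k, (ξ, ξ) ∈ goodPairs G := fun ξ hξ => by
      obtain ⟨ξ', h1, h2⟩ := mem_thickening_iff.1 hξ
      have h3 : ξ ∈ ball ξ' r := mem_ball.2 (by linarith)
      exact (hG ξ' h1).2 ξ h3 ξ h3
    have hV : IsOpen (Prod.snd ⁻¹' thickening (r / 2) k : Set (Phase d)) :=
      isOpen_thickening.preimage continuous_snd
    have hW : IsOpen {w : Phase d | ‖w.1‖ < c + 1 ∧ ‖w.2‖ < 2 * R} :=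
      IsOpen.inter (isOpen_lt (f := fun w : Phase d => ‖w.1‖) (by fun_prop) continuous_const)
        (isOpen_lt (f := fun w : Phase d => ‖w.2‖) (by fun_prop) continuous_const)
    have hκ : ContinuousOn (kappa G) (Prod.snd ⁻¹' thickening (r / 2) k) := fun z hz =>
      (contDiffAt_kappa G (hVgood _ hz).1 (hVgood _ hz).2.2).continuousAt.continuousWithinAt
    refine ⟨_, hκ.isOpen_inter_preimage hV hW, fun z hz =>
      ⟨self_subset_thickening (by positivity) k (hmk z hz), ?_, ?_⟩,
      symS_conjAmp_expansion hp.1 hq hQ hQc (hnear (by positivity) hβ1) (hnear (half_pos hδ₀) hb1)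
        (hκ.isOpen_inter_preimage hV hW) (fun z hz => hVgood _ hz.1)
        (fun z hz => Filter.eventually_of_mem (isOpen_thickening.mem_nhds hz.1) hρ1)
        fun z hz => hqp _ hz.2.1.le hz.2.2.le⟩
    · have h1 := (norm_fst_le (kappa G z)).trans ((hBκ z hz).trans (le_abs_self _))
      have h2 : 0 ≤ (2 * |ΛB| + 1) * (1 + w₀) := by positivity
      linarith
    · have h1 := (norm_snd_le (kappa G z)).trans ((hBκ z hz).trans (le_abs_self _))
      linarith [abs_nonneg RB, abs_nonneg Bκ]

end Main

end

end HelmholtzEgorov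

open HelmholtzEgorov
theorem mainTheorem3 {d : ℕ} (hd : 1 ≤ d) (G : Matrix.GeneralLinearGroup (Fin (d + 1)) ℝ)
    (p₀ : Phase d → ℂ) (hp : IsSymbol p₀) (ε : ℝ) (hε : 0 < ε) :
    -- the Weyl symbol of `U_G⁻¹ P U_G`, for every microlocal left inverse `U_G⁻¹`
    (∀ K : Set (Phase d), IsCompact K → K ⊆ region G ε →
      ∀ b : ℝ → E d × E d × E d → ℂ, IsMicrolocalLeftInverse G b K → HasWeylSymbolNear
          (fun ħ φ => inverseFIO G ħ (b ħ) (weylOp ħ p₀ (propagator G ħ φ)))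
          (r0 G p₀) (r1 G p₀) K) ∧
    (∀ z ∈ region G ε,
      -- microlocal left inverses exist near every point of the region
      (∃ b : ℝ → E d × E d × E d → ℂ, IsMicrolocalLeftInverse G b {z}) ∧
      -- the second formula for `r₁`, with `J̃ = J ∘ g⁻¹ = det d(g⁻¹)`
      (∃ h : E d → E d, IsLocalLeftInverse G h z.2) ∧
      (∀ h : E d → E d, IsLocalLeftInverse G h z.2 →
        (∀ᶠ η in 𝓝 (gMap G z.2), jac G (h η) = (fderiv ℝ h η).det) ∧
        r1 G p₀ z = Complex.I / (2 * (jac G (h (kappa G z).2) : ℂ)) *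
            poisson (fun w => (jac G (h w.2) : ℂ)) p₀ (kappa G z))) := by
  refine ⟨?_, fun z hz => ?_⟩
  · refine fun K hK hKr b hb => hasWeylSymbolNear_conj hK (fun z hz => ?_) hb hp
    have h1 := norm_lt_one_of_mem_region G hε (hKr hz)
    exact ⟨h1, h1, det_kur_ne_zero_of_mem_region G hε (hKr hz)⟩
  · have h1 := norm_lt_one_of_mem_region G hε hz
    have hdet := det_kur_ne_zero_of_mem_region G hε hz
    obtain ⟨k, -, -, -, hk⟩ := exists_local_inverse G h1 hdet
    exact ⟨exists_isMicrolocalLeftInverse G h1 hdet, ⟨k, hk⟩, fun h hh =>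
      ⟨eventually_jac_comp_eq_det G h1 hdet hh, r1_eq_pullback G hp.1 h1 hdet hh⟩⟩
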